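/- Let $\mathcal V$ be a lextensive category, that is, a locally small category with finite limits and small coproducts such that the coproduct functor $\prod_{i\in I}\mathcal V\downarrow X_i\to\mathcal V\downarrow\sum_{i\in I}X_i$ is an equivalence for every small family $(X_i)_{i\in I}$ of objects. Let $T=(T,m,e)$ be a cartesian monad on $\mathcal V$ (the functor $T$ preserves pullbacks, and the naturality squares of $m$ and $e$ are pullbacks); write $T$ also for the induced strong monad on the pseudodouble category $\mathrm{Span}(\mathcal V)$ of spans in $\mathcal V$. Let $\mathcal V\text{-}\mathrm{Mat}$ be the pseudodouble category of $\mathcal V$-matrices: its objects and vertical morphisms are sets and functions, a horizontal morphism from $X$ to $Y$ is a family $(p(x,y))_{x\in X,\,y\in Y}$ of objects of $\mathcal V$, a 2-cell $p\to q$ over $f,g$ is a family of morphisms $p(x,y)\to q(fx,gy)$, and $(s\cdot r)(x,z)=\sum_{y}s(y,z)\times r(x,y)$. In the 2-category of pseudodouble categories, lax functors and vertical transformations there is an adjunction $$-\cdot 1\colon\mathcal V\text{-}\mathrm{Mat}\rightleftarrows\mathrm{Span}(\mathcal V)\colon\mathcal V(1,-),$$ where $X\cdot1=\sum_{x\in X}1$,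 where $p\cdot1$ is the span $X\cdot 1\leftarrow\sum_{x,y}p(x,y)\to Y\cdot 1$, and where $\mathcal V(1,p)(x,y)$ is the fibre of a span $p=(a\leftarrow m\to b)$ at the points $x\colon1\to a$ and $y\colon1\to b$. Its unit $\hat\eta$ is given by the coproduct injections, and its counit $\hat\epsilon$ by the points $1\to a$ and the inclusions of the fibres. Put $\overline T=\mathcal V(1,T(-\cdot1))$, a monad on $\mathcal V\text{-}\mathrm{Mat}$ with unit $\mathcal V(1,e_{-\cdot1})\circ\hat\eta$ and multiplication $\mathcal V(1,m_{-\cdot1}\circ T\hat\epsilon_{T(-\cdot1)})$. Then $(-\cdot1,\hat\epsilon_{T(-\cdot1)})$ is a monad oplax morphism $\overline T\to T$, $(\mathcal V(1,-),\mathcal V(1,T\hat\epsilon))$ is a monad lax morphism $T\to\overline T$, and together with the adjunction they form a conjunction of monads. For a monad $S$ on a pseudodouble category, a horizontal lax $S$-algebra is a tuple $(x,a,\upsilon,\mu)$ with $a\colon Sx\nrightarrow x$ horizontal and 2-cells $\upsilon\colon1_x\to a$ over $(e_x,\mathrm{id})$ and $\mu\colon a\cdot Sa\to a$ over $(m_x,\mathrm{id})$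 satisfying the two unit laws and the associativity law; a morphism is a pair $(f,\zeta)$ of a vertical morphism $f$ and a 2-cell $\zeta\colon a\to b$ over $(Sf,f)$, compatible with $\upsilon$ and $\mu$. Let $(\overline T,\mathcal V)\text{-}\mathrm{Cat}$ and $\mathrm{Cat}(T,\mathcal V)$ be the categories of horizontal lax algebras for $\overline T$ on $\mathcal V\text{-}\mathrm{Mat}$ and for $T$ on $\mathrm{Span}(\mathcal V)$. Write $F=-\cdot1$, $\phi=\hat\epsilon_{T(-\cdot1)}$, $G=\mathcal V(1,-)$ and $\psi=\mathcal V(1,T\hat\epsilon)$, and let $f^*$ and $f_!$ be the conjoint and the companion of a vertical morphism $f$. Suppose that $\phi$ has a strong conjoint: for every horizontal $r\colon x\nrightarrow y$ in $\mathcal V\text{-}\mathrm{Mat}$, the 2-cell $F\overline Tr\cdot\phi_x^*\to\phi_y^*\cdot TFr$ that corresponds to $\phi_r$ is invertible. Then the change-of-base assignments $$F_!(x,a,\upsilon,\mu)=(Fx,\,Fa\cdot\phi_x^*,\,F_!\upsilon,\,F_!\mu),\qquad F_!(f,\zeta)=(Ff,\,F\zeta\cdot\phi_f^*),$$ $$G_!(y,b,\upsilon,\mu)=(Gy,\,Gb\cdot\psi_{y!},\,G_!\upsilon,\,G_!\mu),\qquad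 G_!(g,\xi)=(Gg,\,G\xi\cdot\psi_{g!})$$ are well-defined functors between $(\overline T,\mathcal V)\text{-}\mathrm{Cat}$ and $\mathrm{Cat}(T,\mathcal V)$. Here $\phi_f^*$ and $\psi_{g!}$ are the 2-cells induced by naturality; $F_!\upsilon$ and $G_!\upsilon$ are the horizontal composites of $F\upsilon$ and $G\upsilon$ with the 2-cells induced by $\phi\circ Fe=e_F$ and $\psi\circ e_G=Ge$; the 2-cell $F_!\mu$ is the composite of the canonical isomorphism $(Fa\cdot\phi_x^*)\cdot T(Fa\cdot\phi_x^*)\cong(Fa\cdot F\overline Ta)\cdot(\phi_{\overline Tx}^*\cdot(T\phi_x)^*)$, which uses the inverse of the 2-cell above at $r=a$, with the horizontal composite of $F\mu$ and the 2-cell $\phi_{\overline Tx}^*\cdot(T\phi_x)^*\to\phi_x^*$ over $m_{Fx}$ and $Fm_x$; and $G_!\mu$ is defined analogously, by means of the 2-cell $\psi_{y!}\cdot\overline TGb\to GTb\cdot\psi_{Ty!}$ that corresponds to $\psi_b$. Moreover there is an adjunction of ordinary categories $$F_!=-\cdot1\colon(\overline T,\mathcal V)\text{-}\mathrm{Cat}\rightleftarrows\mathrm{Cat}(T,\mathcal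 V)\colon\mathcal V(1,-)=G_!,\qquad F_!\dashv G_!,$$ whose unit and counit are induced by $\hat\eta$ and $\hat\epsilon$. The unit at $(x,a,\upsilon,\mu)$ consists of $\hat\eta_x$ and the 2-cell $a\to G(Fa\cdot\phi_x^*)\cdot\psi_{Fx!}$ obtained from $\hat\eta_a$ by means of the units $1\to\phi_x^*$ and $1\to\psi_{Fx!}$. The counit at $(y,b,\upsilon,\mu)$ consists of $\hat\epsilon_y$ and the 2-cell $F(Gb\cdot\psi_{y!})\cdot\phi_{Gy}^*\to b$ obtained from $\hat\epsilon_b$ by means of the counits $\psi_{y!}\to1$ and $\phi_{Gy}^*\to1$. -/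

import Mathlib

set_option linter.unusedVariables false
set_option linter.unusedSectionVars false

open CategoryTheory CategoryTheory.Limits

universe w t v u w₁ t₁ v₁ u₁ w₂ t₂ v₂ u₂ w₃ t₃ v₃ u₃

namespace TCat

/-- A pseudodouble category whose vertical structure is the category `D` and whose horizontal
structure is weak.  A 2-cell `θ : Cell r s` carries its vertical source `dom θ` and its vertical
target `cod θ`; `hc β α h` is the horizontal composite `β · α`, defined when `cod α = dom β`, and
`hcomp s r` is the composite `s · r` of `r : a ⇸ b` and `s : b ⇸ c`. -/
class DoubleCategory (D : Type u) [Category.{v} D] where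
  Hor : D → D → Type w
  Cell : ∀ {a b c d : D}, Hor a b → Hor c d → Type t
  dom : ∀ {a b c d : D} {r : Hor a b} {s : Hor c d}, Cell r s → (a ⟶ c)
  cod : ∀ {a b c d : D} {r : Hor a b} {s : Hor c d}, Cell r s → (b ⟶ d)
  cid : ∀ {a b : D} (r : Hor a b), Cell r r
  vcomp : ∀ {a b c d a' b' : D} {r : Hor a b} {s : Hor c d} {q : Hor a' b'},
    Cell r s → Cell s q → Cell r q
  dom_cid : ∀ {a b : D} (r : Hor a b), dom (cid r) = 𝟙 a
  cod_cid : ∀ {a b : D} (r : Hor a b), cod (cid r) = 𝟙 b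
  dom_vcomp : ∀ {a b c d a' b' : D} {r : Hor a b} {s : Hor c d} {q : Hor a' b'}
    (θ : Cell r s) (ξ : Cell s q), dom (vcomp θ ξ) = dom θ ≫ dom ξ
  cod_vcomp : ∀ {a b c d a' b' : D} {r : Hor a b} {s : Hor c d} {q : Hor a' b'}
    (θ : Cell r s) (ξ : Cell s q), cod (vcomp θ ξ) = cod θ ≫ cod ξ
  cid_vcomp : ∀ {a b c d : D} {r : Hor a b} {s : Hor c d} (θ : Cell r s), vcomp (cid r) θ = θ
  vcomp_cid : ∀ {a b c d : D} {r : Hor a b} {s : Hor c d} (θ : Cell r s), vcomp θ (cid s) = θ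
  vcomp_assoc : ∀ {a b c d a' b' c' d' : D} {r : Hor a b} {s : Hor c d} {q : Hor a' b'}
    {p : Hor c' d'} (θ : Cell r s) (ξ : Cell s q) (ζ : Cell q p),
    vcomp (vcomp θ ξ) ζ = vcomp θ (vcomp ξ ζ)
  hone : ∀ a : D, Hor a a
  honeMap : ∀ {a b : D}, (a ⟶ b) → Cell (hone a) (hone b)
  dom_honeMap : ∀ {a b : D} (f : a ⟶ b), dom (honeMap f) = f
  cod_honeMap : ∀ {a b : D} (f : a ⟶ b), cod (honeMap f) = f
  honeMap_id : ∀ a : D, honeMap (𝟙 a) = cid (hone a)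
  honeMap_comp : ∀ {a b c : D} (f : a ⟶ b) (g : b ⟶ c),
    honeMap (f ≫ g) = vcomp (honeMap f) (honeMap g)
  hcomp : ∀ {a b c : D}, Hor b c → Hor a b → Hor a c
  hc : ∀ {a b c a' b' c' : D} {s : Hor b c} {r : Hor a b} {s' : Hor b' c'} {r' : Hor a' b'}
    (β : Cell s s') (α : Cell r r'), cod α = dom β → Cell (hcomp s r) (hcomp s' r')
  dom_hc : ∀ {a b c a' b' c' : D} {s : Hor b c} {r : Hor a b} {s' : Hor b' c'} {r' : Hor a' b'}
    (β : Cell s s') (α : Cell r r') (h : cod α = dom β), dom (hc β α h) = dom α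
  cod_hc : ∀ {a b c a' b' c' : D} {s : Hor b c} {r : Hor a b} {s' : Hor b' c'} {r' : Hor a' b'}
    (β : Cell s s') (α : Cell r r') (h : cod α = dom β), cod (hc β α h) = cod β
  hc_cid : ∀ {a b c : D} (s : Hor b c) (r : Hor a b),
    hc (cid s) (cid r) ((cod_cid r).trans (dom_cid s).symm) = cid (hcomp s r)
  hc_vcomp : ∀ {a b c a' b' c' a'' b'' c'' : D} {s : Hor b c} {r : Hor a b} {s' : Hor b' c'}
    {r' : Hor a' b'} {s'' : Hor b'' c''} {r'' : Hor a'' b''} (β : Cell s s') (α : Cell r r')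
    (h : cod α = dom β) (β' : Cell s' s'') (α' : Cell r' r'') (h' : cod α' = dom β'),
    vcomp (hc β α h) (hc β' α' h') = hc (vcomp β β') (vcomp α α')
      ((cod_vcomp α α').trans ((congrArg₂ (· ≫ ·) h h').trans (dom_vcomp β β').symm))
  /- the left unitor `1 · r ⟶ r` -/
  lam : ∀ {a b : D} (r : Hor a b), Cell (hcomp (hone b) r) r
  lamInv : ∀ {a b : D} (r : Hor a b), Cell r (hcomp (hone b) r)
  dom_lam : ∀ {a b : D} (r : Hor a b), dom (lam r) = 𝟙 a
  cod_lam : ∀ {a b : D} (r : Hor a b), cod (lam r) = 𝟙 b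
  dom_lamInv : ∀ {a b : D} (r : Hor a b), dom (lamInv r) = 𝟙 a
  cod_lamInv : ∀ {a b : D} (r : Hor a b), cod (lamInv r) = 𝟙 b
  lam_lamInv : ∀ {a b : D} (r : Hor a b), vcomp (lam r) (lamInv r) = cid _
  lamInv_lam : ∀ {a b : D} (r : Hor a b), vcomp (lamInv r) (lam r) = cid _
  lam_nat : ∀ {a b c d : D} {r : Hor a b} {s : Hor c d} (θ : Cell r s),
    vcomp (hc (honeMap (cod θ)) θ (dom_honeMap _).symm) (lam s) = vcomp (lam r) θ
  /- the right unitor `r · 1 ⟶ r` -/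
  rho : ∀ {a b : D} (r : Hor a b), Cell (hcomp r (hone a)) r
  rhoInv : ∀ {a b : D} (r : Hor a b), Cell r (hcomp r (hone a))
  dom_rho : ∀ {a b : D} (r : Hor a b), dom (rho r) = 𝟙 a
  cod_rho : ∀ {a b : D} (r : Hor a b), cod (rho r) = 𝟙 b
  dom_rhoInv : ∀ {a b : D} (r : Hor a b), dom (rhoInv r) = 𝟙 a
  cod_rhoInv : ∀ {a b : D} (r : Hor a b), cod (rhoInv r) = 𝟙 b
  rho_rhoInv : ∀ {a b : D} (r : Hor a b), vcomp (rho r) (rhoInv r) = cid _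
  rhoInv_rho : ∀ {a b : D} (r : Hor a b), vcomp (rhoInv r) (rho r) = cid _
  rho_nat : ∀ {a b c d : D} {r : Hor a b} {s : Hor c d} (θ : Cell r s),
    vcomp (hc θ (honeMap (dom θ)) (cod_honeMap _)) (rho s) = vcomp (rho r) θ
  /- the associator `(t · s) · r ⟶ t · (s · r)` -/
  assoc : ∀ {a b c d : D} (t : Hor c d) (s : Hor b c) (r : Hor a b),
    Cell (hcomp (hcomp t s) r) (hcomp t (hcomp s r))
  assocInv : ∀ {a b c d : D} (t : Hor c d) (s : Hor b c) (r : Hor a b),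
    Cell (hcomp t (hcomp s r)) (hcomp (hcomp t s) r)
  dom_assoc : ∀ {a b c d : D} (t : Hor c d) (s : Hor b c) (r : Hor a b), dom (assoc t s r) = 𝟙 a
  cod_assoc : ∀ {a b c d : D} (t : Hor c d) (s : Hor b c) (r : Hor a b), cod (assoc t s r) = 𝟙 d
  dom_assocInv : ∀ {a b c d : D} (t : Hor c d) (s : Hor b c) (r : Hor a b),
    dom (assocInv t s r) = 𝟙 a
  cod_assocInv : ∀ {a b c d : D} (t : Hor c d) (s : Hor b c) (r : Hor a b),
    cod (assocInv t s r) = 𝟙 d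
  assoc_assocInv : ∀ {a b c d : D} (t : Hor c d) (s : Hor b c) (r : Hor a b),
    vcomp (assoc t s r) (assocInv t s r) = cid _
  assocInv_assoc : ∀ {a b c d : D} (t : Hor c d) (s : Hor b c) (r : Hor a b),
    vcomp (assocInv t s r) (assoc t s r) = cid _
  assoc_nat : ∀ {a b c d a' b' c' d' : D} {t : Hor c d} {s : Hor b c} {r : Hor a b}
    {t' : Hor c' d'} {s' : Hor b' c'} {r' : Hor a' b'} (γ : Cell t t') (β : Cell s s')
    (α : Cell r r') (h₁ : cod β = dom γ) (h₂ : cod α = dom β),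
    vcomp (hc (hc γ β h₁) α (h₂.trans (dom_hc γ β h₁).symm)) (assoc t' s' r') =
      vcomp (assoc t s r) (hc γ (hc β α h₂) ((cod_hc β α h₂).trans h₁))
  triangle : ∀ {a b c : D} (s : Hor b c) (r : Hor a b),
    vcomp (assoc s (hone b) r) (hc (cid s) (lam r) ((cod_lam r).trans (dom_cid s).symm)) =
      hc (rho s) (cid r) ((cod_cid r).trans (dom_rho s).symm)
  pentagon : ∀ {a b c d e : D} (t : Hor d e) (s : Hor c d) (r : Hor b c) (q : Hor a b),
    vcomp (assoc (hcomp t s) r q) (assoc t s (hcomp r q)) =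
      vcomp (hc (assoc t s r) (cid q) ((cod_cid q).trans (dom_assoc t s r).symm))
        (vcomp (assoc t (hcomp s r) q)
          (hc (cid t) (assoc s r q) ((cod_assoc s r q).trans (dom_cid t).symm)))

open DoubleCategory

attribute [simp] dom_cid cod_cid dom_vcomp cod_vcomp cid_vcomp vcomp_cid vcomp_assoc dom_honeMap
  cod_honeMap honeMap_id dom_hc cod_hc hc_cid hc_vcomp dom_lam cod_lam dom_lamInv cod_lamInv
  dom_rho cod_rho dom_rhoInv cod_rhoInv dom_assoc cod_assoc dom_assocInv cod_assocInv
  lam_lamInv lamInv_lam rho_rhoInv rhoInv_rho assoc_assocInv assocInv_assoc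

/-- `θ ≫ᵥ ξ` is the vertical composite `ξ ∘ θ` of 2-cells. -/
infixr:80 " ≫ᵥ " => DoubleCategory.vcomp

section Functors

variable {D : Type u} [Category.{v} D] [DoubleCategory.{w, t} D]
  {E : Type u₁} [Category.{v₁} E] [DoubleCategory.{w₁, t₁} E]
  {B : Type u₂} [Category.{v₂} B] [DoubleCategory.{w₂, t₂} B]

/-- A 2-cell is invertible when it has a two-sided inverse for vertical composition. -/
def IsInv {a b c d : D} {r : Hor a b} {s : Hor c d} (θ : Cell r s) : Prop :=
  ∃ ξ : Cell s r, θ ≫ᵥ ξ = cid r ∧ ξ ≫ᵥ θ = cid s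

theorem vcomp_congr {a b c d a' b' : D} {r : Hor a b} {s : Hor c d} {q : Hor a' b'}
    {θ θ' : Cell r s} (h : θ = θ') (χ : Cell s q) : θ ≫ᵥ χ = θ' ≫ᵥ χ := by rw [h]

/-- The inverse of an invertible 2-cell. -/
noncomputable def IsInv.inv {a b c d : D} {r : Hor a b} {s : Hor c d} {θ : Cell r s}
    (h : IsInv θ) : Cell s r := h.choose

theorem IsInv.dom_inv {a b c : D} {r : Hor a b} {s : Hor a c} {θ : Cell r s}
    (h : IsInv θ) (hθ : dom θ = 𝟙 a) : dom h.inv = 𝟙 a := by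
  have := congrArg dom h.choose_spec.1
  simp only [dom_vcomp, dom_cid, hθ, Category.id_comp] at this
  exact this

theorem IsInv.cod_inv {a b c : D} {r : Hor a b} {s : Hor c b} {θ : Cell r s}
    (h : IsInv θ) (hθ : cod θ = 𝟙 b) : cod h.inv = 𝟙 b := by
  have := congrArg cod h.choose_spec.1
  simp only [cod_vcomp, cod_cid, hθ, Category.id_comp] at this
  exact this

variable (D E) in
/-- Lax functors between pseudodouble categories. -/
structure LaxFunctor where
  base : D ⥤ E
  hor : ∀ {a b : D}, Hor a b → Hor (base.obj a) (base.obj b)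
  cell : ∀ {a b c d : D} {r : Hor a b} {s : Hor c d}, Cell r s → Cell (hor r) (hor s)
  dom_cell : ∀ {a b c d : D} {r : Hor a b} {s : Hor c d} (θ : Cell r s),
    dom (cell θ) = base.map (dom θ)
  cod_cell : ∀ {a b c d : D} {r : Hor a b} {s : Hor c d} (θ : Cell r s),
    cod (cell θ) = base.map (cod θ)
  cell_cid : ∀ {a b : D} (r : Hor a b), cell (cid r) = cid (hor r)
  cell_vcomp : ∀ {a b c d a' b' : D} {r : Hor a b} {s : Hor c d} {q : Hor a' b'}
    (θ : Cell r s) (ξ : Cell s q), cell (θ ≫ᵥ ξ) = cell θ ≫ᵥ cell ξ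
  /- the comparison `1 ⟶ F 1` -/
  unitC : ∀ a : D, Cell (hone (base.obj a)) (hor (hone a))
  dom_unitC : ∀ a : D, dom (unitC a) = 𝟙 _
  cod_unitC : ∀ a : D, cod (unitC a) = 𝟙 _
  unitC_nat : ∀ {a b : D} (f : a ⟶ b),
    honeMap (base.map f) ≫ᵥ unitC b = unitC a ≫ᵥ cell (honeMap f)
  /- the comparison `F s · F r ⟶ F (s · r)` -/
  compC : ∀ {a b c : D} (s : Hor b c) (r : Hor a b), Cell (hcomp (hor s) (hor r)) (hor (hcomp s r))
  dom_compC : ∀ {a b c : D} (s : Hor b c) (r : Hor a b), dom (compC s r) = 𝟙 _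
  cod_compC : ∀ {a b c : D} (s : Hor b c) (r : Hor a b), cod (compC s r) = 𝟙 _
  compC_nat : ∀ {a b c a' b' c' : D} {s : Hor b c} {r : Hor a b} {s' : Hor b' c'} {r' : Hor a' b'}
    (β : Cell s s') (α : Cell r r') (h : cod α = dom β),
    hc (cell β) (cell α) (by rw [cod_cell, dom_cell, h]) ≫ᵥ compC s' r' =
      compC s r ≫ᵥ cell (hc β α h)
  left_unit : ∀ {a b : D} (r : Hor a b),
    hc (unitC b) (cid (hor r)) (by simp [dom_unitC]) ≫ᵥ compC (hone b) r ≫ᵥ cell (lam r) =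
      lam (hor r)
  right_unit : ∀ {a b : D} (r : Hor a b),
    hc (cid (hor r)) (unitC a) (by simp [cod_unitC]) ≫ᵥ compC r (hone a) ≫ᵥ cell (rho r) =
      rho (hor r)
  assoc_comp : ∀ {a b c d : D} (p : Hor c d) (s : Hor b c) (r : Hor a b),
    hc (compC p s) (cid (hor r)) (by simp [dom_compC]) ≫ᵥ compC (hcomp p s) r ≫ᵥ
        cell (assoc p s r) =
      assoc (hor p) (hor s) (hor r) ≫ᵥ hc (cid (hor p)) (compC s r) (by simp [cod_compC]) ≫ᵥ
        compC p (hcomp s r)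

attribute [simp] LaxFunctor.dom_cell LaxFunctor.cod_cell LaxFunctor.cell_cid LaxFunctor.cell_vcomp
  LaxFunctor.dom_unitC LaxFunctor.cod_unitC LaxFunctor.dom_compC LaxFunctor.cod_compC

theorem LaxFunctor.cell_vcomp_assoc (F : LaxFunctor D E) {a b c d a' b' : D} {c' d' : E}
    {r : Hor a b} {s : Hor c d} {q : Hor a' b'} {p : Hor c' d'}
    (θ : Cell r s) (ξ : Cell s q) (χ : Cell (F.hor q) p) :
    F.cell θ ≫ᵥ F.cell ξ ≫ᵥ χ = F.cell (θ ≫ᵥ ξ) ≫ᵥ χ := by simp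

theorem LaxFunctor.unitC_nat_assoc (F : LaxFunctor D E) {a b : D} (f : a ⟶ b) {c' d' : E}
    {p : Hor c' d'} (χ : Cell (F.hor (hone b)) p) :
    honeMap (F.base.map f) ≫ᵥ F.unitC b ≫ᵥ χ = F.unitC a ≫ᵥ F.cell (honeMap f) ≫ᵥ χ := by
  rw [← vcomp_assoc, F.unitC_nat, vcomp_assoc]

theorem LaxFunctor.compC_nat_assoc (F : LaxFunctor D E) {a b c a' b' c' : D} {s : Hor b c}
    {r : Hor a b} {s' : Hor b' c'} {r' : Hor a' b'} (β : Cell s s') (α : Cell r r')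
    (h : cod α = dom β) {c'' d'' : E} {p : Hor c'' d''} (χ : Cell (F.hor (hcomp s' r')) p) :
    hc (F.cell β) (F.cell α) (by rw [F.cod_cell, F.dom_cell, h]) ≫ᵥ F.compC s' r' ≫ᵥ χ =
      F.compC s r ≫ᵥ F.cell (hc β α h) ≫ᵥ χ := by
  rw [← vcomp_assoc, F.compC_nat, vcomp_assoc]

variable (D) in
/-- The identity lax functor. -/
abbrev LaxFunctor.id : LaxFunctor D D where
  base := 𝟭 D
  hor r := r
  cell θ := θ
  dom_cell _ := rfl
  cod_cell _ := rfl
  cell_cid _ := rfl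
  cell_vcomp _ _ := rfl
  unitC a := cid _
  dom_unitC _ := by simp
  cod_unitC _ := by simp
  unitC_nat f := by simp
  compC s r := cid _
  dom_compC _ _ := by simp
  cod_compC _ _ := by simp
  compC_nat β α h := by simp
  left_unit r := by simp
  right_unit r := by simp
  assoc_comp p s r := by simp

/-- The composite `G ∘ F` of lax functors. -/
abbrev LaxFunctor.comp (F : LaxFunctor D E) (G : LaxFunctor E B) : LaxFunctor D B where
  base := F.base ⋙ G.base
  hor r := G.hor (F.hor r)
  cell θ := G.cell (F.cell θ)
  dom_cell _ := by simp
  cod_cell _ := by simp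
  cell_cid _ := by simp
  cell_vcomp _ _ := by simp
  unitC a := G.unitC (F.base.obj a) ≫ᵥ G.cell (F.unitC a)
  dom_unitC _ := by simp
  cod_unitC _ := by simp
  unitC_nat {a b} f := by
    have h := congrArg G.cell (F.unitC_nat f)
    have h2 := G.unitC_nat_assoc (F.base.map f) (G.cell (F.unitC b))
    simp only [LaxFunctor.cell_vcomp] at h
    simp only [Functor.comp_obj, Functor.comp_map, vcomp_assoc]
    rw [h2, h]
  compC s r := G.compC (F.hor s) (F.hor r) ≫ᵥ G.cell (F.compC s r)
  dom_compC _ _ := by simp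
  cod_compC _ _ := by simp
  compC_nat {a b c a' b' c' s r s' r'} β α h := by
    have h1 := congrArg G.cell (F.compC_nat β α h)
    simp only [LaxFunctor.cell_vcomp] at h1
    have h2 := G.compC_nat_assoc (F.cell β) (F.cell α) (by rw [F.cod_cell, F.dom_cell, h])
      (G.cell (F.compC s' r'))
    simp only [vcomp_assoc]
    rw [h2, h1]
  left_unit {a b} r := by
    have h1 := congrArg G.cell (F.left_unit r)
    simp only [LaxFunctor.cell_vcomp] at h1
    rw [← G.left_unit, ← h1]
    have h2 := G.compC_nat_assoc (F.unitC b) (cid (F.hor r)) (by simp)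
      (G.cell (F.compC (hone b) r) ≫ᵥ G.cell (F.cell (lam r)))
    simp only [vcomp_assoc]
    rw [← h2, ← vcomp_assoc (hc (G.unitC _) _ _), hc_vcomp]
    simp
  right_unit {a b} r := by
    have h1 := congrArg G.cell (F.right_unit r)
    simp only [LaxFunctor.cell_vcomp] at h1
    rw [← G.right_unit, ← h1]
    have h2 := G.compC_nat_assoc (cid (F.hor r)) (F.unitC a) (by simp)
      (G.cell (F.compC r (hone a)) ≫ᵥ G.cell (F.cell (rho r)))
    simp only [vcomp_assoc]
    rw [← h2, ← vcomp_assoc (hc _ (G.unitC _) _), hc_vcomp]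
    simp
  assoc_comp {a b c d} p s r := by
    have h1 := congrArg G.cell (F.assoc_comp p s r)
    simp only [LaxFunctor.cell_vcomp] at h1
    have h2 := G.compC_nat_assoc (F.compC p s) (cid (F.hor r)) (by simp)
      (G.cell (F.compC (hcomp p s) r) ≫ᵥ G.cell (F.cell (assoc p s r)))
    have h3 := G.compC_nat_assoc (cid (F.hor p)) (F.compC s r) (by simp)
      (G.cell (F.compC p (hcomp s r)))
    have h4 := G.assoc_comp (F.hor p) (F.hor s) (F.hor r)
    have e1 : hc (G.compC (F.hor p) (F.hor s) ≫ᵥ G.cell (F.compC p s)) (cid (G.hor (F.hor r)))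
        (by simp) = hc (G.compC (F.hor p) (F.hor s)) (cid (G.hor (F.hor r))) (by simp) ≫ᵥ
          hc (G.cell (F.compC p s)) (G.cell (cid (F.hor r))) (by simp) := by simp
    have e2 : hc (cid (G.hor (F.hor p))) (G.compC (F.hor s) (F.hor r) ≫ᵥ G.cell (F.compC s r))
        (by simp) = hc (cid (G.hor (F.hor p))) (G.compC (F.hor s) (F.hor r)) (by simp) ≫ᵥ
          hc (G.cell (cid (F.hor p))) (G.cell (F.compC s r)) (by simp) := by simp
    simp only [Functor.comp_obj] at *
    rw [e1, e2]
    simp only [vcomp_assoc]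
    rw [h2, h1, h3, ← vcomp_assoc, ← vcomp_assoc, vcomp_assoc (hc _ _ _), h4]
    simp only [vcomp_assoc]

/-- Vertical transformations between lax functors. -/
structure VertTrans (F G : LaxFunctor D E) where
  app : ∀ a : D, F.base.obj a ⟶ G.base.obj a
  naturality : ∀ {a b : D} (f : a ⟶ b), F.base.map f ≫ app b = app a ≫ G.base.map f
  cell : ∀ {a b : D} (r : Hor a b), Cell (F.hor r) (G.hor r)
  dom_cell : ∀ {a b : D} (r : Hor a b), dom (cell r) = app a
  cod_cell : ∀ {a b : D} (r : Hor a b), cod (cell r) = app b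
  cell_naturality : ∀ {a b c d : D} {r : Hor a b} {s : Hor c d} (θ : Cell r s),
    F.cell θ ≫ᵥ cell s = cell r ≫ᵥ G.cell θ
  unit : ∀ a : D, F.unitC a ≫ᵥ cell (hone a) = honeMap (app a) ≫ᵥ G.unitC a
  comp : ∀ {a b c : D} (s : Hor b c) (r : Hor a b),
    F.compC s r ≫ᵥ cell (hcomp s r) =
      hc (cell s) (cell r) ((cod_cell r).trans (dom_cell s).symm) ≫ᵥ G.compC s r

attribute [simp] VertTrans.dom_cell VertTrans.cod_cell

/-- Vertical composition of vertical transformations. -/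
def VertTrans.vcomp {F G H : LaxFunctor D E} (φ : VertTrans F G) (ψ : VertTrans G H) :
    VertTrans F H where
  app a := φ.app a ≫ ψ.app a
  naturality f := by
    rw [← Category.assoc, φ.naturality, Category.assoc, ψ.naturality, Category.assoc]
  cell r := φ.cell r ≫ᵥ ψ.cell r
  dom_cell r := by simp
  cod_cell r := by simp
  cell_naturality θ := by
    rw [← vcomp_assoc, φ.cell_naturality, vcomp_assoc, ψ.cell_naturality, vcomp_assoc]
  unit a := by
    rw [← vcomp_assoc, φ.unit, vcomp_assoc, ψ.unit, honeMap_comp, vcomp_assoc]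
  comp s r := by
    rw [← vcomp_assoc, φ.comp, vcomp_assoc, ψ.comp, ← vcomp_assoc, hc_vcomp]

/-- The whiskering `φ_F` of a vertical transformation by a lax functor at its source. -/
def VertTrans.whiskerLeft (F : LaxFunctor D E) {G H : LaxFunctor E B} (φ : VertTrans G H) :
    VertTrans (F.comp G) (F.comp H) where
  app a := φ.app (F.base.obj a)
  naturality f := φ.naturality (F.base.map f)
  cell r := φ.cell (F.hor r)
  dom_cell r := φ.dom_cell _
  cod_cell r := φ.cod_cell _
  cell_naturality θ := φ.cell_naturality (F.cell θ)
  unit a := by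
    have h := φ.unit (F.base.obj a)
    have h2 := φ.cell_naturality (F.unitC a)
    simp only [LaxFunctor.comp, Functor.comp_obj, vcomp_assoc]
    rw [h2, ← vcomp_assoc, h, vcomp_assoc]
  comp s r := by
    have h := φ.comp (F.hor s) (F.hor r)
    have h2 := φ.cell_naturality (F.compC s r)
    simp only [LaxFunctor.comp, Functor.comp_obj, vcomp_assoc]
    rw [h2, ← vcomp_assoc, h, vcomp_assoc]

/-- The whiskering `H φ` of a vertical transformation by a lax functor at its target. -/
def VertTrans.whiskerRight {F G : LaxFunctor D E} (φ : VertTrans F G) (H : LaxFunctor E B) :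
    VertTrans (F.comp H) (G.comp H) where
  app a := H.base.map (φ.app a)
  naturality f := by
    simp only [LaxFunctor.comp, Functor.comp_map, Functor.comp_obj, ← H.base.map_comp,
      φ.naturality]
  cell r := H.cell (φ.cell r)
  dom_cell r := (H.dom_cell _).trans (congrArg H.base.map (φ.dom_cell r))
  cod_cell r := (H.cod_cell _).trans (congrArg H.base.map (φ.cod_cell r))
  cell_naturality θ := by
    have := congrArg H.cell (φ.cell_naturality θ)
    simpa [LaxFunctor.comp] using this
  unit a := by
    have h1 := congrArg H.cell (φ.unit a)
    simp only [LaxFunctor.cell_vcomp] at h1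
    have h2 := H.unitC_nat_assoc (φ.app a) (H.cell (G.unitC a))
    simp only [LaxFunctor.comp, Functor.comp_obj, vcomp_assoc]
    rw [h1, ← h2]
  comp s r := by
    have h1 := congrArg H.cell (φ.comp s r)
    simp only [LaxFunctor.cell_vcomp] at h1
    have h2 := H.compC_nat_assoc (φ.cell s) (φ.cell r) (by simp) (H.cell (G.compC s r))
    simp only [LaxFunctor.comp, Functor.comp_obj, vcomp_assoc]
    rw [h1, ← h2]

variable (D) in
/-- Monads in the 2-category of pseudodouble categories, lax functors and vertical
transformations. -/
structure LaxMonad where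
  toFun : LaxFunctor D D
  e : VertTrans (LaxFunctor.id D) toFun
  m : VertTrans (toFun.comp toFun) toFun
  left_unit : ∀ a : D, e.app (toFun.base.obj a) ≫ m.app a = 𝟙 (toFun.base.obj a)
  right_unit : ∀ a : D, toFun.base.map (e.app a) ≫ m.app a = 𝟙 (toFun.base.obj a)
  mul_assoc : ∀ a : D, toFun.base.map (m.app a) ≫ m.app a = m.app (toFun.base.obj a) ≫ m.app a
  left_unit_cell : ∀ {a b : D} (r : Hor a b), e.cell (toFun.hor r) ≫ᵥ m.cell r = cid (toFun.hor r)
  right_unit_cell : ∀ {a b : D} (r : Hor a b),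
    toFun.cell (e.cell r) ≫ᵥ m.cell r = cid (toFun.hor r)
  mul_assoc_cell : ∀ {a b : D} (r : Hor a b),
    toFun.cell (m.cell r) ≫ᵥ m.cell r = m.cell (toFun.hor r) ≫ᵥ m.cell r

/-- An adjunction `F ⊣ G` in the 2-category of pseudodouble categories, lax functors and vertical
transformations. -/
structure LaxAdjunction (F : LaxFunctor D E) (G : LaxFunctor E D) where
  η : VertTrans (LaxFunctor.id D) (F.comp G)
  ε : VertTrans (G.comp F) (LaxFunctor.id E)
  left_triangle : ∀ a : D, F.base.map (η.app a) ≫ ε.app (F.base.obj a) = 𝟙 (F.base.obj a)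
  right_triangle : ∀ x : E, η.app (G.base.obj x) ≫ G.base.map (ε.app x) = 𝟙 (G.base.obj x)
  left_triangle_cell : ∀ {a b : D} (r : Hor a b),
    F.cell (η.cell r) ≫ᵥ ε.cell (F.hor r) = cid (F.hor r)
  right_triangle_cell : ∀ {x y : E} (r : Hor x y),
    η.cell (G.hor r) ≫ᵥ G.cell (ε.cell r) = cid (G.hor r)


/-- The unit `G e_F ∘ η` of the induced monad `G T F`. -/
def LaxAdjunction.monadE {F : LaxFunctor D E} {G : LaxFunctor E D} (A : LaxAdjunction F G)
    (T : LaxMonad E) : VertTrans (LaxFunctor.id D) ((F.comp T.toFun).comp G) where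
  app a := A.η.app a ≫ G.base.map (T.e.app (F.base.obj a))
  naturality {a b} f := by
    have h1 := A.η.naturality f
    have h2 := congrArg G.base.map (T.e.naturality (F.base.map f))
    simp only [Functor.comp_map, Functor.id_map, Functor.map_comp] at h1 h2 ⊢
    rw [← Category.assoc, h1, Category.assoc, h2, Category.assoc]
  cell r := A.η.cell r ≫ᵥ G.cell (T.e.cell (F.hor r))
  dom_cell r := by
    rw [dom_vcomp, A.η.dom_cell, G.dom_cell, T.e.dom_cell]
  cod_cell r := by
    rw [cod_vcomp, A.η.cod_cell, G.cod_cell, T.e.cod_cell]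
  cell_naturality θ := by
    have h1 := A.η.cell_naturality θ
    have h2 := congrArg G.cell (T.e.cell_naturality (F.cell θ))
    simp only [LaxFunctor.cell_vcomp] at h1 h2 ⊢
    rw [← vcomp_assoc, h1, vcomp_assoc, h2, vcomp_assoc]
  unit a := by
    have h1 := A.η.unit a
    have h2 := congrArg G.cell (T.e.cell_naturality (F.unitC a))
    have h3 := congrArg G.cell (T.e.unit (F.base.obj a))
    have h4 := G.unitC_nat_assoc (T.e.app (F.base.obj a))
      (G.cell (T.toFun.unitC (F.base.obj a)) ≫ᵥ G.cell (T.toFun.cell (F.unitC a)))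
    simp only [LaxFunctor.cell_vcomp, cid_vcomp, vcomp_assoc, honeMap_comp] at h1 h2 h3 h4 ⊢
    rw [h1]
    simp only [vcomp_assoc]
    rw [h2, h3]
    simp only [vcomp_assoc]
    exact congrArg (honeMap (A.η.app a) ≫ᵥ ·) h4.symm
  comp s r := by
    have h1 := A.η.comp s r
    have h2 := congrArg G.cell (T.e.cell_naturality (F.compC s r))
    have h3 := congrArg G.cell (T.e.comp (F.hor s) (F.hor r))
    have h4 := G.compC_nat_assoc (T.e.cell (F.hor s)) (T.e.cell (F.hor r)) (by simp)
      (G.cell (T.toFun.compC (F.hor s) (F.hor r)) ≫ᵥ G.cell (T.toFun.cell (F.compC s r)))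
    simp only [LaxFunctor.cell_vcomp, cid_vcomp] at h1 h2 h3 h4 ⊢
    rw [h1]
    simp only [vcomp_assoc]
    rw [h2, h3, ← hc_vcomp (A.η.cell s) (A.η.cell r) (by simp) _ _ (by simp)]
    simp only [vcomp_assoc]
    exact congrArg (hc (A.η.cell s) (A.η.cell r) _ ≫ᵥ ·) h4.symm

/-- The 2-cell `m ∘ T ε_T : T F G T ⟶ T`, precomposed with `F`. -/
def LaxAdjunction.monadN {F : LaxFunctor D E} {G : LaxFunctor E D} (A : LaxAdjunction F G)
    (T : LaxMonad E) :
    VertTrans (((F.comp T.toFun).comp G).comp (F.comp T.toFun)) (F.comp T.toFun) where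
  app a := T.toFun.base.map (A.ε.app (T.toFun.base.obj (F.base.obj a))) ≫ T.m.app (F.base.obj a)
  naturality {a b} f := by
    have h1 := congrArg T.toFun.base.map (A.ε.naturality (T.toFun.base.map (F.base.map f)))
    have h2 := T.m.naturality (F.base.map f)
    simp only [Functor.comp_map, Functor.comp_obj, Functor.id_map, Functor.id_obj,
      Functor.map_comp] at h1 h2 ⊢
    rw [← Category.assoc, h1, Category.assoc, h2, Category.assoc]
  cell r := T.toFun.cell (A.ε.cell (T.toFun.hor (F.hor r))) ≫ᵥ T.m.cell (F.hor r)
  dom_cell r := by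
    rw [dom_vcomp, T.m.dom_cell, LaxFunctor.dom_cell, A.ε.dom_cell]
  cod_cell r := by
    rw [cod_vcomp, T.m.cod_cell, LaxFunctor.cod_cell, A.ε.cod_cell]
  cell_naturality θ := by
    have h1 := congrArg T.toFun.cell (A.ε.cell_naturality (T.toFun.cell (F.cell θ)))
    have h2 := T.m.cell_naturality (F.cell θ)
    simp only [LaxFunctor.cell_vcomp] at h1 h2 ⊢
    rw [← vcomp_assoc, h1, vcomp_assoc, h2, vcomp_assoc]
  unit a := by
    have h1 := congrArg T.toFun.cell
      (A.ε.cell_naturality (T.toFun.unitC (F.base.obj a) ≫ᵥ T.toFun.cell (F.unitC a)))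
    have h2 := congrArg T.toFun.cell (A.ε.unit (T.toFun.base.obj (F.base.obj a)))
    have h3 := T.m.cell_naturality (F.unitC a)
    have h4 := T.m.unit (F.base.obj a)
    have h5 := T.toFun.unitC_nat_assoc (A.ε.app (T.toFun.base.obj (F.base.obj a)))
      (T.toFun.cell (T.toFun.unitC (F.base.obj a)) ≫ᵥ
        T.toFun.cell (T.toFun.cell (F.unitC a)) ≫ᵥ T.m.cell _)
    simp only [LaxFunctor.cell_vcomp, vcomp_cid, vcomp_assoc, honeMap_comp, Functor.comp_obj,
      Functor.id_obj] at h1 h2 h3 h4 h5 ⊢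
    have h1' := vcomp_congr h1 (T.m.cell (F.hor (hone a)))
    have h2' := vcomp_congr h2 (T.toFun.cell (T.toFun.unitC (F.base.obj a)) ≫ᵥ
      T.toFun.cell (T.toFun.cell (F.unitC a)) ≫ᵥ T.m.cell (F.hor (hone a)))
    have h4' := vcomp_congr h4 (T.toFun.cell (F.unitC a))
    simp only [vcomp_assoc] at h1' h2' h4'
    rw [h1', h2', ← h5, h3, h4']
  comp s r := by
    have h1 := congrArg T.toFun.cell (A.ε.cell_naturality
      (T.toFun.compC (F.hor s) (F.hor r) ≫ᵥ T.toFun.cell (F.compC s r)))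
    have h2 := congrArg T.toFun.cell (A.ε.comp (T.toFun.hor (F.hor s)) (T.toFun.hor (F.hor r)))
    have h3 := T.m.cell_naturality (F.compC s r)
    have h4 := T.m.comp (F.hor s) (F.hor r)
    have h5 := T.toFun.compC_nat_assoc (A.ε.cell (T.toFun.hor (F.hor s)))
      (A.ε.cell (T.toFun.hor (F.hor r))) (by simp)
      (T.toFun.cell (T.toFun.compC (F.hor s) (F.hor r)) ≫ᵥ
        T.toFun.cell (T.toFun.cell (F.compC s r)) ≫ᵥ T.m.cell _)
    simp only [LaxFunctor.cell_vcomp, vcomp_cid, vcomp_assoc] at h1 h2 h3 h4 h5 ⊢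
    have h1' := vcomp_congr h1 (T.m.cell (F.hor (hcomp s r)))
    have h2' := vcomp_congr h2 (T.toFun.cell (T.toFun.compC (F.hor s) (F.hor r)) ≫ᵥ
      T.toFun.cell (T.toFun.cell (F.compC s r)) ≫ᵥ T.m.cell (F.hor (hcomp s r)))
    have h4' := vcomp_congr h4 (T.toFun.cell (F.compC s r))
    simp only [vcomp_assoc] at h1' h2' h4'
    rw [h1', h2', ← h5, h3, h4', ← vcomp_assoc, hc_vcomp]

/-- The multiplication `G m_F ∘ G T ε_{T F}` of the induced monad `G T F`. -/
def LaxAdjunction.monadM {F : LaxFunctor D E} {G : LaxFunctor E D} (A : LaxAdjunction F G)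
    (T : LaxMonad E) :
    VertTrans (((F.comp T.toFun).comp G).comp ((F.comp T.toFun).comp G))
      ((F.comp T.toFun).comp G) where
  app a := G.base.map
    (T.toFun.base.map (A.ε.app (T.toFun.base.obj (F.base.obj a))) ≫ T.m.app (F.base.obj a))
  naturality f := ((A.monadN T).whiskerRight G).naturality f
  cell r := G.cell (T.toFun.cell (A.ε.cell (T.toFun.hor (F.hor r))) ≫ᵥ T.m.cell (F.hor r))
  dom_cell r := ((A.monadN T).whiskerRight G).dom_cell r
  cod_cell r := ((A.monadN T).whiskerRight G).cod_cell r
  cell_naturality θ := ((A.monadN T).whiskerRight G).cell_naturality θ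
  unit a := by
    have h := ((A.monadN T).whiskerRight G).unit a
    simp only [LaxAdjunction.monadN, VertTrans.whiskerRight, LaxFunctor.cell_vcomp, vcomp_assoc]
      at h ⊢
    exact h
  comp s r := by
    have h := ((A.monadN T).whiskerRight G).comp s r
    simp only [LaxAdjunction.monadN, VertTrans.whiskerRight, LaxFunctor.cell_vcomp, vcomp_assoc]
      at h ⊢
    exact h

/-- The monad `G T F` induced by an adjunction `F ⊣ G` and a monad `T`. -/
def LaxAdjunction.monad {F : LaxFunctor D E} {G : LaxFunctor E D} (A : LaxAdjunction F G)
    (T : LaxMonad E) : LaxMonad D where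
  toFun := (F.comp T.toFun).comp G
  e := A.monadE T
  m := A.monadM T
  left_unit a := by
    have h1 := congrArg G.base.map (T.e.naturality (A.ε.app (T.toFun.base.obj (F.base.obj a))))
    have h2 := A.right_triangle (T.toFun.base.obj (F.base.obj a))
    have h3 := congrArg G.base.map (T.left_unit (F.base.obj a))
    simp only [LaxAdjunction.monadE, LaxAdjunction.monadM, Functor.comp_obj, Functor.id_obj,
      Functor.id_map, Functor.map_comp, Category.assoc, Functor.map_id] at h1 h2 h3 ⊢
    rw [← reassoc_of% h1, h3]
    exact (congrArg (_ ≫ _ ≫ ·) (G.base.map_id _)).trans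
      ((congrArg (_ ≫ ·) (Category.comp_id _)).trans h2)
  right_unit a := by
    have h1 := congrArg G.base.map (congrArg T.toFun.base.map
      (A.ε.naturality (T.e.app (F.base.obj a))))
    have h2 := congrArg G.base.map (congrArg T.toFun.base.map (A.left_triangle a))
    have h3 := congrArg G.base.map (T.right_unit (F.base.obj a))
    simp only [LaxAdjunction.monadE, LaxAdjunction.monadM, Functor.comp_obj, Functor.id_obj,
      Functor.id_map, Functor.map_comp, Category.assoc, Functor.map_id, Functor.comp_map]
      at h1 h2 h3 ⊢
    rw [reassoc_of% h1, reassoc_of% h2, h3]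
    refine (congrArg (_ ≫ ·) (G.base.map_id _)).trans ((Category.comp_id _).trans ?_)
    exact (congrArg G.base.map (T.toFun.base.map_id _)).trans (G.base.map_id _)
  mul_assoc a := by
    have h1 := congrArg G.base.map (congrArg T.toFun.base.map (A.ε.naturality
      (T.toFun.base.map (A.ε.app (T.toFun.base.obj (F.base.obj a))) ≫ T.m.app (F.base.obj a))))
    have h2 := congrArg G.base.map
      (T.m.naturality (A.ε.app (T.toFun.base.obj (F.base.obj a))))
    have h3 := congrArg G.base.map (T.mul_assoc (F.base.obj a))
    simp only [LaxAdjunction.monadM, Functor.comp_obj, Functor.id_obj,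
      Functor.id_map, Functor.map_comp, Category.assoc, Functor.comp_map] at h1 h2 h3 ⊢
    rw [reassoc_of% h1, h3, reassoc_of% h2]
  left_unit_cell r := by
    have h1 := congrArg G.cell (T.e.cell_naturality (A.ε.cell (T.toFun.hor (F.hor r))))
    have h2 := A.right_triangle_cell (T.toFun.hor (F.hor r))
    have h3 := congrArg G.cell (T.left_unit_cell (F.hor r))
    simp only [LaxAdjunction.monadE, LaxAdjunction.monadM, LaxFunctor.cell_vcomp, vcomp_assoc,
      LaxFunctor.cell_cid] at h1 h2 h3 ⊢
    have h1' := vcomp_congr h1 (G.cell (T.m.cell (F.hor r)))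
    simp only [vcomp_assoc] at h1'
    rw [← h1', h3, vcomp_cid, h2]
  right_unit_cell r := by
    have h1 := congrArg G.cell (congrArg T.toFun.cell (A.ε.cell_naturality (T.e.cell (F.hor r))))
    have h2 := congrArg G.cell (congrArg T.toFun.cell (A.left_triangle_cell r))
    have h3 := congrArg G.cell (T.right_unit_cell (F.hor r))
    simp only [LaxAdjunction.monadE, LaxAdjunction.monadM, LaxFunctor.cell_vcomp, vcomp_assoc,
      LaxFunctor.cell_cid] at h1 h2 h3 ⊢
    have h1' := vcomp_congr h1 (G.cell (T.m.cell (F.hor r)))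
    have h2' := vcomp_congr h2 (G.cell (T.toFun.cell (T.e.cell (F.hor r))) ≫ᵥ
      (G.cell (T.m.cell (F.hor r))))
    simp only [vcomp_assoc, cid_vcomp] at h1' h2'
    rw [h1', h2', h3]
  mul_assoc_cell r := by
    have h1 := congrArg G.cell (congrArg T.toFun.cell (A.ε.cell_naturality
      (T.toFun.cell (A.ε.cell (T.toFun.hor (F.hor r))) ≫ᵥ T.m.cell (F.hor r))))
    have h2 := congrArg G.cell (T.m.cell_naturality (A.ε.cell (T.toFun.hor (F.hor r))))
    have h3 := congrArg G.cell (T.mul_assoc_cell (F.hor r))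
    simp only [LaxAdjunction.monadM, LaxFunctor.cell_vcomp, vcomp_assoc] at h1 h2 h3 ⊢
    have h1' := vcomp_congr h1 (G.cell (T.m.cell (F.hor r)))
    have h2' := vcomp_congr h2 (G.cell (T.m.cell (F.hor r)))
    simp only [vcomp_assoc] at h1' h2'
    rw [h1', h3, h2']

/-- A monad oplax morphism `(F, φ) : S ⟶ T`, with `φ : F S ⟶ T F`. -/
structure OplaxMonadMor (S : LaxMonad D) (T : LaxMonad E) where
  F : LaxFunctor D E
  φ : VertTrans (S.toFun.comp F) (F.comp T.toFun)
  unit : ∀ a : D, F.base.map (S.e.app a) ≫ φ.app a = T.e.app (F.base.obj a)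
  mul : ∀ a : D, F.base.map (S.m.app a) ≫ φ.app a =
    φ.app (S.toFun.base.obj a) ≫ T.toFun.base.map (φ.app a) ≫ T.m.app (F.base.obj a)
  unit_cell : ∀ {a b : D} (r : Hor a b), F.cell (S.e.cell r) ≫ᵥ φ.cell r = T.e.cell (F.hor r)
  mul_cell : ∀ {a b : D} (r : Hor a b), F.cell (S.m.cell r) ≫ᵥ φ.cell r =
    φ.cell (S.toFun.hor r) ≫ᵥ T.toFun.cell (φ.cell r) ≫ᵥ T.m.cell (F.hor r)

/-- A monad lax morphism `(G, ψ) : T ⟶ S`, with `ψ : S G ⟶ G T`. -/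
structure LaxMonadMor (T : LaxMonad E) (S : LaxMonad D) where
  G : LaxFunctor E D
  ψ : VertTrans (G.comp S.toFun) (T.toFun.comp G)
  unit : ∀ x : E, S.e.app (G.base.obj x) ≫ ψ.app x = G.base.map (T.e.app x)
  mul : ∀ x : E, S.m.app (G.base.obj x) ≫ ψ.app x =
    S.toFun.base.map (ψ.app x) ≫ ψ.app (T.toFun.base.obj x) ≫ G.base.map (T.m.app x)
  unit_cell : ∀ {x y : E} (r : Hor x y), S.e.cell (G.hor r) ≫ᵥ ψ.cell r = G.cell (T.e.cell r)
  mul_cell : ∀ {x y : E} (r : Hor x y), S.m.cell (G.hor r) ≫ᵥ ψ.cell r =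
    S.toFun.cell (ψ.cell r) ≫ᵥ ψ.cell (T.toFun.hor r) ≫ᵥ G.cell (T.m.cell r)

/-- A conjunction `(F, φ) ⊣ (G, ψ)` between monads `S` and `T`: a monad oplax morphism and a monad
lax morphism, with an adjunction `F ⊣ G` for which `φ` and `ψ` are mates. -/
structure MonadConjunction (S : LaxMonad D) (T : LaxMonad E) where
  left : OplaxMonadMor S T
  right : LaxMonadMor T S
  adj : LaxAdjunction left.F right.G
  unit_compat : ∀ a : D, adj.η.app (S.toFun.base.obj a) ≫ right.G.base.map (left.φ.app a) =
    S.toFun.base.map (adj.η.app a) ≫ right.ψ.app (left.F.base.obj a)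
  unit_compat_cell : ∀ {a b : D} (r : Hor a b),
    adj.η.cell (S.toFun.hor r) ≫ᵥ right.G.cell (left.φ.cell r) =
      S.toFun.cell (adj.η.cell r) ≫ᵥ right.ψ.cell (left.F.hor r)
  counit_compat : ∀ x : E, left.F.base.map (right.ψ.app x) ≫ adj.ε.app (T.toFun.base.obj x) =
    left.φ.app (right.G.base.obj x) ≫ T.toFun.base.map (adj.ε.app x)
  counit_compat_cell : ∀ {x y : E} (r : Hor x y),
    left.F.cell (right.ψ.cell r) ≫ᵥ adj.ε.cell (T.toFun.hor r) =
      left.φ.cell (right.G.hor r) ≫ᵥ T.toFun.cell (adj.ε.cell r)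

/-- The vertical transformation `ε_{T F} : F G T F ⟶ T F`. -/
def LaxAdjunction.phi {F : LaxFunctor D E} {G : LaxFunctor E D} (A : LaxAdjunction F G)
    (T : LaxMonad E) : VertTrans (((F.comp T.toFun).comp G).comp F) (F.comp T.toFun) where
  app a := A.ε.app (T.toFun.base.obj (F.base.obj a))
  naturality f := A.ε.naturality (T.toFun.base.map (F.base.map f))
  cell r := A.ε.cell (T.toFun.hor (F.hor r))
  dom_cell r := A.ε.dom_cell _
  cod_cell r := A.ε.cod_cell _
  cell_naturality θ := A.ε.cell_naturality (T.toFun.cell (F.cell θ))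
  unit a := by
    have h := (A.ε.whiskerLeft (F.comp T.toFun)).unit a
    simp only [VertTrans.whiskerLeft, LaxFunctor.cell_vcomp, LaxFunctor.cell_cid, vcomp_assoc,
      cid_vcomp] at h ⊢
    exact h.trans (congrArg (_ ≫ᵥ ·) (cid_vcomp _))
  comp s r := by
    have h := (A.ε.whiskerLeft (F.comp T.toFun)).comp s r
    simp only [VertTrans.whiskerLeft, LaxFunctor.cell_vcomp, LaxFunctor.cell_cid, vcomp_assoc,
      cid_vcomp] at h ⊢
    exact h

/-- The vertical transformation `G T ε : G T F G ⟶ G T`. -/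
def LaxAdjunction.psi {F : LaxFunctor D E} {G : LaxFunctor E D} (A : LaxAdjunction F G)
    (T : LaxMonad E) : VertTrans (G.comp ((F.comp T.toFun).comp G)) (T.toFun.comp G) where
  app x := G.base.map (T.toFun.base.map (A.ε.app x))
  naturality f := ((A.ε.whiskerRight T.toFun).whiskerRight G).naturality f
  cell r := G.cell (T.toFun.cell (A.ε.cell r))
  dom_cell r := ((A.ε.whiskerRight T.toFun).whiskerRight G).dom_cell r
  cod_cell r := ((A.ε.whiskerRight T.toFun).whiskerRight G).cod_cell r
  cell_naturality θ := ((A.ε.whiskerRight T.toFun).whiskerRight G).cell_naturality θ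
  unit x := by
    have h := ((A.ε.whiskerRight T.toFun).whiskerRight G).unit x
    simp only [VertTrans.whiskerRight, LaxFunctor.cell_vcomp, LaxFunctor.cell_cid, vcomp_assoc,
      vcomp_cid] at h ⊢
    exact h
  comp s r := by
    have h := ((A.ε.whiskerRight T.toFun).whiskerRight G).comp s r
    simp only [VertTrans.whiskerRight, LaxFunctor.cell_vcomp, LaxFunctor.cell_cid, vcomp_assoc,
      vcomp_cid] at h ⊢
    exact h

/-- The conjunction of monads `(F, ε_{T F}) ⊣ (G, G T ε)` between `G T F` and `T` induced by an
adjunction `F ⊣ G` and a monad `T`. -/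
def LaxAdjunction.conjunction {F : LaxFunctor D E} {G : LaxFunctor E D} (A : LaxAdjunction F G)
    (T : LaxMonad E) : MonadConjunction (A.monad T) T where
  left :=
    { F := F
      φ := A.phi T
      unit := fun a => by
        have h1 := A.ε.naturality (T.e.app (F.base.obj a))
        have h2 := A.left_triangle a
        simp only [LaxAdjunction.monad, LaxAdjunction.monadE, LaxAdjunction.phi, Functor.comp_obj,
          Functor.id_obj, Functor.id_map, Functor.map_comp, Category.assoc, Functor.comp_map]
          at h1 h2 ⊢
        rw [h1, reassoc_of% h2]
      mul := fun a => A.ε.naturality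
        (T.toFun.base.map (A.ε.app (T.toFun.base.obj (F.base.obj a))) ≫ T.m.app (F.base.obj a))
      unit_cell := fun {a b} r => by
        have h1 := A.ε.cell_naturality (T.e.cell (F.hor r))
        have h2 := vcomp_congr (A.left_triangle_cell r) (T.e.cell (F.hor r))
        simp only [LaxAdjunction.monad, LaxAdjunction.monadE, LaxAdjunction.phi,
          LaxFunctor.cell_vcomp, vcomp_assoc, cid_vcomp] at h1 h2 ⊢
        rw [h1, h2]
      mul_cell := fun {a b} r => A.ε.cell_naturality
        (T.toFun.cell (A.ε.cell (T.toFun.hor (F.hor r))) ≫ᵥ T.m.cell (F.hor r)) }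
  right :=
    { G := G
      ψ := A.psi T
      unit := fun x => by
        have h1 := congrArg G.base.map (T.e.naturality (A.ε.app x))
        have h2 := A.right_triangle x
        simp only [LaxAdjunction.monad, LaxAdjunction.monadE, LaxAdjunction.psi, Functor.comp_obj,
          Functor.id_obj, Functor.id_map, Functor.map_comp, Category.assoc, Functor.comp_map]
          at h1 h2 ⊢
        rw [← h1, reassoc_of% h2]
      mul := fun x => by
        have h1 := congrArg G.base.map (congrArg T.toFun.base.map
          (A.ε.naturality (T.toFun.base.map (A.ε.app x))))
        have h2 := congrArg G.base.map (T.m.naturality (A.ε.app x))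
        simp only [LaxAdjunction.monad, LaxAdjunction.monadM, LaxAdjunction.psi, Functor.comp_obj,
          Functor.id_obj, Functor.id_map, Functor.map_comp, Category.assoc, Functor.comp_map]
          at h1 h2 ⊢
        rw [reassoc_of% h1, h2]
      unit_cell := fun {x y} r => by
        have h1 := congrArg G.cell (T.e.cell_naturality (A.ε.cell r))
        have h2 := vcomp_congr (A.right_triangle_cell r) (G.cell (T.e.cell r))
        simp only [LaxAdjunction.monad, LaxAdjunction.monadE, LaxAdjunction.psi,
          LaxFunctor.cell_vcomp, vcomp_assoc, cid_vcomp] at h1 h2 ⊢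
        rw [← h1, h2]
      mul_cell := fun {x y} r => by
        have h1 := congrArg G.cell (congrArg T.toFun.cell
          (A.ε.cell_naturality (T.toFun.cell (A.ε.cell r))))
        have h2 := congrArg G.cell (T.m.cell_naturality (A.ε.cell r))
        simp only [LaxAdjunction.monad, LaxAdjunction.monadM, LaxAdjunction.psi,
          LaxFunctor.cell_vcomp, vcomp_assoc] at h1 h2 ⊢
        have h1' := vcomp_congr h1 (G.cell (T.m.cell r))
        simp only [vcomp_assoc] at h1'
        rw [h1', h2] }
  adj := A
  unit_compat a := by
    have h1 := A.right_triangle (T.toFun.base.obj (F.base.obj a))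
    have h2 := congrArg G.base.map (congrArg T.toFun.base.map (A.left_triangle a))
    simp only [LaxAdjunction.monad, LaxAdjunction.phi, LaxAdjunction.psi, Functor.comp_obj,
      Functor.id_obj, Functor.map_comp, Functor.map_id, Functor.comp_map] at h1 h2 ⊢
    rw [h1, h2]
    exact ((congrArg G.base.map (T.toFun.base.map_id _)).trans (G.base.map_id _)).symm
  unit_compat_cell r := by
    have h1 := A.right_triangle_cell (T.toFun.hor (F.hor r))
    have h2 := congrArg G.cell (congrArg T.toFun.cell (A.left_triangle_cell r))
    simp only [LaxAdjunction.monad, LaxAdjunction.phi, LaxAdjunction.psi,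
      LaxFunctor.cell_vcomp, LaxFunctor.cell_cid] at h1 h2 ⊢
    rw [h1, h2]
  counit_compat x := A.ε.naturality (T.toFun.base.map (A.ε.app x))
  counit_compat_cell r := A.ε.cell_naturality (T.toFun.cell (A.ε.cell r))

end Functors

section Invertible

variable {D : Type u} [Category.{v} D] [DoubleCategory.{w, t} D]

theorem isInv_cid {a b : D} (r : Hor a b) : IsInv (cid r) := ⟨cid r, by simp, by simp⟩

theorem IsInv.vcomp {a b c d a' b' : D} {r : Hor a b} {s : Hor c d} {q : Hor a' b'}
    {θ : Cell r s} {ξ : Cell s q} (h : IsInv θ) (h' : IsInv ξ) : IsInv (θ ≫ᵥ ξ) := by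
  obtain ⟨θ', h₁, h₂⟩ := h
  obtain ⟨ξ', h₃, h₄⟩ := h'
  refine ⟨ξ' ≫ᵥ θ', ?_, ?_⟩
  · rw [vcomp_assoc, ← vcomp_assoc ξ, h₃, cid_vcomp, h₁]
  · rw [vcomp_assoc, ← vcomp_assoc θ', h₂, cid_vcomp, h₄]

theorem IsInv.hc {a b c a' c' : D} {s : Hor b c} {r : Hor a b} {s' : Hor b c'} {r' : Hor a' b}
    {β : Cell s s'} {α : Cell r r'} (hβ : IsInv β) (hα : IsInv α) (h₁ : dom β = 𝟙 b)
    (h₂ : cod α = 𝟙 b) (h : cod α = dom β) : IsInv (hc β α h) := by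
  have h₃ := hβ.choose_spec
  have h₄ := hα.choose_spec
  refine ⟨DoubleCategory.hc hβ.choose hα.choose
    ((hα.cod_inv h₂).trans (hβ.dom_inv h₁).symm), ?_, ?_⟩
  · refine (DoubleCategory.hc_vcomp _ _ _ _ _ _).trans ?_
    simp only [h₃.1, h₄.1, DoubleCategory.hc_cid]
  · refine (DoubleCategory.hc_vcomp _ _ _ _ _ _).trans ?_
    simp only [h₃.2, h₄.2, DoubleCategory.hc_cid]

end Invertible

section Conjoints

variable {D : Type u} [Category.{v} D] [DoubleCategory.{w, t} D]
  {E : Type u₁} [Category.{v₁} E] [DoubleCategory.{w₁, t₁} E]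

/-- A conjoint `f^* : b ⇸ a` of a vertical morphism `f : a ⟶ b`. -/
structure Conjoint {a b : D} (f : a ⟶ b) where
  hor : Hor b a
  unit : Cell (hone a) hor
  counit : Cell hor (hone b)
  dom_unit : dom unit = f
  cod_unit : cod unit = 𝟙 a
  dom_counit : dom counit = 𝟙 b
  cod_counit : cod counit = f
  unit_counit : unit ≫ᵥ counit = honeMap f
  hc_unit_counit : hc unit counit (cod_counit.trans dom_unit.symm) = lam hor ≫ᵥ rhoInv hor

/-- A companion `f_! : a ⇸ b` of a vertical morphism `f : a ⟶ b`. -/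
structure Companion {a b : D} (f : a ⟶ b) where
  hor : Hor a b
  unit : Cell (hone a) hor
  counit : Cell hor (hone b)
  dom_unit : dom unit = 𝟙 a
  cod_unit : cod unit = f
  dom_counit : dom counit = f
  cod_counit : cod counit = 𝟙 b
  unit_counit : unit ≫ᵥ counit = honeMap f
  hc_counit_unit : hc counit unit (cod_unit.trans dom_counit.symm) = rho hor ≫ᵥ lamInv hor

attribute [simp] Conjoint.dom_unit Conjoint.cod_unit Conjoint.dom_counit Conjoint.cod_counit
  Companion.dom_unit Companion.cod_unit Companion.dom_counit Companion.cod_counit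

variable (D) in
/-- A pseudodouble category in which every vertical morphism has a (chosen) conjoint. -/
class ConjointClosed where
  conj : ∀ {a b : D} (f : a ⟶ b), Conjoint f

variable (D) in
/-- A pseudodouble category in which every vertical morphism has a (chosen) companion. -/
class CompanionClosed where
  comp : ∀ {a b : D} (f : a ⟶ b), Companion f

/-- The chosen conjoint `f^*`. -/
abbrev conj [ConjointClosed D] {a b : D} (f : a ⟶ b) : Conjoint f := ConjointClosed.conj f

/-- The chosen companion `f_!`. -/
abbrev companion [CompanionClosed D] {a b : D} (f : a ⟶ b) : Companion f := CompanionClosed.comp f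

/-- The unique 2-cell `ξ : p ⟶ f^*` over `h : c ⟶ b` and `k : d ⟶ a` whose composite with
`f^* ⟶ 1` is `χ`. -/
def Conjoint.lift {a b c d : D} {f : a ⟶ b} (C : Conjoint f) {p : Hor c d}
    (χ : Cell p (hone b)) (k : d ⟶ a) (h : cod χ = k ≫ f) : Cell p C.hor :=
  lamInv p ≫ᵥ hc (honeMap k ≫ᵥ C.unit) χ (by simp [h]) ≫ᵥ rho C.hor

/-- The unique 2-cell `ξ : p ⟶ f_!` over `k : c ⟶ a` and `h : d ⟶ b` whose composite with
`f_! ⟶ 1` is `χ`. -/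
def Companion.lift {a b c d : D} {f : a ⟶ b} (C : Companion f) {p : Hor c d}
    (χ : Cell p (hone b)) (k : c ⟶ a) (h : dom χ = k ≫ f) : Cell p C.hor :=
  rhoInv p ≫ᵥ hc χ (honeMap k ≫ᵥ C.unit) (by simp [h]) ≫ᵥ lam C.hor

theorem Conjoint.dom_lift {a b c d : D} {f : a ⟶ b} (C : Conjoint f) {p : Hor c d}
    (χ : Cell p (hone b)) (k : d ⟶ a) (h : cod χ = k ≫ f) : dom (C.lift χ k h) = dom χ := by
  simp [Conjoint.lift]

theorem Conjoint.cod_lift {a b c d : D} {f : a ⟶ b} (C : Conjoint f) {p : Hor c d}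
    (χ : Cell p (hone b)) (k : d ⟶ a) (h : cod χ = k ≫ f) : cod (C.lift χ k h) = k := by
  simp [Conjoint.lift]

theorem Companion.dom_lift {a b c d : D} {f : a ⟶ b} (C : Companion f) {p : Hor c d}
    (χ : Cell p (hone b)) (k : c ⟶ a) (h : dom χ = k ≫ f) : dom (C.lift χ k h) = k := by
  simp [Companion.lift]

theorem Companion.cod_lift {a b c d : D} {f : a ⟶ b} (C : Companion f) {p : Hor c d}
    (χ : Cell p (hone b)) (k : c ⟶ a) (h : dom χ = k ≫ f) : cod (C.lift χ k h) = cod χ := by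
  simp [Companion.lift]

attribute [simp] Conjoint.dom_lift Conjoint.cod_lift Companion.dom_lift Companion.cod_lift

/-- The 2-cell `F r · φ_x^* ⟶ φ_y^* · G r` that corresponds to `φ_r`. -/
def VertTrans.conjN [ConjointClosed E] {F G : LaxFunctor D E} (φ : VertTrans F G) {x y : D}
    (r : Hor x y) : Cell (hcomp (F.hor r) (conj (φ.app x)).hor)
      (hcomp (conj (φ.app y)).hor (G.hor r)) :=
  lamInv _ ≫ᵥ hc (conj (φ.app y)).unit (hc (φ.cell r) (conj (φ.app x)).counit (by simp))
    (by simp) ≫ᵥ hc (cid _) (rho _) (by simp)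

/-- A vertical transformation `φ` has a strong conjoint when the 2-cells
`F r · φ_x^* ⟶ φ_y^* · G r` are invertible. -/
def VertTrans.HasStrongConjoint [ConjointClosed E] {F G : LaxFunctor D E}
    (φ : VertTrans F G) : Prop :=
  ∀ {x y : D} (r : Hor x y), IsInv (φ.conjN r)

/-- The 2-cell `ψ_{y!} · F r ⟶ G r · ψ_{x!}` that corresponds to `ψ_r`. -/
def VertTrans.compN [CompanionClosed E] {F G : LaxFunctor D E} (ψ : VertTrans F G) {x y : D}
    (r : Hor x y) : Cell (hcomp (companion (ψ.app y)).hor (F.hor r))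
      (hcomp (G.hor r) (companion (ψ.app x)).hor) :=
  rhoInv _ ≫ᵥ hc (hc (companion (ψ.app y)).counit (ψ.cell r) (by simp))
    (companion (ψ.app x)).unit (by simp) ≫ᵥ hc (lam _) (cid _) (by simp)

/-- The comparison `(T f)^* ⟶ T (f^*)`. -/
def LaxFunctor.sigma [ConjointClosed D] [ConjointClosed E] (T : LaxFunctor D E) {a b : D}
    (f : a ⟶ b) : Cell (conj (T.base.map f)).hor (T.hor (conj f).hor) :=
  lamInv _ ≫ᵥ hc (T.unitC a ≫ᵥ T.cell (conj f).unit) (conj (T.base.map f)).counit (by simp) ≫ᵥ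
    rho _

/-- The comparison `T r · (T f)^* ⟶ T (r · f^*)`. -/
def LaxFunctor.conjComp [ConjointClosed D] [ConjointClosed E] (T : LaxFunctor D E) {a b c : D}
    (r : Hor a c) (f : a ⟶ b) : Cell (hcomp (T.hor r) (conj (T.base.map f)).hor)
      (T.hor (hcomp r (conj f).hor)) :=
  hc (cid _) (T.sigma f) (by simp [LaxFunctor.sigma]) ≫ᵥ T.compC r (conj f).hor

/-- The 2-cell `S (r · f_!) ⟶ S r · (S f)_!`, inverse to the canonical comparison. -/
def LaxFunctor.compComp [CompanionClosed D] [CompanionClosed E] (S : LaxFunctor D E) {a b c : D}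
    (r : Hor b c) (f : a ⟶ b) : Cell (S.hor (hcomp r (companion f).hor))
      (hcomp (S.hor r) (companion (S.base.map f)).hor) :=
  rhoInv _ ≫ᵥ hc (S.cell (hc (cid r) (companion f).counit (by simp) ≫ᵥ rho r))
    (companion (S.base.map f)).unit (by simp)

theorem LaxFunctor.dom_sigma [ConjointClosed D] [ConjointClosed E] (T : LaxFunctor D E) {a b : D}
    (f : a ⟶ b) : dom (T.sigma f) = 𝟙 _ := by simp [LaxFunctor.sigma]

theorem LaxFunctor.cod_sigma [ConjointClosed D] [ConjointClosed E] (T : LaxFunctor D E) {a b : D}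
    (f : a ⟶ b) : cod (T.sigma f) = 𝟙 _ := by simp [LaxFunctor.sigma]

theorem LaxFunctor.dom_conjComp [ConjointClosed D] [ConjointClosed E] (T : LaxFunctor D E)
    {a b c : D} (r : Hor a c) (f : a ⟶ b) : dom (T.conjComp r f) = 𝟙 _ := by
  simp [LaxFunctor.conjComp, LaxFunctor.dom_sigma]

theorem LaxFunctor.cod_conjComp [ConjointClosed D] [ConjointClosed E] (T : LaxFunctor D E)
    {a b c : D} (r : Hor a c) (f : a ⟶ b) : cod (T.conjComp r f) = 𝟙 _ := by
  simp [LaxFunctor.conjComp]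

theorem LaxFunctor.dom_compComp [CompanionClosed D] [CompanionClosed E] (S : LaxFunctor D E)
    {a b c : D} (r : Hor b c) (f : a ⟶ b) : dom (S.compComp r f) = 𝟙 _ := by
  simp [LaxFunctor.compComp]

theorem LaxFunctor.cod_compComp [CompanionClosed D] [CompanionClosed E] (S : LaxFunctor D E)
    {a b c : D} (r : Hor b c) (f : a ⟶ b) : cod (S.compComp r f) = 𝟙 _ := by
  simp [LaxFunctor.compComp]

theorem VertTrans.dom_conjN [ConjointClosed E] {F G : LaxFunctor D E} (φ : VertTrans F G) {x y : D}
    (r : Hor x y) : dom (φ.conjN r) = 𝟙 _ := by simp [VertTrans.conjN]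

theorem VertTrans.cod_conjN [ConjointClosed E] {F G : LaxFunctor D E} (φ : VertTrans F G) {x y : D}
    (r : Hor x y) : cod (φ.conjN r) = 𝟙 _ := by simp [VertTrans.conjN]

theorem VertTrans.dom_compN [CompanionClosed E] {F G : LaxFunctor D E} (φ : VertTrans F G) {x y : D}
    (r : Hor x y) : dom (φ.compN r) = 𝟙 _ := by simp [VertTrans.compN]

theorem VertTrans.cod_compN [CompanionClosed E] {F G : LaxFunctor D E} (φ : VertTrans F G) {x y : D}
    (r : Hor x y) : cod (φ.compN r) = 𝟙 _ := by simp [VertTrans.compN]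

end Conjoints

section Algebras

variable {D : Type u} [Category.{v} D] [DoubleCategory.{w, t} D]
  {E : Type u₁} [Category.{v₁} E] [DoubleCategory.{w₁, t₁} E]

/-- The data of a horizontal lax `T`-algebra: `a : T x ⇸ x` with unit and multiplication 2-cells,
the axioms not being imposed. -/
structure HLaxAlgData (T : LaxMonad D) where
  x : D
  a : Hor (T.toFun.base.obj x) x
  υ : Cell (hone x) a
  dom_υ : dom υ = T.e.app x
  cod_υ : cod υ = 𝟙 x
  μ : Cell (hcomp a (T.toFun.hor a)) a
  dom_μ : dom μ = T.m.app x
  cod_μ : cod μ = 𝟙 x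

attribute [simp] HLaxAlgData.dom_υ HLaxAlgData.cod_υ HLaxAlgData.dom_μ HLaxAlgData.cod_μ

variable {T : LaxMonad D}

/-- The axioms of a horizontal lax `T`-algebra: two unit laws and associativity. -/
structure HLaxAlgData.IsAlg (A : HLaxAlgData T) : Prop where
  left_unit : hc A.υ (T.e.cell A.a) (by simp) ≫ᵥ A.μ = lam A.a
  right_unit : hc (cid A.a) (T.toFun.unitC A.x ≫ᵥ T.toFun.cell A.υ) (by simp) ≫ᵥ A.μ = rho A.a
  assoc : hc (cid A.a) (T.toFun.compC A.a (T.toFun.hor A.a) ≫ᵥ T.toFun.cell A.μ) (by simp) ≫ᵥ A.μ =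
    assocInv _ _ _ ≫ᵥ hc A.μ (T.m.cell A.a) (by simp) ≫ᵥ A.μ

/-- The data of a morphism between (data of) horizontal lax `T`-algebras. -/
structure HLaxAlgData.PreHom (A B : HLaxAlgData T) where
  f : A.x ⟶ B.x
  ζ : Cell A.a B.a
  dom_ζ : dom ζ = T.toFun.base.map f
  cod_ζ : cod ζ = f

theorem HLaxAlgData.PreHom.ext {A B : HLaxAlgData T} {h k : A.PreHom B} (hf : h.f = k.f)
    (hζ : h.ζ = k.ζ) : h = k := by
  cases h
  cases k
  simp only at hf hζ
  subst hf hζ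
  rfl

attribute [simp] HLaxAlgData.PreHom.dom_ζ HLaxAlgData.PreHom.cod_ζ

/-- Compatibility of a morphism of horizontal lax `T`-algebras with units and multiplications. -/
structure HLaxAlgData.PreHom.IsHom {A B : HLaxAlgData T} (h : A.PreHom B) : Prop where
  unit : A.υ ≫ᵥ h.ζ = honeMap h.f ≫ᵥ B.υ
  mul : A.μ ≫ᵥ h.ζ = hc h.ζ (T.toFun.cell h.ζ) (by simp) ≫ᵥ B.μ

/-- The identity morphism. -/
def HLaxAlgData.PreHom.id (A : HLaxAlgData T) : A.PreHom A where
  f := 𝟙 _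
  ζ := cid _
  dom_ζ := by simp
  cod_ζ := by simp

/-- Composition of morphisms. -/
def HLaxAlgData.PreHom.comp {A B C : HLaxAlgData T} (h : A.PreHom B) (k : B.PreHom C) :
    A.PreHom C where
  f := h.f ≫ k.f
  ζ := h.ζ ≫ᵥ k.ζ
  dom_ζ := by simp
  cod_ζ := by simp

theorem HLaxAlgData.PreHom.isHom_id (A : HLaxAlgData T) : (HLaxAlgData.PreHom.id A).IsHom where
  unit := by simp [HLaxAlgData.PreHom.id]
  mul := by simp [HLaxAlgData.PreHom.id]

theorem HLaxAlgData.PreHom.IsHom.comp {A B C : HLaxAlgData T} {h : A.PreHom B} {k : B.PreHom C}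
    (hh : h.IsHom) (hk : k.IsHom) : (HLaxAlgData.PreHom.comp h k).IsHom where
  unit := by
    simp only [HLaxAlgData.PreHom.comp]
    rw [← vcomp_assoc, hh.unit, vcomp_assoc, hk.unit, honeMap_comp, vcomp_assoc]
  mul := by
    simp only [HLaxAlgData.PreHom.comp]
    rw [← vcomp_assoc, hh.mul, vcomp_assoc, hk.mul, ← vcomp_assoc, hc_vcomp]
    simp

/-- Horizontal lax `T`-algebras. -/
structure HLaxAlg (T : LaxMonad D) extends HLaxAlgData T where
  isAlg : toHLaxAlgData.IsAlg

/-- Morphisms of horizontal lax `T`-algebras. -/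
structure HLaxAlg.Hom (A B : HLaxAlg T) extends A.toHLaxAlgData.PreHom B.toHLaxAlgData where
  isHom : toPreHom.IsHom

theorem HLaxAlg.Hom.ext {A B : HLaxAlg T} {h k : HLaxAlg.Hom A B} (hf : h.f = k.f)
    (hζ : h.ζ = k.ζ) : h = k := by
  have := HLaxAlgData.PreHom.ext hf hζ
  cases h
  cases k
  simp only at this
  subst this
  rfl

/-- The category of horizontal lax `T`-algebras. -/
instance : Category (HLaxAlg T) where
  Hom A B := HLaxAlg.Hom A B
  id A := ⟨HLaxAlgData.PreHom.id _, HLaxAlgData.PreHom.isHom_id _⟩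
  comp h k := ⟨HLaxAlgData.PreHom.comp h.toPreHom k.toPreHom, h.isHom.comp k.isHom⟩
  id_comp h := by
    cases h; simp [HLaxAlgData.PreHom.comp, HLaxAlgData.PreHom.id]
  comp_id h := by
    cases h; simp [HLaxAlgData.PreHom.comp, HLaxAlgData.PreHom.id]
  assoc h k l := by
    simp [HLaxAlgData.PreHom.comp]

/-- An assignment on horizontal lax algebras and their morphisms, before the axioms of algebras,
morphisms and functors are checked. -/
structure AlgPrefunctor (S : LaxMonad D) (T : LaxMonad E) where
  obj : HLaxAlg S → HLaxAlgData T
  map : ∀ {A B : HLaxAlg S}, (A ⟶ B) → (obj A).PreHom (obj B)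

/-- The assignment takes values in algebras and morphisms, and it is functorial. -/
structure AlgPrefunctor.IsFunctorial {S : LaxMonad D} {T : LaxMonad E} (P : AlgPrefunctor S T) :
    Prop where
  isAlg : ∀ A, (P.obj A).IsAlg
  isHom : ∀ {A B : HLaxAlg S} (h : A ⟶ B), (P.map h).IsHom
  map_id : ∀ A, P.map (𝟙 A) = HLaxAlgData.PreHom.id (P.obj A)
  map_comp : ∀ {A B C : HLaxAlg S} (h : A ⟶ B) (k : B ⟶ C),
    P.map (h ≫ k) = HLaxAlgData.PreHom.comp (P.map h) (P.map k)

/-- The functor between categories of horizontal lax algebras given by a functorial assignment. -/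
def AlgPrefunctor.IsFunctorial.functor {S : LaxMonad D} {T : LaxMonad E} {P : AlgPrefunctor S T}
    (hP : P.IsFunctorial) : HLaxAlg S ⥤ HLaxAlg T where
  obj A := ⟨P.obj A, hP.isAlg A⟩
  map h := ⟨P.map h, hP.isHom h⟩
  map_id A := HLaxAlg.Hom.ext (congrArg (·.f) (hP.map_id A)) (congrArg (·.ζ) (hP.map_id A))
  map_comp h k := HLaxAlg.Hom.ext (congrArg (·.f) (hP.map_comp h k))
    (congrArg (·.ζ) (hP.map_comp h k))

end Algebras

section BaseChange

variable {D : Type u} [Category.{v} D] [DoubleCategory.{w, t} D]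
  {E : Type u₁} [Category.{v₁} E] [DoubleCategory.{w₁, t₁} E]

namespace OplaxMonadMor

variable [ConjointClosed E] {S : LaxMonad D} {T : LaxMonad E} (M : OplaxMonadMor S T)

/-- The conjoint `φ_x^* : T F x ⇸ F S x`. -/
abbrev conjφ (x : D) : Conjoint (a := M.F.base.obj (S.toFun.base.obj x))
  (b := T.toFun.base.obj (M.F.base.obj x)) (M.φ.app x) := conj _

/-- The 2-cell `1 ⟶ φ_x^*` over `e_{F x}` and `F e_x`. -/
def eC (x : D) : Cell (hone (M.F.base.obj x)) (M.conjφ x).hor :=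
  honeMap (M.F.base.map (S.e.app x)) ≫ᵥ (M.conjφ x).unit

theorem dom_eC (x : D) : dom (M.eC x) = T.e.app (M.F.base.obj x) := by
  rw [eC, dom_vcomp, dom_honeMap, Conjoint.dom_unit]
  exact M.unit x

theorem cod_eC (x : D) : cod (M.eC x) = M.F.base.map (S.e.app x) := by
  rw [eC, cod_vcomp, cod_honeMap, Conjoint.cod_unit]
  exact Category.comp_id _

/-- The 2-cell `φ_{S x}^* · (T φ_x)^* ⟶ φ_x^*` over `m_{F x}` and `F m_x`. -/
def mC (x : D) : Cell (hcomp (M.conjφ (S.toFun.base.obj x)).hor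
    (conj (T.toFun.base.map (M.φ.app x))).hor) (M.conjφ x).hor :=
  (M.conjφ x).lift
    (hc ((M.conjφ (S.toFun.base.obj x)).counit ≫ᵥ honeMap (T.toFun.base.map (M.φ.app x)))
        (conj (T.toFun.base.map (M.φ.app x))).counit (by simp) ≫ᵥ
      rho _ ≫ᵥ honeMap (T.m.app (M.F.base.obj x)))
    (M.F.base.map (S.m.app x))
    (by
      have := M.mul x
      simp at this ⊢
      exact this.symm)

theorem dom_mC (x : D) : dom (M.mC x) = T.m.app (M.F.base.obj x) := by
  simp [mC]

theorem cod_mC (x : D) : cod (M.mC x) = M.F.base.map (S.m.app x) := by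
  simp [mC]

/-- The 2-cell `φ_f^* : φ_x^* ⟶ φ_y^*` over `T F f` and `F S f`. -/
def fC {x y : D} (f : x ⟶ y) : Cell (M.conjφ x).hor (M.conjφ y).hor :=
  (M.conjφ y).lift ((M.conjφ x).counit ≫ᵥ honeMap (T.toFun.base.map (M.F.base.map f)))
    (M.F.base.map (S.toFun.base.map f)) (by
      have := M.φ.naturality f
      simp at this ⊢
      exact this.symm)

theorem dom_fC {x y : D} (f : x ⟶ y) :
    dom (M.fC f) = T.toFun.base.map (M.F.base.map f) := by
  simp [fC]

theorem cod_fC {x y : D} (f : x ⟶ y) :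
    cod (M.fC f) = M.F.base.map (S.toFun.base.map f) := by
  simp [fC]

variable (hφ : M.φ.HasStrongConjoint)
  (hT : ∀ {a b c : E} (r : Hor a c) (f : a ⟶ b), IsInv (T.toFun.conjComp r f))

/-- The inverse `φ_x^* · T F a ⟶ F S a · φ_{S x}^*` of the strong conjoint 2-cell at `a`. -/
noncomputable def nInv (A : HLaxAlgData S) :
    Cell (hcomp (M.conjφ A.x).hor (T.toFun.hor (M.F.hor A.a)))
      (hcomp (M.F.hor (S.toFun.hor A.a)) (M.conjφ (S.toFun.base.obj A.x)).hor) :=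
  (hφ A.a).inv

/-- The 2-cell `T (F a · φ_x^*) ⟶ T F a · (T φ_x)^*`, inverse to the canonical comparison. -/
noncomputable def theta (A : HLaxAlgData S) :
    Cell (T.toFun.hor (hcomp (M.F.hor A.a) (M.conjφ A.x).hor))
      (hcomp (T.toFun.hor (M.F.hor A.a)) (conj (T.toFun.base.map (M.φ.app A.x))).hor) :=
  (hT (M.F.hor A.a) (M.φ.app A.x)).inv

theorem dom_nInv (A : HLaxAlgData S) : dom (M.nInv hφ A) = 𝟙 _ :=
  (hφ A.a).dom_inv (M.φ.dom_conjN _)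

theorem cod_nInv (A : HLaxAlgData S) : cod (M.nInv hφ A) = 𝟙 _ :=
  (hφ A.a).cod_inv (M.φ.cod_conjN _)

theorem dom_theta (A : HLaxAlgData S) : dom (M.theta hT A) = 𝟙 _ :=
  (hT (M.F.hor A.a) (M.φ.app A.x)).dom_inv (LaxFunctor.dom_conjComp _ _ _)

theorem cod_theta (A : HLaxAlgData S) : cod (M.theta hT A) = 𝟙 _ :=
  (hT (M.F.hor A.a) (M.φ.app A.x)).cod_inv (LaxFunctor.cod_conjComp _ _ _)

/-- The 2-cell `φ_x^* · T (F a · φ_x^*) ⟶ F S a · (φ_{S x}^* · (T φ_x)^*)`. -/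
noncomputable def shuffle (A : HLaxAlgData S) :
    Cell (hcomp (M.conjφ A.x).hor (T.toFun.hor (hcomp (M.F.hor A.a) (M.conjφ A.x).hor)))
      (hcomp (M.F.hor (S.toFun.hor A.a)) (hcomp (M.conjφ (S.toFun.base.obj A.x)).hor
        (conj (T.toFun.base.map (M.φ.app A.x))).hor)) :=
  hc (cid _) (M.theta hT A) (by simp [cod_theta]) ≫ᵥ assocInv _ _ _ ≫ᵥ
    hc (M.nInv hφ A) (cid _) (by simp [dom_nInv]) ≫ᵥ assoc _ _ _

theorem dom_shuffle (A : HLaxAlgData S) : dom (M.shuffle hφ hT A) = 𝟙 _ := by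
  simp [shuffle, dom_theta]

theorem cod_shuffle (A : HLaxAlgData S) : cod (M.shuffle hφ hT A) = 𝟙 _ := by
  simp [shuffle, cod_nInv]

/-- The algebra `F_! (x, a, υ, μ) = (F x, F a · φ_x^*, F_! υ, F_! μ)`. -/
noncomputable def algObj (A : HLaxAlgData S) : HLaxAlgData T where
  x := M.F.base.obj A.x
  a := hcomp (M.F.hor A.a) (M.conjφ A.x).hor
  υ := lamInv _ ≫ᵥ hc (M.F.unitC A.x ≫ᵥ M.F.cell A.υ) (M.eC A.x) (by simp [cod_eC])
  dom_υ := by simp [dom_eC]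
  cod_υ := by simp
  μ := assoc _ _ _ ≫ᵥ hc (cid _) (M.shuffle hφ hT A) (by simp [cod_shuffle]) ≫ᵥ
    assocInv _ _ _ ≫ᵥ hc (M.F.compC A.a (S.toFun.hor A.a) ≫ᵥ M.F.cell A.μ) (M.mC A.x)
      (by simp [cod_mC])
  dom_μ := by simp [dom_mC, dom_shuffle]
  cod_μ := by simp

/-- The 2-cell `F ζ · φ_f^*`. -/
def algMapCell {A B : HLaxAlgData S} (h : A.PreHom B) :
    Cell (hcomp (M.F.hor A.a) (M.conjφ A.x).hor) (hcomp (M.F.hor B.a) (M.conjφ B.x).hor) :=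
  hc (M.F.cell h.ζ) (M.fC h.f) (by simp [cod_fC])

theorem dom_algMapCell {A B : HLaxAlgData S} (h : A.PreHom B) :
    dom (M.algMapCell h) = T.toFun.base.map (M.F.base.map h.f) := by
  simp [algMapCell, dom_fC]

theorem cod_algMapCell {A B : HLaxAlgData S} (h : A.PreHom B) :
    cod (M.algMapCell h) = M.F.base.map h.f := by
  simp [algMapCell]

/-- The assignment `F_!`, with `F_! (f, ζ) = (F f, F ζ · φ_f^*)`. -/
noncomputable def baseChange : AlgPrefunctor S T where
  obj A := M.algObj hφ hT A.toHLaxAlgData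
  map h :=
    { f := M.F.base.map h.f
      ζ := M.algMapCell h.toPreHom
      dom_ζ := M.dom_algMapCell h.toPreHom
      cod_ζ := M.cod_algMapCell h.toPreHom }

end OplaxMonadMor

namespace LaxMonadMor

variable [CompanionClosed D] {S : LaxMonad D} {T : LaxMonad E} (M : LaxMonadMor T S)

/-- The companion `ψ_{y!} : S G y ⇸ G T y`. -/
abbrev compψ (y : E) : Companion (a := S.toFun.base.obj (M.G.base.obj y))
  (b := M.G.base.obj (T.toFun.base.obj y)) (M.ψ.app y) := companion _

/-- The 2-cell `1 ⟶ ψ_{y!}` over `e_{G y}` and `G e_y`. -/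
def eC (y : E) : Cell (hone (M.G.base.obj y)) (M.compψ y).hor :=
  honeMap (S.e.app (M.G.base.obj y)) ≫ᵥ (M.compψ y).unit

theorem dom_eC (y : E) : dom (M.eC y) = S.e.app (M.G.base.obj y) := by
  rw [eC, dom_vcomp, dom_honeMap, Companion.dom_unit]
  exact Category.comp_id _

theorem cod_eC (y : E) : cod (M.eC y) = M.G.base.map (T.e.app y) := by
  rw [eC, cod_vcomp, cod_honeMap, Companion.cod_unit]
  exact M.unit y

/-- The 2-cell `ψ_{T y!} · (S ψ_y)_! ⟶ ψ_{y!}` over `m_{G y}` and `G m_y`. -/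
def mC (y : E) : Cell (hcomp (M.compψ (T.toFun.base.obj y)).hor
    (companion (S.toFun.base.map (M.ψ.app y))).hor) (M.compψ y).hor :=
  (M.compψ y).lift
    (hc (M.compψ (T.toFun.base.obj y)).counit
        ((companion (S.toFun.base.map (M.ψ.app y))).counit ≫ᵥ
          honeMap (M.ψ.app (T.toFun.base.obj y))) (by simp) ≫ᵥ
      lam _ ≫ᵥ honeMap (M.G.base.map (T.m.app y)))
    (S.m.app (M.G.base.obj y))
    (by
      have := M.mul y
      simp at this ⊢
      exact this.symm)

theorem dom_mC (y : E) : dom (M.mC y) = S.m.app (M.G.base.obj y) := by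
  simp [mC]

theorem cod_mC (y : E) : cod (M.mC y) = M.G.base.map (T.m.app y) := by
  simp [mC]

/-- The 2-cell `ψ_{f!} : ψ_{x!} ⟶ ψ_{y!}` over `S G f` and `G T f`. -/
def fC {x y : E} (f : x ⟶ y) : Cell (M.compψ x).hor (M.compψ y).hor :=
  (M.compψ y).lift ((M.compψ x).counit ≫ᵥ honeMap (M.G.base.map (T.toFun.base.map f)))
    (S.toFun.base.map (M.G.base.map f)) (by
      have := M.ψ.naturality f
      simp at this ⊢
      exact this.symm)

theorem dom_fC {x y : E} (f : x ⟶ y) :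
    dom (M.fC f) = S.toFun.base.map (M.G.base.map f) := by
  simp [fC]

theorem cod_fC {x y : E} (f : x ⟶ y) :
    cod (M.fC f) = M.G.base.map (T.toFun.base.map f) := by
  simp [fC]

/-- The 2-cell `ψ_{y!} · S (G b · ψ_{y!}) ⟶ G T b · (ψ_{T y!} · (S ψ_y)_!)`. -/
def shuffle (B : HLaxAlgData T) :
    Cell (hcomp (M.compψ B.x).hor (S.toFun.hor (hcomp (M.G.hor B.a) (M.compψ B.x).hor)))
      (hcomp (M.G.hor (T.toFun.hor B.a)) (hcomp (M.compψ (T.toFun.base.obj B.x)).hor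
        (companion (S.toFun.base.map (M.ψ.app B.x))).hor)) :=
  hc (cid _) (S.toFun.compComp (M.G.hor B.a) (M.ψ.app B.x))
      (by simp [LaxFunctor.cod_compComp]) ≫ᵥ
    assocInv _ _ _ ≫ᵥ hc (M.ψ.compN B.a) (cid _) (by simp [VertTrans.dom_compN]) ≫ᵥ assoc _ _ _

theorem dom_shuffle (B : HLaxAlgData T) : dom (M.shuffle B) = 𝟙 _ := by
  simp [shuffle, LaxFunctor.dom_compComp]

theorem cod_shuffle (B : HLaxAlgData T) : cod (M.shuffle B) = 𝟙 _ := by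
  simp [shuffle, VertTrans.cod_compN]

/-- The algebra `G_! (y, b, υ, μ) = (G y, G b · ψ_{y!}, G_! υ, G_! μ)`. -/
def algObj (B : HLaxAlgData T) : HLaxAlgData S where
  x := M.G.base.obj B.x
  a := hcomp (M.G.hor B.a) (M.compψ B.x).hor
  υ := lamInv _ ≫ᵥ hc (M.G.unitC B.x ≫ᵥ M.G.cell B.υ) (M.eC B.x) (by simp [cod_eC])
  dom_υ := by simp [dom_eC]
  cod_υ := by simp
  μ := assoc _ _ _ ≫ᵥ hc (cid _) (M.shuffle B) (by simp [cod_shuffle]) ≫ᵥ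
    assocInv _ _ _ ≫ᵥ hc (M.G.compC B.a (T.toFun.hor B.a) ≫ᵥ M.G.cell B.μ) (M.mC B.x)
      (by simp [cod_mC])
  dom_μ := by simp [dom_mC, dom_shuffle]
  cod_μ := by simp

/-- The 2-cell `G ζ · ψ_{f!}`. -/
def algMapCell {A B : HLaxAlgData T} (h : A.PreHom B) :
    Cell (hcomp (M.G.hor A.a) (M.compψ A.x).hor) (hcomp (M.G.hor B.a) (M.compψ B.x).hor) :=
  hc (M.G.cell h.ζ) (M.fC h.f) (by simp [cod_fC])

theorem dom_algMapCell {A B : HLaxAlgData T} (h : A.PreHom B) :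
    dom (M.algMapCell h) = S.toFun.base.map (M.G.base.map h.f) := by
  simp [algMapCell, dom_fC]

theorem cod_algMapCell {A B : HLaxAlgData T} (h : A.PreHom B) :
    cod (M.algMapCell h) = M.G.base.map h.f := by
  simp [algMapCell]

/-- The assignment `G_!`, with `G_! (f, ζ) = (G f, G ζ · ψ_{f!})`. -/
def baseChange : AlgPrefunctor T S where
  obj A := M.algObj A.toHLaxAlgData
  map h :=
    { f := M.G.base.map h.f
      ζ := M.algMapCell h.toPreHom
      dom_ζ := M.dom_algMapCell h.toPreHom
      cod_ζ := M.cod_algMapCell h.toPreHom }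

end LaxMonadMor

namespace MonadConjunction

variable [CompanionClosed D] [ConjointClosed E] {S : LaxMonad D} {T : LaxMonad E}
  (C : MonadConjunction S T) (hφ : C.left.φ.HasStrongConjoint)
  (hT : ∀ {a b c : E} (r : Hor a c) (f : a ⟶ b), IsInv (T.toFun.conjComp r f))

/-- The 2-cell `a ⟶ G (F a · φ_x^*) · ψ_{F x !}` obtained from `η_a`. -/
def unitCell (A : HLaxAlgData S) : Cell A.a
    (hcomp (C.right.G.hor (hcomp (C.left.F.hor A.a) (C.left.conjφ A.x).hor))
      (C.right.compψ (C.left.F.base.obj A.x)).hor) :=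
  rhoInv A.a ≫ᵥ
    hc (C.adj.η.cell A.a ≫ᵥ C.right.G.cell (rhoInv (C.left.F.hor A.a) ≫ᵥ
          hc (cid (C.left.F.hor A.a)) (C.left.conjφ A.x).unit (by simp)))
      (honeMap (S.toFun.base.map (C.adj.η.app A.x)) ≫ᵥ
        (C.right.compψ (C.left.F.base.obj A.x)).unit)
      (by
        have := C.unit_compat A.x
        simp at this ⊢
        exact this.symm)

theorem dom_unitCell (A : HLaxAlgData S) :
    dom (C.unitCell A) = S.toFun.base.map (C.adj.η.app A.x) := by
  simp [unitCell]

theorem cod_unitCell (A : HLaxAlgData S) : cod (C.unitCell A) = C.adj.η.app A.x := by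
  simp [unitCell]

/-- The component at `(x, a, υ, μ)` of the unit of `F_! ⊣ G_!`, given by `η_x` and `η_a`. -/
noncomputable def unitHom (A : HLaxAlgData S) :
    A.PreHom (C.right.algObj (C.left.algObj hφ hT A)) where
  f := C.adj.η.app A.x
  ζ := C.unitCell A
  dom_ζ := C.dom_unitCell A
  cod_ζ := C.cod_unitCell A

/-- The 2-cell `F (G b · ψ_{y!}) · φ_{G y}^* ⟶ b` obtained from `ε_b`. -/
def counitCell (B : HLaxAlgData T) : Cell
    (hcomp (C.left.F.hor (hcomp (C.right.G.hor B.a) (C.right.compψ B.x).hor))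
      (C.left.conjφ (C.right.G.base.obj B.x)).hor) B.a :=
  hc (C.left.F.cell (hc (cid (C.right.G.hor B.a)) (C.right.compψ B.x).counit (by simp) ≫ᵥ
          rho (C.right.G.hor B.a)) ≫ᵥ C.adj.ε.cell B.a)
      ((C.left.conjφ (C.right.G.base.obj B.x)).counit ≫ᵥ
        honeMap (T.toFun.base.map (C.adj.ε.app B.x)))
      (by
        have := C.counit_compat B.x
        simp at this ⊢
        exact this.symm) ≫ᵥ
    rho B.a

theorem dom_counitCell (B : HLaxAlgData T) :
    dom (C.counitCell B) = T.toFun.base.map (C.adj.ε.app B.x) := by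
  simp [counitCell]

theorem cod_counitCell (B : HLaxAlgData T) : cod (C.counitCell B) = C.adj.ε.app B.x := by
  simp [counitCell]

/-- The component at `(y, b, υ, μ)` of the counit of `F_! ⊣ G_!`, given by `ε_y` and `ε_b`. -/
noncomputable def counitHom (B : HLaxAlgData T) :
    (C.left.algObj hφ hT (C.right.algObj B)).PreHom B where
  f := C.adj.ε.app B.x
  ζ := C.counitCell B
  dom_ζ := C.dom_counitCell B
  cod_ζ := C.cod_counitCell B

end MonadConjunction

end BaseChange

attribute [local simp] pullback.lift_fst pullback.lift_snd pullback.lift_fst_assoc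
  pullback.lift_snd_assoc Sigma.ι_desc Sigma.ι_desc_assoc prod.lift_fst prod.lift_snd
  prod.lift_fst_assoc prod.lift_snd_assoc Sigma.ι_map Sigma.ι_map_assoc

section Extensive

variable {V : Type u} [Category.{v} V]

/-- The coproduct functor `∏ᵢ V/Xᵢ ⥤ V/∐ᵢ Xᵢ`. -/
noncomputable def coprodOver [HasCoproducts.{v} V] {I : Type v} (X : I → V) :
    (∀ i, Over (X i)) ⥤ Over (∐ X) where
  obj A := Over.mk (Limits.Sigma.map fun i => (A i).hom)
  map f := Over.homMk (Limits.Sigma.map fun i => (f i).left) (by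
    apply Sigma.hom_ext
    intro i
    simp)
  map_id A := by
    apply Over.OverMorphism.ext
    apply Sigma.hom_ext
    intro i
    simp
  map_comp f g := by
    apply Over.OverMorphism.ext
    apply Sigma.hom_ext
    intro i
    simp

/-- An extensive category: a category with coproducts in which the coproduct functors
`∏ᵢ V/Xᵢ ⥤ V/∐ᵢ Xᵢ` are equivalences. -/
class Extensive (V : Type u) [Category.{v} V] [HasCoproducts.{v} V] : Prop where
  isEquivalence : ∀ {I : Type v} (X : I → V), (coprodOver X).IsEquivalence

variable [HasCoproducts.{v} V]

/-- The morphisms `eᵢ` exhibit their common codomain as a coproduct. -/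
def IsCop {I : Type v} {A : I → V} {B : V} (e : ∀ i, A i ⟶ B) : Prop := IsIso (Sigma.desc e)

namespace IsCop

theorem sigma {I : Type v} (A : I → V) : IsCop (Sigma.ι A) := by
  have : Sigma.desc (Sigma.ι A) = 𝟙 _ := by
    apply Sigma.hom_ext
    simp
  rw [IsCop, this]
  infer_instance

variable {I : Type v} {A : I → V} {B : V} {e : ∀ i, A i ⟶ B}

theorem out (h : IsCop e) : IsIso (Sigma.desc e) := h

/-- The morphism out of a coproduct with given components. -/
noncomputable def desc (h : IsCop e) {Z : V} (f : ∀ i, A i ⟶ Z) : B ⟶ Z :=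
  have : IsIso (Sigma.desc e) := h.out
  inv (Sigma.desc e) ≫ Sigma.desc f

@[simp]
theorem fac (h : IsCop e) {Z : V} (f : ∀ i, A i ⟶ Z) (i : I) : e i ≫ h.desc f = f i := by
  have : IsIso (Sigma.desc e) := h.out
  have h1 : e i = Sigma.ι A i ≫ Sigma.desc e := by simp
  rw [h1, desc, Category.assoc, IsIso.hom_inv_id_assoc, Sigma.ι_desc]

@[simp]
theorem fac_assoc (h : IsCop e) {Z : V} (f : ∀ i, A i ⟶ Z) (i : I) {Z' : V}
    (h' : _ ⟶ Z') :
    e i ≫ h.desc f ≫ h' =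
      f i ≫ h' := by
  rw [← Category.assoc, fac]

theorem hom_ext (h : IsCop e) {Z : V} {f g : B ⟶ Z} (w : ∀ i, e i ≫ f = e i ≫ g) : f = g := by
  have : IsIso (Sigma.desc e) := h.out
  rw [← cancel_epi (Sigma.desc e)]
  apply Sigma.hom_ext
  simpa using w

theorem isIso (h : IsCop e) {B' : V} {e' : ∀ i, A i ⟶ B'} (h' : IsCop e') (f : B ⟶ B')
    (w : ∀ i, e i ≫ f = e' i) : IsIso f :=
  ⟨h'.desc e, h.hom_ext fun i => by rw [reassoc_of% w]; simp,
    h'.hom_ext fun i => by simp [w]⟩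

theorem of_exists {e : ∀ i, A i ⟶ B} (d : ∀ f : (∀ i, A i ⟶ ∐ A), ∃ g : B ⟶ ∐ A, ∀ i, e i ≫ g = f i)
    (u : ∀ f g : B ⟶ B, (∀ i, e i ≫ f = e i ≫ g) → f = g) : IsCop e := by
  obtain ⟨g, hg⟩ := d (Sigma.ι A)
  refine ⟨g, ?_, ?_⟩
  · apply Sigma.hom_ext
    simp [hg]
  · apply u
    intro i
    rw [reassoc_of% hg]
    simp

theorem comp_iso (h : IsCop e) {B' : V} (f : B ⟶ B') [IsIso f] : IsCop fun i => e i ≫ f := by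
  have : IsIso (Sigma.desc e) := h.out
  have h1 : Sigma.desc (fun i => e i ≫ f) = Sigma.desc e ≫ f := by
    apply Sigma.hom_ext
    simp
  rw [IsCop, h1]
  infer_instance

theorem iso_comp (h : IsCop e) {A' : I → V} (f : ∀ i, A' i ⟶ A i) [∀ i, IsIso (f i)] :
    IsCop fun i => f i ≫ e i := by
  have : IsIso (Sigma.desc e) := h.out
  have h1 : Sigma.desc (fun i => f i ≫ e i) = Limits.Sigma.map f ≫ Sigma.desc e := by
    apply Sigma.hom_ext
    simp
  have h2 : IsIso (Limits.Sigma.map f) := ⟨Limits.Sigma.map fun i => inv (f i), by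
    apply Sigma.hom_ext
    simp, by
    apply Sigma.hom_ext
    simp⟩
  rw [IsCop, h1]
  infer_instance

theorem comp_sigma (h : IsCop e) {J : I → Type v} {C : ∀ i, J i → V} {d : ∀ i j, C i j ⟶ A i}
    (hd : ∀ i, IsCop (d i)) :
    IsCop (I := Σ i, J i) (A := fun k => C k.1 k.2) fun k => d k.1 k.2 ≫ e k.1 := by
  apply of_exists
  · intro f
    refine ⟨h.desc fun i => (hd i).desc fun j => f ⟨i, j⟩, ?_⟩
    rintro ⟨i, j⟩
    simp
  · intro f g w
    exact h.hom_ext fun i => (hd i).hom_ext fun j => by simpa using w ⟨i, j⟩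

theorem reindex (h : IsCop e) {J : Type v} (σ : J ≃ I) : IsCop fun j => e (σ j) := by
  apply of_exists
  · intro f
    refine ⟨h.desc fun i => eqToHom (by simp) ≫ f (σ.symm i), ?_⟩
    intro j
    rw [h.fac]
    have : ∀ (j' : J) (hj : j' = j), eqToHom (by rw [hj]) ≫ f j' = f j := by
      rintro _ rfl
      simp
    exact this _ (by simp)
  · intro f g w
    refine h.hom_ext fun i => ?_
    obtain ⟨j, rfl⟩ := σ.surjective i
    exact w j

theorem exists_lift [Extensive V] {X : I → V} {A C : I → V} (a : ∀ i, A i ⟶ X i)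
    (c : ∀ i, C i ⟶ X i) (s : ∐ A ⟶ ∐ C)
    (w : s ≫ Limits.Sigma.map c = Limits.Sigma.map a) :
    ∃ h : ∀ i, A i ⟶ C i, (∀ i, h i ≫ c i = a i) ∧ ∀ i, Sigma.ι A i ≫ s = h i ≫ Sigma.ι C i := by
  have hE := Extensive.isEquivalence X
  let s' : (coprodOver X).obj (fun i => Over.mk (a i)) ⟶
    (coprodOver X).obj (fun i => Over.mk (c i)) := Over.homMk s w
  obtain ⟨h, hh⟩ := (coprodOver X).map_surjective s'
  refine ⟨fun i => (h i).left, fun i => Over.w (h i), fun i => ?_⟩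
  have h1 : Limits.Sigma.map (fun i => (h i).left) = s := congrArg (fun t => t.left) hh
  rw [← h1]
  exact Sigma.ι_map _ _

theorem lift_unique [Extensive V] {X : I → V} {A C : I → V} (c : ∀ i, C i ⟶ X i)
    (h h' : ∀ i, A i ⟶ C i) (w : ∀ i, h i ≫ c i = h' i ≫ c i)
    (w' : ∀ i, h i ≫ Sigma.ι C i = h' i ≫ Sigma.ι C i) : h = h' := by
  have hE := Extensive.isEquivalence X
  let k : (fun i => Over.mk (h i ≫ c i) : ∀ i, Over (X i)) ⟶ (fun i => Over.mk (c i)) :=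
    fun i => Over.homMk (h i) rfl
  let k' : (fun i => Over.mk (h i ≫ c i) : ∀ i, Over (X i)) ⟶ (fun i => Over.mk (c i)) :=
    fun i => Over.homMk (h' i) (w i).symm
  have : k = k' := by
    apply (coprodOver X).map_injective
    apply Over.OverMorphism.ext
    apply Sigma.hom_ext
    intro i
    exact (Sigma.ι_map _ _).trans ((w' i).trans (Sigma.ι_map _ _).symm)
  funext i
  exact congrArg (fun t => (t i).left) this

theorem exists_cover [Extensive V] {X : I → V} {Z : V} (f : Z ⟶ ∐ X) :
    ∃ (C : I → V) (c : ∀ i, C i ⟶ X i) (j : ∀ i, C i ⟶ Z), IsCop j ∧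
      ∀ i, j i ≫ f = c i ≫ Sigma.ι X i := by
  have hE := Extensive.isEquivalence X
  let C := (coprodOver X).objPreimage (Over.mk f)
  let k : (coprodOver X).obj C ≅ Over.mk f := (coprodOver X).objObjPreimageIso (Over.mk f)
  let k₁ : (∐ fun i => (C i).left) ⟶ Z := k.hom.left
  let k₂ : Z ⟶ (∐ fun i => (C i).left) := k.inv.left
  have hk : IsIso k₁ := ⟨k₂, congrArg (fun t => t.left) k.hom_inv_id,
    congrArg (fun t => t.left) k.inv_hom_id⟩
  have hw : k₁ ≫ f = Limits.Sigma.map (fun i => (C i).hom) := Over.w k.hom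
  refine ⟨fun i => (C i).left, fun i => (C i).hom, fun i => Sigma.ι (fun i => (C i).left) i ≫ k₁,
    (IsCop.sigma (fun i => (C i).left)).comp_iso k₁, fun i => ?_⟩
  rw [Category.assoc, hw]
  exact Sigma.ι_map _ _

/-- Squares between coproduct injections in an extensive category are pullbacks. -/
theorem isPullback [HasPullbacks V] [Extensive V] {X C : I → V} {B Z : V} {e : ∀ i, X i ⟶ B}
    (he : IsCop e) {j : ∀ i, C i ⟶ Z} (hj : IsCop j) (f : Z ⟶ B) (g : ∀ i, C i ⟶ X i)
    (w : ∀ i, j i ≫ f = g i ≫ e i) (i : I) : IsPullback (j i) (g i) f (e i) := by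
  have hf : hj.desc (Sigma.ι C) ≫ Limits.Sigma.map g ≫ Sigma.desc e = f :=
    hj.hom_ext fun i => by simp [w]
  have : IsIso (Sigma.desc e) := he.out
  obtain ⟨h, hc, hι⟩ := exists_lift (fun i => pullback.snd f (e i)) g
    (Sigma.desc fun i => pullback.fst f (e i) ≫ hj.desc (Sigma.ι C)) (by
      rw [← cancel_mono (Sigma.desc e)]
      apply Sigma.hom_ext
      intro i
      simp [hf, pullback.condition])
  simp only [Sigma.ι_desc] at hι
  have hj' : hj.desc (Sigma.ι C) ≫ Sigma.desc j = 𝟙 _ := hj.hom_ext fun i => by simp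
  have hjι : ∀ i, j i = Sigma.ι C i ≫ Sigma.desc j := fun i => by simp
  have h1 : (fun i => pullback.lift (j i) (g i) (w i) ≫ h i) = fun i => 𝟙 (C i) := by
    apply lift_unique g
    · intro i
      simp [hc]
    · intro i
      simp [← hι]
  have h2 : ∀ i, h i ≫ pullback.lift (j i) (g i) (w i) = 𝟙 _ := by
    intro i
    apply pullback.hom_ext
    · rw [Category.assoc, pullback.lift_fst, hjι, ← reassoc_of% (hι i), hj']
      simp
    · simp [hc]
  exact IsPullback.of_iso_pullback ⟨w i⟩
    ⟨pullback.lift (j i) (g i) (w i), h i, congrFun h1 i, h2 i⟩ (by simp) (by simp)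

/-- Coproducts in an extensive category are stable under pullback. -/
theorem of_isPullback [HasPullbacks V] [Extensive V] {X P : I → V} {B Z : V} {e : ∀ i, X i ⟶ B}
    (he : IsCop e) (f : Z ⟶ B) {j : ∀ i, P i ⟶ Z} {g : ∀ i, P i ⟶ X i}
    (h : ∀ i, IsPullback (j i) (g i) f (e i)) : IsCop j := by
  have : IsIso (Sigma.desc e) := he.out
  obtain ⟨C, c, j', hj', w⟩ := exists_cover (f ≫ inv (Sigma.desc e))
  have h3 := fun i => he.isPullback hj' f c (fun i => by
    have := w i
    rw [← Category.assoc, IsIso.comp_inv_eq] at this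
    simpa using this) i
  have h4 : ∀ i, j i = ((h i).isoIsPullback _ _ (h3 i)).hom ≫ j' i := fun i => by simp
  rw [show j = _ from funext h4]
  exact hj'.iso_comp _

end IsCop

end Extensive

attribute [local simp] pullback.lift_fst pullback.lift_snd pullback.lift_fst_assoc
  pullback.lift_snd_assoc Sigma.ι_desc Sigma.ι_desc_assoc prod.lift_fst prod.lift_snd
  prod.lift_fst_assoc prod.lift_snd_assoc Sigma.ι_map Sigma.ι_map_assoc

section Matrices

variable {V : Type u} [Category.{v} V]

theorem isPullback_prod_fst [HasFiniteLimits V] {A B : V} (e : A ⟶ B) (Y : V) :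
    IsPullback (prod.map e (𝟙 Y)) prod.fst (prod.fst : B ⨯ Y ⟶ B) e :=
  ⟨⟨by simp⟩, ⟨PullbackCone.IsLimit.mk _ (fun s => prod.lift s.snd (s.fst ≫ prod.snd))
    (fun s => by
      apply Limits.prod.hom_ext
      · simpa using s.condition.symm
      · simp)
    (fun s => by simp)
    (fun s m h₁ h₂ => by
      apply Limits.prod.hom_ext
      · simpa using h₂
      · simpa using congrArg (· ≫ prod.snd) h₁)⟩⟩

theorem isPullback_prod_snd [HasFiniteLimits V] {A B : V} (e : A ⟶ B) (Y : V) :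
    IsPullback (prod.map (𝟙 Y) e) prod.snd (prod.snd : Y ⨯ B ⟶ B) e :=
  ⟨⟨by simp⟩, ⟨PullbackCone.IsLimit.mk _ (fun s => prod.lift (s.fst ≫ prod.fst) s.snd)
    (fun s => by
      apply Limits.prod.hom_ext
      · simp
      · simpa using s.condition.symm)
    (fun s => by simp)
    (fun s m h₁ h₂ => by
      apply Limits.prod.hom_ext
      · simpa using congrArg (· ≫ prod.fst) h₁
      · simpa using h₂)⟩⟩

variable [HasFiniteLimits V] [HasCoproducts.{v} V]

/-- Products distribute over coproducts in an extensive category. -/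
theorem IsCop.prod_left [Extensive V] {I : Type v} {A : I → V} {B : V} {e : ∀ i, A i ⟶ B}
    (h : IsCop e) (Y : V) : IsCop fun i => prod.map (e i) (𝟙 Y) :=
  h.of_isPullback prod.fst fun i => isPullback_prod_fst (e i) Y

theorem IsCop.prod_right [Extensive V] {I : Type v} {A : I → V} {B : V} {e : ∀ i, A i ⟶ B}
    (h : IsCop e) (Y : V) : IsCop fun i => prod.map (𝟙 Y) (e i) :=
  h.of_isPullback prod.snd fun i => isPullback_prod_snd (e i) Y

/-- Composition of `V`-matrices: `(s · r)(x, z) = ∐_y s(y, z) × r(x, y)`. -/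
noncomputable def matComp {X Y Z : Type v} (s : Y → Z → V) (r : X → Y → V) : X → Z → V :=
  fun x z => ∐ fun y => s y z ⨯ r x y

/-- The identity `V`-matrix: the terminal object on the diagonal, initial elsewhere. -/
noncomputable def matOne (V : Type u) [Category.{v} V] [HasFiniteLimits V] [HasCoproducts.{v} V]
    (X : Type v) : X → X → V :=
  fun x x' => ∐ fun _ : ULift.{v} (PLift (x = x')) => ⊤_ V

/-- The injection `s(y, z) × r(x, y) ⟶ (s · r)(x, z)`. -/
noncomputable def matι {X Y Z : Type v} (s : Y → Z → V) (r : X → Y → V) (x : X) (z : Z) (y : Y) :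
    s y z ⨯ r x y ⟶ matComp s r x z :=
  Sigma.ι (fun y => s y z ⨯ r x y) y

theorem matι_cop {X Y Z : Type v} (s : Y → Z → V) (r : X → Y → V) (x : X) (z : Z) :
    IsCop (matι s r x z) :=
  IsCop.sigma _

/-- The injection of the component at `h : x = x'` into the identity matrix. -/
noncomputable def oneι {X : Type v} (x x' : X) (h : ULift.{v} (PLift (x = x'))) :
    ⊤_ V ⟶ matOne V X x x' :=
  Sigma.ι (fun _ : ULift.{v} (PLift (x = x')) => ⊤_ V) h

theorem oneι_cop {X : Type v} (x x' : X) : IsCop (oneι (V := V) x x') :=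
  IsCop.sigma _

/-- The generalised element of `(s · r)(x, z)` given by elements `a` of `s(y, z)` and `b` of
`r(x, y)`. -/
noncomputable def pair {X Y Z : Type v} {s : Y → Z → V} {r : X → Y → V} {x : X} (y : Y) {z : Z}
    {A : V} (a : A ⟶ s y z) (b : A ⟶ r x y) : A ⟶ matComp s r x z :=
  prod.lift a b ≫ matι s r x z y

/-- The generalised element of the identity matrix given by `h : x = x'`. -/
noncomputable def pt {X : Type v} {x x' : X} (A : V) (h : x = x') : A ⟶ matOne V X x x' :=
  terminal.from A ≫ oneι x x' ⟨⟨h⟩⟩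

theorem comp_pair {X Y Z : Type v} {s : Y → Z → V} {r : X → Y → V} {x : X} (y : Y) {z : Z}
    {A B : V} (f : B ⟶ A) (a : A ⟶ s y z) (b : A ⟶ r x y) :
    f ≫ pair (s := s) (r := r) y a b = pair y (f ≫ a) (f ≫ b) := by
  rw [pair, pair, ← Category.assoc, prod.comp_lift]

theorem comp_pair_assoc {X Y Z : Type v} {s : Y → Z → V} {r : X → Y → V} {x : X} (y : Y) {z : Z}
    {A B : V} (f : B ⟶ A) (a : A ⟶ s y z) (b : A ⟶ r x y) {Z' : V}
    (h' : _ ⟶ Z') :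
    f ≫ pair (s := s) (r := r) y a b ≫ h' =
      pair y (f ≫ a) (f ≫ b) ≫ h' := by
  rw [← Category.assoc, comp_pair]

theorem comp_pt {X : Type v} {x x' : X} {A B : V} (f : B ⟶ A) (h : x = x') :
    f ≫ pt (V := V) A h = pt B h := by
  rw [pt, pt, ← Category.assoc, terminal.comp_from]

theorem comp_pt_assoc {X : Type v} {x x' : X} {A B : V} (f : B ⟶ A) (h : x = x') {Z' : V}
    (h' : _ ⟶ Z') :
    f ≫ pt (V := V) A h ≫ h' =
      pt B h ≫ h' := by
  rw [← Category.assoc, comp_pt]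

/-- Morphisms out of `(s · r)(x, z)`. -/
noncomputable def matDesc {X Y Z : Type v} {s : Y → Z → V} {r : X → Y → V} {x : X} {z : Z} {B : V}
    (f : ∀ y, s y z ⨯ r x y ⟶ B) : matComp s r x z ⟶ B :=
  (matι_cop s r x z).desc f

theorem pair_matDesc {X Y Z : Type v} {s : Y → Z → V} {r : X → Y → V} {x : X} {z : Z} {A B : V}
    (f : ∀ y, s y z ⨯ r x y ⟶ B) (y : Y) (a : A ⟶ s y z) (b : A ⟶ r x y) :
    pair y a b ≫ matDesc f = prod.lift a b ≫ f y := by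
  rw [pair, Category.assoc, matDesc, IsCop.fac]

theorem pair_matDesc_assoc {X Y Z : Type v} {s : Y → Z → V} {r : X → Y → V} {x : X} {z : Z} {A B : V}
    (f : ∀ y, s y z ⨯ r x y ⟶ B) (y : Y) (a : A ⟶ s y z) (b : A ⟶ r x y) {Z' : V}
    (h' : _ ⟶ Z') :
    pair y a b ≫ matDesc f ≫ h' =
      prod.lift a b ≫ f y ≫ h' := by
  rw [← Category.assoc, pair_matDesc, Category.assoc]

theorem matι_eq {X Y Z : Type v} (s : Y → Z → V) (r : X → Y → V) (x : X) (z : Z) (y : Y) :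
    matι s r x z y = pair y prod.fst prod.snd := by
  rw [pair, prod.lift_fst_snd, Category.id_comp]

theorem mat_ext {X Y Z : Type v} {s : Y → Z → V} {r : X → Y → V} {x : X} {z : Z} {B : V}
    {f g : matComp s r x z ⟶ B} (h : ∀ (y : Y) (A : V) (a : A ⟶ s y z) (b : A ⟶ r x y),
      pair y a b ≫ f = pair y a b ≫ g) : f = g :=
  (matι_cop s r x z).hom_ext fun y => by rw [matι_eq, h]

/-- Morphisms out of the identity matrix. -/
noncomputable def oneDesc {X : Type v} {x x' : X} {B : V} (f : x = x' → (⊤_ V ⟶ B)) :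
    matOne V X x x' ⟶ B :=
  (oneι_cop x x').desc fun h => f h.down.down

theorem pt_oneDesc {X : Type v} {x x' : X} {A B : V} (f : x = x' → (⊤_ V ⟶ B)) (h : x = x') :
    pt A h ≫ oneDesc f = terminal.from A ≫ f h := by
  rw [pt, Category.assoc, oneDesc, IsCop.fac]

theorem pt_oneDesc_assoc {X : Type v} {x x' : X} {A B : V} (f : x = x' → (⊤_ V ⟶ B)) (h : x = x') {Z' : V}
    (h' : _ ⟶ Z') :
    pt A h ≫ oneDesc f ≫ h' =
      terminal.from A ≫ f h ≫ h' := by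
  rw [← Category.assoc, pt_oneDesc, Category.assoc]

theorem oneι_eq {X : Type v} (x x' : X) (h : ULift.{v} (PLift (x = x'))) :
    oneι (V := V) x x' h = pt _ h.down.down := by
  have h2 : terminal.from (⊤_ V) = 𝟙 _ := by subsingleton
  rw [pt, h2, Category.id_comp]

theorem one_ext {X : Type v} {x x' : X} {B : V} {f g : matOne V X x x' ⟶ B}
    (w : ∀ (h : x = x') (A : V), pt A h ≫ f = pt A h ≫ g) : f = g :=
  (oneι_cop x x').hom_ext fun h => by rw [oneι_eq, w]

section

variable [Extensive V]

theorem mat_cases {X Y Z : Type v} {s : Y → Z → V} {r : X → Y → V} {x : X} {z : Z} {A B : V}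
    (a : A ⟶ matComp s r x z) {f g : A ⟶ B}
    (h : ∀ (y : Y) (C : V) (j : C ⟶ A) (b : C ⟶ s y z) (c : C ⟶ r x y), j ≫ a = pair y b c →
      j ≫ f = j ≫ g) : f = g := by
  have hj : IsCop fun y => pullback.fst a (matι s r x z y) :=
    (matι_cop s r x z).of_isPullback a fun y => IsPullback.of_hasPullback _ _
  refine hj.hom_ext fun y => h y _ _ (pullback.snd _ _ ≫ prod.fst) (pullback.snd _ _ ≫ prod.snd) ?_
  rw [pullback.condition, matι_eq, comp_pair]

theorem one_cases {X : Type v} {x x' : X} {A B : V} (a : A ⟶ matOne V X x x') {f g : A ⟶ B}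
    (w : ∀ (h : x = x') (C : V) (j : C ⟶ A), j ≫ a = pt C h → j ≫ f = j ≫ g) : f = g := by
  have hj : IsCop fun h => pullback.fst a (oneι x x' h) :=
    (oneι_cop x x').of_isPullback a fun y => IsPullback.of_hasPullback _ _
  refine hj.hom_ext fun h => w h.down.down _ _ ?_
  rw [pullback.condition, oneι_eq, comp_pt]

/-- Morphisms out of `(t · s)(y, w) × C`. -/
noncomputable def compLDesc {Y Z W : Type v} {t : Z → W → V} {s : Y → Z → V} {y : Y} {w : W}
    {C B : V} (f : ∀ z, (t z w ⨯ s y z) ⨯ C ⟶ B) : matComp t s y w ⨯ C ⟶ B :=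
  ((matι_cop t s y w).prod_left C).desc f

/-- Morphisms out of `C × (s · r)(x, z)`. -/
noncomputable def compRDesc {X Y Z : Type v} {s : Y → Z → V} {r : X → Y → V} {x : X} {z : Z}
    {C B : V} (f : ∀ y, C ⨯ (s y z ⨯ r x y) ⟶ B) : C ⨯ matComp s r x z ⟶ B :=
  ((matι_cop s r x z).prod_right C).desc f

/-- Morphisms out of `1(x, x') × C`. -/
noncomputable def oneLDesc {X : Type v} {x x' : X} {B C : V} (f : x = x' → (C ⟶ B)) :
    matOne V X x x' ⨯ C ⟶ B :=
  ((oneι_cop x x').prod_left C).desc fun h => prod.snd ≫ f h.down.down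

/-- Morphisms out of `C × 1(x, x')`. -/
noncomputable def oneRDesc {X : Type v} {x x' : X} {B C : V} (f : x = x' → (C ⟶ B)) :
    C ⨯ matOne V X x x' ⟶ B :=
  ((oneι_cop x x').prod_right C).desc fun h => prod.fst ≫ f h.down.down

theorem lift_compLDesc {Y Z W : Type v} {t : Z → W → V} {s : Y → Z → V} {y : Y} {w : W}
    {C B A : V} (f : ∀ z, (t z w ⨯ s y z) ⨯ C ⟶ B) (z : Z) (a : A ⟶ t z w) (b : A ⟶ s y z)
    (c : A ⟶ C) :
    prod.lift (pair z a b) c ≫ compLDesc f = prod.lift (prod.lift a b) c ≫ f z := by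
  have h := ((matι_cop t s y w).prod_left C).fac f z
  rw [pair, ← Category.comp_id c, ← prod.lift_map, Category.assoc, compLDesc, h, Category.comp_id]

theorem lift_compLDesc_assoc {Y Z W : Type v} {t : Z → W → V} {s : Y → Z → V} {y : Y} {w : W}
    {C B A : V} (f : ∀ z, (t z w ⨯ s y z) ⨯ C ⟶ B) (z : Z) (a : A ⟶ t z w) (b : A ⟶ s y z)
    (c : A ⟶ C) {Z' : V}
    (h' : _ ⟶ Z') :
    prod.lift (pair z a b) c ≫ compLDesc f ≫ h' =
      prod.lift (prod.lift a b) c ≫ f z ≫ h' := by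
  rw [← Category.assoc, lift_compLDesc, Category.assoc]

theorem lift_compRDesc {X Y Z : Type v} {s : Y → Z → V} {r : X → Y → V} {x : X} {z : Z}
    {C B A : V} (f : ∀ y, C ⨯ (s y z ⨯ r x y) ⟶ B) (y : Y) (a : A ⟶ C) (b : A ⟶ s y z)
    (c : A ⟶ r x y) :
    prod.lift a (pair y b c) ≫ compRDesc f = prod.lift a (prod.lift b c) ≫ f y := by
  have h := ((matι_cop s r x z).prod_right C).fac f y
  rw [pair, ← Category.comp_id a, ← prod.lift_map, Category.assoc, compRDesc, h, Category.comp_id]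

theorem lift_compRDesc_assoc {X Y Z : Type v} {s : Y → Z → V} {r : X → Y → V} {x : X} {z : Z}
    {C B A : V} (f : ∀ y, C ⨯ (s y z ⨯ r x y) ⟶ B) (y : Y) (a : A ⟶ C) (b : A ⟶ s y z)
    (c : A ⟶ r x y) {Z' : V}
    (h' : _ ⟶ Z') :
    prod.lift a (pair y b c) ≫ compRDesc f ≫ h' =
      prod.lift a (prod.lift b c) ≫ f y ≫ h' := by
  rw [← Category.assoc, lift_compRDesc, Category.assoc]

theorem lift_oneLDesc {X : Type v} {x x' : X} {A B C : V} (f : x = x' → (C ⟶ B)) (h : x = x')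
    (c : A ⟶ C) : prod.lift (pt A h) c ≫ oneLDesc f = c ≫ f h := by
  have h1 := ((oneι_cop (V := V) x x').prod_left C).fac (fun h => prod.snd ≫ f h.down.down) ⟨⟨h⟩⟩
  rw [pt, ← Category.comp_id c, ← prod.lift_map, Category.assoc, oneLDesc, h1, Category.comp_id,
    prod.lift_snd_assoc]

theorem lift_oneLDesc_assoc {X : Type v} {x x' : X} {A B C : V} (f : x = x' → (C ⟶ B)) (h : x = x')
    (c : A ⟶ C) {Z' : V}
    (h' : _ ⟶ Z') :
    prod.lift (pt A h) c ≫ oneLDesc f ≫ h' =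
      c ≫ f h ≫ h' := by
  rw [← Category.assoc, lift_oneLDesc, Category.assoc]

theorem lift_oneRDesc {X : Type v} {x x' : X} {A B C : V} (f : x = x' → (C ⟶ B)) (h : x = x')
    (c : A ⟶ C) : prod.lift c (pt A h) ≫ oneRDesc f = c ≫ f h := by
  have h1 := ((oneι_cop (V := V) x x').prod_right C).fac (fun h => prod.fst ≫ f h.down.down) ⟨⟨h⟩⟩
  rw [pt, ← Category.comp_id c, ← prod.lift_map, Category.assoc, oneRDesc, h1, Category.comp_id,
    prod.lift_fst_assoc]

theorem lift_oneRDesc_assoc {X : Type v} {x x' : X} {A B C : V} (f : x = x' → (C ⟶ B)) (h : x = x')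
    (c : A ⟶ C) {Z' : V}
    (h' : _ ⟶ Z') :
    prod.lift c (pt A h) ≫ oneRDesc f ≫ h' =
      c ≫ f h ≫ h' := by
  rw [← Category.assoc, lift_oneRDesc, Category.assoc]

end

/-- The components of horizontal composites. -/
noncomputable def hcθ {X Y Z X' Y' Z' : Type v} {s : Y → Z → V} {r : X → Y → V}
    {s' : Y' → Z' → V} {r' : X' → Y' → V} {f : X → X'} {g : Y → Y'} {k : Z → Z'}
    (β : ∀ y z, s y z ⟶ s' (g y) (k z)) (α : ∀ x y, r x y ⟶ r' (f x) (g y)) (x : X) (z : Z) :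
    matComp s r x z ⟶ matComp s' r' (f x) (k z) :=
  matDesc fun y => pair (g y) (prod.fst ≫ β y z) (prod.snd ≫ α x y)

theorem pair_hcθ {X Y Z X' Y' Z' : Type v} {s : Y → Z → V} {r : X → Y → V}
    {s' : Y' → Z' → V} {r' : X' → Y' → V} {f : X → X'} {g : Y → Y'} {k : Z → Z'}
    (β : ∀ y z, s y z ⟶ s' (g y) (k z)) (α : ∀ x y, r x y ⟶ r' (f x) (g y)) (x : X) (y : Y) (z : Z)
    {A : V} (a : A ⟶ s y z) (b : A ⟶ r x y) :
    pair y a b ≫ hcθ β α x z = pair (g y) (a ≫ β y z) (b ≫ α x y) := by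
  simp [hcθ, pair_matDesc, comp_pair]

theorem pair_hcθ_assoc {X Y Z X' Y' Z' : Type v} {s : Y → Z → V} {r : X → Y → V}
    {s' : Y' → Z' → V} {r' : X' → Y' → V} {f : X → X'} {g : Y → Y'} {k : Z → Z'}
    (β : ∀ y z, s y z ⟶ s' (g y) (k z)) (α : ∀ x y, r x y ⟶ r' (f x) (g y)) (x : X) (y : Y) (z : Z)
    {A : V} (a : A ⟶ s y z) (b : A ⟶ r x y) {Z' : V}
    (h' : _ ⟶ Z') :
    pair y a b ≫ hcθ β α x z ≫ h' =
      pair (g y) (a ≫ β y z) (b ≫ α x y) ≫ h' := by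
  rw [← Category.assoc, pair_hcθ]

/-- The components of 2-cells between identity matrices. -/
noncomputable def oneθ {X Y : Type v} (f : X → Y) (x x' : X) :
    matOne V X x x' ⟶ matOne V Y (f x) (f x') :=
  oneDesc fun h => pt _ (congrArg f h)

theorem pt_oneθ {X Y : Type v} (f : X → Y) {x x' : X} (h : x = x') (A : V) :
    pt A h ≫ oneθ f x x' = pt A (congrArg f h) := by
  simp [oneθ, pt_oneDesc, comp_pt]

theorem pt_oneθ_assoc {X Y : Type v} (f : X → Y) {x x' : X} (h : x = x') (A : V) {Z' : V}
    (h' : _ ⟶ Z') :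
    pt A h ≫ oneθ f x x' ≫ h' =
      pt A (congrArg f h) ≫ h' := by
  rw [← Category.assoc, pt_oneθ]

/-- The components of the inverse of the left unitor. -/
noncomputable def lamInvθ {X Y : Type v} (r : X → Y → V) (x : X) (y : Y) :
    r x y ⟶ matComp (matOne V Y) r x y :=
  pair y (pt _ rfl) (𝟙 _)

/-- The components of the inverse of the right unitor. -/
noncomputable def rhoInvθ {X Y : Type v} (r : X → Y → V) (x : X) (y : Y) :
    r x y ⟶ matComp r (matOne V X) x y :=
  pair x (𝟙 _) (pt _ rfl)

theorem comp_lamInvθ {X Y : Type v} (r : X → Y → V) (x : X) (y : Y) {A : V} (b : A ⟶ r x y) :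
    b ≫ lamInvθ r x y = pair y (pt _ rfl) b := by
  rw [lamInvθ, comp_pair, comp_pt, Category.comp_id]

theorem comp_lamInvθ_assoc {X Y : Type v} (r : X → Y → V) (x : X) (y : Y) {A : V} (b : A ⟶ r x y) {Z' : V}
    (h' : _ ⟶ Z') :
    b ≫ lamInvθ r x y ≫ h' =
      pair y (pt _ rfl) b ≫ h' := by
  rw [← Category.assoc, comp_lamInvθ]

theorem comp_rhoInvθ {X Y : Type v} (r : X → Y → V) (x : X) (y : Y) {A : V} (b : A ⟶ r x y) :
    b ≫ rhoInvθ r x y = pair x b (pt _ rfl) := by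
  rw [rhoInvθ, comp_pair, comp_pt, Category.comp_id]

theorem comp_rhoInvθ_assoc {X Y : Type v} (r : X → Y → V) (x : X) (y : Y) {A : V} (b : A ⟶ r x y) {Z' : V}
    (h' : _ ⟶ Z') :
    b ≫ rhoInvθ r x y ≫ h' =
      pair x b (pt _ rfl) ≫ h' := by
  rw [← Category.assoc, comp_rhoInvθ]

section

variable [Extensive V]

/-- The components of the left unitor. -/
noncomputable def lamθ {X Y : Type v} (r : X → Y → V) (x : X) (y : Y) :
    matComp (matOne V Y) r x y ⟶ r x y :=
  matDesc fun _ => oneLDesc fun h => eqToHom (by rw [h])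

/-- The components of the right unitor. -/
noncomputable def rhoθ {X Y : Type v} (r : X → Y → V) (x : X) (y : Y) :
    matComp r (matOne V X) x y ⟶ r x y :=
  matDesc fun _ => oneRDesc fun h => eqToHom (by rw [h])

/-- The components of the associator. -/
noncomputable def assocθ {X Y Z W : Type v} (t : Z → W → V) (s : Y → Z → V) (r : X → Y → V) (x : X)
    (w : W) : matComp (matComp t s) r x w ⟶ matComp t (matComp s r) x w :=
  matDesc fun y => compLDesc fun z =>
    pair z (prod.fst ≫ prod.fst) (pair y (prod.fst ≫ prod.snd) prod.snd)

/-- The components of the inverse of the associator. -/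
noncomputable def assocInvθ {X Y Z W : Type v} (t : Z → W → V) (s : Y → Z → V) (r : X → Y → V)
    (x : X) (w : W) : matComp t (matComp s r) x w ⟶ matComp (matComp t s) r x w :=
  matDesc fun z => compRDesc fun y =>
    pair y (pair z prod.fst (prod.snd ≫ prod.fst)) (prod.snd ≫ prod.snd)

theorem pair_lamθ {X Y : Type v} (r : X → Y → V) (x : X) (y : Y) {A : V} (b : A ⟶ r x y) :
    pair y (pt _ rfl) b ≫ lamθ r x y = b := by
  simp [lamθ, pair_matDesc, lift_oneLDesc]

theorem pair_lamθ_assoc {X Y : Type v} (r : X → Y → V) (x : X) (y : Y) {A : V} (b : A ⟶ r x y) {Z' : V}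
    (h' : _ ⟶ Z') :
    pair y (pt _ rfl) b ≫ lamθ r x y ≫ h' =
      b ≫ h' := by
  rw [← Category.assoc, pair_lamθ]

theorem pair_rhoθ {X Y : Type v} (r : X → Y → V) (x : X) (y : Y) {A : V} (b : A ⟶ r x y) :
    pair x b (pt _ rfl) ≫ rhoθ r x y = b := by
  simp [rhoθ, pair_matDesc, lift_oneRDesc]

theorem pair_rhoθ_assoc {X Y : Type v} (r : X → Y → V) (x : X) (y : Y) {A : V} (b : A ⟶ r x y) {Z' : V}
    (h' : _ ⟶ Z') :
    pair x b (pt _ rfl) ≫ rhoθ r x y ≫ h' =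
      b ≫ h' := by
  rw [← Category.assoc, pair_rhoθ]

theorem pair_assocθ {X Y Z W : Type v} (t : Z → W → V) (s : Y → Z → V) (r : X → Y → V) (x : X)
    (y : Y) (z : Z) (w : W) {A : V} (a : A ⟶ t z w) (b : A ⟶ s y z) (c : A ⟶ r x y) :
    pair y (pair z a b) c ≫ assocθ t s r x w = pair z a (pair y b c) := by
  simp [assocθ, pair_matDesc, lift_compLDesc, comp_pair]

theorem pair_assocθ_assoc {X Y Z W : Type v} (t : Z → W → V) (s : Y → Z → V) (r : X → Y → V) (x : X)
    (y : Y) (z : Z) (w : W) {A : V} (a : A ⟶ t z w) (b : A ⟶ s y z) (c : A ⟶ r x y) {Z' : V}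
    (h' : _ ⟶ Z') :
    pair y (pair z a b) c ≫ assocθ t s r x w ≫ h' =
      pair z a (pair y b c) ≫ h' := by
  rw [← Category.assoc, pair_assocθ]

theorem pair_assocInvθ {X Y Z W : Type v} (t : Z → W → V) (s : Y → Z → V) (r : X → Y → V) (x : X)
    (y : Y) (z : Z) (w : W) {A : V} (a : A ⟶ t z w) (b : A ⟶ s y z) (c : A ⟶ r x y) :
    pair z a (pair y b c) ≫ assocInvθ t s r x w = pair y (pair z a b) c := by
  simp [assocInvθ, pair_matDesc, lift_compRDesc, comp_pair]

theorem pair_assocInvθ_assoc {X Y Z W : Type v} (t : Z → W → V) (s : Y → Z → V) (r : X → Y → V) (x : X)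
    (y : Y) (z : Z) (w : W) {A : V} (a : A ⟶ t z w) (b : A ⟶ s y z) (c : A ⟶ r x y) {Z' : V}
    (h' : _ ⟶ Z') :
    pair z a (pair y b c) ≫ assocInvθ t s r x w ≫ h' =
      pair y (pair z a b) c ≫ h' := by
  rw [← Category.assoc, pair_assocInvθ]

theorem lam_ext {X Y : Type v} {r : X → Y → V} {x : X} {y : Y} {B : V}
    {f g : matComp (matOne V Y) r x y ⟶ B}
    (h : ∀ (A : V) (b : A ⟶ r x y), pair y (pt _ rfl) b ≫ f = pair y (pt _ rfl) b ≫ g) :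
    f = g := by
  refine mat_ext fun y' A a b => one_cases a fun h' C j hj => ?_
  subst h'
  rw [comp_pair_assoc, comp_pair_assoc, hj, h]

theorem rho_ext {X Y : Type v} {r : X → Y → V} {x : X} {y : Y} {B : V}
    {f g : matComp r (matOne V X) x y ⟶ B}
    (h : ∀ (A : V) (b : A ⟶ r x y), pair x b (pt _ rfl) ≫ f = pair x b (pt _ rfl) ≫ g) :
    f = g := by
  refine mat_ext fun y' A a b => one_cases b fun h' C j hj => ?_
  subst h'
  rw [comp_pair_assoc, comp_pair_assoc, hj, h]

theorem left_ext {X Y Z W : Type v} {t : Z → W → V} {s : Y → Z → V} {r : X → Y → V} {x : X} {w : W}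
    {B : V} {f g : matComp (matComp t s) r x w ⟶ B}
    (h : ∀ (y : Y) (z : Z) (A : V) (a : A ⟶ t z w) (b : A ⟶ s y z) (c : A ⟶ r x y),
      pair y (pair z a b) c ≫ f = pair y (pair z a b) c ≫ g) : f = g := by
  refine mat_ext fun y A a c => mat_cases a fun z C j b b' hj => ?_
  rw [comp_pair_assoc, comp_pair_assoc, hj, h]

theorem right_ext {X Y Z W : Type v} {t : Z → W → V} {s : Y → Z → V} {r : X → Y → V} {x : X} {w : W}
    {B : V} {f g : matComp t (matComp s r) x w ⟶ B}
    (h : ∀ (y : Y) (z : Z) (A : V) (a : A ⟶ t z w) (b : A ⟶ s y z) (c : A ⟶ r x y),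
      pair z a (pair y b c) ≫ f = pair z a (pair y b c) ≫ g) : f = g := by
  refine mat_ext fun y A a c => mat_cases c fun z C j b b' hj => ?_
  rw [comp_pair_assoc, comp_pair_assoc, hj, h]

theorem triangle_ext {X Y Z : Type v} {s : Y → Z → V} {r : X → Y → V} {x : X} {z : Z}
    {B : V} {f g : matComp (matComp s (matOne V Y)) r x z ⟶ B}
    (h : ∀ (y : Y) (A : V) (a : A ⟶ s y z) (c : A ⟶ r x y),
      pair y (pair y a (pt _ rfl)) c ≫ f = pair y (pair y a (pt _ rfl)) c ≫ g) : f = g := by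
  refine left_ext fun y y' A a b c => one_cases b fun h' C j hj => ?_
  subst h'
  rw [comp_pair_assoc, comp_pair_assoc, comp_pair, hj, h]

theorem pentagon_ext {X Y Z W U : Type v} {t : W → U → V} {s : Z → W → V} {r : Y → Z → V}
    {q : X → Y → V} {x : X} {u : U} {B : V} {f g : matComp (matComp (matComp t s) r) q x u ⟶ B}
    (h : ∀ (y : Y) (z : Z) (w : W) (A : V) (a : A ⟶ t w u) (b : A ⟶ s z w) (c : A ⟶ r y z)
      (d : A ⟶ q x y), pair y (pair z (pair w a b) c) d ≫ f =
        pair y (pair z (pair w a b) c) d ≫ g) : f = g := by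
  refine left_ext fun y z A a b c => mat_cases a fun w C j a' b' hj => ?_
  rw [comp_pair_assoc, comp_pair_assoc, comp_pair, hj, h]

end

/-- A 2-cell of `V`-matrices. -/
structure MatCell {X Y X' Y' : Type v} (r : X → Y → V) (s : X' → Y' → V) where
  left : X → X'
  right : Y → Y'
  θ : ∀ x y, r x y ⟶ s (left x) (right y)

namespace MatCell

theorem mk_congr {X Y X' Y' : Type v} {r : X → Y → V} {s : X' → Y' → V} {f : X → X'} {g : Y → Y'}
    {θ ξ : ∀ x y, r x y ⟶ s (f x) (g y)} (h : ∀ x y, θ x y = ξ x y) :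
    MatCell.mk f g θ = MatCell.mk f g ξ := by
  have : θ = ξ := by
    funext x y
    exact h x y
  rw [this]

/-- The identity 2-cell. -/
abbrev id {X Y : Type v} (r : X → Y → V) : MatCell r r := ⟨fun x => x, fun y => y, fun _ _ => 𝟙 _⟩

/-- Vertical composition. -/
abbrev comp {X Y X' Y' X'' Y'' : Type v} {r : X → Y → V} {s : X' → Y' → V} {t : X'' → Y'' → V}
    (α : MatCell r s) (β : MatCell s t) : MatCell r t :=
  ⟨fun x => β.left (α.left x), fun y => β.right (α.right y),
    fun x y => α.θ x y ≫ β.θ (α.left x) (α.right y)⟩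

/-- Horizontal composition. -/
noncomputable def hcomp {X Y Z X' Y' Z' : Type v} {s : Y → Z → V} {r : X → Y → V}
    {s' : Y' → Z' → V} {r' : X' → Y' → V} (β : MatCell s s') (α : MatCell r r')
    (h : α.right = β.left) : MatCell (matComp s r) (matComp s' r') :=
  ⟨α.left, β.right, hcθ β.θ fun x y => α.θ x y ≫ eqToHom (by rw [h])⟩

theorem hcomp_mk {X Y Z X' Y' Z' : Type v} {s : Y → Z → V} {r : X → Y → V}
    {s' : Y' → Z' → V} {r' : X' → Y' → V} (f : X → X') (g : Y → Y') (k : Z → Z')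
    (β : ∀ y z, s y z ⟶ s' (g y) (k z)) (α : ∀ x y, r x y ⟶ r' (f x) (g y)) (h : g = g) :
    hcomp ⟨g, k, β⟩ ⟨f, g, α⟩ h = ⟨f, k, hcθ β α⟩ := by
  simp [hcomp]

end MatCell

/-- Sets, regarded as the objects of the double category of `V`-matrices. -/
structure MatObj (V : Type u) [Category.{v} V] : Type (v + 1) where
  carrier : Type v

/-- The category of sets and functions. -/
instance : Category (MatObj V) where
  Hom X Y := X.carrier → Y.carrier
  id X := fun x => x
  comp f g := fun x => g (f x)

variable [Extensive V]

/-- The pseudodouble category of `V`-matrices. -/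
noncomputable instance : DoubleCategory.{max u v, v} (MatObj V) where
  Hor X Y := X.carrier → Y.carrier → V
  Cell r s := MatCell r s
  dom θ := θ.left
  cod θ := θ.right
  cid r := MatCell.id r
  vcomp θ ξ := θ.comp ξ
  dom_cid _ := rfl
  cod_cid _ := rfl
  dom_vcomp _ _ := rfl
  cod_vcomp _ _ := rfl
  cid_vcomp θ := MatCell.mk_congr fun x y => Category.id_comp _
  vcomp_cid θ := MatCell.mk_congr fun x y => Category.comp_id _
  vcomp_assoc θ ξ ζ := MatCell.mk_congr fun x y => Category.assoc _ _ _
  hone X := matOne V X.carrier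
  honeMap f := ⟨f, f, oneθ f⟩
  dom_honeMap _ := rfl
  cod_honeMap _ := rfl
  honeMap_id X := MatCell.mk_congr fun x y => one_ext fun h A => by
    rw [pt_oneθ, Category.comp_id]
  honeMap_comp f g := MatCell.mk_congr fun x y => one_ext fun h A => by
    rw [pt_oneθ, pt_oneθ_assoc, pt_oneθ]
  hcomp s r := matComp s r
  hc β α h := MatCell.hcomp β α h
  dom_hc _ _ _ := rfl
  cod_hc _ _ _ := rfl
  hc_cid s r := by
    refine (MatCell.hcomp_mk _ _ _ _ _ rfl).trans ?_
    exact MatCell.mk_congr fun x z => mat_ext fun y A a b => by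
      simp [pair_hcθ]
  hc_vcomp β α h β' α' h' := by
    obtain ⟨f, g, α⟩ := α
    obtain ⟨g₁, k, β⟩ := β
    obtain ⟨f', g', α'⟩ := α'
    obtain ⟨g₁', k', β'⟩ := β'
    obtain rfl : g = g₁ := h
    obtain rfl : g' = g₁' := h'
    rw [MatCell.hcomp_mk, MatCell.hcomp_mk, MatCell.hcomp_mk]
    exact MatCell.mk_congr fun x z => mat_ext fun y A a b => by
      simp [pair_hcθ, pair_hcθ_assoc]
  lam r := ⟨fun x => x, fun y => y, lamθ r⟩
  lamInv r := ⟨fun x => x, fun y => y, lamInvθ r⟩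
  dom_lam _ := rfl
  cod_lam _ := rfl
  dom_lamInv _ := rfl
  cod_lamInv _ := rfl
  lam_lamInv r := MatCell.mk_congr fun x y => lam_ext fun A b => by
    rw [pair_lamθ_assoc, comp_lamInvθ, Category.comp_id]
  lamInv_lam r := MatCell.mk_congr fun x y => pair_lamθ r x y (𝟙 _)
  lam_nat θ := by
    obtain ⟨f, g, α⟩ := θ
    refine (congrArg (fun t => MatCell.comp t _) (MatCell.hcomp_mk _ _ _ _ _ rfl)).trans ?_
    exact MatCell.mk_congr fun x y => lam_ext fun A b => by
      rw [pair_hcθ_assoc, pt_oneθ, pair_lamθ, pair_lamθ_assoc]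
  rho r := ⟨fun x => x, fun y => y, rhoθ r⟩
  rhoInv r := ⟨fun x => x, fun y => y, rhoInvθ r⟩
  dom_rho _ := rfl
  cod_rho _ := rfl
  dom_rhoInv _ := rfl
  cod_rhoInv _ := rfl
  rho_rhoInv r := MatCell.mk_congr fun x y => rho_ext fun A b => by
    rw [pair_rhoθ_assoc, comp_rhoInvθ, Category.comp_id]
  rhoInv_rho r := MatCell.mk_congr fun x y => pair_rhoθ r x y (𝟙 _)
  rho_nat θ := by
    obtain ⟨f, g, α⟩ := θ
    refine (congrArg (fun t => MatCell.comp t _) (MatCell.hcomp_mk _ _ _ _ _ rfl)).trans ?_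
    exact MatCell.mk_congr fun x y => rho_ext fun A b => by
      rw [pair_hcθ_assoc, pt_oneθ, pair_rhoθ, pair_rhoθ_assoc]
  assoc t s r := ⟨fun x => x, fun w => w, assocθ t s r⟩
  assocInv t s r := ⟨fun x => x, fun w => w, assocInvθ t s r⟩
  dom_assoc _ _ _ := rfl
  cod_assoc _ _ _ := rfl
  dom_assocInv _ _ _ := rfl
  cod_assocInv _ _ _ := rfl
  assoc_assocInv t s r := MatCell.mk_congr fun x w => left_ext fun y z A a b c => by
    rw [pair_assocθ_assoc, pair_assocInvθ, Category.comp_id]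
  assocInv_assoc t s r := MatCell.mk_congr fun x w => right_ext fun y z A a b c => by
    rw [pair_assocInvθ_assoc, pair_assocθ, Category.comp_id]
  assoc_nat γ β α h₁ h₂ := by
    obtain ⟨f, g, α⟩ := α
    obtain ⟨g₁, k, β⟩ := β
    obtain ⟨k₁, l, γ⟩ := γ
    obtain rfl : k = k₁ := h₁
    obtain rfl : g = g₁ := h₂
    simp only [MatCell.hcomp_mk]
    exact MatCell.mk_congr fun x w => left_ext fun y z A a b c => by
      simp only [pair_hcθ_assoc, pair_hcθ, pair_assocθ, pair_assocθ_assoc]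
  triangle s r := by
    simp only [MatCell.hcomp_mk]
    exact MatCell.mk_congr fun x z => triangle_ext fun y A a c => by
      simp only [pair_hcθ, pair_assocθ_assoc, pair_rhoθ, pair_lamθ, Category.comp_id]
  pentagon t s r q := by
    simp only [MatCell.hcomp_mk]
    exact MatCell.mk_congr fun x u => pentagon_ext fun y z w A a b c d => by
      simp only [pair_hcθ, pair_hcθ_assoc, pair_assocθ_assoc, pair_assocθ, Category.comp_id]

end Matrices

section MatCompanions

variable {V : Type u} [Category.{v} V] [HasFiniteLimits V] [HasCoproducts.{v} V] [Extensive V]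

/-- The companion `f_!(x, y) = 1(f x, y)` of a function `f`. -/
noncomputable instance : CompanionClosed (MatObj V) where
  comp {X Y} f :=
    { hor := fun x y => matOne V Y.carrier (f x) y
      unit := ⟨fun x => x, f, oneθ f⟩
      counit := ⟨f, fun y => y, fun _ _ => 𝟙 _⟩
      dom_unit := rfl
      cod_unit := rfl
      dom_counit := rfl
      cod_counit := rfl
      unit_counit := MatCell.mk_congr fun _ _ => Category.comp_id _
      hc_counit_unit := by
        refine (MatCell.hcomp_mk _ _ _ _ _ rfl).trans ?_
        refine MatCell.mk_congr fun x y => rho_ext fun A a => ?_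
        have h₁ : pair (s := fun x y => matOne V Y.carrier (f x) y) x a (pt A rfl) ≫
            hcθ (r := matOne V X.carrier) (r' := fun x y => matOne V Y.carrier (f x) y)
              (s' := matOne V Y.carrier) (f := fun x => x) (g := f) (k := fun y => y)
              (fun _ _ => 𝟙 _) (oneθ f) x y =
            pair x a (pt A rfl) ≫ rhoθ (fun x y => matOne V Y.carrier (f x) y) x y ≫
              lamInvθ (fun x y => matOne V Y.carrier (f x) y) x y := by
          refine Eq.trans ?_ ((pair_rhoθ_assoc (fun x y => matOne V Y.carrier (f x) y) x y a
            (lamInvθ (fun x y => matOne V Y.carrier (f x) y) x y)).trans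
            (comp_lamInvθ (fun x y => matOne V Y.carrier (f x) y) x y a)).symm
          rw [pair_hcθ, pt_oneθ]
          refine one_cases a fun h C j hj => ?_
          subst h
          rw [comp_pair, comp_pair, comp_pt, Category.comp_id, hj]
        exact h₁ }

end MatCompanions

section Spans

variable {V : Type u} [Category.{v} V]

/-- Spans `a ← apex → b`. -/
structure Span (a b : V) where
  apex : V
  l : apex ⟶ a
  r : apex ⟶ b

/-- 2-cells between spans. -/
structure SpanCell {a b c d : V} (p : Span a b) (q : Span c d) where
  left : a ⟶ c
  right : b ⟶ d
  mid : p.apex ⟶ q.apex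
  wl : mid ≫ q.l = p.l ≫ left
  wr : mid ≫ q.r = p.r ≫ right

attribute [simp] SpanCell.wl SpanCell.wr

@[simp]
theorem SpanCell.wl_assoc {a b c d : V} {p : Span a b} {q : Span c d} (α : SpanCell p q) {Z : V}
    (h : c ⟶ Z) : α.mid ≫ q.l ≫ h = p.l ≫ α.left ≫ h := by
  rw [← Category.assoc, α.wl, Category.assoc]

@[simp]
theorem SpanCell.wr_assoc {a b c d : V} {p : Span a b} {q : Span c d} (α : SpanCell p q) {Z : V}
    (h : d ⟶ Z) : α.mid ≫ q.r ≫ h = p.r ≫ α.right ≫ h := by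
  rw [← Category.assoc, α.wr, Category.assoc]

theorem SpanCell.ext {a b c d : V} {p : Span a b} {q : Span c d} {α β : SpanCell p q}
    (h₁ : α.left = β.left) (h₂ : α.right = β.right) (h₃ : α.mid = β.mid) : α = β := by
  cases α
  cases β
  simp only at h₁ h₂ h₃
  subst h₁ h₂ h₃
  rfl

variable [HasPullbacks V]

/-- The identity span. -/
abbrev Span.one (a : V) : Span a a := ⟨a, 𝟙 a, 𝟙 a⟩

/-- Composition of spans, by pullback. -/
noncomputable abbrev Span.comp {a b c : V} (s : Span b c) (r : Span a b) : Span a c :=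
  ⟨pullback r.r s.l, pullback.fst _ _ ≫ r.l, pullback.snd _ _ ≫ s.r⟩

namespace SpanCell

/-- The identity 2-cell. -/
abbrev id {a b : V} (p : Span a b) : SpanCell p p := ⟨𝟙 _, 𝟙 _, 𝟙 _, by simp, by simp⟩

/-- Vertical composition. -/
abbrev comp {a b c d a' b' : V} {r : Span a b} {s : Span c d} {q : Span a' b'}
    (θ : SpanCell r s) (ξ : SpanCell s q) : SpanCell r q :=
  ⟨θ.left ≫ ξ.left, θ.right ≫ ξ.right, θ.mid ≫ ξ.mid, by simp, by simp⟩

/-- The 2-cell between identity spans given by a morphism. -/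
abbrev one {a b : V} (f : a ⟶ b) : SpanCell (Span.one a) (Span.one b) :=
  ⟨f, f, f, by simp, by simp⟩

/-- Horizontal composition. -/
noncomputable abbrev hcomp {a b c a' b' c' : V} {s : Span b c} {r : Span a b} {s' : Span b' c'}
    {r' : Span a' b'} (β : SpanCell s s') (α : SpanCell r r') (h : α.right = β.left) :
    SpanCell (s.comp r) (s'.comp r') :=
  ⟨α.left, β.right,
    pullback.lift (pullback.fst _ _ ≫ α.mid) (pullback.snd _ _ ≫ β.mid) (by
      simp [pullback.condition_assoc, h]), by simp, by simp⟩

/-- The left unitor. -/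
noncomputable abbrev lam {a b : V} (r : Span a b) : SpanCell ((Span.one b).comp r) r :=
  ⟨𝟙 _, 𝟙 _, pullback.fst _ _, by simp, by simp [pullback.condition]⟩

/-- The inverse of the left unitor. -/
noncomputable abbrev lamInv {a b : V} (r : Span a b) : SpanCell r ((Span.one b).comp r) :=
  ⟨𝟙 _, 𝟙 _, pullback.lift (𝟙 _) r.r (by simp), by simp, by simp⟩

/-- The right unitor. -/
noncomputable abbrev rho {a b : V} (r : Span a b) : SpanCell (r.comp (Span.one a)) r :=
  ⟨𝟙 _, 𝟙 _, pullback.snd _ _, by simpa using (pullback.condition (f := 𝟙 _) (g := r.l)).symm,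
    by simp⟩

/-- The inverse of the right unitor. -/
noncomputable abbrev rhoInv {a b : V} (r : Span a b) : SpanCell r (r.comp (Span.one a)) :=
  ⟨𝟙 _, 𝟙 _, pullback.lift r.l (𝟙 _) (by simp), by simp, by simp⟩

/-- The associator. -/
noncomputable abbrev assoc {a b c d : V} (t : Span c d) (s : Span b c) (r : Span a b) :
    SpanCell ((t.comp s).comp r) (t.comp (s.comp r)) :=
  ⟨𝟙 _, 𝟙 _,
    pullback.lift (pullback.lift (pullback.fst _ _) (pullback.snd _ _ ≫ pullback.fst _ _)
      (by simp [pullback.condition])) (pullback.snd _ _ ≫ pullback.snd _ _)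
      (by simp [pullback.condition]), by simp, by simp⟩

/-- The inverse of the associator. -/
noncomputable abbrev assocInv {a b c d : V} (t : Span c d) (s : Span b c) (r : Span a b) :
    SpanCell (t.comp (s.comp r)) ((t.comp s).comp r) :=
  ⟨𝟙 _, 𝟙 _,
    pullback.lift (pullback.fst _ _ ≫ pullback.fst _ _)
      (pullback.lift (pullback.fst _ _ ≫ pullback.snd _ _) (pullback.snd _ _)
        (by simpa using pullback.condition)) (by simp [pullback.condition]), by simp, by simp⟩

end SpanCell

/-- The pseudodouble category of spans in `V`. -/
noncomputable instance : DoubleCategory.{max u v, v} V where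
  Hor a b := Span a b
  Cell p q := SpanCell p q
  dom θ := θ.left
  cod θ := θ.right
  cid p := SpanCell.id p
  vcomp θ ξ := SpanCell.comp θ ξ
  dom_cid _ := rfl
  cod_cid _ := rfl
  dom_vcomp _ _ := rfl
  cod_vcomp _ _ := rfl
  cid_vcomp θ := SpanCell.ext (Category.id_comp _) (Category.id_comp _) (Category.id_comp _)
  vcomp_cid θ := SpanCell.ext (Category.comp_id _) (Category.comp_id _) (Category.comp_id _)
  vcomp_assoc θ ξ ζ :=
    SpanCell.ext (Category.assoc _ _ _) (Category.assoc _ _ _) (Category.assoc _ _ _)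
  hone a := Span.one a
  honeMap f := SpanCell.one f
  dom_honeMap _ := rfl
  cod_honeMap _ := rfl
  honeMap_id _ := rfl
  honeMap_comp _ _ := rfl
  hcomp s r := Span.comp s r
  hc β α h := SpanCell.hcomp β α h
  dom_hc _ _ _ := rfl
  cod_hc _ _ _ := rfl
  hc_cid s r := SpanCell.ext rfl rfl (by apply pullback.hom_ext <;> simp)
  hc_vcomp β α h β' α' h' := SpanCell.ext rfl rfl (by apply pullback.hom_ext <;> simp)
  lam r := SpanCell.lam r
  lamInv r := SpanCell.lamInv r
  dom_lam _ := rfl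
  cod_lam _ := rfl
  dom_lamInv _ := rfl
  cod_lamInv _ := rfl
  lam_lamInv r := SpanCell.ext (Category.id_comp _) (Category.id_comp _) (by
    apply pullback.hom_ext <;> simp [pullback.condition])
  lamInv_lam r := SpanCell.ext (Category.id_comp _) (Category.id_comp _) (by simp)
  lam_nat θ := SpanCell.ext (by simp) (by simp) (by simp)
  rho r := SpanCell.rho r
  rhoInv r := SpanCell.rhoInv r
  dom_rho _ := rfl
  cod_rho _ := rfl
  dom_rhoInv _ := rfl
  cod_rhoInv _ := rfl
  rho_rhoInv r := SpanCell.ext (Category.id_comp _) (Category.id_comp _) (by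
    apply pullback.hom_ext <;> simp [← pullback.condition])
  rhoInv_rho r := SpanCell.ext (Category.id_comp _) (Category.id_comp _) (by simp)
  rho_nat θ := SpanCell.ext (by simp) (by simp) (by simp)
  assoc t s r := SpanCell.assoc t s r
  assocInv t s r := SpanCell.assocInv t s r
  dom_assoc _ _ _ := rfl
  cod_assoc _ _ _ := rfl
  dom_assocInv _ _ _ := rfl
  cod_assocInv _ _ _ := rfl
  assoc_assocInv t s r := SpanCell.ext (Category.id_comp _) (Category.id_comp _) (by
    apply pullback.hom_ext
    · simp
    · apply pullback.hom_ext <;> simp)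
  assocInv_assoc t s r := SpanCell.ext (Category.id_comp _) (Category.id_comp _) (by
    apply pullback.hom_ext
    · apply pullback.hom_ext <;> simp
    · simp)
  assoc_nat γ β α h₁ h₂ := SpanCell.ext (by simp) (by simp) (by
    apply pullback.hom_ext
    · apply pullback.hom_ext <;> simp
    · simp)
  triangle s r := SpanCell.ext (by simp) (by simp) (by
    apply pullback.hom_ext <;> simp)
  pentagon t s r q := SpanCell.ext (by simp) (by simp) (by
    apply pullback.hom_ext
    · apply pullback.hom_ext
      · apply pullback.hom_ext <;> simp
      · simp
    · simp)

/-- The conjoint of `f : a ⟶ b` is the span `b ← a → a` given by `f` and the identity. -/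
abbrev Span.conj {a b : V} (f : a ⟶ b) : Span b a := ⟨a, f, 𝟙 a⟩

/-- The unit of the conjoint. -/
abbrev SpanCell.conjUnit {a b : V} (f : a ⟶ b) : SpanCell (Span.one a) (Span.conj f) :=
  ⟨f, 𝟙 a, 𝟙 a, by simp, by simp⟩

/-- The counit of the conjoint. -/
abbrev SpanCell.conjCounit {a b : V} (f : a ⟶ b) : SpanCell (Span.conj f) (Span.one b) :=
  ⟨𝟙 b, f, f, by simp, by simp⟩

theorem SpanCell.conj_hcomp {a b : V} (f : a ⟶ b) :
    SpanCell.hcomp (SpanCell.conjUnit f) (SpanCell.conjCounit f) rfl =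
      (SpanCell.lam (Span.conj f)).comp (SpanCell.rhoInv (Span.conj f)) :=
  SpanCell.ext (by simp) (by simp) (by
    apply pullback.hom_ext
    · simp
    · simpa using (pullback.condition (f := 𝟙 a) (g := 𝟙 a)).symm)

noncomputable instance : ConjointClosed V where
  conj {a b} f :=
    { hor := Span.conj f
      unit := SpanCell.conjUnit f
      counit := SpanCell.conjCounit f
      dom_unit := rfl
      cod_unit := rfl
      dom_counit := rfl
      cod_counit := rfl
      unit_counit := SpanCell.ext (Category.comp_id _) (Category.id_comp _) (Category.id_comp _)
      hc_unit_counit := SpanCell.conj_hcomp f }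

theorem Span.isInv {a b : V} {p q : Span a b} (α : SpanCell p q) (h₁ : α.left = 𝟙 a)
    (h₂ : α.right = 𝟙 b) (h₃ : IsIso α.mid) : IsInv (D := V) (r := p) (s := q) α := by
  refine ⟨(⟨𝟙 a, 𝟙 b, inv α.mid, ?_, ?_⟩ : SpanCell q p), ?_, ?_⟩
  · rw [IsIso.inv_comp_eq, Category.comp_id, α.wl, h₁, Category.comp_id]
  · rw [IsIso.inv_comp_eq, Category.comp_id, α.wr, h₂, Category.comp_id]
  · exact SpanCell.ext ((Category.comp_id _).trans h₁) ((Category.comp_id _).trans h₂)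
      (IsIso.hom_inv_id _)
  · exact SpanCell.ext ((Category.id_comp _).trans h₁) ((Category.id_comp _).trans h₂)
      (IsIso.inv_hom_id _)

end Spans

section SpanMonads

variable {V : Type u} [Category.{v} V] [HasPullbacks V]

/-- The inverse of the comparison `T (a ×_c b) ⟶ T a ×_{T c} T b`. -/
noncomputable def pbInv (T : V ⥤ V) [PreservesLimitsOfShape WalkingCospan T] {a b c : V}
    (f : a ⟶ c) (g : b ⟶ c) : pullback (T.map f) (T.map g) ⟶ T.obj (pullback f g) :=
  inv (pullbackComparison T f g)

@[simp]
theorem pbInv_fst (T : V ⥤ V) [PreservesLimitsOfShape WalkingCospan T] {a b c : V}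
    (f : a ⟶ c) (g : b ⟶ c) : pbInv T f g ≫ T.map (pullback.fst f g) = pullback.fst _ _ := by
  rw [pbInv, IsIso.inv_comp_eq, pullbackComparison_comp_fst]

@[simp]
theorem pbInv_fst_assoc (T : V ⥤ V) [PreservesLimitsOfShape WalkingCospan T] {a b c : V}
    (f : a ⟶ c) (g : b ⟶ c) {Z' : V}
    (h' : _ ⟶ Z') :
    pbInv T f g ≫ T.map (pullback.fst f g) ≫ h' =
      pullback.fst _ _ ≫ h' := by
  rw [← Category.assoc, pbInv_fst]

@[simp]
theorem pbInv_snd (T : V ⥤ V) [PreservesLimitsOfShape WalkingCospan T] {a b c : V}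
    (f : a ⟶ c) (g : b ⟶ c) : pbInv T f g ≫ T.map (pullback.snd f g) = pullback.snd _ _ := by
  rw [pbInv, IsIso.inv_comp_eq, pullbackComparison_comp_snd]

@[simp]
theorem pbInv_snd_assoc (T : V ⥤ V) [PreservesLimitsOfShape WalkingCospan T] {a b c : V}
    (f : a ⟶ c) (g : b ⟶ c) {Z' : V}
    (h' : _ ⟶ Z') :
    pbInv T f g ≫ T.map (pullback.snd f g) ≫ h' =
      pullback.snd _ _ ≫ h' := by
  rw [← Category.assoc, pbInv_snd]

instance (T : V ⥤ V) [PreservesLimitsOfShape WalkingCospan T] {a b c : V}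
    (f : a ⟶ c) (g : b ⟶ c) : IsIso (pbInv T f g) := by
  rw [pbInv]
  infer_instance

theorem map_pb_ext (T : V ⥤ V) [PreservesLimitsOfShape WalkingCospan T] {a b c : V}
    {f : a ⟶ c} {g : b ⟶ c} {d : V} {h k : d ⟶ T.obj (pullback f g)}
    (h₁ : h ≫ T.map (pullback.fst f g) = k ≫ T.map (pullback.fst f g))
    (h₂ : h ≫ T.map (pullback.snd f g) = k ≫ T.map (pullback.snd f g)) : h = k := by
  rw [← cancel_mono (pullbackComparison T f g)]
  apply pullback.hom_ext
  · simpa using h₁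
  · simpa using h₂

@[simp]
theorem map_lift_fst (T : V ⥤ V) {a b c d : V} {f : a ⟶ c} {g : b ⟶ c}
    (h : d ⟶ a) (k : d ⟶ b) (w : h ≫ f = k ≫ g) :
    T.map (pullback.lift h k w) ≫ T.map (pullback.fst f g) = T.map h := by
  rw [← T.map_comp, pullback.lift_fst]

@[simp]
theorem map_lift_fst_assoc (T : V ⥤ V) {a b c d : V} {f : a ⟶ c} {g : b ⟶ c}
    (h : d ⟶ a) (k : d ⟶ b) (w : h ≫ f = k ≫ g) {Z' : V}
    (h' : _ ⟶ Z') :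
    T.map (pullback.lift h k w) ≫ T.map (pullback.fst f g) ≫ h' =
      T.map h ≫ h' := by
  rw [← Category.assoc, map_lift_fst]

@[simp]
theorem map_lift_snd (T : V ⥤ V) {a b c d : V} {f : a ⟶ c} {g : b ⟶ c}
    (h : d ⟶ a) (k : d ⟶ b) (w : h ≫ f = k ≫ g) :
    T.map (pullback.lift h k w) ≫ T.map (pullback.snd f g) = T.map k := by
  rw [← T.map_comp, pullback.lift_snd]

@[simp]
theorem map_lift_snd_assoc (T : V ⥤ V) {a b c d : V} {f : a ⟶ c} {g : b ⟶ c}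
    (h : d ⟶ a) (k : d ⟶ b) (w : h ≫ f = k ≫ g) {Z' : V}
    (h' : _ ⟶ Z') :
    T.map (pullback.lift h k w) ≫ T.map (pullback.snd f g) ≫ h' =
      T.map k ≫ h' := by
  rw [← Category.assoc, map_lift_snd]

@[simp]
theorem map_pbInv_fst (T : V ⥤ V) [PreservesLimitsOfShape WalkingCospan T] {a b c : V}
    (f : a ⟶ c) (g : b ⟶ c) :
    T.map (pbInv T f g) ≫ T.map (T.map (pullback.fst f g)) = T.map (pullback.fst _ _) := by
  rw [← T.map_comp, pbInv_fst]

@[simp]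
theorem map_pbInv_fst_assoc (T : V ⥤ V) [PreservesLimitsOfShape WalkingCospan T] {a b c : V}
    (f : a ⟶ c) (g : b ⟶ c) {Z' : V}
    (h' : _ ⟶ Z') :
    T.map (pbInv T f g) ≫ T.map (T.map (pullback.fst f g)) ≫ h' =
      T.map (pullback.fst _ _) ≫ h' := by
  rw [← Category.assoc, map_pbInv_fst]

@[simp]
theorem map_pbInv_snd (T : V ⥤ V) [PreservesLimitsOfShape WalkingCospan T] {a b c : V}
    (f : a ⟶ c) (g : b ⟶ c) :
    T.map (pbInv T f g) ≫ T.map (T.map (pullback.snd f g)) = T.map (pullback.snd _ _) := by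
  rw [← T.map_comp, pbInv_snd]

@[simp]
theorem map_pbInv_snd_assoc (T : V ⥤ V) [PreservesLimitsOfShape WalkingCospan T] {a b c : V}
    (f : a ⟶ c) (g : b ⟶ c) {Z' : V}
    (h' : _ ⟶ Z') :
    T.map (pbInv T f g) ≫ T.map (T.map (pullback.snd f g)) ≫ h' =
      T.map (pullback.snd _ _) ≫ h' := by
  rw [← Category.assoc, map_pbInv_snd]

/-- The image of a span under a functor. -/
abbrev Span.map (T : V ⥤ V) {a b : V} (p : Span a b) : Span (T.obj a) (T.obj b) :=
  ⟨T.obj p.apex, T.map p.l, T.map p.r⟩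

namespace SpanCell

/-- The image of a 2-cell of spans under a functor. -/
abbrev map (T : V ⥤ V) {a b c d : V} {p : Span a b} {q : Span c d} (θ : SpanCell p q) :
    SpanCell (p.map T) (q.map T) :=
  ⟨T.map θ.left, T.map θ.right, T.map θ.mid,
    by rw [← T.map_comp, θ.wl, T.map_comp], by rw [← T.map_comp, θ.wr, T.map_comp]⟩

/-- The comparison of identity spans. -/
abbrev mapOne (T : V ⥤ V) (a : V) : SpanCell (Span.one (T.obj a)) ((Span.one a).map T) :=
  ⟨𝟙 _, 𝟙 _, 𝟙 _, by simp, by simp⟩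

variable (T : V ⥤ V) [PreservesLimitsOfShape WalkingCospan T]

/-- The comparison of composite spans. -/
noncomputable abbrev mapComp {a b c : V} (s : Span b c) (r : Span a b) :
    SpanCell ((s.map T).comp (r.map T)) ((s.comp r).map T) :=
  ⟨𝟙 _, 𝟙 _, pbInv T r.r s.l, by simp, by simp⟩

theorem mapComp_nat {a b c a' b' c' : V} {s : Span b c} {r : Span a b} {s' : Span b' c'}
    {r' : Span a' b'} (β : SpanCell s s') (α : SpanCell r r') (h : α.right = β.left) (h') :
    ((β.map T).hcomp (α.map T) h').comp (mapComp T s' r') =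
      (mapComp T s r).comp ((β.hcomp α h).map T) :=
  SpanCell.ext (by simp) (by simp) (by
    apply map_pb_ext
    · simp
    · simp)

theorem map_left_unit {a b : V} (r : Span a b) (h) :
    ((mapOne T b).hcomp (id (r.map T)) h).comp
      ((mapComp T (Span.one b) r).comp ((lam r).map T)) = lam (r.map T) :=
  SpanCell.ext (by simp) (by simp) (by simp)

theorem map_right_unit {a b : V} (r : Span a b) (h) :
    ((id (r.map T)).hcomp (mapOne T a) h).comp
      ((mapComp T r (Span.one a)).comp ((rho r).map T)) = rho (r.map T) :=
  SpanCell.ext (by simp) (by simp) (by simp)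

theorem map_assoc {a b c d : V} (p : Span c d) (s : Span b c) (r : Span a b) (h h') :
    ((mapComp T p s).hcomp (id (r.map T)) h).comp
      ((mapComp T (p.comp s) r).comp ((assoc p s r).map T)) =
    (assoc (p.map T) (s.map T) (r.map T)).comp
      (((id (p.map T)).hcomp (mapComp T s r) h').comp (mapComp T p (s.comp r))) :=
  SpanCell.ext (by simp) (by simp) (by
    apply map_pb_ext
    · apply map_pb_ext
      · simp
      · simp
    · simp)

end SpanCell

/-- The action of a pullback-preserving functor on spans. -/
noncomputable def spanFunctor (T : V ⥤ V) [PreservesLimitsOfShape WalkingCospan T] :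
    LaxFunctor V V where
  base := T
  hor p := Span.map T p
  cell θ := SpanCell.map T θ
  dom_cell _ := rfl
  cod_cell _ := rfl
  cell_cid p := SpanCell.ext (T.map_id _) (T.map_id _) (T.map_id _)
  cell_vcomp θ ξ := SpanCell.ext (T.map_comp _ _) (T.map_comp _ _) (T.map_comp _ _)
  unitC a := SpanCell.mapOne T a
  dom_unitC _ := rfl
  cod_unitC _ := rfl
  unitC_nat f := SpanCell.ext ((Category.comp_id _).trans (Category.id_comp _).symm)
    ((Category.comp_id _).trans (Category.id_comp _).symm)
    ((Category.comp_id _).trans (Category.id_comp _).symm)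
  compC s r := SpanCell.mapComp T s r
  dom_compC _ _ := rfl
  cod_compC _ _ := rfl
  compC_nat β α h := SpanCell.mapComp_nat T β α h _
  left_unit r := SpanCell.map_left_unit T r _
  right_unit r := SpanCell.map_right_unit T r _
  assoc_comp p s r := SpanCell.map_assoc T p s r _ _

/-- A cartesian monad: the underlying functor preserves pullbacks, and the naturality squares of
the unit and of the multiplication are pullbacks. -/
class CartesianMonad (T : Monad V) : Prop where
  preserves : PreservesLimitsOfShape WalkingCospan T.toFunctor
  unit : ∀ {a b : V} (f : a ⟶ b),
    IsPullback f (T.η.app a) (T.η.app b) (T.toFunctor.map f)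
  mul : ∀ {a b : V} (f : a ⟶ b),
    IsPullback (T.toFunctor.map (T.toFunctor.map f)) (T.μ.app a) (T.μ.app b) (T.toFunctor.map f)

attribute [instance] CartesianMonad.preserves

variable (T : Monad V) [CartesianMonad T]

/-- The unit of the monad on `Span(V)`. -/
noncomputable def spanUnit : VertTrans (LaxFunctor.id V) (spanFunctor T.toFunctor) where
  app a := T.η.app a
  naturality f := T.η.naturality f
  cell p := ⟨T.η.app _, T.η.app _, T.η.app _, (T.η.naturality _).symm, (T.η.naturality _).symm⟩
  dom_cell _ := rfl
  cod_cell _ := rfl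
  cell_naturality θ :=
    SpanCell.ext (T.η.naturality _) (T.η.naturality _) (T.η.naturality _)
  unit a := SpanCell.ext ((Category.id_comp _).trans (Category.comp_id _).symm)
    ((Category.id_comp _).trans (Category.comp_id _).symm)
    ((Category.id_comp _).trans (Category.comp_id _).symm)
  comp s r := SpanCell.ext ((Category.id_comp _).trans (Category.comp_id _).symm)
    ((Category.id_comp _).trans (Category.comp_id _).symm) (by
      refine (Category.id_comp _).trans (map_pb_ext T.toFunctor ?_ ?_)
      · exact ((T.η.naturality _).symm).trans
          ((pullback.lift_fst _ _ _).symm.trans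
            ((congrArg (_ ≫ ·) (pbInv_fst _ _ _).symm).trans (Category.assoc _ _ _).symm))
      · exact ((T.η.naturality _).symm).trans
          ((pullback.lift_snd _ _ _).symm.trans
            ((congrArg (_ ≫ ·) (pbInv_snd _ _ _).symm).trans (Category.assoc _ _ _).symm)))

theorem pbInv_mul {a b c : V} (f : a ⟶ c) (g : b ⟶ c) (w) :
    (pbInv T.toFunctor (T.toFunctor.map f) (T.toFunctor.map g) ≫
      T.toFunctor.map (pbInv T.toFunctor f g)) ≫ T.μ.app (pullback f g) =
    pullback.lift (pullback.fst _ _ ≫ T.μ.app a) (pullback.snd _ _ ≫ T.μ.app b) w ≫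
      pbInv T.toFunctor f g := by
  have h₁ := T.μ.naturality (pullback.fst f g)
  have h₂ := T.μ.naturality (pullback.snd f g)
  simp only [Functor.comp_map] at h₁ h₂
  apply map_pb_ext
  · simp [← h₁]
  · simp [← h₂]

/-- The multiplication of the monad on `Span(V)`. -/
noncomputable def spanMul : VertTrans ((spanFunctor T.toFunctor).comp (spanFunctor T.toFunctor))
    (spanFunctor T.toFunctor) where
  app a := T.μ.app a
  naturality f := T.μ.naturality f
  cell p := ⟨T.μ.app _, T.μ.app _, T.μ.app _, (T.μ.naturality _).symm, (T.μ.naturality _).symm⟩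
  dom_cell _ := rfl
  cod_cell _ := rfl
  cell_naturality θ :=
    SpanCell.ext (T.μ.naturality _) (T.μ.naturality _) (T.μ.naturality _)
  unit a := by
    have h : (𝟙 (T.toFunctor.obj (T.toFunctor.obj a)) ≫ T.toFunctor.map (𝟙 _)) ≫ T.μ.app a =
      T.μ.app a ≫ 𝟙 _ := by simp
    exact SpanCell.ext h h h
  comp s r := by
    have h : ∀ a, (𝟙 (T.toFunctor.obj (T.toFunctor.obj a)) ≫ T.toFunctor.map (𝟙 _)) ≫ T.μ.app a =
      T.μ.app a ≫ 𝟙 _ := by simp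
    exact SpanCell.ext (h _) (h _) (pbInv_mul T _ _ _)

/-- The monad on `Span(V)` induced by a cartesian monad on `V`. -/
noncomputable def spanMonad : LaxMonad V where
  toFun := spanFunctor T.toFunctor
  e := spanUnit T
  m := spanMul T
  left_unit a := T.left_unit a
  right_unit a := T.right_unit a
  mul_assoc a := T.assoc a
  left_unit_cell r := SpanCell.ext (T.left_unit _) (T.left_unit _) (T.left_unit _)
  right_unit_cell r := SpanCell.ext (T.right_unit _) (T.right_unit _) (T.right_unit _)
  mul_assoc_cell r := SpanCell.ext (T.assoc _) (T.assoc _) (T.assoc _)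

theorem spanMonad_sigma {a b : V} (f : a ⟶ b) : IsInv ((spanMonad T).toFun.sigma f) := by
  refine Span.isInv _ (LaxFunctor.dom_sigma (spanMonad T).toFun f)
    (LaxFunctor.cod_sigma (spanMonad T).toFun f) ?_
  let T' := T.toFunctor
  have h : ∀ w w', pullback.lift (f := 𝟙 _) (g := 𝟙 _) (𝟙 (T'.obj a)) (𝟙 (T'.obj a)) w ≫
      pullback.lift (f := 𝟙 _) (g := T'.map f) (pullback.fst _ _ ≫ T'.map f)
        (pullback.snd _ _ ≫ 𝟙 _ ≫ T'.map (𝟙 a)) w' ≫ pullback.snd _ _ = 𝟙 (T'.obj a) := by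
    intro w w'
    simp
  have h' : SpanCell.mid ((spanMonad T).toFun.sigma f) = 𝟙 (T'.obj a) := h _ _
  exact h'.symm ▸ (inferInstance : IsIso (𝟙 (T'.obj a)))

/-- The comparison `T r · (T f)^* ⟶ T (r · f^*)` is invertible. -/
theorem spanMonad_conjComp {a b c : V} (r : Hor a c) (f : a ⟶ b) :
    IsInv ((spanMonad T).toFun.conjComp r f) := by
  refine IsInv.vcomp (IsInv.hc (isInv_cid _) (spanMonad_sigma T f) (dom_cid _)
    (LaxFunctor.cod_sigma _ _) _) ?_
  refine Span.isInv _ rfl rfl ?_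
  change IsIso (pbInv _ _ _)
  infer_instance

end SpanMonads

section Copower

variable {V : Type u} [Category.{v} V] [HasFiniteLimits V] [HasCoproducts.{v} V]

/-- The copower `X · 1 = ∐_{x ∈ X} 1`. -/
noncomputable def cop1 (V : Type u) [Category.{v} V] [HasFiniteLimits V] [HasCoproducts.{v} V]
    (X : Type v) : V :=
  ∐ fun _ : X => ⊤_ V

/-- The injection of the component at `x`. -/
noncomputable def cop1ι {X : Type v} (x : X) : ⊤_ V ⟶ cop1 V X := Sigma.ι (fun _ : X => ⊤_ V) x

theorem cop1ι_cop (X : Type v) : IsCop (cop1ι (V := V) (X := X)) := IsCop.sigma _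

/-- Morphisms out of `X · 1`. -/
noncomputable def cop1Desc {X : Type v} {B : V} (f : X → (⊤_ V ⟶ B)) : cop1 V X ⟶ B := Sigma.desc f

/-- The generalised element of `X · 1` given by `x`. -/
noncomputable def px {X : Type v} (A : V) (x : X) : A ⟶ cop1 V X := terminal.from A ≫ cop1ι x

theorem comp_px {X : Type v} {A B : V} (f : B ⟶ A) (x : X) : f ≫ px (V := V) A x = px B x := by
  rw [px, px, ← Category.assoc, terminal.comp_from]

theorem cop1ι_desc {X : Type v} {B : V} (f : X → (⊤_ V ⟶ B)) (x : X) :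
    cop1ι x ≫ cop1Desc f = f x := Sigma.ι_desc _ _

theorem px_desc {X : Type v} {A B : V} (f : X → (⊤_ V ⟶ B)) (x : X) :
    px A x ≫ cop1Desc f = terminal.from A ≫ f x := by
  rw [px, Category.assoc, cop1ι_desc]

theorem cop1ι_eq {X : Type v} (x : X) : cop1ι (V := V) x = px _ x := by
  have h : terminal.from (⊤_ V) = 𝟙 _ := by subsingleton
  rw [px, h, Category.id_comp]

theorem px_ext {X : Type v} {B : V} {f g : cop1 V X ⟶ B}
    (h : ∀ (x : X) (A : V), px A x ≫ f = px A x ≫ g) : f = g :=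
  (cop1ι_cop X).hom_ext fun x => by rw [cop1ι_eq, h]

/-- The coproduct of all the entries of a matrix. -/
noncomputable def tot {X Y : Type v} (p : X → Y → V) : V := ∐ fun k : X × Y => p k.1 k.2

/-- The injection of the entry at `(x, y)`. -/
noncomputable def totι {X Y : Type v} (p : X → Y → V) (x : X) (y : Y) : p x y ⟶ tot p :=
  Sigma.ι (fun k : X × Y => p k.1 k.2) (x, y)

theorem totι_cop {X Y : Type v} (p : X → Y → V) :
    IsCop (A := fun k : X × Y => p k.1 k.2) fun k : X × Y => totι p k.1 k.2 :=
  IsCop.sigma _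

/-- Morphisms out of `∐_{x, y} p(x, y)`. -/
noncomputable def totDesc {X Y : Type v} {p : X → Y → V} {B : V} (f : ∀ x y, p x y ⟶ B) :
    tot p ⟶ B :=
  Sigma.desc fun k : X × Y => f k.1 k.2

/-- The generalised element of `∐_{x, y} p(x, y)` given by an element of `p(x, y)`. -/
noncomputable def el {X Y : Type v} {p : X → Y → V} {A : V} (x : X) (y : Y) (a : A ⟶ p x y) :
    A ⟶ tot p :=
  a ≫ totι p x y

theorem comp_el {X Y : Type v} {p : X → Y → V} {A B : V} (f : B ⟶ A) (x : X) (y : Y)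
    (a : A ⟶ p x y) : f ≫ el x y a = el x y (f ≫ a) :=
  (Category.assoc _ _ _).symm

theorem el_desc {X Y : Type v} {p : X → Y → V} {A B : V} (f : ∀ x y, p x y ⟶ B) (x : X) (y : Y)
    (a : A ⟶ p x y) : el x y a ≫ totDesc f = a ≫ f x y := by
  rw [el, Category.assoc]
  exact congrArg (a ≫ ·) (Sigma.ι_desc _ _)

theorem el_desc_assoc {X Y : Type v} {p : X → Y → V} {A B : V} (f : ∀ x y, p x y ⟶ B) (x : X)
    (y : Y) (a : A ⟶ p x y) {Z : V} (h : B ⟶ Z) : el x y a ≫ totDesc f ≫ h = a ≫ f x y ≫ h := by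
  rw [← Category.assoc, el_desc, Category.assoc]

theorem tot_ext {X Y : Type v} {p : X → Y → V} {B : V} {f g : tot p ⟶ B}
    (h : ∀ (x : X) (y : Y) (A : V) (a : A ⟶ p x y), el x y a ≫ f = el x y a ≫ g) : f = g :=
  (totι_cop p).hom_ext fun k => by
    have := h k.1 k.2 _ (𝟙 _)
    simpa [el] using this

/-- The left leg of the span `p · 1`. -/
noncomputable def totL {X Y : Type v} (p : X → Y → V) : tot p ⟶ cop1 V X :=
  totDesc fun x _ => px _ x

/-- The right leg of the span `p · 1`. -/
noncomputable def totR {X Y : Type v} (p : X → Y → V) : tot p ⟶ cop1 V Y :=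
  totDesc fun _ y => px _ y

theorem el_totL {X Y : Type v} {p : X → Y → V} {A : V} (x : X) (y : Y) (a : A ⟶ p x y) :
    el x y a ≫ totL p = px A x := by
  rw [totL, el_desc, comp_px]

theorem el_totR {X Y : Type v} {p : X → Y → V} {A : V} (x : X) (y : Y) (a : A ⟶ p x y) :
    el x y a ≫ totR p = px A y := by
  rw [totR, el_desc, comp_px]

/-- The span `p · 1` from `X · 1` to `Y · 1`. -/
noncomputable abbrev totSpan {X Y : Type v} (p : X → Y → V) : Span (cop1 V X) (cop1 V Y) :=
  ⟨tot p, totL p, totR p⟩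

/-- The function `f · 1`. -/
noncomputable def cop1Map (V : Type u) [Category.{v} V] [HasFiniteLimits V] [HasCoproducts.{v} V]
    {X Y : Type v} (f : X → Y) : cop1 V X ⟶ cop1 V Y :=
  cop1Desc fun x => cop1ι (f x)

theorem px_map {X Y : Type v} (f : X → Y) (A : V) (x : X) :
    px A x ≫ cop1Map V f = px A (f x) := by
  rw [cop1Map, px_desc, px]

/-- The 2-cell `θ · 1`. -/
noncomputable def totCell {X Y X' Y' : Type v} {p : X → Y → V} {q : X' → Y' → V}
    (θ : MatCell p q) : SpanCell (totSpan p) (totSpan q) where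
  left := cop1Map V θ.left
  right := cop1Map V θ.right
  mid := totDesc fun x y => el (θ.left x) (θ.right y) (θ.θ x y)
  wl := tot_ext fun x y A a => by
    rw [el_desc_assoc, el_totL, comp_px, ← Category.assoc, el_totL, px_map]
  wr := tot_ext fun x y A a => by
    rw [el_desc_assoc, el_totR, comp_px, ← Category.assoc, el_totR, px_map]

theorem el_totCell {X Y X' Y' : Type v} {p : X → Y → V} {q : X' → Y' → V}
    (θ : MatCell p q) {A : V} (x : X) (y : Y) (a : A ⟶ p x y) :
    el x y a ≫ (totCell θ).mid = el (θ.left x) (θ.right y) (a ≫ θ.θ x y) :=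
  (el_desc (fun x y => el (θ.left x) (θ.right y) (θ.θ x y)) x y a).trans (comp_el _ _ _ _)

/-- The comparison `X · 1 ⟶ ∐_{x, x'} 1(x, x')`. -/
noncomputable def totUnit (V : Type u) [Category.{v} V] [HasFiniteLimits V] [HasCoproducts.{v} V]
    (X : Type v) : SpanCell (Span.one (cop1 V X)) (totSpan (matOne V X)) where
  left := 𝟙 _
  right := 𝟙 _
  mid := cop1Desc fun x => el x x (pt _ rfl)
  wl := px_ext fun x A => by
    rw [← Category.assoc, px_desc, comp_el, el_totL]
    simp
  wr := px_ext fun x A => by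
    rw [← Category.assoc, px_desc, comp_el, el_totR]
    simp

theorem px_totUnit {X : Type v} (A : V) (x : X) :
    px A x ≫ (totUnit V X).mid = el x x (pt A rfl) := by
  refine (px_desc _ _).trans ?_
  rw [comp_el, comp_pt]

/-- The morphism `A ⟶ r · 1 ×_{Y · 1} s · 1` given by elements of `s(y, z)` and of `r(x, y)`. -/
noncomputable def el₂ {X Y Z : Type v} {s : Y → Z → V} {r : X → Y → V} {A : V} (x : X) (y : Y)
    (z : Z) (a : A ⟶ s y z) (b : A ⟶ r x y) : A ⟶ pullback (totR r) (totL s) :=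
  pullback.lift (el x y b) (el y z a) (by rw [el_totR, el_totL])

theorem comp_el₂ {X Y Z : Type v} {s : Y → Z → V} {r : X → Y → V} {A B : V} (f : B ⟶ A) (x : X)
    (y : Y) (z : Z) (a : A ⟶ s y z) (b : A ⟶ r x y) :
    f ≫ el₂ x y z a b = el₂ x y z (f ≫ a) (f ≫ b) := by
  apply pullback.hom_ext
  · simp [el₂, comp_el]
  · simp [el₂, comp_el]

/-- The canonical morphism `(s · r) · 1 ⟶ (r · 1) ×_{Y · 1} (s · 1)`. -/
noncomputable def totOplax {X Y Z : Type v} (s : Y → Z → V) (r : X → Y → V) :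
    tot (matComp s r) ⟶ pullback (totR r) (totL s) :=
  totDesc fun x z => matDesc fun y => el₂ x y z prod.fst prod.snd

theorem el_totOplax {X Y Z : Type v} {s : Y → Z → V} {r : X → Y → V} {A : V} (x : X) (y : Y)
    (z : Z) (a : A ⟶ s y z) (b : A ⟶ r x y) :
    el x z (pair y a b) ≫ totOplax s r = el₂ x y z a b := by
  rw [totOplax, el_desc, pair_matDesc, comp_el₂]
  simp

theorem totι_totL {X Y : Type v} (p : X → Y → V) (x : X) (y : Y) :
    totι p x y ≫ totL p = px _ x := by
  have := el_totL (p := p) x y (𝟙 _)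
  rwa [el, Category.id_comp] at this

theorem totι_totR {X Y : Type v} (p : X → Y → V) (x : X) (y : Y) :
    totι p x y ≫ totR p = px _ y := by
  have := el_totR (p := p) x y (𝟙 _)
  rwa [el, Category.id_comp] at this

theorem totP_w {X Y Z : Type v} (s : Y → Z → V) (r : X → Y → V) (k : X × Y) :
    (pullback.fst (pullback.fst (totR r) (totL s)) (totι r k.1 k.2) ≫ pullback.snd _ _) ≫ totL s =
      terminal.from _ ≫ cop1ι k.2 := by
  rw [Category.assoc, ← pullback.condition, ← Category.assoc, pullback.condition, Category.assoc,
    totι_totR, comp_px]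
  rfl

section

variable [Extensive V]

theorem IsCop.cases {I : Type v} {A : I → V} {B : V} {e : ∀ i, A i ⟶ B} (h : IsCop e) {C Z : V}
    (t : C ⟶ B) {f g : C ⟶ Z} (w : ∀ (i : I) (D : V) (j : D ⟶ C) (a : D ⟶ A i), j ≫ t = a ≫ e i →
      j ≫ f = j ≫ g) : f = g :=
  (h.of_isPullback t fun i => IsPullback.of_hasPullback t (e i)).hom_ext fun i =>
    w i _ _ _ pullback.condition

/-- The coproduct of the `y`-th row of a matrix. -/
noncomputable def row {Y Z : Type v} (s : Y → Z → V) (y : Y) : V := ∐ fun z => s y z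

/-- The injections into a row. -/
noncomputable def rowIn {Y Z : Type v} (s : Y → Z → V) (y : Y) (z : Z) : s y z ⟶ row s y :=
  Sigma.ι (fun z => s y z) z

theorem rowIn_cop {Y Z : Type v} (s : Y → Z → V) (y : Y) : IsCop (rowIn s y) := IsCop.sigma _

/-- The inclusion of a row. -/
noncomputable def rowι {Y Z : Type v} (s : Y → Z → V) (y : Y) : row s y ⟶ tot s :=
  (rowIn_cop s y).desc fun z => totι s y z

theorem rowIn_rowι {Y Z : Type v} (s : Y → Z → V) (y : Y) (z : Z) :
    rowIn s y z ≫ rowι s y = totι s y z := by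
  rw [rowι, IsCop.fac]

theorem rowEl_rowι {Y Z : Type v} {s : Y → Z → V} {y : Y} {A : V} (z : Z) (a : A ⟶ s y z) :
    (a ≫ rowIn s y z) ≫ rowι s y = el y z a := by
  rw [Category.assoc, rowIn_rowι, el]

theorem rowι_cop {Y Z : Type v} (s : Y → Z → V) : IsCop (rowι s) := by
  apply IsCop.of_exists
  · intro f
    refine ⟨totDesc fun y z => rowIn s y z ≫ f y, fun y => (rowIn_cop s y).hom_ext fun z => ?_⟩
    have := el_desc (fun y z => rowIn s y z ≫ f y) y z (𝟙 _)
    rw [el, Category.id_comp, Category.id_comp] at this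
    rw [← Category.assoc, rowIn_rowι, this]
  · intro f g w
    refine tot_ext fun y z A a => ?_
    simp only [← rowEl_rowι, Category.assoc, w]

theorem row_isPullback {Y Z : Type v} (s : Y → Z → V) (y : Y) :
    IsPullback (rowι s y) (terminal.from _) (totL s) (cop1ι y) :=
  (cop1ι_cop Y).isPullback (rowι_cop s) (totL s) (fun _ => terminal.from _) (fun y =>
    (rowIn_cop s y).hom_ext fun z => by
      rw [← Category.assoc, rowIn_rowι, totι_totL]
      exact (comp_px _ _).symm) y

/-- The distributivity morphism used for the inverse of `totOplax`. -/
noncomputable def rowDist {X Y Z : Type v} (s : Y → Z → V) (r : X → Y → V) (x : X) (y : Y) :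
    row s y ⨯ r x y ⟶ tot (matComp s r) :=
  ((rowIn_cop s y).prod_left (r x y)).desc fun z => el x z (pair y prod.fst prod.snd)

theorem lift_rowDist {X Y Z : Type v} (s : Y → Z → V) (r : X → Y → V) (x : X) (y : Y) (z : Z)
    {A : V} (a : A ⟶ s y z) (b : A ⟶ r x y) :
    prod.lift (a ≫ rowIn s y z) b ≫ rowDist s r x y = el x z (pair y a b) := by
  have h := ((rowIn_cop s y).prod_left (r x y)).fac
    (fun z => el (p := matComp s r) x z (pair y prod.fst prod.snd)) z
  have h' : prod.lift (a ≫ rowIn s y z) b =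
      prod.lift a b ≫ prod.map (rowIn s y z) (𝟙 (r x y)) := by
    rw [prod.lift_map, Category.comp_id]
  rw [h', Category.assoc, rowDist, h, comp_el, comp_pair, prod.lift_fst, prod.lift_snd]

theorem totP_cop {X Y Z : Type v} (s : Y → Z → V) (r : X → Y → V) :
    IsCop fun k : X × Y => pullback.fst (pullback.fst (totR r) (totL s)) (totι r k.1 k.2) :=
  (totι_cop r).of_isPullback _ fun k => IsPullback.of_hasPullback _ _

/-- The inverse of `totOplax`. -/
noncomputable def totInv {X Y Z : Type v} (s : Y → Z → V) (r : X → Y → V) :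
    pullback (totR r) (totL s) ⟶ tot (matComp s r) :=
  (totP_cop s r).desc fun k => prod.lift
    ((row_isPullback s k.2).lift _ _ (totP_w s r k)) (pullback.snd _ _) ≫ rowDist s r k.1 k.2

theorem el₂_totInv {X Y Z : Type v} {s : Y → Z → V} {r : X → Y → V} {A : V} (x : X) (y : Y)
    (z : Z) (a : A ⟶ s y z) (b : A ⟶ r x y) :
    el₂ x y z a b ≫ totInv s r = el x z (pair y a b) := by
  have w : el₂ (s := s) x y z a b ≫ pullback.fst _ _ = b ≫ totι r x y := pullback.lift_fst _ _ _
  have h : el₂ x y z a b = pullback.lift (el₂ x y z a b) b w ≫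
      pullback.fst (pullback.fst (totR r) (totL s)) (totι r x y) := by simp
  have h₁ : pullback.lift (el₂ x y z a b) b w ≫
      (row_isPullback s y).lift _ _ (totP_w s r (x, y)) = a ≫ rowIn s y z := by
    apply (row_isPullback s y).hom_ext
    · rw [Category.assoc, IsPullback.lift_fst, ← Category.assoc, ← h, rowEl_rowι, el₂,
        pullback.lift_snd]
    · subsingleton
  rw [h, Category.assoc, totInv]
  refine (congrArg (_ ≫ ·) ((totP_cop s r).fac _ (x, y))).trans ?_
  rw [← Category.assoc, prod.comp_lift, pullback.lift_snd, h₁, lift_rowDist]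

theorem pb_cases {X Y Z : Type v} {s : Y → Z → V} {r : X → Y → V} {A B : V}
    (t : A ⟶ pullback (totR r) (totL s)) {f g : A ⟶ B}
    (h : ∀ (x : X) (y : Y) (z : Z) (C : V) (j : C ⟶ A) (a : C ⟶ s y z) (b : C ⟶ r x y),
      j ≫ t = el₂ x y z a b → j ≫ f = j ≫ g) : f = g := by
  refine (totι_cop r).cases (t ≫ pullback.fst _ _) fun k C j b hj => ?_
  obtain ⟨x, y⟩ := k
  simp only at b hj
  have w : (j ≫ t ≫ pullback.snd _ _) ≫ totL s = terminal.from _ ≫ cop1ι y := by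
    rw [Category.assoc, Category.assoc, ← pullback.condition, ← Category.assoc t, ← Category.assoc,
      hj, Category.assoc, totι_totR, comp_px]
    rfl
  refine (rowIn_cop s y).cases ((row_isPullback s y).lift _ _ w) fun z D k a hk => ?_
  rw [← Category.assoc, ← Category.assoc]
  refine h x y z D (k ≫ j) a (k ≫ b) ?_
  apply pullback.hom_ext
  · rw [el₂, pullback.lift_fst, Category.assoc, Category.assoc, hj, el, Category.assoc]
  · have := congrArg (· ≫ rowι s y) hk
    simp only [Category.assoc, IsPullback.lift_fst, rowIn_rowι] at this
    rw [el₂, pullback.lift_snd, Category.assoc, Category.assoc, this, el]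

theorem pb_ext {X Y Z : Type v} {s : Y → Z → V} {r : X → Y → V} {B : V}
    {f g : pullback (totR r) (totL s) ⟶ B}
    (h : ∀ (x : X) (y : Y) (z : Z) (A : V) (a : A ⟶ s y z) (b : A ⟶ r x y),
      el₂ x y z a b ≫ f = el₂ x y z a b ≫ g) : f = g :=
  pb_cases (𝟙 _) fun x y z C j a b hj => by
    rw [Category.comp_id] at hj
    rw [hj, h]

/-- The comparison `(r · 1) ×_{Y · 1} (s · 1) ⟶ (s · r) · 1`, inverse to the canonical one. -/
noncomputable def totComp {X Y Z : Type v} (s : Y → Z → V) (r : X → Y → V) :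
    SpanCell ((totSpan s).comp (totSpan r)) (totSpan (matComp s r)) where
  left := 𝟙 _
  right := 𝟙 _
  mid := totInv s r
  wl := pb_ext fun x y z A a b => by
    rw [← Category.assoc, el₂_totInv, el_totL, Category.comp_id, el₂, pullback.lift_fst_assoc,
      el_totL]
  wr := pb_ext fun x y z A a b => by
    rw [← Category.assoc, el₂_totInv, el_totR, Category.comp_id, el₂, pullback.lift_snd_assoc,
      el_totR]

theorem totOplax_totInv {X Y Z : Type v} (s : Y → Z → V) (r : X → Y → V) :
    totOplax s r ≫ totInv s r = 𝟙 _ :=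
  tot_ext fun x z A c => mat_cases c fun y C j a b hj => by
    rw [← Category.assoc (el x z c), ← Category.assoc, ← Category.assoc j, ← Category.assoc j,
      comp_el, hj, el_totOplax, el₂_totInv, Category.comp_id]

theorem totInv_totOplax {X Y Z : Type v} (s : Y → Z → V) (r : X → Y → V) :
    totInv s r ≫ totOplax s r = 𝟙 _ :=
  pb_ext fun x y z A a b => by
    rw [← Category.assoc, el₂_totInv, el_totOplax, Category.comp_id]

end

end Copower

section PullbackExt

variable {V : Type u} [Category.{v} V] [HasPullbacks V]

theorem pbl_ext {a b c : V} {f : a ⟶ b} {g h : pullback f (𝟙 b) ⟶ c}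
    (w : pullback.lift (𝟙 a) f (by simp) ≫ g = pullback.lift (𝟙 a) f (by simp) ≫ h) : g = h := by
  have e : pullback.fst f (𝟙 b) ≫ pullback.lift (𝟙 a) f (by simp) = 𝟙 _ := by
    apply pullback.hom_ext <;> simp [pullback.condition]
  rw [← Category.id_comp g, ← Category.id_comp h, ← e, Category.assoc, Category.assoc, w]

theorem pbr_ext {a b c : V} {f : a ⟶ b} {g h : pullback (𝟙 b) f ⟶ c}
    (w : pullback.lift f (𝟙 a) (by simp) ≫ g = pullback.lift f (𝟙 a) (by simp) ≫ h) : g = h := by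
  have e : pullback.snd (𝟙 b) f ≫ pullback.lift f (𝟙 a) (by simp) = 𝟙 _ := by
    apply pullback.hom_ext <;> simp [← pullback.condition]
  rw [← Category.id_comp g, ← Category.id_comp h, ← e, Category.assoc, Category.assoc, w]

end PullbackExt

section CopowerFunctor

variable {V : Type u} [Category.{v} V] [HasFiniteLimits V] [HasCoproducts.{v} V]

theorem cop1Map_id (X : Type v) : cop1Map V (fun x : X => x) = 𝟙 _ :=
  px_ext fun x A => by rw [px_map, Category.comp_id]

theorem cop1Map_comp {X Y Z : Type v} (f : X → Y) (g : Y → Z) :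
    cop1Map V (fun x => g (f x)) = cop1Map V f ≫ cop1Map V g :=
  px_ext fun x A => by rw [px_map, ← Category.assoc, px_map, px_map]

theorem totCell_id {X Y : Type v} (p : X → Y → V) :
    totCell (MatCell.id p) = SpanCell.id (totSpan p) :=
  SpanCell.ext (cop1Map_id _) (cop1Map_id _) (tot_ext fun x y A a => by
    rw [el_totCell, Category.comp_id, Category.comp_id])

theorem totCell_comp {X Y X' Y' X'' Y'' : Type v} {r : X → Y → V} {s : X' → Y' → V}
    {t : X'' → Y'' → V} (α : MatCell r s) (β : MatCell s t) :
    totCell (α.comp β) = (totCell α).comp (totCell β) :=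
  SpanCell.ext (cop1Map_comp α.left β.left) (cop1Map_comp α.right β.right) (tot_ext fun x y A a => by
    rw [el_totCell, ← Category.assoc (el x y a), el_totCell, el_totCell, Category.assoc])

theorem totUnit_nat {X Y : Type v} (f : X → Y) :
    (SpanCell.one (cop1Map V f)).comp (totUnit V Y) =
      (totUnit V X).comp (totCell ⟨f, f, oneθ f⟩) :=
  SpanCell.ext ((Category.comp_id _).trans (Category.id_comp _).symm)
    ((Category.comp_id _).trans (Category.id_comp _).symm) (px_ext fun x A => by
      rw [← Category.assoc, ← Category.assoc, px_map, px_totUnit, px_totUnit, el_totCell, pt_oneθ])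

variable [Extensive V]

theorem totComp_nat {X Y Z X' Y' Z' : Type v} {s : Y → Z → V} {r : X → Y → V} {s' : Y' → Z' → V}
    {r' : X' → Y' → V} (β : MatCell s s') (α : MatCell r r') (h : α.right = β.left) (h') :
    ((totCell β).hcomp (totCell α) h').comp (totComp s' r') =
      (totComp s r).comp (totCell (β.hcomp α h)) := by
  obtain ⟨f, g, α⟩ := α
  obtain ⟨g₁, k, β⟩ := β
  obtain rfl : g = g₁ := h
  refine SpanCell.ext ((Category.comp_id _).trans (Category.id_comp _).symm)
    ((Category.comp_id _).trans (Category.id_comp _).symm) (pb_ext fun x y z A a b => ?_)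
  have h₁ : ∀ w, el₂ x y z a b ≫
      pullback.lift (pullback.fst _ _ ≫ (totCell ⟨f, g, α⟩).mid)
        (pullback.snd _ _ ≫ (totCell ⟨g, k, β⟩).mid) w =
      el₂ (f x) (g y) (k z) (a ≫ β y z) (b ≫ α x y) := by
    intro w
    apply pullback.hom_ext
    · rw [Category.assoc, pullback.lift_fst, el₂, pullback.lift_fst_assoc, el_totCell, el₂,
        pullback.lift_fst]
    · rw [Category.assoc, pullback.lift_snd, el₂, pullback.lift_snd_assoc, el_totCell, el₂,
        pullback.lift_snd]
  rw [MatCell.hcomp_mk]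
  refine (Category.assoc _ _ _).symm.trans ((congrArg (· ≫ _) (h₁ _)).trans ?_)
  refine (el₂_totInv _ _ _ _ _).trans (Eq.trans ?_ (Category.assoc _ _ _))
  refine Eq.trans ?_ (congrArg (· ≫ _) (el₂_totInv _ _ _ _ _)).symm
  rw [el_totCell, pair_hcθ]

theorem tot_left_unit {X Y : Type v} (r : X → Y → V) (h) :
    ((totUnit V Y).hcomp (SpanCell.id (totSpan r)) h).comp
      ((totComp (matOne V Y) r).comp (totCell ⟨fun x => x, fun y => y, lamθ r⟩)) =
      SpanCell.lam (totSpan r) := by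
  refine SpanCell.ext ?_ ?_ (pbl_ext (tot_ext fun x y A a => ?_))
  · exact (Category.id_comp _).trans ((Category.id_comp _).trans (cop1Map_id _))
  · exact (Category.id_comp _).trans ((Category.id_comp _).trans (cop1Map_id _))
  have h₁ : ∀ w w', (el x y a ≫ pullback.lift (f := totR r) (g := 𝟙 _) (𝟙 _) (totR r) w) ≫
      pullback.lift (f := totR r) (g := totL (matOne V Y)) (pullback.fst _ _ ≫ 𝟙 _)
        (pullback.snd _ _ ≫ (totUnit V Y).mid) w' =
      el₂ x y y (pt A rfl) a := by
    intro w w'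
    apply pullback.hom_ext
    · simp [el₂]
    · simp only [Category.assoc, pullback.lift_snd, pullback.lift_snd_assoc, el₂]
      rw [← Category.assoc, el_totR, px_totUnit]
  refine (Category.assoc _ _ _).symm.trans ((Category.assoc _ _ _).symm.trans
    ((congrArg (· ≫ _) (h₁ _ _)).trans ?_))
  refine (Category.assoc _ _ _).symm.trans ((congrArg (· ≫ _) (el₂_totInv _ _ _ _ _)).trans ?_)
  rw [el_totCell, pair_lamθ]
  simp

theorem tot_right_unit {X Y : Type v} (r : X → Y → V) (h) :
    ((SpanCell.id (totSpan r)).hcomp (totUnit V X) h).comp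
      ((totComp r (matOne V X)).comp (totCell ⟨fun x => x, fun y => y, rhoθ r⟩)) =
      SpanCell.rho (totSpan r) := by
  refine SpanCell.ext ?_ ?_ (pbr_ext (tot_ext fun x y A a => ?_))
  · exact (Category.id_comp _).trans ((Category.id_comp _).trans (cop1Map_id _))
  · exact (Category.id_comp _).trans ((Category.id_comp _).trans (cop1Map_id _))
  have h₁ : ∀ w w', (el x y a ≫ pullback.lift (f := 𝟙 _) (g := totL r) (totL r) (𝟙 _) w) ≫
      pullback.lift (f := totR (matOne V X)) (g := totL r)
        (pullback.fst _ _ ≫ (totUnit V X).mid) (pullback.snd _ _ ≫ 𝟙 _) w' =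
      el₂ x x y a (pt A rfl) := by
    intro w w'
    apply pullback.hom_ext
    · simp only [Category.assoc, pullback.lift_fst, pullback.lift_fst_assoc, el₂]
      rw [← Category.assoc, el_totL, px_totUnit]
    · simp [el₂]
  refine (Category.assoc _ _ _).symm.trans ((Category.assoc _ _ _).symm.trans
    ((congrArg (· ≫ _) (h₁ _ _)).trans ?_))
  refine (Category.assoc _ _ _).symm.trans ((congrArg (· ≫ _) (el₂_totInv _ _ _ _ _)).trans ?_)
  rw [el_totCell, pair_rhoθ]
  simp

/-- The generalised element of a triple composite given by elements of the three entries. -/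
noncomputable def el₃ {X Y Z W : Type v} {t : Z → W → V} {s : Y → Z → V} {r : X → Y → V} {A : V}
    (x : X) (y : Y) (z : Z) (w : W) (a : A ⟶ t z w) (b : A ⟶ s y z) (c : A ⟶ r x y) :
    A ⟶ pullback (totR r) (pullback.fst (totR s) (totL t) ≫ totL s) :=
  pullback.lift (el x y c) (el₂ y z w a b) (by
    rw [el_totR, el₂, pullback.lift_fst_assoc, el_totL])

theorem assoc_ext {X Y Z W : Type v} {t : Z → W → V} {s : Y → Z → V} {r : X → Y → V} {B : V}
    {f g : pullback (totR r) (pullback.fst (totR s) (totL t) ≫ totL s) ⟶ B}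
    (h : ∀ (x : X) (y : Y) (z : Z) (w : W) (A : V) (a : A ⟶ t z w) (b : A ⟶ s y z) (c : A ⟶ r x y),
      el₃ x y z w a b c ≫ f = el₃ x y z w a b c ≫ g) : f = g := by
  have h₁ : totOplax t s ≫ pullback.fst (totR s) (totL t) ≫ totL s = totL (matComp t s) := by
    have : totInv t s ≫ totL (matComp t s) = pullback.fst (totR s) (totL t) ≫ totL s :=
      (totComp t s).wl.trans (Category.comp_id _)
    rw [← this, ← Category.assoc, totOplax_totInv, Category.id_comp]
  have h₂ : totInv t s ≫ totL (matComp t s) = pullback.fst (totR s) (totL t) ≫ totL s := by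
    rw [← h₁, ← Category.assoc, totInv_totOplax, Category.id_comp]
  let k : pullback (totR r) (totL (matComp t s)) ⟶
      pullback (totR r) (pullback.fst (totR s) (totL t) ≫ totL s) :=
    pullback.lift (pullback.fst _ _) (pullback.snd _ _ ≫ totOplax t s) (by
      rw [Category.assoc, h₁, pullback.condition])
  let k' : pullback (totR r) (pullback.fst (totR s) (totL t) ≫ totL s) ⟶
      pullback (totR r) (totL (matComp t s)) :=
    pullback.lift (pullback.fst _ _) (pullback.snd _ _ ≫ totInv t s) (by
      rw [Category.assoc, h₂, pullback.condition])
  have e : k' ≫ k = 𝟙 _ := by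
    apply pullback.hom_ext
    · simp [k, k']
    · simp [k, k', totInv_totOplax]
  suffices hs : k ≫ f = k ≫ g by
    rw [← Category.id_comp f, ← Category.id_comp g, ← e, Category.assoc, Category.assoc, hs]
  refine pb_ext fun x y w A p c => mat_cases p fun z C j a b hj => ?_
  have h₃ : j ≫ el₂ x y w p c ≫ k = el₃ x y z w a b (j ≫ c) := by
    rw [← Category.assoc, comp_el₂, hj]
    apply pullback.hom_ext
    · simp [k, el₃, el₂]
    · simp [k, el₃, el₂, el_totOplax]
  rw [← Category.assoc (el₂ x y w p c), ← Category.assoc j, h₃, h,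
    ← Category.assoc (el₂ x y w p c), ← Category.assoc j, h₃]

theorem tot_assoc {X Y Z W : Type v} (t : Z → W → V) (s : Y → Z → V) (r : X → Y → V) (h h') :
    ((totComp t s).hcomp (SpanCell.id (totSpan r)) h).comp
      ((totComp (matComp t s) r).comp (totCell ⟨fun x => x, fun y => y, assocθ t s r⟩)) =
    (SpanCell.assoc (totSpan t) (totSpan s) (totSpan r)).comp
      (((SpanCell.id (totSpan t)).hcomp (totComp s r) h').comp (totComp t (matComp s r))) := by
  refine SpanCell.ext ?_ ?_ (assoc_ext fun x y z w A a b c => ?_)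
  · exact congrArg (_ ≫ _ ≫ ·) (cop1Map_id _)
  · exact congrArg (_ ≫ _ ≫ ·) (cop1Map_id _)
  have h₁ : ∀ w₁, el₃ x y z w a b c ≫ pullback.lift (f := totR r) (g := totL (matComp t s))
      (pullback.fst _ _ ≫ 𝟙 _) (pullback.snd _ _ ≫ totInv t s) w₁ =
      el₂ x y w (pair z a b) c := by
    intro w₁
    apply pullback.hom_ext
    · simp [el₂, el₃]
    · rw [Category.assoc, pullback.lift_snd, el₃, pullback.lift_snd_assoc, el₂_totInv, el₂,
        pullback.lift_snd]
  have h₂ : el₃ x y z w a b c ≫ (SpanCell.assoc (totSpan t) (totSpan s) (totSpan r)).mid =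
      pullback.lift (f := pullback.snd (totR r) (totL s) ≫ totR s) (g := totL t)
        (el₂ x y z b c) (el z w a) (by
          rw [el₂, pullback.lift_snd_assoc, el_totR, el_totL]) := by
    apply pullback.hom_ext
    · rw [Category.assoc, pullback.lift_fst, pullback.lift_fst]
      apply pullback.hom_ext
      · simp [el₂, el₃]
      · simp [el₂, el₃]
    · simp [el₂, el₃]
  have h₃ : ∀ w₁ w₂, pullback.lift (f := pullback.snd (totR r) (totL s) ≫ totR s) (g := totL t)
        (el₂ x y z b c) (el z w a) w₁ ≫ pullback.lift (f := totR (matComp s r)) (g := totL t)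
        (pullback.fst _ _ ≫ totInv s r) (pullback.snd _ _ ≫ 𝟙 _) w₂ =
      el₂ x z w a (pair y b c) := by
    intro w₁ w₂
    apply pullback.hom_ext
    · rw [Category.assoc, pullback.lift_fst, pullback.lift_fst_assoc, el₂_totInv, el₂,
        pullback.lift_fst]
    · simp [el₂]
  refine (Category.assoc _ _ _).symm.trans ((congrArg (· ≫ _) (h₁ _)).trans ?_)
  refine (Category.assoc _ _ _).symm.trans ((congrArg (· ≫ _) (el₂_totInv _ _ _ _ _)).trans ?_)
  refine Eq.trans ?_ ((congrArg (· ≫ _) h₂).symm.trans (Category.assoc _ _ _))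
  refine Eq.trans ?_ ((congrArg (· ≫ _) (h₃ _ _)).symm.trans (Category.assoc _ _ _))
  rw [el_totCell, pair_assocθ]
  exact (el₂_totInv _ _ _ _ _).symm

/-- The lax functor `- · 1` from `V`-matrices to spans in `V`. -/
noncomputable def copowerFunctor (V : Type u) [Category.{v} V] [HasFiniteLimits V]
    [HasCoproducts.{v} V] [Extensive V] : LaxFunctor (MatObj V) V where
  base :=
    { obj := fun X => cop1 V X.carrier
      map := fun f => cop1Map V f
      map_id := fun X => cop1Map_id _
      map_comp := fun f g => cop1Map_comp f g }
  hor p := totSpan p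
  cell θ := totCell θ
  dom_cell _ := rfl
  cod_cell _ := rfl
  cell_cid p := totCell_id p
  cell_vcomp θ ξ := totCell_comp θ ξ
  unitC X := totUnit V X.carrier
  dom_unitC _ := rfl
  cod_unitC _ := rfl
  unitC_nat f := totUnit_nat f
  compC s r := totComp s r
  dom_compC _ _ := rfl
  cod_compC _ _ := rfl
  compC_nat β α h := totComp_nat β α h _
  left_unit r := tot_left_unit r _
  right_unit r := tot_right_unit r _
  assoc_comp p s r := tot_assoc p s r _ _

end CopowerFunctor

section PointsFunctor

variable {V : Type u} [Category.{v} V] [HasFiniteLimits V]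

/-- The fibre of a span `p` from `a` to `b` at points `x` of `a` and `y` of `b`, that is, the entry
`V(1, p)(x, y)`. -/
noncomputable def fib {a b : V} (p : Span a b) (x : ⊤_ V ⟶ a) (y : ⊤_ V ⟶ b) : V :=
  pullback (prod.lift p.l p.r) (prod.lift x y)

/-- The inclusion of a fibre into the apex. -/
noncomputable def fibι {a b : V} (p : Span a b) (x : ⊤_ V ⟶ a) (y : ⊤_ V ⟶ b) :
    fib p x y ⟶ p.apex :=
  pullback.fst _ _

theorem fibι_l {a b : V} (p : Span a b) (x : ⊤_ V ⟶ a) (y : ⊤_ V ⟶ b) :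
    fibι p x y ≫ p.l = terminal.from _ ≫ x := by
  have h := congrArg (· ≫ prod.fst) (pullback.condition (f := prod.lift p.l p.r)
    (g := prod.lift x y))
  simp only [Category.assoc, prod.lift_fst] at h
  exact h.trans (congrArg (· ≫ x) (by subsingleton))

theorem fibι_r {a b : V} (p : Span a b) (x : ⊤_ V ⟶ a) (y : ⊤_ V ⟶ b) :
    fibι p x y ≫ p.r = terminal.from _ ≫ y := by
  have h := congrArg (· ≫ prod.snd) (pullback.condition (f := prod.lift p.l p.r)
    (g := prod.lift x y))
  simp only [Category.assoc, prod.lift_snd] at h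
  exact h.trans (congrArg (· ≫ y) (by subsingleton))

theorem fib_ext {a b : V} {p : Span a b} {x : ⊤_ V ⟶ a} {y : ⊤_ V ⟶ b} {A : V}
    {f g : A ⟶ fib p x y} (h : f ≫ fibι p x y = g ≫ fibι p x y) : f = g :=
  pullback.hom_ext h (by subsingleton)

/-- Morphisms into a fibre. -/
noncomputable def fibLift {a b : V} {p : Span a b} {x : ⊤_ V ⟶ a} {y : ⊤_ V ⟶ b} {A : V}
    (h : A ⟶ p.apex) (hl : h ≫ p.l = terminal.from _ ≫ x) (hr : h ≫ p.r = terminal.from _ ≫ y) :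
    A ⟶ fib p x y :=
  pullback.lift h (terminal.from _) (by
    rw [prod.comp_lift, prod.comp_lift, hl, hr])

theorem fibLift_ι {a b : V} {p : Span a b} {x : ⊤_ V ⟶ a} {y : ⊤_ V ⟶ b} {A : V}
    (h : A ⟶ p.apex) (hl : h ≫ p.l = terminal.from _ ≫ x) (hr : h ≫ p.r = terminal.from _ ≫ y) :
    fibLift h hl hr ≫ fibι p x y = h :=
  pullback.lift_fst _ _ _

theorem fib_w {a b c : V} {s : Span b c} {r : Span a b} {x : ⊤_ V ⟶ a}
    {y : ⊤_ V ⟶ b} {z : ⊤_ V ⟶ c} {A : V} (g : A ⟶ fib s y z) (h : A ⟶ fib r x y) :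
    (h ≫ fibι r x y) ≫ r.r = (g ≫ fibι s y z) ≫ s.l := by
  rw [Category.assoc, Category.assoc, fibι_l, fibι_r, ← Category.assoc, ← Category.assoc]
  exact congrArg (· ≫ y) (by subsingleton)

variable [HasCoproducts.{v} V]

theorem MatCell.ext_fib {X Y : Type v} {r : X → Y → V} {a b : V} {p : Span a b}
    {α β : MatCell r (fib p)} (h₁ : α.left = β.left) (h₂ : α.right = β.right)
    (h₃ : ∀ x y, α.θ x y ≫ fibι p _ _ = β.θ x y ≫ fibι p _ _) : α = β := by
  obtain ⟨f, g, α⟩ := α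
  obtain ⟨f', g', β⟩ := β
  obtain rfl : f = f' := h₁
  obtain rfl : g = g' := h₂
  exact MatCell.mk_congr fun x y => fib_ext (h₃ x y)

/-- The components of `V(1, θ)`. -/
noncomputable def fibMap {a b c d : V} {p : Span a b} {q : Span c d} (θ : SpanCell p q)
    (x : ⊤_ V ⟶ a) (y : ⊤_ V ⟶ b) : fib p x y ⟶ fib q (x ≫ θ.left) (y ≫ θ.right) :=
  fibLift (fibι p x y ≫ θ.mid)
    (by rw [Category.assoc, θ.wl, ← Category.assoc, fibι_l, Category.assoc])
    (by rw [Category.assoc, θ.wr, ← Category.assoc, fibι_r, Category.assoc])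

theorem fibMap_ι {a b c d : V} {p : Span a b} {q : Span c d} (θ : SpanCell p q)
    (x : ⊤_ V ⟶ a) (y : ⊤_ V ⟶ b) :
    fibMap θ x y ≫ fibι q (x ≫ θ.left) (y ≫ θ.right) = fibι p x y ≫ θ.mid :=
  fibLift_ι _ _ _

/-- The 2-cell `V(1, θ)`. -/
noncomputable abbrev fibCell {a b c d : V} {p : Span a b} {q : Span c d} (θ : SpanCell p q) :
    MatCell (fib p) (fib q) :=
  ⟨fun x => x ≫ θ.left, fun y => y ≫ θ.right, fibMap θ⟩

theorem fibCell_id {a b : V} (p : Span a b) : fibCell (SpanCell.id p) = MatCell.id (fib p) :=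
  MatCell.ext_fib (funext fun _ => Category.comp_id _) (funext fun _ => Category.comp_id _)
    fun x y => (fibMap_ι _ _ _).trans ((Category.comp_id _).trans (Category.id_comp _).symm)

theorem fibCell_comp {a b c d a' b' : V} {p : Span a b} {q : Span c d} {r : Span a' b'}
    (θ : SpanCell p q) (ξ : SpanCell q r) :
    fibCell (θ.comp ξ) = (fibCell θ).comp (fibCell ξ) :=
  MatCell.ext_fib (funext fun _ => (Category.assoc _ _ _).symm)
    (funext fun _ => (Category.assoc _ _ _).symm) fun x y => by
      refine (fibMap_ι _ _ _).trans ?_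
      change _ = (fibMap θ x y ≫ fibMap ξ _ _) ≫ fibι r _ _
      rw [Category.assoc, fibMap_ι, ← Category.assoc, ← Category.assoc, fibMap_ι]

/-- The components of the comparison `1 ⟶ V(1, 1)`. -/
noncomputable def fibUnitθ (a : V) (x x' : ⊤_ V ⟶ a) :
    matOne V (⊤_ V ⟶ a) x x' ⟶ fib (Span.one a) x x' :=
  oneDesc fun h => fibLift (p := Span.one a) x
    (by rw [Category.comp_id]; exact ((congrArg (· ≫ x) (by subsingleton)).trans
      (Category.id_comp x)).symm)
    (by rw [Category.comp_id, ← h]; exact ((congrArg (· ≫ x) (by subsingleton)).trans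
      (Category.id_comp x)).symm)

theorem pt_fibUnitθ (a : V) {x x' : ⊤_ V ⟶ a} (h : x = x') (A : V) :
    pt A h ≫ fibUnitθ a x x' ≫ fibι (Span.one a) x x' = terminal.from A ≫ x := by
  rw [fibUnitθ, pt_oneDesc_assoc, fibLift_ι]

/-- The comparison `1 ⟶ V(1, 1)`. -/
noncomputable abbrev fibUnit (a : V) : MatCell (matOne V (⊤_ V ⟶ a)) (fib (Span.one a)) :=
  ⟨fun x => x, fun x => x, fibUnitθ a⟩

theorem fibUnit_nat {a b : V} (f : a ⟶ b) :
    (MatCell.mk (fun x => x ≫ f) (fun x => x ≫ f) (oneθ fun x => x ≫ f)).comp (fibUnit b) =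
      (fibUnit a).comp (fibCell (SpanCell.one f)) :=
  MatCell.ext_fib rfl rfl fun x y => one_ext fun h A => by
    subst h
    change pt A rfl ≫ (oneθ (fun x => x ≫ f) x x ≫ fibUnitθ b (x ≫ f) (x ≫ f)) ≫ fibι _ _ _ =
      pt A rfl ≫ (fibUnitθ a x x ≫ fibMap (SpanCell.one f) x x) ≫ fibι _ (x ≫ f) (x ≫ f)
    rw [Category.assoc, pt_oneθ_assoc, pt_fibUnitθ, Category.assoc]
    refine Eq.trans ?_ (congrArg (fun t => pt A rfl ≫ fibUnitθ a x x ≫ t)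
      (fibMap_ι (SpanCell.one f) x x)).symm
    rw [← Category.assoc (fibUnitθ a x x), ← Category.assoc (pt A rfl), pt_fibUnitθ, Category.assoc]

/-- The components of the comparison `V(1, s) · V(1, r) ⟶ V(1, s · r)`. -/
noncomputable def fibCompθ {a b c : V} (s : Span b c) (r : Span a b) (x : ⊤_ V ⟶ a)
    (z : ⊤_ V ⟶ c) : matComp (fib s) (fib r) x z ⟶ fib (s.comp r) x z :=
  matDesc fun y => fibLift (p := s.comp r)
    (pullback.lift (prod.snd ≫ fibι r x y) (prod.fst ≫ fibι s y z) (by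
      rw [Category.assoc, Category.assoc, fibι_l, fibι_r, ← Category.assoc, ← Category.assoc]
      exact congrArg (· ≫ y) (by subsingleton)))
    (by
      rw [pullback.lift_fst_assoc, Category.assoc, fibι_l, ← Category.assoc]
      exact congrArg (· ≫ x) (by subsingleton))
    (by
      rw [pullback.lift_snd_assoc, Category.assoc, fibι_r, ← Category.assoc]
      exact congrArg (· ≫ z) (by subsingleton))

theorem pair_fibCompθ {a b c : V} (s : Span b c) (r : Span a b) (x : ⊤_ V ⟶ a)
    (y : ⊤_ V ⟶ b) (z : ⊤_ V ⟶ c) {A : V} (g : A ⟶ fib s y z) (h : A ⟶ fib r x y) :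
    pair y g h ≫ fibCompθ s r x z ≫ fibι (s.comp r) x z =
      pullback.lift (h ≫ fibι r x y) (g ≫ fibι s y z) (fib_w g h) := by
  rw [fibCompθ, pair_matDesc_assoc, fibLift_ι]
  apply pullback.hom_ext
  · simp
  · simp

/-- The comparison `V(1, s) · V(1, r) ⟶ V(1, s · r)`. -/
noncomputable abbrev fibComp {a b c : V} (s : Span b c) (r : Span a b) :
    MatCell (matComp (fib s) (fib r)) (fib (s.comp r)) :=
  ⟨fun x => x, fun z => z, fibCompθ s r⟩

theorem fibComp_nat {a b c a' b' c' : V} {s : Span b c} {r : Span a b} {s' : Span b' c'}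
    {r' : Span a' b'} (β : SpanCell s s') (α : SpanCell r r') (h : α.right = β.left) (h') :
    ((fibCell β).hcomp (fibCell α) h').comp (fibComp s' r') =
      (fibComp s r).comp (fibCell (β.hcomp α h)) := by
  obtain ⟨f, g, m, wl, wr⟩ := α
  obtain ⟨g', k, n, wl', wr'⟩ := β
  obtain rfl : g = g' := h
  refine (congrArg (fun t => MatCell.comp t _) (MatCell.hcomp_mk _ _ _ _ _ rfl)).trans ?_
  refine MatCell.ext_fib rfl rfl fun x z => mat_ext fun y A u v => ?_
  refine (congrArg (pair y u v ≫ ·) (Category.assoc _ _ _)).trans ?_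
  refine (pair_hcθ_assoc _ _ _ _ _ _ _ _).trans ((pair_fibCompθ _ _ _ _ _ _ _).trans ?_)
  refine Eq.trans ?_ (congrArg (pair y u v ≫ ·) (((congrArg (fibCompθ s r x z ≫ ·)
    (fibMap_ι (SpanCell.hcomp _ _ rfl) x z)).symm).trans (Category.assoc _ _ _).symm))
  refine Eq.trans ?_ (congrArg (pair y u v ≫ ·) (Category.assoc _ _ _))
  refine Eq.trans ?_ (Category.assoc _ _ _)
  refine Eq.trans ?_ (congrArg (· ≫ _) (pair_fibCompθ s r x y z u v).symm)
  apply pullback.hom_ext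
  · simp only [pullback.lift_fst, pullback.lift_fst_assoc, Category.assoc]
    exact congrArg (v ≫ ·) (fibMap_ι _ _ _)
  · simp only [pullback.lift_snd, pullback.lift_snd_assoc, Category.assoc]
    exact congrArg (u ≫ ·) (fibMap_ι _ _ _)

theorem comp_fibMap {a b c d : V} {p : Span a b} {q : Span c d} (θ : SpanCell p q)
    (x : ⊤_ V ⟶ a) (y : ⊤_ V ⟶ b) {A : V} (k : A ⟶ fib p x y) :
    (k ≫ fibMap θ x y) ≫ fibι q (x ≫ θ.left) (y ≫ θ.right) = (k ≫ fibι p x y) ≫ θ.mid := by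
  rw [Category.assoc, fibMap_ι, Category.assoc]

theorem comp_fibCompθ {a b c : V} (s : Span b c) (r : Span a b) (x : ⊤_ V ⟶ a)
    (y : ⊤_ V ⟶ b) (z : ⊤_ V ⟶ c) {A : V} (g : A ⟶ fib s y z) (h : A ⟶ fib r x y) :
    (pair y g h ≫ fibCompθ s r x z) ≫ fibι (s.comp r) x z =
      pullback.lift (h ≫ fibι r x y) (g ≫ fibι s y z) (fib_w g h) := by
  rw [Category.assoc, pair_fibCompθ]

variable [Extensive V]

theorem fib_left_unit {a b : V} (r : Span a b) (h) :
    ((fibUnit b).hcomp (MatCell.id (fib r)) h).comp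
      ((fibComp (Span.one b) r).comp (fibCell (SpanCell.lam r))) =
      ⟨fun x => x, fun y => y, lamθ (fib r)⟩ := by
  refine (congrArg (fun t => MatCell.comp t _) (MatCell.hcomp_mk _ _ _ _ _ rfl)).trans ?_
  refine MatCell.ext_fib (funext fun _ => Category.comp_id _) (funext fun _ => Category.comp_id _)
    fun x y => lam_ext fun A k => ?_
  change pair y (pt A rfl) k ≫ (hcθ (f := fun x => x) (g := fun x => x) (k := fun x => x)
      (fibUnitθ b) (fun _ _ => 𝟙 _) x y ≫ fibCompθ (Span.one b) r x y ≫
      fibMap (SpanCell.lam r) x y) ≫ fibι r (x ≫ 𝟙 a) (y ≫ 𝟙 b) =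
    pair y (pt A rfl) k ≫ lamθ (fib r) x y ≫ fibι r x y
  rw [Category.assoc, pair_hcθ_assoc, pair_lamθ_assoc, ← Category.assoc, ← Category.assoc]
  refine (comp_fibMap (SpanCell.lam r) x y _).trans ?_
  refine (congrArg (· ≫ _) (comp_fibCompθ _ _ _ _ _ _ _)).trans ?_
  simp

theorem fib_right_unit {a b : V} (r : Span a b) (h) :
    ((MatCell.id (fib r)).hcomp (fibUnit a) h).comp
      ((fibComp r (Span.one a)).comp (fibCell (SpanCell.rho r))) =
      ⟨fun x => x, fun y => y, rhoθ (fib r)⟩ := by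
  refine (congrArg (fun t => MatCell.comp t _) (MatCell.hcomp_mk _ _ _ _ _ rfl)).trans ?_
  refine MatCell.ext_fib (funext fun _ => Category.comp_id _) (funext fun _ => Category.comp_id _)
    fun x y => rho_ext fun A k => ?_
  change pair x k (pt A rfl) ≫ (hcθ (f := fun x => x) (g := fun x => x) (k := fun x => x)
      (fun _ _ => 𝟙 _) (fibUnitθ a) x y ≫ fibCompθ r (Span.one a) x y ≫
      fibMap (SpanCell.rho r) x y) ≫ fibι r (x ≫ 𝟙 a) (y ≫ 𝟙 b) =
    pair x k (pt A rfl) ≫ rhoθ (fib r) x y ≫ fibι r x y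
  rw [Category.assoc, pair_hcθ_assoc, pair_rhoθ_assoc, ← Category.assoc, ← Category.assoc]
  refine (comp_fibMap (SpanCell.rho r) x y _).trans ?_
  refine (congrArg (· ≫ _) (comp_fibCompθ _ _ _ _ _ _ _)).trans ?_
  simp

theorem fib_assoc {a b c d : V} (t : Span c d) (s : Span b c) (r : Span a b) (h h') :
    ((fibComp t s).hcomp (MatCell.id (fib r)) h).comp
      ((fibComp (t.comp s) r).comp (fibCell (SpanCell.assoc t s r))) =
    (MatCell.mk (fun x => x) (fun y => y) (assocθ (fib t) (fib s) (fib r))).comp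
      (((MatCell.id (fib t)).hcomp (fibComp s r) h').comp (fibComp t (s.comp r))) := by
  refine (congrArg (fun t => MatCell.comp t _) (MatCell.hcomp_mk _ _ _ _ _ rfl)).trans ?_
  refine Eq.trans ?_ (congrArg (fun t => MatCell.comp _ (MatCell.comp t _))
    (MatCell.hcomp_mk _ _ _ _ _ rfl)).symm
  refine MatCell.ext_fib (funext fun _ => Category.comp_id _) (funext fun _ => Category.comp_id _)
    fun x w => left_ext fun y z A k l m => ?_
  change pair y (pair z k l) m ≫ (hcθ (f := fun x => x) (g := fun x => x) (k := fun x => x)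
      (fibCompθ t s) (fun _ _ => 𝟙 _) x w ≫ fibCompθ (t.comp s) r x w ≫
      fibMap (SpanCell.assoc t s r) x w) ≫ fibι (t.comp (s.comp r)) (x ≫ 𝟙 a) (w ≫ 𝟙 d) =
    pair y (pair z k l) m ≫ (assocθ (fib t) (fib s) (fib r) x w ≫
      hcθ (f := fun x => x) (g := fun x => x) (k := fun x => x) (fun _ _ => 𝟙 _) (fibCompθ s r) x w
        ≫ fibCompθ t (s.comp r) x w) ≫ fibι (t.comp (s.comp r)) x w
  simp only [Category.assoc]
  rw [pair_hcθ_assoc, pair_assocθ_assoc, pair_hcθ_assoc, ← Category.assoc, ← Category.assoc]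
  refine (comp_fibMap (SpanCell.assoc t s r) x w _).trans ?_
  refine (congrArg (· ≫ _) (comp_fibCompθ _ _ _ _ _ _ _)).trans ?_
  refine Eq.trans ?_ ((Category.assoc _ _ _).symm.trans (comp_fibCompθ _ _ _ _ _ _ _)).symm
  have h₁ := comp_fibCompθ t s y z w k l
  have h₂ := comp_fibCompθ s r x y z l m
  apply pullback.hom_ext
  · apply pullback.hom_ext
    · simp [h₁, h₂]
    · simp [h₁, h₂]
  · simp [h₁, h₂]

/-- The lax functor `V(1, -)` from spans in `V` to `V`-matrices. -/
noncomputable def pointsFunctor (V : Type u) [Category.{v} V] [HasFiniteLimits V]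
    [HasCoproducts.{v} V] [Extensive V] : LaxFunctor V (MatObj V) where
  base :=
    { obj := fun a => ⟨⊤_ V ⟶ a⟩
      map := fun f x => x ≫ f
      map_id := fun _ => funext fun _ => Category.comp_id _
      map_comp := fun _ _ => funext fun _ => (Category.assoc _ _ _).symm }
  hor p := fib p
  cell θ := fibCell θ
  dom_cell _ := rfl
  cod_cell _ := rfl
  cell_cid p := fibCell_id p
  cell_vcomp θ ξ := fibCell_comp θ ξ
  unitC a := fibUnit a
  dom_unitC _ := rfl
  cod_unitC _ := rfl
  unitC_nat f := fibUnit_nat f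
  compC s r := fibComp s r
  dom_compC _ _ := rfl
  cod_compC _ _ := rfl
  compC_nat β α h := fibComp_nat β α h _
  left_unit r := fib_left_unit r _
  right_unit r := fib_right_unit r _
  assoc_comp p s r := fib_assoc p s r _ _

end PointsFunctor

section Points

variable {V : Type u} [Category.{v} V] [HasFiniteLimits V] [HasCoproducts.{v} V]

theorem totι_totCell {X Y X' Y' : Type v} {p : X → Y → V} {q : X' → Y' → V}
    (θ : MatCell p q) (x : X) (y : Y) :
    totι p x y ≫ (totCell θ).mid = θ.θ x y ≫ totι q (θ.left x) (θ.right y) := by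
  have := el_totCell θ x y (𝟙 _)
  rwa [el, Category.id_comp, Category.id_comp] at this

theorem totι_l {X Y : Type v} (p : X → Y → V) (x : X) (y : Y) :
    totι p x y ≫ (totSpan p).l = terminal.from _ ≫ cop1ι x := totι_totL p x y

theorem totι_r {X Y : Type v} (p : X → Y → V) (x : X) (y : Y) :
    totι p x y ≫ (totSpan p).r = terminal.from _ ≫ cop1ι y := totι_totR p x y

/-- The components of `η`. -/
noncomputable def etaθ {X Y : Type v} (p : X → Y → V) (x : X) (y : Y) :
    p x y ⟶ fib (totSpan p) (cop1ι x) (cop1ι y) :=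
  fibLift (p := totSpan p) (totι p x y) (totι_l p x y) (totι_r p x y)

theorem comp_etaθ {X Y : Type v} (p : X → Y → V) (x : X) (y : Y) {A : V} (a : A ⟶ p x y) :
    (a ≫ etaθ p x y) ≫ fibι (totSpan p) (cop1ι x) (cop1ι y) = el x y a := by
  rw [Category.assoc, etaθ, fibLift_ι, el]

/-- The 2-cell `η_p`, whose components are given by the coproduct injections. -/
noncomputable abbrev etaCell {X Y : Type v} (p : X → Y → V) : MatCell p (fib (totSpan p)) :=
  ⟨cop1ι, cop1ι, etaθ p⟩

theorem etaCell_nat {X Y X' Y' : Type v} {p : X → Y → V} {q : X' → Y' → V} (θ : MatCell p q) :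
    θ.comp (etaCell q) = (etaCell p).comp (fibCell (totCell θ)) :=
  MatCell.ext_fib (funext fun x => (cop1ι_desc _ x).symm) (funext fun x => (cop1ι_desc _ x).symm)
    fun x y => by
      refine Eq.trans ?_ (comp_fibMap (totCell θ) (cop1ι x) (cop1ι y) (etaθ p x y)).symm
      refine (comp_etaθ q _ _ (θ.θ x y)).trans ?_
      rw [etaθ, fibLift_ι, totι_totCell, el]

theorem etaCell_unit (X : Type v) :
    (MatCell.id (matOne V X)).comp (etaCell (matOne V X)) =
      (MatCell.mk cop1ι cop1ι (oneθ cop1ι)).comp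
        ((fibUnit (cop1 V X)).comp (fibCell (totUnit V X))) :=
  MatCell.ext_fib (funext fun x => (Category.comp_id _).symm)
    (funext fun x => (Category.comp_id _).symm) fun x y => one_ext fun h A => by
      subst h
      change pt A rfl ≫ (𝟙 _ ≫ etaθ _ x x) ≫ fibι _ (cop1ι x) (cop1ι x) =
        pt A rfl ≫ (oneθ cop1ι x x ≫ fibUnitθ (cop1 V X) (cop1ι x) (cop1ι x) ≫
          fibMap (totUnit V X) (cop1ι x) (cop1ι x)) ≫
            fibι (totSpan (matOne V X)) (cop1ι x ≫ (totUnit V X).left)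
              (cop1ι x ≫ (totUnit V X).right)
      rw [Category.id_comp, ← Category.assoc, comp_etaθ]
      simp only [Category.assoc]
      rw [pt_oneθ_assoc, ← Category.assoc, ← Category.assoc]
      refine Eq.trans ?_ (comp_fibMap (totUnit V X) (cop1ι x) (cop1ι x) _).symm
      rw [Category.assoc (pt A _), pt_fibUnitθ]
      exact (px_totUnit A x).symm

variable [Extensive V]

theorem etaCell_comp {X Y Z : Type v} (s : Y → Z → V) (r : X → Y → V) (h) :
    (MatCell.id (matComp s r)).comp (etaCell (matComp s r)) =
      ((etaCell s).hcomp (etaCell r) h).comp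
        ((fibComp (totSpan s) (totSpan r)).comp (fibCell (totComp s r))) := by
  refine Eq.trans ?_ (congrArg (fun t => MatCell.comp t _) (MatCell.hcomp_mk _ _ _ _ _ rfl)).symm
  refine MatCell.ext_fib (funext fun x => (Category.comp_id _).symm)
    (funext fun x => (Category.comp_id _).symm) fun x z => mat_ext fun y A a b => ?_
  change pair y a b ≫ (𝟙 _ ≫ etaθ (matComp s r) x z) ≫ fibι _ (cop1ι x) (cop1ι z) =
    pair y a b ≫ (hcθ (f := cop1ι) (g := cop1ι) (k := cop1ι) (etaθ s) (etaθ r) x z ≫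
      fibCompθ (totSpan s) (totSpan r) (cop1ι x) (cop1ι z) ≫
      fibMap (totComp s r) (cop1ι x) (cop1ι z)) ≫
        fibι (totSpan (matComp s r)) (cop1ι x ≫ (totComp s r).left) (cop1ι z ≫ (totComp s r).right)
  rw [Category.id_comp, ← Category.assoc, comp_etaθ]
  simp only [Category.assoc]
  rw [pair_hcθ_assoc, ← Category.assoc, ← Category.assoc]
  refine Eq.trans ?_ (comp_fibMap (totComp s r) (cop1ι x) (cop1ι z) _).symm
  refine Eq.trans ?_ (congrArg (· ≫ _) (comp_fibCompθ _ _ _ _ _ _ _)).symm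
  refine (el₂_totInv x y z a b).symm.trans (congrArg (· ≫ totInv s r) ?_)
  apply pullback.hom_ext
  · rw [el₂, pullback.lift_fst, pullback.lift_fst, comp_etaθ]
  · rw [el₂, pullback.lift_snd, pullback.lift_snd, comp_etaθ]

/-- The vertical transformation `η : id ⟶ V(1, - · 1)`. -/
noncomputable def copowerEta (V : Type u) [Category.{v} V] [HasFiniteLimits V]
    [HasCoproducts.{v} V] [Extensive V] :
    VertTrans (LaxFunctor.id (MatObj V)) ((copowerFunctor V).comp (pointsFunctor V)) where
  app _ := cop1ι
  naturality f := funext fun x => (cop1ι_desc _ x).symm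
  cell p := etaCell p
  dom_cell _ := rfl
  cod_cell _ := rfl
  cell_naturality θ := etaCell_nat θ
  unit X := etaCell_unit X.carrier
  comp s r := etaCell_comp s r _

/-- The 2-cell `ε_p`, whose components are given by the inclusions of the fibres. -/
noncomputable def epsCell {a b : V} (p : Span a b) : SpanCell (totSpan (fib p)) p where
  left := cop1Desc fun x => x
  right := cop1Desc fun y => y
  mid := totDesc fun x y => fibι p x y
  wl := tot_ext fun x y A k => by
    rw [el_desc_assoc, fibι_l, ← Category.assoc (el x y k), el_totL, px_desc, ← Category.assoc,
      terminal.comp_from]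
  wr := tot_ext fun x y A k => by
    rw [el_desc_assoc, fibι_r, ← Category.assoc (el x y k), el_totR, px_desc, ← Category.assoc,
      terminal.comp_from]

theorem el_epsCell {a b : V} (p : Span a b) (x : ⊤_ V ⟶ a) (y : ⊤_ V ⟶ b) {A : V}
    (k : A ⟶ fib p x y) : el x y k ≫ (epsCell p).mid = k ≫ fibι p x y :=
  el_desc (fun x y => fibι p x y) x y k

theorem cop1Desc_nat {a b : V} (f : a ⟶ b) :
    cop1Map V (fun x : ⊤_ V ⟶ a => x ≫ f) ≫ cop1Desc (fun y => y) = cop1Desc (fun x => x) ≫ f :=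
  px_ext fun x A => by
    rw [← Category.assoc, px_map, px_desc, ← Category.assoc (px A x), px_desc, Category.assoc]

theorem epsCell_nat {a b c d : V} {p : Span a b} {q : Span c d} (θ : SpanCell p q) :
    (totCell (fibCell θ)).comp (epsCell q) = (epsCell p).comp θ :=
  SpanCell.ext (cop1Desc_nat _) (cop1Desc_nat _) (tot_ext fun x y A k => by
    refine (Category.assoc _ _ _).symm.trans ((congrArg (· ≫ _) (el_totCell _ _ _ _)).trans ?_)
    refine (el_epsCell q _ _ _).trans ((comp_fibMap θ x y k).trans ?_)
    rw [← Category.assoc, el_epsCell])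

theorem epsCell_unit (a : V) :
    ((totUnit V (⊤_ V ⟶ a)).comp (totCell (fibUnit a))).comp (epsCell (Span.one a)) =
      (SpanCell.one (cop1Desc fun x : ⊤_ V ⟶ a => x)).comp (SpanCell.id (Span.one a)) := by
  have h : (𝟙 _ ≫ cop1Map V fun x : ⊤_ V ⟶ a => x) ≫ cop1Desc (fun x => x) =
      cop1Desc (fun x => x) ≫ 𝟙 a := by
    rw [cop1Map_id, Category.id_comp, Category.id_comp, Category.comp_id]
  refine SpanCell.ext h h (px_ext fun x A => ?_)
  refine (Category.assoc _ _ _).symm.trans ((congrArg (· ≫ _) ((Category.assoc _ _ _).symm.trans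
    (congrArg (· ≫ _) (px_totUnit _ _)))).trans ?_)
  rw [el_totCell]
  refine (el_epsCell (Span.one a) x x _).trans ?_
  rw [Category.assoc, pt_fibUnitθ]
  exact (px_desc (A := A) (fun x : ⊤_ V ⟶ a => x) x).symm.trans
    (congrArg (px A x ≫ ·) (Category.comp_id (cop1Desc fun x : ⊤_ V ⟶ a => x)).symm)

theorem epsCell_comp {a b c : V} (s : Span b c) (r : Span a b) (h) :
    ((totComp (fib s) (fib r)).comp (totCell (fibComp s r))).comp (epsCell (s.comp r)) =
      ((epsCell s).hcomp (epsCell r) h).comp (SpanCell.id (s.comp r)) := by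
  have h' : ∀ a : V, (𝟙 _ ≫ cop1Map V fun x : ⊤_ V ⟶ a => x) ≫ cop1Desc (fun x => x) =
      cop1Desc (fun x => x) ≫ 𝟙 a := by
    intro a
    rw [cop1Map_id, Category.id_comp, Category.id_comp, Category.comp_id]
  refine SpanCell.ext (h' a) (h' c) (pb_ext fun x y z A k l => ?_)
  refine (Category.assoc _ _ _).symm.trans ((congrArg (· ≫ _) ((Category.assoc _ _ _).symm.trans
    (congrArg (· ≫ _) (el₂_totInv _ _ _ _ _)))).trans ?_)
  rw [el_totCell]
  refine (el_epsCell (s.comp r) x z _).trans ((comp_fibCompθ s r x y z k l).trans ?_)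
  refine Eq.trans ?_ (congrArg (_ ≫ ·) (Category.comp_id _).symm)
  apply pullback.hom_ext
  · rw [Category.assoc, pullback.lift_fst, pullback.lift_fst, el₂, pullback.lift_fst_assoc,
      el_epsCell]
  · rw [Category.assoc, pullback.lift_snd, pullback.lift_snd, el₂, pullback.lift_snd_assoc,
      el_epsCell]

/-- The vertical transformation `ε : V(1, -) · 1 ⟶ id`. -/
noncomputable def copowerEps (V : Type u) [Category.{v} V] [HasFiniteLimits V]
    [HasCoproducts.{v} V] [Extensive V] :
    VertTrans ((pointsFunctor V).comp (copowerFunctor V)) (LaxFunctor.id V) where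
  app a := cop1Desc fun x : ⊤_ V ⟶ a => x
  naturality f := cop1Desc_nat f
  cell p := epsCell p
  dom_cell _ := rfl
  cod_cell _ := rfl
  cell_naturality θ := epsCell_nat θ
  unit a := epsCell_unit a
  comp s r := epsCell_comp s r _

theorem cop_left_triangle (X : Type v) :
    cop1Map V (fun x : X => cop1ι (V := V) x) ≫ cop1Desc (fun x => x) = 𝟙 (cop1 V X) :=
  px_ext fun x A => by
    rw [← Category.assoc, px_map, px_desc, Category.comp_id]
    rfl

theorem eta_epsCell {a b : V} (p : Span a b) :
    (etaCell (fib p)).comp (fibCell (epsCell p)) = MatCell.id (fib p) :=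
  MatCell.ext_fib (funext fun x => cop1ι_desc _ x) (funext fun x => cop1ι_desc _ x)
    fun x y => by
      refine (comp_fibMap (epsCell p) (cop1ι x) (cop1ι y) (etaθ (fib p) x y)).trans ?_
      have h : etaθ (fib p) x y ≫ fibι (totSpan (fib p)) (cop1ι x) (cop1ι y) = el x y (𝟙 _) := by
        rw [← comp_etaθ, Category.id_comp]
      exact (congrArg (· ≫ (epsCell p).mid) h).trans (el_epsCell p x y (𝟙 _))

/-- The adjunction `- · 1 ⊣ V(1, -)` between `V`-matrices and spans in `V`. -/
noncomputable def copowerAdj (V : Type u) [Category.{v} V] [HasFiniteLimits V]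
    [HasCoproducts.{v} V] [Extensive V] :
    LaxAdjunction (copowerFunctor V) (pointsFunctor V) where
  η := copowerEta V
  ε := copowerEps V
  left_triangle X := cop_left_triangle X.carrier
  right_triangle a := funext fun x => cop1ι_desc _ x
  left_triangle_cell p := SpanCell.ext (cop_left_triangle _) (cop_left_triangle _)
    (tot_ext fun x y A a => by
      refine (Category.assoc _ _ _).symm.trans ((congrArg (· ≫ _) (el_totCell _ _ _ _)).trans ?_)
      refine (el_epsCell (totSpan p) (cop1ι x) (cop1ι y) _).trans ((comp_etaθ p x y a).trans ?_)
      exact (Category.comp_id _).symm)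
  right_triangle_cell p := eta_epsCell p

variable (T : Monad V) [CartesianMonad T]

/-- The monad `T̄ = V(1, T(- · 1))` on `V`-matrices. -/
noncomputable def matMonad : LaxMonad (MatObj V) := (copowerAdj V).monad (spanMonad T)

/-- The conjunction `(- · 1, ε_{T(- · 1)}) ⊣ (V(1, -), V(1, T ε))` between `T̄` on `V`-matrices and
`T` on spans in `V`. -/
noncomputable def matConjunction : MonadConjunction (matMonad T) (spanMonad T) :=
  (copowerAdj V).conjunction (spanMonad T)

end Points

end TCat

/-! Both base changes are governed by universal 2-cells. Write `S` for the monad `T̄`. The composite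
`Fa · φ_x^*` is the extension of `Fa` along `φ_x`: there is an opcartesian 2-cell `ι : Fa ⟶ Fa ·
φ_x^*` over `φ_x` and the identity, and a 2-cell out of `Fa · φ_x^*` is determined by its vertical
source and its composite with `ι`. Dually, `Gb · ψ_{y!}` is the restriction of `Gb` along `ψ_y`:
there is a cartesian 2-cell `π : Gb · ψ_{y!} ⟶ Gb`, and a 2-cell into `Gb · ψ_{y!}` is determined by
its vertical source and its composite with `π`.

Modulo these universal properties the structure cells become simple. `F_!υ` is `Fυ` followed by `ι`,
and `F_!μ` satisfies `(ι · (φ_a ≫ Tι)) ≫ F_!μ = Fμ ≫ ι` up to the comparison of `F` (`algObj_υ`,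
`square_algObj_μ`). Likewise `G_!υ ≫ π = Gυ` and `G_!μ ≫ π = (π · (Sπ ≫ ψ_b)) ≫ Gμ` up to the
comparisons of `G` (`algObj_υ_res`, `algObj_μ_res`). Every algebra or morphism law is then tested
against the universal 2-cells, where it becomes the image under `F` or `G` of the law that is given,
combined with the monad morphism axioms for `φ` or `ψ`.

For `G_!` the cell to be tested against is always `π` itself, so no further condition is needed. For
`F_!` the multiplication lives on `a' · Ta'`, with `a' = Fa · φ_x^*`, so `ι · (φ_a ≫ Tι)` has to be
epimorphic in the same sense. This is where the strong conjoint enters: invertibility of `Fr · φ^* ⟶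
φ^* · TFr` makes the horizontal composite of an extension with `φ_r` an extension again
(`IsExtension.hc_isExact`). Since `T` preserves extensions (`IsExtension.map`), the required cell is
a composite of extensions (`square_hom_ext`); associativity uses the threefold version
(`cube_hom_ext`), which also needs the composition comparison of `T` to be invertible. On spans both
facts about `T` come from preservation of pullbacks.

For the adjunction, the proposed unit followed by `π` is `η_a ≫ Gι`, and `ι` followed by the
proposed counit is `Fπ ≫ ε_b` (`unitCell_res`, `ext_counitCell`). Compatibility with the structure
follows from naturality of `η` and `ε`, their compatibility with the comparisons, and the mate
equations between `φ` and `ψ`; naturality of unit and counit and the triangle identities follow from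
those of `F ⊣ G`. -/

namespace TCat

open DoubleCategory

/-! ### Coherence: consequences of the triangle and the pentagon. -/

section Coherence

variable {D : Type u} [Category.{v} D] [DoubleCategory.{w, t} D]

/-- The boundary proof carried by `hc` mentions both 2-cells, so rewriting one factor in place can
break the motive. Replacing a factor of a horizontal composite goes through this congruence, in
which both boundary proofs are free. -/
theorem hc_congr {a b c a' b' c' : D} {s : Hor b c} {r : Hor a b} {s' : Hor b' c'}
    {r' : Hor a' b'} {β β' : Cell s s'} {α α' : Cell r r'} (hβ : β = β') (hα : α = α')
    (h : cod α = dom β) (h' : cod α' = dom β') : hc β α h = hc β' α' h' := by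
  subst hβ hα
  rfl

/-- Vertical composites are normalised to the right, so an equation for two consecutive cells must
be usable at the head of a longer chain. -/
theorem vcomp_reassoc {a b c d a' b' a'' b'' : D} {r : Hor a b} {s : Hor c d} {q : Hor a' b'}
    {p : Hor a'' b''} {θ : Cell r s} {ξ : Cell s q} {ζ : Cell r q} (h : θ ≫ᵥ ξ = ζ)
    (χ : Cell q p) : θ ≫ᵥ ξ ≫ᵥ χ = ζ ≫ᵥ χ := by
  rw [← h, vcomp_assoc]

@[simp]
theorem hc_vcomp_assoc {a b c a' b' c' a'' b'' c'' d e : D} {s : Hor b c} {r : Hor a b}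
    {s' : Hor b' c'} {r' : Hor a' b'} {s'' : Hor b'' c''} {r'' : Hor a'' b''} (β : Cell s s')
    (α : Cell r r') (h : cod α = dom β) (β' : Cell s' s'') (α' : Cell r' r'')
    (h' : cod α' = dom β') {p : Hor d e} (χ : Cell (hcomp s'' r'') p) :
    hc β α h ≫ᵥ hc β' α' h' ≫ᵥ χ = hc (β ≫ᵥ β') (α ≫ᵥ α') (by simp [h, h']) ≫ᵥ χ :=
  vcomp_reassoc (hc_vcomp β α h β' α' h') χ

@[simp]
theorem lamInv_lam_assoc {a b c d : D} (r : Hor a b) {p : Hor c d} (χ : Cell r p) :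
    lamInv r ≫ᵥ lam r ≫ᵥ χ = χ := by
  rw [vcomp_reassoc (lamInv_lam r), cid_vcomp]

@[simp]
theorem rhoInv_rho_assoc {a b c d : D} (r : Hor a b) {p : Hor c d} (χ : Cell r p) :
    rhoInv r ≫ᵥ rho r ≫ᵥ χ = χ := by
  rw [vcomp_reassoc (rhoInv_rho r), cid_vcomp]

@[simp]
theorem assoc_assocInv_assoc {a b c d a' b' : D} (t : Hor c d) (s : Hor b c) (r : Hor a b)
    {p : Hor a' b'} (χ : Cell (hcomp (hcomp t s) r) p) :
    assoc t s r ≫ᵥ assocInv t s r ≫ᵥ χ = χ := by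
  rw [vcomp_reassoc (assoc_assocInv t s r), cid_vcomp]

@[simp]
theorem assocInv_assoc_assoc {a b c d a' b' : D} (t : Hor c d) (s : Hor b c) (r : Hor a b)
    {p : Hor a' b'} (χ : Cell (hcomp t (hcomp s r)) p) :
    assocInv t s r ≫ᵥ assoc t s r ≫ᵥ χ = χ := by
  rw [vcomp_reassoc (assocInv_assoc t s r), cid_vcomp]

theorem lamInv_nat {a b c d : D} {r : Hor a b} {s : Hor c d} (θ : Cell r s) :
    lamInv r ≫ᵥ hc (honeMap (cod θ)) θ (dom_honeMap _).symm = θ ≫ᵥ lamInv s := by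
  rw [← vcomp_cid (hc _ _ _), ← lam_lamInv, vcomp_reassoc (lam_nat θ), vcomp_assoc,
    lamInv_lam_assoc]

theorem rhoInv_nat {a b c d : D} {r : Hor a b} {s : Hor c d} (θ : Cell r s) :
    rhoInv r ≫ᵥ hc θ (honeMap (dom θ)) (cod_honeMap _) = θ ≫ᵥ rhoInv s := by
  rw [← vcomp_cid (hc _ _ _), ← rho_rhoInv, vcomp_reassoc (rho_nat θ), vcomp_assoc,
    rhoInv_rho_assoc]

theorem assocInv_nat {a b c d a' b' c' d' : D} {t : Hor c d} {s : Hor b c} {r : Hor a b}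
    {t' : Hor c' d'} {s' : Hor b' c'} {r' : Hor a' b'} (γ : Cell t t') (β : Cell s s')
    (α : Cell r r') (h₁ : cod β = dom γ) (h₂ : cod α = dom β) :
    assocInv t s r ≫ᵥ hc (hc γ β h₁) α (h₂.trans (dom_hc γ β h₁).symm) =
      hc γ (hc β α h₂) ((cod_hc β α h₂).trans h₁) ≫ᵥ assocInv t' s' r' := by
  rw [← vcomp_cid (hc (hc γ β h₁) α _), ← assoc_assocInv, vcomp_reassoc (assoc_nat γ β α h₁ h₂),
    vcomp_assoc, assocInv_assoc_assoc]

/-- Whiskering by an identity loop is injective. -/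
theorem hc_cid_hone_injective {a b c d : D} {r : Hor a b} {q : Hor c d} {θ ξ : Cell r q}
    (h : hc (honeMap (cod θ)) θ (by simp) = hc (honeMap (cod ξ)) ξ (by simp)) : θ = ξ := by
  have h₁ := lamInv_nat θ
  rw [h, lamInv_nat ξ] at h₁
  have h₂ := congrArg (· ≫ᵥ lam q) h₁
  simpa using h₂.symm

theorem rhoInv_triangle {a b c : D} (s : Hor b c) (r : Hor a b) :
    hc (rhoInv s) (cid r) (by simp) ≫ᵥ assoc s (hone b) r = hc (cid s) (lamInv r) (by simp) := by
  have h := congrArg (fun θ => hc (rhoInv s) (cid r) (by simp) ≫ᵥ θ ≫ᵥ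
    hc (cid s) (lamInv r) (by simp)) (triangle s r)
  simpa using h

theorem lamInv_triangle {a b c : D} (s : Hor b c) (r : Hor a b) :
    hc (cid s) (lamInv r) (by simp) ≫ᵥ assocInv s (hone b) r =
      hc (rhoInv s) (cid r) (by simp) := by
  rw [← rhoInv_triangle]
  simp

/-- Whiskering by an identity loop on the right is injective. -/
theorem hc_hone_injective {a b c d : D} {r : Hor a b} {q : Hor c d} {θ ξ : Cell r q}
    (h : hc θ (honeMap (dom θ)) (by simp) = hc ξ (honeMap (dom ξ)) (by simp)) : θ = ξ := by
  have h₁ := rhoInv_nat θ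
  rw [h, rhoInv_nat ξ] at h₁
  have h₂ := congrArg (· ≫ᵥ rho q) h₁
  simpa using h₂.symm

/-- Kelly's argument: since whiskering by an identity loop is injective, the equation may be checked
after composing horizontally with `hone a`. There the pentagon with two identity factors, the
triangle for `r` and for `s · r`, and naturality of the associator give it. -/
theorem assoc_rho {a b c : D} (s : Hor b c) (r : Hor a b) :
    assoc s r (hone a) ≫ᵥ hc (cid s) (rho r) (by simp) = rho (hcomp s r) := by
  apply hc_hone_injective
  -- The triangle at `r` trades the right unitor of `r` for a left unitor of the last identity;
  -- associator naturality moves it under `s`.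
  have h₁ : hc (hc (cid s) (rho r) (by simp)) (cid (hone a)) (by simp) =
      assoc s (hcomp r (hone a)) (hone a) ≫ᵥ
        hc (cid s) (assoc r (hone a) (hone a) ≫ᵥ hc (cid r) (lam (hone a)) (by simp)) (by simp) ≫ᵥ
          assocInv s r (hone a) := by
    have h := assoc_nat (cid s) (rho r) (cid (hone a)) (by simp) (by simp)
    rw [hc_congr rfl (triangle r (hone a)) _ (by simp)]
    rw [vcomp_reassoc h.symm]
    simp
  have h₂ := assoc_nat (cid s) (cid r) (lam (hone a)) (by simp) (by simp)
  have h₃ : hc (assoc s r (hone a) ≫ᵥ hc (cid s) (rho r) (by simp)) (cid (hone a)) (by simp) =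
      hc (rho (hcomp s r)) (cid (hone a)) (by simp) := by
    calc _ = hc (assoc s r (hone a)) (cid (hone a)) (by simp) ≫ᵥ
          hc (hc (cid s) (rho r) (by simp)) (cid (hone a)) (by simp) := by simp
      _ = (hc (assoc s r (hone a)) (cid (hone a)) (by simp) ≫ᵥ
          assoc s (hcomp r (hone a)) (hone a) ≫ᵥ
            hc (cid s) (assoc r (hone a) (hone a)) (by simp)) ≫ᵥ
            hc (cid s) (hc (cid r) (lam (hone a)) (by simp)) (by simp) ≫ᵥ
              assocInv s r (hone a) := by rw [h₁]; simp
      _ = assoc (hcomp s r) (hone a) (hone a) ≫ᵥ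
          (assoc s r (hcomp (hone a) (hone a)) ≫ᵥ
            hc (cid s) (hc (cid r) (lam (hone a)) (by simp)) (by simp)) ≫ᵥ
              assocInv s r (hone a) := by rw [← pentagon]; simp only [vcomp_assoc]
      _ = _ := by
        rw [← h₂, ← triangle]
        simp
  refine (hc_congr rfl ?_ _ _).trans (h₃.trans (hc_congr rfl ?_ _ _)) <;> simp

/-- Naturality of `rho` at the cell `rho (hone a)` identifies the unitor of `1 · 1` with `rho · 1`;
comparing the triangle with `assoc_rho` then gives `1 · lam = 1 · rho`, and the whiskering is
cancelled. The equality is needed because conjoints and companions mix left and right unitors on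
identities. -/
theorem lam_hone (a : D) : lam (hone a) = rho (hone a) := by
  apply hc_cid_hone_injective
  have h₁ : rho (hcomp (hone a) (hone a)) = hc (rho (hone a)) (cid (hone a)) (by simp) := by
    have h := congrArg (· ≫ᵥ rhoInv (hone a)) (rho_nat (rho (hone a)))
    simpa using h.symm
  have h₂ : hc (cid (hone a)) (lam (hone a)) (by simp) =
      hc (cid (hone a)) (rho (hone a)) (by simp) := by
    have h := congrArg (assocInv (hone a) (hone a) (hone a) ≫ᵥ ·)
      ((triangle (hone a) (hone a)).trans (h₁.symm.trans (assoc_rho (hone a) (hone a)).symm))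
    simpa using h
  refine (hc_congr ?_ rfl _ _).trans (h₂.trans (hc_congr ?_ rfl _ _)) <;> simp

theorem lamInv_hone (a : D) : lamInv (hone a) = rhoInv (hone a) := by
  have h := congrArg (fun θ => lamInv (hone a) ≫ᵥ θ ≫ᵥ rhoInv (hone a)) (lam_hone a)
  simpa using h.symm

theorem assocInv_rho {a b c : D} (s : Hor b c) (r : Hor a b) :
    assocInv s r (hone a) ≫ᵥ rho (hcomp s r) = hc (cid s) (rho r) (by simp) := by
  rw [← assoc_rho, assocInv_assoc_assoc]

theorem rhoInv_assoc {a b c : D} (s : Hor b c) (r : Hor a b) :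
    rhoInv (hcomp s r) ≫ᵥ assoc s r (hone a) = hc (cid s) (rhoInv r) (by simp) := by
  have h := congrArg (fun θ => rhoInv (hcomp s r) ≫ᵥ θ ≫ᵥ hc (cid s) (rhoInv r) (by simp))
    (assoc_rho s r)
  simpa using h

theorem rhoInv_assocInv {a b c : D} (s : Hor b c) (r : Hor a b) :
    hc (cid s) (rhoInv r) (by simp) ≫ᵥ assocInv s r (hone a) = rhoInv (hcomp s r) := by
  rw [← rhoInv_assoc]
  simp

end Coherence

/-! ### Universal properties of conjoints and companions. -/

section ConjointCalculus

variable {D : Type u} [Category.{v} D] [DoubleCategory.{w, t} D]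

/-- The naturality axiom has the literal loop `honeMap (dom θ)`. In applications the loop is on a
morphism only provably equal to `dom θ`; the boundary condition supplies the equality. The variants
below serve the other unitors and identity loops. -/
theorem hc_honeMap_rho {a b c d : D} {r : Hor a b} {s : Hor c d} (θ : Cell r s) {k : a ⟶ c}
    (h : cod (honeMap k) = dom θ) : hc θ (honeMap k) h ≫ᵥ rho s = rho r ≫ᵥ θ := by
  rw [← rho_nat]
  obtain rfl : k = dom θ := by simpa using h
  rfl

theorem hc_honeMap_lam {a b c d : D} {r : Hor a b} {s : Hor c d} (θ : Cell r s) {k : b ⟶ d}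
    (h : cod θ = dom (honeMap k)) : hc (honeMap k) θ h ≫ᵥ lam s = lam r ≫ᵥ θ := by
  rw [← lam_nat]
  obtain rfl : cod θ = k := by simpa using h
  rfl

theorem rhoInv_hc_honeMap {a b c d : D} {r : Hor a b} {s : Hor c d} (θ : Cell r s) {k : a ⟶ c}
    (h : cod (honeMap k) = dom θ) : rhoInv r ≫ᵥ hc θ (honeMap k) h = θ ≫ᵥ rhoInv s := by
  rw [← rhoInv_nat]
  obtain rfl : k = dom θ := by simpa using h
  rfl

theorem lamInv_hc_honeMap {a b c d : D} {r : Hor a b} {s : Hor c d} (θ : Cell r s) {k : b ⟶ d}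
    (h : cod θ = dom (honeMap k)) : lamInv r ≫ᵥ hc (honeMap k) θ h = θ ≫ᵥ lamInv s := by
  rw [← lamInv_nat]
  obtain rfl : cod θ = k := by simpa using h
  rfl

theorem rhoInv_hc_cid {a b d : D} {r : Hor a b} {s : Hor a d} (θ : Cell r s)
    (h : cod (cid (hone a)) = dom θ) : rhoInv r ≫ᵥ hc θ (cid (hone a)) h = θ ≫ᵥ rhoInv s := by
  rw [← rhoInv_hc_honeMap θ (k := 𝟙 a) (by simpa using h)]
  exact congrArg (_ ≫ᵥ ·) (hc_congr rfl (honeMap_id a).symm _ _)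

theorem hc_cid_rho {a b d : D} {r : Hor a b} {s : Hor a d} (θ : Cell r s)
    (h : cod (cid (hone a)) = dom θ) : hc θ (cid (hone a)) h ≫ᵥ rho s = rho r ≫ᵥ θ := by
  rw [← hc_honeMap_rho θ (k := 𝟙 a) (by simpa using h)]
  exact congrArg (· ≫ᵥ _) (hc_congr rfl (honeMap_id a).symm _ _)

theorem lamInv_hc_cid {a b c : D} {r : Hor a b} {s : Hor c b} (θ : Cell r s)
    (h : cod θ = dom (cid (hone b))) : lamInv r ≫ᵥ hc (cid (hone b)) θ h = θ ≫ᵥ lamInv s := by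
  rw [← lamInv_hc_honeMap θ (k := 𝟙 b) (by simpa using h)]
  exact congrArg (_ ≫ᵥ ·) (hc_congr (honeMap_id b).symm rfl _ _)

theorem hc_cid_lam {a b c : D} {r : Hor a b} {s : Hor c b} (θ : Cell r s)
    (h : cod θ = dom (cid (hone b))) : hc (cid (hone b)) θ h ≫ᵥ lam s = lam r ≫ᵥ θ := by
  rw [← hc_honeMap_lam θ (k := 𝟙 b) (by simpa using h)]
  exact congrArg (· ≫ᵥ _) (hc_congr (honeMap_id b).symm rfl _ _)

namespace Conjoint

variable {a b : D} {f : a ⟶ b} (C : Conjoint f)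

/-- Pushing the counit through the right unitor puts it next to the unit, and the two collapse to
`honeMap f`. What remains is a left unitor followed by a right one on an identity, which cancel by
`lam_hone`. -/
theorem lift_counit {c d : D} {p : Hor c d} (χ : Cell p (hone b)) (k : d ⟶ a)
    (h : cod χ = k ≫ f) : C.lift χ k h ≫ᵥ C.counit = χ := by
  have h₁ := rho_nat C.counit
  have h₂ := hc_honeMap_lam χ (k := k ≫ f) (by simp [h])
  rw [Conjoint.lift]
  simp only [vcomp_assoc]
  rw [← h₁, hc_vcomp_assoc]
  refine (congrArg (fun θ => _ ≫ᵥ θ ≫ᵥ _) (hc_congr (β' := honeMap (k ≫ f)) (α' := χ) ?_ ?_ _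
    (by simp [h]))).trans ?_
  · simp [C.unit_counit, honeMap_comp]
  · simp
  · rw [← lam_hone, h₂, lamInv_lam_assoc]

/-- Here the second conjoint identity, `hc_unit_counit`, is used. Together with `lift_counit` it
makes `lift` a bijection, so equality of 2-cells into a conjoint can be tested after the counit. -/
theorem eq_lift {c d : D} {p : Hor c d} (ξ : Cell p C.hor) :
    ξ = C.lift (ξ ≫ᵥ C.counit) (cod ξ) (by simp) := by
  have h : hc (honeMap (cod ξ) ≫ᵥ C.unit) (ξ ≫ᵥ C.counit) (by simp) =
      hc (honeMap (cod ξ)) ξ (by simp) ≫ᵥ hc C.unit C.counit (by simp) := by simp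
  rw [Conjoint.lift, h, vcomp_assoc, C.hc_unit_counit, vcomp_reassoc (lamInv_nat ξ)]
  simp

theorem hom_ext {c d : D} {p : Hor c d} {ξ ξ' : Cell p C.hor} (h : cod ξ = cod ξ')
    (h' : ξ ≫ᵥ C.counit = ξ' ≫ᵥ C.counit) : ξ = ξ' := by
  rw [C.eq_lift ξ, C.eq_lift ξ']
  simp only [h, h']

/-- The opcartesian 2-cell `r ⟶ r · f^*` over `f`. -/
def extend {c : D} (r : Hor a c) : Cell r (hcomp r C.hor) :=
  rhoInv r ≫ᵥ hc (cid r) C.unit (by simp)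

@[simp]
theorem dom_extend {c : D} (r : Hor a c) : dom (C.extend r) = f := by simp [extend]

@[simp]
theorem cod_extend {c : D} (r : Hor a c) : cod (C.extend r) = 𝟙 c := by simp [extend]

/-- This is the identity `hc_unit_counit` whiskered by `r`. It allows a cell out of `r · f^*` to be
rebuilt from its restriction along `extend` by pasting the counit back on. -/
theorem hc_extend_counit {c : D} (r : Hor a c) :
    hc (C.extend r) C.counit (by simp) ≫ᵥ rho (hcomp r C.hor) = cid _ := by
  have h₁ : hc (C.extend r) C.counit (by simp) = hc (rhoInv r) (cid C.hor) (by simp) ≫ᵥ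
      hc (hc (cid r) C.unit (by simp)) C.counit (by simp) := by simp [extend]
  have h₂ := assoc_nat (cid r) C.unit C.counit (by simp) (by simp)
  rw [h₁, ← assoc_rho, vcomp_assoc, vcomp_reassoc h₂, vcomp_assoc,
    vcomp_reassoc (rhoInv_triangle _ _)]
  simp [C.hc_unit_counit]

/-- The uniqueness half of the opcartesian property. The vertical source must be given separately,
because restriction along `extend` only sees its precomposite with `f`. -/
theorem extend_hom_ext {c : D} {r : Hor a c} {d e : D} {q : Hor d e}
    {χ χ' : Cell (hcomp r C.hor) q} (h : dom χ = dom χ')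
    (h' : C.extend r ≫ᵥ χ = C.extend r ≫ᵥ χ') : χ = χ' := by
  -- The right-hand side depends on `χ` only through its restriction and its vertical source.
  have key : ∀ χ : Cell (hcomp r C.hor) q,
      χ = hc (C.extend r ≫ᵥ χ) (C.counit ≫ᵥ honeMap (dom χ)) (by simp) ≫ᵥ rho q := by
    intro χ
    have h₁ : hc (C.extend r ≫ᵥ χ) (C.counit ≫ᵥ honeMap (dom χ)) (by simp) =
      hc (C.extend r) C.counit (by simp) ≫ᵥ hc χ (honeMap (dom χ)) (by simp) := by simp
    rw [h₁, vcomp_assoc, rho_nat, vcomp_reassoc (C.hc_extend_counit r), cid_vcomp]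
  rw [key χ, key χ']
  simp only [h, h']

/-- Opcartesian cells are stable under whiskering on the side away from `f`, up to the associator;
the only coherence involved is that of the right unitor. -/
theorem hc_cid_extend {c d : D} (s : Hor c d) (r : Hor a c) :
    hc (cid s) (C.extend r) (by simp) = C.extend (hcomp s r) ≫ᵥ assoc s r C.hor := by
  have h := assoc_nat (cid s) (cid r) C.unit (by simp) (by simp)
  have h₁ : C.extend (hcomp s r) ≫ᵥ assoc s r C.hor = rhoInv (hcomp s r) ≫ᵥ
    hc (hc (cid s) (cid r) (by simp)) C.unit (by simp) ≫ᵥ assoc s r C.hor := by simp [extend]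
  rw [h₁, h, vcomp_reassoc (rhoInv_assoc s r)]
  simp [extend]

theorem extend_nat {c d : D} {r : Hor a c} {s : Hor a d} (θ : Cell r s) (h : dom θ = 𝟙 a) :
    θ ≫ᵥ C.extend s = C.extend r ≫ᵥ hc θ (cid C.hor) (by simp [h]) := by
  rw [extend, vcomp_reassoc (rhoInv_hc_cid θ (by simp [h])).symm]
  simp [extend]

/-- The existence half of the opcartesian property, with explicit witness: a cell whose vertical
source factors through `f` extends along `extend` by pasting with the counit. -/
theorem extend_hc_counit {c d e : D} {r : Hor a c} {s : Hor d e} (θ : Cell r s)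
    {k : b ⟶ d} (h : dom θ = f ≫ k) :
    C.extend r ≫ᵥ hc θ (C.counit ≫ᵥ honeMap k) (by simp [h]) ≫ᵥ rho s = θ := by
  have h₁ : hc (cid r) C.unit (by simp) ≫ᵥ hc θ (C.counit ≫ᵥ honeMap k) (by simp [h]) =
      hc θ (honeMap (f ≫ k)) (by simp [h]) := by
    rw [hc_vcomp]
    exact hc_congr (by simp) (by rw [← vcomp_assoc, C.unit_counit, honeMap_comp]) _ _
  rw [extend, vcomp_assoc, vcomp_reassoc h₁, hc_honeMap_rho, rhoInv_rho_assoc]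

end Conjoint

namespace Companion

variable {a b : D} {f : a ⟶ b} (C : Companion f)

theorem lift_counit {c d : D} {p : Hor c d} (χ : Cell p (hone b)) (k : c ⟶ a)
    (h : dom χ = k ≫ f) : C.lift χ k h ≫ᵥ C.counit = χ := by
  have h₁ := lam_nat C.counit
  have h₂ := hc_honeMap_rho χ (k := k ≫ f) (by simp [h])
  rw [Companion.lift]
  simp only [vcomp_assoc]
  rw [← h₁, hc_vcomp_assoc]
  refine (congrArg (fun θ => _ ≫ᵥ θ ≫ᵥ _) (hc_congr (α' := honeMap (k ≫ f)) (β' := χ) ?_ ?_ _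
    (by simp [h]))).trans ?_
  · simp
  · simp [C.unit_counit, honeMap_comp]
  · rw [lam_hone, h₂, rhoInv_rho_assoc]

/-- The cartesian 2-cell `r · f_! ⟶ r` over `f`. -/
def restrict {c : D} (r : Hor b c) : Cell (hcomp r C.hor) r :=
  hc (cid r) C.counit (by simp) ≫ᵥ rho r

@[simp]
theorem dom_restrict {c : D} (r : Hor b c) : dom (C.restrict r) = f := by simp [restrict]

@[simp]
theorem cod_restrict {c : D} (r : Hor b c) : cod (C.restrict r) = 𝟙 c := by simp [restrict]

/-- Dual to `hc_extend_counit`: the identity `hc_counit_unit` whiskered by `r` recovers a cell into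
`r · f_!` from its composite with `restrict`. -/
theorem hc_restrict_unit {c : D} (r : Hor b c) :
    rhoInv (hcomp r C.hor) ≫ᵥ hc (C.restrict r) C.unit (by simp) = cid _ := by
  have h₁ : hc (C.restrict r) C.unit (by simp) =
      hc (hc (cid r) C.counit (by simp)) C.unit (by simp) ≫ᵥ
        hc (rho r) (cid C.hor) (by simp) := by simp [restrict]
  have h₂ := assocInv_nat (cid r) C.counit C.unit (by simp) (by simp)
  rw [h₁, ← rhoInv_assocInv, vcomp_assoc, vcomp_reassoc h₂, vcomp_assoc]
  simp only [C.hc_counit_unit, hc_vcomp_assoc, vcomp_cid, rhoInv_rho_assoc]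
  rw [vcomp_reassoc (lamInv_triangle _ _)]
  simp

/-- The uniqueness half of the cartesian property. After `restrict` the vertical source is only
known up to postcomposition with `f`, hence the first hypothesis. -/
theorem restrict_hom_ext {c : D} {r : Hor b c} {d e : D} {q : Hor d e}
    {χ χ' : Cell q (hcomp r C.hor)} (h : dom χ = dom χ')
    (h' : χ ≫ᵥ C.restrict r = χ' ≫ᵥ C.restrict r) : χ = χ' := by
  have key : ∀ χ : Cell q (hcomp r C.hor),
      χ = rhoInv q ≫ᵥ hc (χ ≫ᵥ C.restrict r) (honeMap (dom χ) ≫ᵥ C.unit) (by simp) := by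
    intro χ
    have h₁ : hc (χ ≫ᵥ C.restrict r) (honeMap (dom χ) ≫ᵥ C.unit) (by simp) =
      hc χ (honeMap (dom χ)) (by simp) ≫ᵥ hc (C.restrict r) C.unit (by simp) := by simp
    rw [h₁, vcomp_reassoc (rhoInv_nat χ), vcomp_assoc, C.hc_restrict_unit, vcomp_cid]
  rw [key χ, key χ']
  simp only [h, h']

theorem assocInv_restrict {c d : D} (s : Hor c d) (r : Hor b c) :
    assocInv s r C.hor ≫ᵥ C.restrict (hcomp s r) = hc (cid s) (C.restrict r) (by simp) := by
  have h := assocInv_nat (cid s) (cid r) C.counit (by simp) (by simp)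
  have h₁ : assocInv s r C.hor ≫ᵥ C.restrict (hcomp s r) = assocInv s r C.hor ≫ᵥ
    hc (hc (cid s) (cid r) (by simp)) C.counit (by simp) ≫ᵥ rho _ := by simp [restrict]
  rw [h₁, vcomp_reassoc h, vcomp_assoc, assocInv_rho]
  simp [restrict]

theorem restrict_nat {c d : D} {r : Hor b c} {s : Hor b d} (θ : Cell r s) (h : dom θ = 𝟙 b) :
    C.restrict r ≫ᵥ θ = hc θ (cid C.hor) (by simp [h]) ≫ᵥ C.restrict s := by
  rw [restrict, vcomp_assoc, ← hc_cid_rho θ (by simp [h])]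
  simp [restrict]

/-- The existence half of the cartesian property: the factorisation is obtained by pasting with the
unit of the companion. -/
theorem rhoInv_hc_unit_restrict {c d e : D} {r : Hor b c} {s : Hor d e} (θ : Cell s r)
    {k : d ⟶ a} (h : dom θ = k ≫ f) :
    rhoInv s ≫ᵥ hc θ (honeMap k ≫ᵥ C.unit) (by simp [h]) ≫ᵥ C.restrict r = θ := by
  have h₁ : hc θ (honeMap k ≫ᵥ C.unit) (by simp [h]) ≫ᵥ hc (cid r) C.counit (by simp) =
      hc θ (honeMap (k ≫ f)) (by simp [h]) := by
    rw [hc_vcomp]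
    exact hc_congr (by simp) (by rw [vcomp_assoc, C.unit_counit, honeMap_comp]) _ _
  rw [restrict, vcomp_reassoc h₁, hc_honeMap_rho, rhoInv_rho_assoc]

end Companion

end ConjointCalculus

/-! ### The canonical comparison cells, characterised by universal 2-cells. -/

section Comparisons

variable {D : Type u} [Category.{v} D] [DoubleCategory.{w, t} D]
  {E : Type u₁} [Category.{v₁} E] [DoubleCategory.{w₁, t₁} E]

/-- The counit inside `conjN` is absorbed by the opcartesian cell, leaving `φ_r` next to the unit of
the conjoint. The explicit formula for `conjN` is not needed after this. -/
theorem VertTrans.extend_conjN [ConjointClosed E] {F G : LaxFunctor D E} (φ : VertTrans F G)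
    {x y : D} (r : Hor x y) : (conj (φ.app x)).extend (F.hor r) ≫ᵥ φ.conjN r =
      lamInv _ ≫ᵥ hc (conj (φ.app y)).unit (φ.cell r) (by simp) := by
  have h := (conj (φ.app x)).extend_hc_counit (φ.cell r) (k := 𝟙 _) (by simp)
  simp only [honeMap_id, vcomp_cid] at h
  rw [VertTrans.conjN, vcomp_reassoc (lamInv_hc_cid ((conj (φ.app x)).extend (F.hor r))
    (by simp)).symm]
  simp only [vcomp_assoc, hc_vcomp, cid_vcomp, vcomp_cid]
  exact congrArg (_ ≫ᵥ ·) (hc_congr rfl h _ _)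

theorem VertTrans.compN_restrict [CompanionClosed E] {F G : LaxFunctor D E} (ψ : VertTrans F G)
    {x y : D} (r : Hor x y) : ψ.compN r ≫ᵥ (companion (ψ.app x)).restrict (G.hor r) =
      hc (companion (ψ.app y)).counit (ψ.cell r) (by simp) ≫ᵥ lam _ := by
  have h := (companion (ψ.app x)).rhoInv_hc_unit_restrict
    (hc (companion (ψ.app y)).counit (ψ.cell r) (by simp) ≫ᵥ lam _) (k := 𝟙 _) (by simp)
  simp only [honeMap_id, cid_vcomp] at h
  rw [← h, VertTrans.compN]
  simp

/-- A lax functor carries the opcartesian cell to the opcartesian cell followed by `conjComp`; hence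
invertibility of `conjComp` says exactly that `T` preserves these extensions. -/
theorem LaxFunctor.map_extend [ConjointClosed D] [ConjointClosed E] (T : LaxFunctor D E)
    {a b c : D} (r : Hor a c) (f : a ⟶ b) :
    T.cell ((conj f).extend r) =
      (conj (T.base.map f)).extend (T.hor r) ≫ᵥ T.conjComp r f := by
  -- `sigma` is the mate of the unit cell: restricted along the unit of `(T f)^*` it gives back the
  -- image of the unit of `f^*`.
  have h₁ : (conj (T.base.map f)).unit ≫ᵥ T.sigma f = T.unitC a ≫ᵥ T.cell (conj f).unit := by
    rw [LaxFunctor.sigma, vcomp_reassoc (lamInv_hc_cid (conj (T.base.map f)).unit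
      (by simp)).symm]
    simp only [vcomp_assoc, hc_vcomp_assoc, cid_vcomp, Conjoint.unit_counit]
    rw [hc_honeMap_rho, lamInv_hone, rhoInv_rho_assoc]
  -- The right unit law of `T` with the unitors moved to the other side.
  have h₂ : rhoInv (T.hor r) ≫ᵥ hc (cid (T.hor r)) (T.unitC a) (by simp) ≫ᵥ T.compC r (hone a) =
      T.cell (rhoInv r) := by
    have h := congrArg (fun θ => rhoInv (T.hor r) ≫ᵥ θ ≫ᵥ T.cell (rhoInv r)) (T.right_unit r)
    simp only [vcomp_assoc, ← LaxFunctor.cell_vcomp] at h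
    simpa using h
  have h₃ := T.compC_nat (cid r) (conj f).unit (by simp)
  rw [Conjoint.extend, Conjoint.extend, LaxFunctor.conjComp, LaxFunctor.cell_vcomp, ← h₂]
  simp only [vcomp_assoc, hc_vcomp_assoc, cid_vcomp]
  rw [← h₃]
  refine congrArg (_ ≫ᵥ ·) ?_
  rw [hc_vcomp_assoc]
  exact congrArg (· ≫ᵥ _) (hc_congr (by simp) h₁.symm _ _)

theorem LaxFunctor.compComp_restrict [CompanionClosed D] [CompanionClosed E] (S : LaxFunctor D E)
    {a b c : D} (r : Hor b c) (f : a ⟶ b) :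
    S.compComp r f ≫ᵥ (companion (S.base.map f)).restrict (S.hor r) =
      S.cell ((companion f).restrict r) := by
  have h := (companion (S.base.map f)).rhoInv_hc_unit_restrict
    (S.cell ((companion f).restrict r)) (k := 𝟙 _) (by simp)
  simp only [honeMap_id, cid_vcomp] at h
  refine Eq.trans ?_ h
  rw [LaxFunctor.compComp, vcomp_assoc]
  rfl

end Comparisons

/-! ### Extensions along vertical morphisms, and exact 2-cells. -/

section Extensions

variable {D : Type u} [Category.{v} D] [DoubleCategory.{w, t} D]
  {E : Type u₁} [Category.{v₁} E] [DoubleCategory.{w₁, t₁} E]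

theorem IsInv.cancel_left {a b c d a' b' : D} {r : Hor a b} {s : Hor c d} {q : Hor a' b'}
    {θ : Cell r s} (h : IsInv θ) {χ χ' : Cell s q} (e : θ ≫ᵥ χ = θ ≫ᵥ χ') : χ = χ' := by
  obtain ⟨θ', -, h₂⟩ := h
  rw [← cid_vcomp χ, ← h₂, vcomp_assoc, e, ← vcomp_assoc, h₂, cid_vcomp]

theorem IsInv.vcomp_inv {a b c d : D} {r : Hor a b} {s : Hor c d} {θ : Cell r s} (h : IsInv θ) :
    θ ≫ᵥ h.inv = cid r := h.choose_spec.1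

theorem IsInv.map (F : LaxFunctor D E) {a b c d : D} {r : Hor a b} {s : Hor c d} {θ : Cell r s}
    (h : IsInv θ) : IsInv (F.cell θ) := by
  obtain ⟨ξ, h₁, h₂⟩ := h
  exact ⟨F.cell ξ, by rw [← F.cell_vcomp, h₁, F.cell_cid], by rw [← F.cell_vcomp, h₂, F.cell_cid]⟩

theorem isInv_assoc {a b c d : D} (t : Hor c d) (s : Hor b c) (r : Hor a b) :
    IsInv (assoc t s r) := ⟨assocInv t s r, by simp, by simp⟩

theorem isInv_assocInv {a b c d : D} (t : Hor c d) (s : Hor b c) (r : Hor a b) :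
    IsInv (assocInv t s r) := ⟨assoc t s r, by simp, by simp⟩

/-- A 2-cell `r ⟶ s` over `f` exhibits `s` as `r · f^*`. -/
def IsExtension [ConjointClosed D] {a b c : D} (f : a ⟶ b) {r : Hor a c} {s : Hor b c}
    (θ : Cell r s) : Prop :=
  ∃ κ : Cell (hcomp r (conj f).hor) s, IsInv κ ∧ dom κ = 𝟙 b ∧ cod κ = 𝟙 c ∧
    θ = (conj f).extend r ≫ᵥ κ

/-- A 2-cell `r ⟶ s` over `f` and `g` is exact when the corresponding 2-cell
`r · f^* ⟶ g^* · s` is invertible. -/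
def IsExact [ConjointClosed D] {a b c d : D} (f : a ⟶ c) (g : b ⟶ d) {r : Hor a b} {s : Hor c d}
    (θ : Cell r s) (h : dom θ = f) (h' : cod θ = g) : Prop :=
  ∃ κ : Cell (hcomp r (conj f).hor) (hcomp (conj g).hor s), IsInv κ ∧ dom κ = 𝟙 c ∧ cod κ = 𝟙 b ∧
    (conj f).extend r ≫ᵥ κ = lamInv r ≫ᵥ hc (conj g).unit θ (by simp [h'])

/-- The only use made of a strong conjoint is this one: `conjN` is the invertible cell that
exactness asks for, by `extend_conjN`. -/
theorem VertTrans.HasStrongConjoint.isExact [ConjointClosed E] {F G : LaxFunctor D E}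
    {φ : VertTrans F G} (h : φ.HasStrongConjoint) {x y : D} (r : Hor x y) :
    IsExact (φ.app x) (φ.app y) (φ.cell r) (φ.dom_cell r) (φ.cod_cell r) :=
  ⟨φ.conjN r, h r, φ.dom_conjN r, φ.cod_conjN r, φ.extend_conjN r⟩

namespace IsExtension

variable [ConjointClosed D] [ConjointClosed E] {a b c : D} {f : a ⟶ b}

theorem extend (f : a ⟶ b) (r : Hor a c) : IsExtension f ((conj f).extend r) :=
  ⟨cid _, isInv_cid _, by simp, by simp, by simp⟩

variable {r : Hor a c} {s : Hor b c} {θ : Cell r s}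

theorem dom_eq (h : IsExtension f θ) : dom θ = f := by
  obtain ⟨κ, -, h₁, h₂, rfl⟩ := h
  simp [h₁]

theorem cod_eq (h : IsExtension f θ) : cod θ = 𝟙 c := by
  obtain ⟨κ, -, h₁, h₂, rfl⟩ := h
  simp [h₂]

/-- The opcartesian property transported along the invertible comparison; the closure properties
below are all proved for the sake of this cancellation. -/
theorem hom_ext (h : IsExtension f θ) {d e : D} {q : Hor d e} {χ χ' : Cell s q}
    (h₁ : dom χ = dom χ') (h₂ : θ ≫ᵥ χ = θ ≫ᵥ χ') : χ = χ' := by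
  obtain ⟨κ, hκ, h₃, h₄, rfl⟩ := h
  refine hκ.cancel_left ((conj f).extend_hom_ext (by simp [h₁]) ?_)
  simpa using h₂

theorem vcomp_isInv (h : IsExtension f θ) {q : Hor b c} {κ : Cell s q} (hκ : IsInv κ)
    (h₁ : dom κ = 𝟙 b) (h₂ : cod κ = 𝟙 c) : IsExtension f (θ ≫ᵥ κ) := by
  obtain ⟨κ', hκ', h₃, h₄, rfl⟩ := h
  exact ⟨κ' ≫ᵥ κ, hκ'.vcomp hκ, by simp [h₁, h₃], by simp [h₂, h₄], by simp⟩

theorem isInv_vcomp (h : IsExtension f θ) {q : Hor a c} {κ : Cell q r} (hκ : IsInv κ)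
    (h₁ : dom κ = 𝟙 a) (h₂ : cod κ = 𝟙 c) : IsExtension f (κ ≫ᵥ θ) := by
  obtain ⟨κ', hκ', h₃, h₄, rfl⟩ := h
  refine ⟨hc κ (cid _) (by simp [h₁]) ≫ᵥ κ', IsInv.vcomp (IsInv.hc hκ (isInv_cid _) h₁ (by simp) _)
    hκ', by simp [h₃], by simp [h₂, h₄], ?_⟩
  rw [vcomp_reassoc ((conj f).extend_nat κ h₁)]
  simp

theorem hc_cid (h : IsExtension f θ) {d : D} (t : Hor c d) (e : cod θ = dom (cid t)) :
    IsExtension f (hc (cid t) θ e) := by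
  obtain ⟨κ, hκ, h₃, h₄, rfl⟩ := h
  refine ⟨assoc t r _ ≫ᵥ hc (cid t) κ (by simp [h₄]), IsInv.vcomp (isInv_assoc _ _ _)
    (IsInv.hc (isInv_cid _) hκ (by simp) h₄ _), by simp [h₃], by simp, ?_⟩
  rw [vcomp_reassoc ((conj f).hc_cid_extend t r).symm]
  simp

/-- By `map_extend`, the image of an extension is the opcartesian cell for `T f` followed by
`conjComp` and an image of an invertible cell. -/
theorem map {T : LaxFunctor D E}
    (hT : ∀ {a b c : D} (r : Hor a c) (f : a ⟶ b), IsInv (T.conjComp r f))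
    (h : IsExtension f θ) : IsExtension (T.base.map f) (T.cell θ) := by
  obtain ⟨κ, hκ, h₃, h₄, rfl⟩ := h
  refine ⟨T.conjComp r f ≫ᵥ T.cell κ, (hT r f).vcomp (hκ.map T), ?_, ?_, ?_⟩
  · simp [T.dom_conjComp, h₃]
  · simp [T.cod_conjComp, h₄]
  · rw [T.cell_vcomp, T.map_extend, vcomp_assoc]

/-- If `s` is `r · f^*`, then `s · q` is `r · (f^* · q)`. Exactness of `φ` replaces `f^* · q` by `p
· g^*`, so `s · q` is `(r · p) · g^*`. This is the step that turns the strong conjoint hypothesis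
into a cancellation principle. -/
theorem hc_isExact (h : IsExtension f θ) {d e : D} {g : d ⟶ e} {p : Hor d a} {q : Hor e b}
    {φ : Cell p q} {h₁ : dom φ = g} {h₂ : cod φ = f} (hφ : IsExact g f φ h₁ h₂)
    (h₃ : cod φ = dom θ) : IsExtension g (hc θ φ h₃) := by
  obtain ⟨κ, hκ, h₄, h₅, rfl⟩ := h
  obtain ⟨N, hN, h₆, h₇, h₈⟩ := hφ
  -- The case in which `θ` is the opcartesian cell itself. The unit of `f^*` is moved from `r` onto
  -- `φ` across the associator, where it forms the cell that defines exactness.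
  have e₁ : hc ((conj f).extend r) φ (by simp [h₂]) =
      (conj g).extend (hcomp r p) ≫ᵥ assoc r p (conj g).hor ≫ᵥ hc (cid r) N (by simp [h₇]) ≫ᵥ
        assocInv r (conj f).hor q := by
    have e₂ : hc ((conj f).extend r) φ (by simp [h₂]) = hc (rhoInv r) (cid p) (by simp) ≫ᵥ
      hc (hc (cid r) (conj f).unit (by simp)) φ (by simp [h₂]) := by simp [Conjoint.extend]
    have e₃ := assoc_nat (cid r) (conj f).unit φ (by simp) (by simp [h₂])
    have e₄ : hc (rhoInv r) (cid p) (by simp) ≫ᵥ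
        hc (hc (cid r) (conj f).unit (by simp)) φ (by simp [h₂]) ≫ᵥ assoc r (conj f).hor q =
        hc (cid r) (lamInv p ≫ᵥ hc (conj f).unit φ (by simp [h₂])) (by simp) := by
      rw [e₃, vcomp_reassoc (rhoInv_triangle r p)]
      simp
    have e₅ := congrArg (· ≫ᵥ assocInv r (conj f).hor q) e₄
    simp only [vcomp_assoc, assoc_assocInv, vcomp_cid] at e₅
    rw [e₂, e₅, vcomp_reassoc ((conj g).hc_cid_extend r p).symm, hc_vcomp_assoc]
    exact congrArg (· ≫ᵥ _) (hc_congr (by simp) h₈.symm _ _)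
  -- The comparison is `(r · p) · g^* ≅ r · (p · g^*) ≅ r · (f^* · q) ≅ (r · f^*) · q`, followed by
  -- the comparison for `θ` whiskered by `q`.
  refine ⟨(assoc r p (conj g).hor ≫ᵥ hc (cid r) N (by simp [h₇]) ≫ᵥ
        assocInv r (conj f).hor q) ≫ᵥ hc κ (cid q) (by simp [h₄]), ?_, ?_, ?_, ?_⟩
  · exact ((isInv_assoc _ _ _).vcomp ((IsInv.hc (isInv_cid _) hN (by simp) h₇ _).vcomp
      (isInv_assocInv _ _ _))).vcomp (IsInv.hc hκ (isInv_cid _) h₄ (by simp) _)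
  · simp [h₆]
  · simp [h₅]
  · rw [← vcomp_assoc, ← e₁]
    simp

end IsExtension

end Extensions

/-! ### Components of monads and monad morphisms, with composite lax functors unfolded. -/

section MonadCells

variable {D : Type u} [Category.{v} D] [DoubleCategory.{w, t} D]
  {E : Type u₁} [Category.{v₁} E] [DoubleCategory.{w₁, t₁} E]

namespace LaxMonad

variable (S : LaxMonad D)

/-- The component `r ⟶ S r` of the unit. -/
def unitCell {x y : D} (r : Hor x y) : Cell r (S.toFun.hor r) := S.e.cell r

/-- The component `S S r ⟶ S r` of the multiplication. -/
def mulCell {x y : D} (r : Hor x y) : Cell (S.toFun.hor (S.toFun.hor r)) (S.toFun.hor r) :=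
  S.m.cell r

@[simp]
theorem dom_unitCell {x y : D} (r : Hor x y) : dom (S.unitCell r) = S.e.app x := S.e.dom_cell r

@[simp]
theorem cod_unitCell {x y : D} (r : Hor x y) : cod (S.unitCell r) = S.e.app y := S.e.cod_cell r

@[simp]
theorem dom_mulCell {x y : D} (r : Hor x y) : dom (S.mulCell r) = S.m.app x := S.m.dom_cell r

@[simp]
theorem cod_mulCell {x y : D} (r : Hor x y) : cod (S.mulCell r) = S.m.app y := S.m.cod_cell r

theorem unitCell_nat {a b c d : D} {r : Hor a b} {s : Hor c d} (θ : Cell r s) :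
    θ ≫ᵥ S.unitCell s = S.unitCell r ≫ᵥ S.toFun.cell θ := S.e.cell_naturality θ

theorem mulCell_nat {a b c d : D} {r : Hor a b} {s : Hor c d} (θ : Cell r s) :
    S.toFun.cell (S.toFun.cell θ) ≫ᵥ S.mulCell s = S.mulCell r ≫ᵥ S.toFun.cell θ :=
  S.m.cell_naturality θ

end LaxMonad

theorem LaxFunctor.unitC_compC_lam (F : LaxFunctor D E) {a b : D} (r : Hor a b) :
    hc (F.unitC b) (cid (F.hor r)) (by simp) ≫ᵥ F.compC (hone b) r ≫ᵥ F.cell (lam r) =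
      lam (F.hor r) := F.left_unit r

/-- The associativity law of an algebra is written with `assocInv`, so the coherence of the
comparison is needed for the inverse associator. -/
theorem LaxFunctor.assocInv_comp (F : LaxFunctor D E) {a b c d : D} (p : Hor c d) (s : Hor b c)
    (r : Hor a b) : hc (cid (F.hor p)) (F.compC s r) (by simp) ≫ᵥ F.compC p (hcomp s r) ≫ᵥ
      F.cell (assocInv p s r) = assocInv (F.hor p) (F.hor s) (F.hor r) ≫ᵥ
        hc (F.compC p s) (cid (F.hor r)) (by simp) ≫ᵥ F.compC (hcomp p s) r := by
  have h := congrArg (fun θ => assocInv (F.hor p) (F.hor s) (F.hor r) ≫ᵥ θ ≫ᵥ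
    F.cell (assocInv p s r)) (F.assoc_comp p s r)
  simp only [vcomp_assoc, assocInv_assoc_assoc] at h
  rw [← h, ← F.cell_vcomp]
  simp

namespace OplaxMonadMor

variable {S : LaxMonad D} {T : LaxMonad E} (M : OplaxMonadMor S T)

/-- The component `φ_x : F S x ⟶ T F x`. -/
def appφ (x : D) : M.F.base.obj (S.toFun.base.obj x) ⟶ T.toFun.base.obj (M.F.base.obj x) :=
  M.φ.app x

/-- The component `φ_r : F S r ⟶ T F r`. -/
def cellφ {x y : D} (r : Hor x y) : Cell (M.F.hor (S.toFun.hor r)) (T.toFun.hor (M.F.hor r)) :=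
  M.φ.cell r

@[simp]
theorem dom_cellφ {x y : D} (r : Hor x y) : dom (M.cellφ r) = M.appφ x := M.φ.dom_cell r

@[simp]
theorem cod_cellφ {x y : D} (r : Hor x y) : cod (M.cellφ r) = M.appφ y := M.φ.cod_cell r

theorem appφ_nat {x y : D} (f : x ⟶ y) : M.F.base.map (S.toFun.base.map f) ≫ M.appφ y =
    M.appφ x ≫ T.toFun.base.map (M.F.base.map f) := M.φ.naturality f

theorem cellφ_nat {a b c d : D} {r : Hor a b} {s : Hor c d} (θ : Cell r s) :
    M.F.cell (S.toFun.cell θ) ≫ᵥ M.cellφ s = M.cellφ r ≫ᵥ T.toFun.cell (M.F.cell θ) :=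
  M.φ.cell_naturality θ

theorem cellφ_unit (x : D) :
    M.F.unitC (S.toFun.base.obj x) ≫ᵥ M.F.cell (S.toFun.unitC x) ≫ᵥ M.cellφ (hone x) =
      honeMap (M.appφ x) ≫ᵥ T.toFun.unitC (M.F.base.obj x) ≫ᵥ T.toFun.cell (M.F.unitC x) :=
  (vcomp_assoc _ _ _).symm.trans (M.φ.unit x)

theorem cellφ_comp {x y z : D} (s : Hor y z) (r : Hor x y) :
    M.F.compC (S.toFun.hor s) (S.toFun.hor r) ≫ᵥ M.F.cell (S.toFun.compC s r) ≫ᵥ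
      M.cellφ (hcomp s r) = hc (M.cellφ s) (M.cellφ r) (by simp) ≫ᵥ
        T.toFun.compC (M.F.hor s) (M.F.hor r) ≫ᵥ T.toFun.cell (M.F.compC s r) :=
  (vcomp_assoc _ _ _).symm.trans (M.φ.comp s r)

theorem cell_unitCell {x y : D} (r : Hor x y) :
    M.F.cell (S.unitCell r) ≫ᵥ M.cellφ r = T.unitCell (M.F.hor r) := M.unit_cell r

theorem cell_mulCell {x y : D} (r : Hor x y) : M.F.cell (S.mulCell r) ≫ᵥ M.cellφ r =
    M.cellφ (S.toFun.hor r) ≫ᵥ T.toFun.cell (M.cellφ r) ≫ᵥ T.mulCell (M.F.hor r) :=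
  M.mul_cell r

end OplaxMonadMor

namespace LaxMonadMor

variable {S : LaxMonad D} {T : LaxMonad E} (M : LaxMonadMor T S)

/-- The component `ψ_y : S G y ⟶ G T y`. -/
def appψ (y : E) : S.toFun.base.obj (M.G.base.obj y) ⟶ M.G.base.obj (T.toFun.base.obj y) :=
  M.ψ.app y

/-- The component `ψ_r : S G r ⟶ G T r`. -/
def cellψ {x y : E} (r : Hor x y) : Cell (S.toFun.hor (M.G.hor r)) (M.G.hor (T.toFun.hor r)) :=
  M.ψ.cell r

@[simp]
theorem dom_cellψ {x y : E} (r : Hor x y) : dom (M.cellψ r) = M.appψ x := M.ψ.dom_cell r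

@[simp]
theorem cod_cellψ {x y : E} (r : Hor x y) : cod (M.cellψ r) = M.appψ y := M.ψ.cod_cell r

theorem appψ_nat {x y : E} (f : x ⟶ y) : S.toFun.base.map (M.G.base.map f) ≫ M.appψ y =
    M.appψ x ≫ M.G.base.map (T.toFun.base.map f) := M.ψ.naturality f

theorem cellψ_nat {a b c d : E} {r : Hor a b} {s : Hor c d} (θ : Cell r s) :
    S.toFun.cell (M.G.cell θ) ≫ᵥ M.cellψ s = M.cellψ r ≫ᵥ M.G.cell (T.toFun.cell θ) :=
  M.ψ.cell_naturality θ

theorem cellψ_unit (y : E) :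
    S.toFun.unitC (M.G.base.obj y) ≫ᵥ S.toFun.cell (M.G.unitC y) ≫ᵥ M.cellψ (hone y) =
      honeMap (M.appψ y) ≫ᵥ M.G.unitC (T.toFun.base.obj y) ≫ᵥ M.G.cell (T.toFun.unitC y) :=
  (vcomp_assoc _ _ _).symm.trans (M.ψ.unit y)

theorem cellψ_comp {x y z : E} (s : Hor y z) (r : Hor x y) :
    S.toFun.compC (M.G.hor s) (M.G.hor r) ≫ᵥ S.toFun.cell (M.G.compC s r) ≫ᵥ
      M.cellψ (hcomp s r) = hc (M.cellψ s) (M.cellψ r) (by simp) ≫ᵥ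
        M.G.compC (T.toFun.hor s) (T.toFun.hor r) ≫ᵥ M.G.cell (T.toFun.compC s r) :=
  (vcomp_assoc _ _ _).symm.trans (M.ψ.comp s r)

theorem unitCell_cellψ {x y : E} (r : Hor x y) :
    S.unitCell (M.G.hor r) ≫ᵥ M.cellψ r = M.G.cell (T.unitCell r) := M.unit_cell r

theorem mulCell_cellψ {x y : E} (r : Hor x y) : S.mulCell (M.G.hor r) ≫ᵥ M.cellψ r =
    S.toFun.cell (M.cellψ r) ≫ᵥ M.cellψ (T.toFun.hor r) ≫ᵥ M.G.cell (T.mulCell r) :=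
  M.mul_cell r

end LaxMonadMor

end MonadCells

/-! ### Cancellation on double and triple composites of an extended algebra. -/

section ExtendedAlgebras

variable {D : Type u} [Category.{v} D] [DoubleCategory.{w, t} D]
  {E : Type u₁} [Category.{v₁} E] [DoubleCategory.{w₁, t₁} E]

namespace OplaxMonadMor

variable [ConjointClosed E] {S : LaxMonad D} {T : LaxMonad E} (M : OplaxMonadMor S T)

section

variable {x : D} {a : Hor (S.toFun.base.obj x) x}
  {a' : Hor (T.toFun.base.obj (M.F.base.obj x)) (M.F.base.obj x)} {ι : Cell (M.F.hor a) a'}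

/-- The 2-cell `F a · F S a ⟶ a' · T a'` induced by `ι : F a ⟶ a'`. -/
def square (ι : Cell (M.F.hor a) a') (h₁ : dom ι = M.appφ x) (h₂ : cod ι = 𝟙 _) :
    Cell (hcomp (M.F.hor a) (M.F.hor (S.toFun.hor a))) (hcomp a' (T.toFun.hor a')) :=
  hc ι (M.cellφ a ≫ᵥ T.toFun.cell ι) (by simp [h₁, h₂])

/-- The square is `ι · φ_a` followed by `1 · Tι`. The first factor is an extension by exactness of
`φ_a`, the second because `T` preserves the extension `ι`; cancelling them in turn shows that cells
out of `a' · Ta'` may be tested on `Fa · FSa`. -/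
theorem square_hom_ext
    (hφ : ∀ {x y : D} (r : Hor x y), IsExact (M.appφ x) (M.appφ y) (M.cellφ r)
      (M.dom_cellφ r) (M.cod_cellφ r))
    (hT : ∀ {a b c : E} (r : Hor a c) (f : a ⟶ b), IsInv (T.toFun.conjComp r f))
    (h : IsExtension (M.appφ x) ι) {d e : E} {q : Hor d e}
    {χ χ' : Cell (hcomp a' (T.toFun.hor a')) q} (h₁ : dom χ = dom χ')
    (h₂ : M.square ι h.dom_eq h.cod_eq ≫ᵥ χ = M.square ι h.dom_eq h.cod_eq ≫ᵥ χ') : χ = χ' := by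
  have e : M.square ι h.dom_eq h.cod_eq = hc ι (M.cellφ a) (by simp [h.dom_eq]) ≫ᵥ
      hc (cid a') (T.toFun.cell ι) (by simp [h.cod_eq]) := by simp [square]
  have e₁ : IsExtension _ (hc ι (M.cellφ a) (by simp [h.dom_eq])) := h.hc_isExact (hφ a) _
  have e₂ : IsExtension _ (hc (cid a') (T.toFun.cell ι) (by simp [h.cod_eq])) :=
    (h.map hT).hc_cid a' _
  rw [e, vcomp_assoc, vcomp_assoc] at h₂
  exact e₂.hom_ext h₁ (e₁.hom_ext (by simp [h₁]) h₂)

/-- The threefold analogue of `square_hom_ext`, needed for associativity. The new point is that `Tι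
· Tφ_a` must be an extension although `Tφ_a` is not known to be exact; it is compared with the image
under `T` of `ι · φ_a`, which requires `compC` to be invertible. -/
theorem cube_hom_ext
    (hφ : ∀ {x y : D} (r : Hor x y), IsExact (M.appφ x) (M.appφ y) (M.cellφ r)
      (M.dom_cellφ r) (M.cod_cellφ r))
    (hT : ∀ {a b c : E} (r : Hor a c) (f : a ⟶ b), IsInv (T.toFun.conjComp r f))
    (hc' : ∀ {a b c : E} (s : Hor b c) (r : Hor a b), IsInv (T.toFun.compC s r))
    (h : IsExtension (M.appφ x) ι) {d e : E} {q : Hor d e}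
    {χ χ' : Cell (hcomp a' (hcomp (T.toFun.hor a') (T.toFun.hor (T.toFun.hor a')))) q}
    (h₁ : dom χ = dom χ')
    (h₂ : hc ι (hc (M.cellφ a ≫ᵥ T.toFun.cell ι) (M.cellφ (S.toFun.hor a) ≫ᵥ
        T.toFun.cell (M.cellφ a ≫ᵥ T.toFun.cell ι)) (by simp [h.dom_eq, h.cod_eq]))
          (by simp [h.dom_eq, h.cod_eq]) ≫ᵥ χ =
      hc ι (hc (M.cellφ a ≫ᵥ T.toFun.cell ι) (M.cellφ (S.toFun.hor a) ≫ᵥ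
        T.toFun.cell (M.cellφ a ≫ᵥ T.toFun.cell ι)) (by simp [h.dom_eq, h.cod_eq]))
          (by simp [h.dom_eq, h.cod_eq]) ≫ᵥ χ') : χ = χ' := by
  have e₁ : IsExtension _ (hc ι (M.cellφ a) (by simp [h.dom_eq])) := h.hc_isExact (hφ a) _
  have e₂ : IsExtension _ (hc (hc ι (M.cellφ a) (by simp [h.dom_eq]))
    (M.cellφ (S.toFun.hor a)) (by simp)) := e₁.hc_isExact (hφ _) _
  -- `k` inverts the comparison at the target. Its vertical boundaries are identities because those
  -- of `compC` are, so composing with it preserves extensions.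
  obtain ⟨k, hk₁, hk₂⟩ := hc' a' (T.toFun.hor (M.F.hor a))
  have hk : IsInv k := ⟨_, hk₂, hk₁⟩
  have hkd : dom k = 𝟙 _ := by simpa using congrArg dom hk₁
  have hkc : cod k = 𝟙 _ := by simpa using congrArg cod hk₁
  -- By naturality of `compC`, this cell is `T (ι · φ_a)` with the invertible comparisons composed
  -- on both sides.
  have e₃ : IsExtension (T.toFun.base.map (M.appφ (S.toFun.base.obj x))) (hc (T.toFun.cell ι) (T.toFun.cell (M.cellφ a))
      (by simp [h.dom_eq])) := by
    have := ((e₁.map hT).isInv_vcomp (hc' (M.F.hor a) (M.F.hor (S.toFun.hor a))) (by simp)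
      (by simp)).vcomp_isInv hk hkd hkc
    rw [← T.toFun.compC_nat, vcomp_assoc, hk₁, vcomp_cid] at this
    exact this
  have e₄ := e₃.hc_cid a' (by simp [h.cod_eq])
  have e₅ := (((h.map hT).map hT).hc_cid (T.toFun.hor a') (by simp [h.cod_eq])).hc_cid a' (by simp)
  -- The cube factors into `(ι · φ_a) · φ_{Sa}`, then `1 · (Tι · Tφ_a)`, then `1 · (1 · TTι)`, with
  -- associators between them. The three extensions are `e₂`, `e₄` and `e₅`.
  have e₆ : hc ι (hc (M.cellφ a ≫ᵥ T.toFun.cell ι) (M.cellφ (S.toFun.hor a) ≫ᵥ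
        T.toFun.cell (M.cellφ a ≫ᵥ T.toFun.cell ι)) (by simp [h.dom_eq, h.cod_eq]))
          (by simp [h.dom_eq, h.cod_eq]) =
      assocInv _ _ _ ≫ᵥ hc (hc ι (M.cellφ a) (by simp [h.dom_eq]))
        (M.cellφ (S.toFun.hor a)) (by simp) ≫ᵥ assoc _ _ _ ≫ᵥ hc (cid a') (hc (T.toFun.cell ι)
          (T.toFun.cell (M.cellφ a)) (by simp [h.dom_eq])) (by simp [h.cod_eq]) ≫ᵥ
          hc (cid a') (hc (cid _) (T.toFun.cell (T.toFun.cell ι)) (by simp [h.cod_eq]))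
            (by simp) := by
    rw [vcomp_reassoc (assocInv_nat ι (M.cellφ a) (M.cellφ (S.toFun.hor a)) (by simp [h.dom_eq])
      (by simp))]
    simp
  rw [e₆] at h₂
  simp only [vcomp_assoc] at h₂
  refine e₅.hom_ext h₁ (e₄.hom_ext (by simp [h₁]) ((isInv_assoc _ _ _).cancel_left
    (e₂.hom_ext (by simp [h₁]) ((isInv_assocInv _ _ _).cancel_left h₂))))

end

end OplaxMonadMor

end ExtendedAlgebras

/-! ### Algebra laws transferred along an extension `F a ⟶ a'`. -/

section ExtendedAlgebraLaws

variable {D : Type u} [Category.{v} D] [DoubleCategory.{w, t} D]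
  {E : Type u₁} [Category.{v₁} E] [DoubleCategory.{w₁, t₁} E]

namespace OplaxMonadMor

variable [ConjointClosed E] {S : LaxMonad D} {T : LaxMonad E} (M : OplaxMonadMor S T)
  {A : HLaxAlgData S} {a' : Hor (T.toFun.base.obj (M.F.base.obj A.x)) (M.F.base.obj A.x)}
  {ι : Cell (M.F.hor A.a) a'} {υ' : Cell (hone (M.F.base.obj A.x)) a'}
  {μ' : Cell (hcomp a' (T.toFun.hor a')) a'}

/-- Only the two equations `eυ` and `eμ` are used about the new structure, so the laws are proved
without unfolding the formula for `F_!μ`. The law is tested on `1 · ι`; there `ι` followed by the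
unit of `T` is the image of the unit of `S` followed by `φ_a ≫ Tι`, so the left unit law of `A`
applies under `F`. -/
theorem extended_left_unit (hA : A.IsAlg) (h : IsExtension (M.appφ A.x) ι)
    (dυ : dom υ' = T.e.app (M.F.base.obj A.x))
    (dμ : dom μ' = T.m.app (M.F.base.obj A.x))
    (eυ : υ' = M.F.unitC A.x ≫ᵥ M.F.cell A.υ ≫ᵥ ι)
    (eμ : M.square ι h.dom_eq h.cod_eq ≫ᵥ μ' =
      M.F.compC A.a (S.toFun.hor A.a) ≫ᵥ M.F.cell A.μ ≫ᵥ ι) :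
    hc υ' (T.unitCell a') (by simp [dυ]) ≫ᵥ μ' = lam a' := by
  refine (h.hc_cid (hone _) (by simp [h.cod_eq])).hom_ext ?_ ?_
  · simp only [dom_vcomp, dom_hc, LaxMonad.dom_unitCell, dμ, dom_lam]
    exact T.left_unit _
  · have h₁ : ι ≫ᵥ T.unitCell a' =
        M.F.cell (S.unitCell A.a) ≫ᵥ M.cellφ A.a ≫ᵥ T.toFun.cell ι := by
      rw [T.unitCell_nat, vcomp_reassoc (M.cell_unitCell A.a)]
    have h₂ : hc (cid _) ι (by simp [h.cod_eq]) ≫ᵥ hc υ' (T.unitCell a') (by simp [dυ]) =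
        hc (M.F.unitC A.x) (cid (M.F.hor A.a)) (by simp) ≫ᵥ
          hc (M.F.cell A.υ) (M.F.cell (S.unitCell A.a)) (by simp) ≫ᵥ
            M.square ι h.dom_eq h.cod_eq := by
      simp only [square, hc_vcomp, cid_vcomp]
      exact hc_congr eυ h₁ _ _
    have h₃ := M.F.compC_nat_assoc A.υ (S.unitCell A.a) (by simp) (M.F.cell A.μ ≫ᵥ ι)
    have h₄ : hc A.υ (S.unitCell A.a) (by simp) ≫ᵥ A.μ = lam A.a := hA.left_unit
    rw [vcomp_reassoc h₂, vcomp_assoc, vcomp_assoc, eμ, h₃, M.F.cell_vcomp_assoc, h₄,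
      hc_cid_lam, ← M.F.unitC_compC_lam]
    simp only [vcomp_assoc]

/-- The law is tested on `ι · 1`, where the compatibility of `φ` with identity comparisons turns
`Tυ'` into the image of `Sυ`; the right unit law of `A` then applies under `F`. -/
theorem extended_right_unit (hA : A.IsAlg) (h : IsExtension (M.appφ A.x) ι)
    (dυ : dom υ' = T.e.app (M.F.base.obj A.x)) (cυ : cod υ' = 𝟙 _)
    (dμ : dom μ' = T.m.app (M.F.base.obj A.x))
    (eυ : υ' = M.F.unitC A.x ≫ᵥ M.F.cell A.υ ≫ᵥ ι)
    (eμ : M.square ι h.dom_eq h.cod_eq ≫ᵥ μ' =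
      M.F.compC A.a (S.toFun.hor A.a) ≫ᵥ M.F.cell A.μ ≫ᵥ ι) :
    hc (cid a') (T.toFun.unitC (M.F.base.obj A.x) ≫ᵥ T.toFun.cell υ') (by simp [cυ]) ≫ᵥ μ' =
      rho a' := by
  -- By naturality of the right unitor, `ι · 1` is `ι` conjugated by invertible cells with identity
  -- boundaries; this makes it an extension without any exactness of an identity loop.
  have hι : IsExtension (M.appφ A.x) (rho _ ≫ᵥ ι ≫ᵥ rhoInv _) := by
    refine IsExtension.isInv_vcomp (h.vcomp_isInv ⟨rho _, by simp, by simp⟩ (by simp) (by simp))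
      ⟨rhoInv _, by simp, by simp⟩ (by simp) (by simp)
  have hι' : rho _ ≫ᵥ ι ≫ᵥ rhoInv _ = hc ι (honeMap (M.appφ A.x)) (by simp [h.dom_eq]) := by
    rw [← vcomp_assoc, ← hc_honeMap_rho ι (k := M.appφ A.x) (by simp [h.dom_eq])]
    simp
  rw [hι'] at hι
  refine hι.hom_ext ?_ ?_
  · simp only [dom_vcomp, dom_hc, LaxFunctor.dom_unitC, LaxFunctor.dom_cell, dυ, dμ, dom_rho,
      Category.id_comp]
    exact T.right_unit _
  · have h₁ : honeMap (M.appφ A.x) ≫ᵥ T.toFun.unitC (M.F.base.obj A.x) ≫ᵥ T.toFun.cell υ' =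
        M.F.unitC (S.toFun.base.obj A.x) ≫ᵥ M.F.cell (S.toFun.unitC A.x ≫ᵥ S.toFun.cell A.υ) ≫ᵥ
          M.cellφ A.a ≫ᵥ T.toFun.cell ι := by
      have e := M.cellφ_unit A.x
      rw [eυ, T.toFun.cell_vcomp, T.toFun.cell_vcomp, M.F.cell_vcomp, vcomp_assoc,
        vcomp_reassoc (M.cellφ_nat A.υ)]
      have e' := vcomp_congr e (T.toFun.cell (M.F.cell A.υ) ≫ᵥ T.toFun.cell ι)
      simp only [vcomp_assoc] at e' ⊢
      exact e'.symm
    have h₂ : hc ι (honeMap (M.appφ A.x)) (by simp [h.dom_eq]) ≫ᵥ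
        hc (cid a') (T.toFun.unitC (M.F.base.obj A.x) ≫ᵥ T.toFun.cell υ') (by simp [cυ]) =
        hc (cid (M.F.hor A.a)) (M.F.unitC (S.toFun.base.obj A.x)) (by simp) ≫ᵥ
          hc (M.F.cell (cid A.a)) (M.F.cell (S.toFun.unitC A.x ≫ᵥ S.toFun.cell A.υ)) (by simp) ≫ᵥ
            M.square ι h.dom_eq h.cod_eq := by
      simp only [square, hc_vcomp]
      exact hc_congr (by simp) h₁ _ _
    have h₃ := M.F.compC_nat_assoc (cid A.a) (S.toFun.unitC A.x ≫ᵥ S.toFun.cell A.υ) (by simp)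
      (M.F.cell A.μ ≫ᵥ ι)
    rw [vcomp_reassoc h₂, vcomp_assoc, vcomp_assoc, eμ, h₃, M.F.cell_vcomp_assoc, hA.right_unit,
      hc_honeMap_rho, ← M.F.right_unit]
    simp only [vcomp_assoc]

/-- Tested on the cube, both sides become composites of comparisons of `F`, the image under `F` of
one side of the associativity law of `A`, and `ι`. The two bracketings of the comparisons agree by
the coherence of `F`. -/
theorem extended_assoc
    (hφ : ∀ {x y : D} (r : Hor x y), IsExact (M.appφ x) (M.appφ y) (M.cellφ r)
      (M.dom_cellφ r) (M.cod_cellφ r))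
    (hT : ∀ {a b c : E} (r : Hor a c) (f : a ⟶ b), IsInv (T.toFun.conjComp r f))
    (hc' : ∀ {a b c : E} (s : Hor b c) (r : Hor a b), IsInv (T.toFun.compC s r))
    (hA : A.IsAlg) (h : IsExtension (M.appφ A.x) ι)
    (dμ : dom μ' = T.m.app (M.F.base.obj A.x)) (cμ : cod μ' = 𝟙 _)
    (eμ : M.square ι h.dom_eq h.cod_eq ≫ᵥ μ' =
      M.F.compC A.a (S.toFun.hor A.a) ≫ᵥ M.F.cell A.μ ≫ᵥ ι) :
    hc (cid a') (T.toFun.compC a' (T.toFun.hor a') ≫ᵥ T.toFun.cell μ') (by simp [cμ]) ≫ᵥ μ' =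
      assocInv _ _ _ ≫ᵥ hc μ' (T.mulCell a') (by simp [dμ]) ≫ᵥ μ' := by
  refine M.cube_hom_ext hφ hT hc' h ?_ ?_
  · simp only [dom_vcomp, dom_hc, LaxFunctor.dom_compC, LaxFunctor.dom_cell, dμ, dom_assocInv,
      Category.id_comp, LaxMonad.dom_mulCell]
    exact T.mul_assoc _
  · have h₁ : hc (M.cellφ A.a ≫ᵥ T.toFun.cell ι) (M.cellφ (S.toFun.hor A.a) ≫ᵥ
        T.toFun.cell (M.cellφ A.a ≫ᵥ T.toFun.cell ι)) (by simp [h.dom_eq, h.cod_eq]) ≫ᵥ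
          T.toFun.compC a' (T.toFun.hor a') ≫ᵥ T.toFun.cell μ' =
        M.F.compC (S.toFun.hor A.a) (S.toFun.hor (S.toFun.hor A.a)) ≫ᵥ
          M.F.cell (S.toFun.compC A.a (S.toFun.hor A.a) ≫ᵥ S.toFun.cell A.μ) ≫ᵥ
            M.cellφ A.a ≫ᵥ T.toFun.cell ι := by
      have e₁ := T.toFun.compC_nat_assoc ι (M.cellφ A.a ≫ᵥ T.toFun.cell ι)
        (by simp [h.dom_eq, h.cod_eq]) (T.toFun.cell μ')
      have e₂ : T.toFun.cell (M.square ι h.dom_eq h.cod_eq) ≫ᵥ T.toFun.cell μ' =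
          T.toFun.cell (M.F.compC A.a (S.toFun.hor A.a)) ≫ᵥ T.toFun.cell (M.F.cell A.μ) ≫ᵥ
            T.toFun.cell ι := by
        rw [← LaxFunctor.cell_vcomp, eμ, LaxFunctor.cell_vcomp, LaxFunctor.cell_vcomp]
      have e₃ := vcomp_congr (M.cellφ_comp A.a (S.toFun.hor A.a))
        (T.toFun.cell (M.F.cell A.μ) ≫ᵥ T.toFun.cell ι)
      have e₄ := vcomp_congr (M.cellφ_nat A.μ) (T.toFun.cell ι)
      have e₅ : hc (M.cellφ A.a ≫ᵥ T.toFun.cell ι) (M.cellφ (S.toFun.hor A.a) ≫ᵥ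
          T.toFun.cell (M.cellφ A.a ≫ᵥ T.toFun.cell ι)) (by simp [h.dom_eq, h.cod_eq]) =
          hc (M.cellφ A.a) (M.cellφ (S.toFun.hor A.a)) (by simp) ≫ᵥ hc (T.toFun.cell ι)
            (T.toFun.cell (M.cellφ A.a ≫ᵥ T.toFun.cell ι)) (by simp [h.dom_eq, h.cod_eq]) := by
        simp only [hc_vcomp]
      simp only [vcomp_assoc] at e₃ e₄
      rw [e₅, vcomp_assoc, e₁, M.F.cell_vcomp, vcomp_assoc, e₄, e₃]
      exact congrArg (_ ≫ᵥ _ ≫ᵥ ·) e₂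
    have h₂ : hc ι (hc (M.cellφ A.a ≫ᵥ T.toFun.cell ι) (M.cellφ (S.toFun.hor A.a) ≫ᵥ
        T.toFun.cell (M.cellφ A.a ≫ᵥ T.toFun.cell ι)) (by simp [h.dom_eq, h.cod_eq]))
          (by simp [h.dom_eq, h.cod_eq]) ≫ᵥ
        hc (cid a') (T.toFun.compC a' (T.toFun.hor a') ≫ᵥ T.toFun.cell μ') (by simp [cμ]) =
        hc (cid (M.F.hor A.a)) (M.F.compC (S.toFun.hor A.a) (S.toFun.hor (S.toFun.hor A.a)))
          (by simp) ≫ᵥ hc (M.F.cell (cid A.a)) (M.F.cell (S.toFun.compC A.a (S.toFun.hor A.a) ≫ᵥ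
            S.toFun.cell A.μ)) (by simp) ≫ᵥ M.square ι h.dom_eq h.cod_eq := by
      simp only [square, hc_vcomp]
      exact hc_congr (by simp) h₁ _ _
    have h₃ : hc ι (hc (M.cellφ A.a ≫ᵥ T.toFun.cell ι) (M.cellφ (S.toFun.hor A.a) ≫ᵥ
        T.toFun.cell (M.cellφ A.a ≫ᵥ T.toFun.cell ι)) (by simp [h.dom_eq, h.cod_eq]))
          (by simp [h.dom_eq, h.cod_eq]) ≫ᵥ assocInv _ _ _ = assocInv _ _ _ ≫ᵥ
        hc (M.square ι h.dom_eq h.cod_eq) (M.cellφ (S.toFun.hor A.a) ≫ᵥ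
        T.toFun.cell (M.cellφ A.a ≫ᵥ T.toFun.cell ι)) (by simp [square, h.dom_eq, h.cod_eq]) :=
      (assocInv_nat _ _ _ _ _).symm
    -- The last factor on the other side: this is the axiom relating `φ` to the two monad
    -- multiplications.
    have h₄ : (M.cellφ (S.toFun.hor A.a) ≫ᵥ T.toFun.cell (M.cellφ A.a ≫ᵥ T.toFun.cell ι)) ≫ᵥ
        T.mulCell a' = M.F.cell (S.mulCell A.a) ≫ᵥ M.cellφ A.a ≫ᵥ T.toFun.cell ι := by
      rw [T.toFun.cell_vcomp, vcomp_assoc, vcomp_assoc, T.mulCell_nat,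
        vcomp_reassoc (M.cell_mulCell A.a)]
      simp only [vcomp_assoc]
    have h₅ : hc (M.square ι h.dom_eq h.cod_eq) (M.cellφ (S.toFun.hor A.a) ≫ᵥ
        T.toFun.cell (M.cellφ A.a ≫ᵥ T.toFun.cell ι)) (by simp [square, h.dom_eq, h.cod_eq]) ≫ᵥ
          hc μ' (T.mulCell a') (by simp [dμ]) =
        hc (M.F.compC A.a (S.toFun.hor A.a)) (cid (M.F.hor (S.toFun.hor (S.toFun.hor A.a))))
          (by simp) ≫ᵥ hc (M.F.cell A.μ) (M.F.cell (S.mulCell A.a)) (by simp) ≫ᵥ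
            M.square ι h.dom_eq h.cod_eq := by
      simp only [square, hc_vcomp, cid_vcomp]
      exact hc_congr eμ h₄ _ _
    have h₆ := M.F.compC_nat_assoc (cid A.a) (S.toFun.compC A.a (S.toFun.hor A.a) ≫ᵥ
      S.toFun.cell A.μ) (by simp) (M.F.cell A.μ ≫ᵥ ι)
    have h₇ := M.F.compC_nat_assoc A.μ (S.mulCell A.a) (by simp) (M.F.cell A.μ ≫ᵥ ι)
    have h₈ : hc (cid A.a) (S.toFun.compC A.a (S.toFun.hor A.a) ≫ᵥ S.toFun.cell A.μ)
        (by simp) ≫ᵥ A.μ = assocInv _ _ _ ≫ᵥ hc A.μ (S.mulCell A.a) (by simp) ≫ᵥ A.μ := hA.assoc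
    have h₉ := vcomp_congr (M.F.assocInv_comp A.a (S.toFun.hor A.a)
      (S.toFun.hor (S.toFun.hor A.a)))
      (M.F.cell (hc A.μ (S.mulCell A.a) (by simp) ≫ᵥ A.μ) ≫ᵥ ι)
    rw [vcomp_reassoc h₂, vcomp_assoc, vcomp_assoc, eμ, h₆, M.F.cell_vcomp_assoc, h₈,
      vcomp_reassoc h₃, vcomp_assoc, vcomp_reassoc h₅, vcomp_assoc, vcomp_assoc, eμ, h₇]
    simp only [vcomp_assoc, M.F.cell_vcomp] at h₉ ⊢
    exact h₉

end OplaxMonadMor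

end ExtendedAlgebraLaws

/-! ### Rearrangement of conjoints inside the multiplication of `F_!`. -/

section ConjointShuffle

variable {D : Type u} [Category.{v} D] [DoubleCategory.{w, t} D]

namespace Conjoint

/-- This identifies `F_!υ` with `Fυ` followed by the opcartesian cell. The formula for `F_!υ` starts
with a left unitor and `extend` with a right one; on an identity they coincide. -/
theorem lamInv_hc_unit {a b c d : D} {f : a ⟶ b} (C : Conjoint f) {r : Hor a c}
    (θ : Cell (hone d) r) {k : d ⟶ a} (h : dom θ = k) :
    lamInv (hone d) ≫ᵥ hc θ (honeMap k ≫ᵥ C.unit) (by simp [h]) = θ ≫ᵥ C.extend r := by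
  have e : hc θ (honeMap k ≫ᵥ C.unit) (by simp [h]) =
      hc θ (honeMap k) (by simp [h]) ≫ᵥ hc (cid r) C.unit (by simp) := by simp
  rw [e, lamInv_hone, vcomp_reassoc (rhoInv_hc_honeMap θ (by simp [h])), extend, vcomp_assoc]

theorem rhoInv_hc_unit {a c a' b' c' : D} {f' : a' ⟶ b'} (C' : Conjoint f') {r : Hor a c}
    {s : Hor a' c'} (β : Cell r s) {k : a ⟶ a'} (h : dom β = k) :
    rhoInv r ≫ᵥ hc β (honeMap k ≫ᵥ C'.unit) (by simp [h]) = β ≫ᵥ C'.extend s := by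
  have e : hc β (honeMap k ≫ᵥ C'.unit) (by simp [h]) =
      hc β (honeMap k) (by simp [h]) ≫ᵥ hc (cid s) C'.unit (by simp) := by simp
  rw [e, vcomp_reassoc (rhoInv_hc_honeMap β (by simp [h])), extend, vcomp_assoc]

/-- The unit inside `extend` meets `m`, and `hm` converts it into the unit of the second conjoint.
With `m` the cell `φ_f^*`, this computes `F_!` on morphisms. -/
theorem extend_hc {a b c a' b' c' : D} {f : a ⟶ b} (C : Conjoint f) {f' : a' ⟶ b'}
    (C' : Conjoint f') {r : Hor a c} {s : Hor a' c'} (β : Cell r s) (m : Cell C.hor C'.hor)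
    {k : a ⟶ a'} (h : dom β = k) (hm : C.unit ≫ᵥ m = honeMap k ≫ᵥ C'.unit)
    (h' : cod m = dom β) :
    C.extend r ≫ᵥ hc β m h' = β ≫ᵥ C'.extend s := by
  have e : hc (cid r) C.unit (by simp) ≫ᵥ hc β m h' =
      hc β (honeMap k ≫ᵥ C'.unit) (by simp [h]) := by
    rw [hc_vcomp]
    exact hc_congr (by simp) hm _ _
  rw [extend, vcomp_assoc, e, rhoInv_hc_unit C' β h]

/-- The interchange of the conjoints of `f`, `g` and `h` along `φ : q ⟶ r` over `g` and `f`. -/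
theorem extend_shuffle {s₀ s₁ t₀ t₁ t₂ y : D} {f : s₀ ⟶ t₀} {g : s₁ ⟶ t₁} {h : t₁ ⟶ t₂}
    (Cf : Conjoint f) (Cg : Conjoint g) (Ch : Conjoint h) {p : Hor s₀ y} {q : Hor s₁ s₀}
    {r : Hor t₁ t₀} {r' : Hor t₂ t₀} {φ : Cell q r} {τ : Cell r r'}
    {θ : Cell r' (hcomp r Ch.hor)} {n : Cell (hcomp Cf.hor r) (hcomp q Cg.hor)}
    (cφ : cod φ = f) (cτ : cod τ = 𝟙 _) (cθ : cod θ = 𝟙 _)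
    (dn : dom n = 𝟙 _) (cn : cod n = 𝟙 _) (hθ : τ ≫ᵥ θ = Ch.extend r)
    (hn : lamInv q ≫ᵥ hc Cf.unit φ (by simp [cφ]) ≫ᵥ n = Cg.extend q) :
    hc (Cf.extend p) (φ ≫ᵥ τ) (by simp [cφ, cτ]) ≫ᵥ assoc p Cf.hor r' ≫ᵥ
      hc (cid p) (hc (cid Cf.hor) θ (by simp [cθ]) ≫ᵥ assocInv Cf.hor r Ch.hor ≫ᵥ
        hc n (cid Ch.hor) (by simp [dn]) ≫ᵥ assoc q Cg.hor Ch.hor) (by simp [cn]) ≫ᵥ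
          assocInv p q (hcomp Cg.hor Ch.hor) =
    rhoInv (hcomp p q) ≫ᵥ hc (cid (hcomp p q)) (Cg.unit ≫ᵥ Ch.extend Cg.hor) (by simp) := by
  -- The unit of `f^*` is carried across the associator, so that the rest of the computation takes
  -- place under `p`.
  have e₁ : hc (Cf.extend p) (φ ≫ᵥ τ) (by simp [cφ, cτ]) ≫ᵥ assoc p Cf.hor r' =
      hc (cid p) (lamInv q ≫ᵥ hc Cf.unit (φ ≫ᵥ τ) (by simp [cφ, cτ])) (by simp) := by
    have e : hc (Cf.extend p) (φ ≫ᵥ τ) (by simp [cφ, cτ]) = hc (rhoInv p) (cid q) (by simp) ≫ᵥ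
        hc (hc (cid p) Cf.unit (by simp)) (φ ≫ᵥ τ) (by simp [cφ, cτ]) := by simp [extend]
    rw [e, vcomp_assoc, assoc_nat (cid p) Cf.unit (φ ≫ᵥ τ) (by simp) (by simp [cφ, cτ]),
      vcomp_reassoc (rhoInv_triangle p q)]
    simp
  -- `hθ` turns `τ` followed by `θ` into an extension along `h`; that extension slides past `n` by
  -- naturality, and `hn` then trades `φ` next to the unit of `f^*` for an extension along `g`.
  have e₂ : lamInv q ≫ᵥ hc Cf.unit (φ ≫ᵥ τ) (by simp [cφ, cτ]) ≫ᵥ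
      hc (cid Cf.hor) θ (by simp [cθ]) ≫ᵥ assocInv Cf.hor r Ch.hor ≫ᵥ
        hc n (cid Ch.hor) (by simp [dn]) ≫ᵥ assoc q Cg.hor Ch.hor =
      rhoInv q ≫ᵥ hc (cid q) (Cg.unit ≫ᵥ Ch.extend Cg.hor) (by simp) := by
    have i₁ : hc Cf.unit (φ ≫ᵥ τ) (by simp [cφ, cτ]) ≫ᵥ hc (cid Cf.hor) θ (by simp [cθ]) =
        hc Cf.unit φ (by simp [cφ]) ≫ᵥ hc (cid Cf.hor) (Ch.extend r) (by simp) := by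
      rw [hc_vcomp, hc_vcomp]
      exact hc_congr rfl (by rw [vcomp_assoc, hθ]) _ _
    have i₂ := Ch.extend_nat n dn
    have i₃ : Cg.extend q ≫ᵥ Ch.extend (hcomp q Cg.hor) ≫ᵥ assoc q Cg.hor Ch.hor =
        rhoInv q ≫ᵥ hc (cid q) (Cg.unit ≫ᵥ Ch.extend Cg.hor) (by simp) := by
      rw [← Ch.hc_cid_extend]
      simp [extend]
    rw [vcomp_reassoc i₁, Ch.hc_cid_extend, vcomp_assoc, vcomp_assoc, assoc_assocInv_assoc,
      ← vcomp_assoc (Ch.extend (hcomp Cf.hor r)), ← i₂, ← i₃, ← hn]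
    simp only [vcomp_assoc]
  rw [vcomp_reassoc e₁, hc_vcomp_assoc]
  have e₃ := hc_congr (β := cid p ≫ᵥ cid p) (β' := cid p ≫ᵥ cid p) rfl
    ((vcomp_assoc _ _ _).trans e₂) (by simp [cn]) (by simp)
  rw [e₃, ← hc_vcomp (cid p) (rhoInv q) (by simp) (cid p)
    (hc (cid q) (Cg.unit ≫ᵥ Ch.extend Cg.hor) (by simp)) (by simp), vcomp_assoc,
    ← assocInv_nat (cid p) (cid q) (Cg.unit ≫ᵥ Ch.extend Cg.hor) (by simp) (by simp),
    vcomp_reassoc (rhoInv_assocInv p q)]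
  simp

end Conjoint

end ConjointShuffle

/-! ### The functor `F_!`. -/

section ExtendedAlgebras

variable {D : Type u} [Category.{v} D] [DoubleCategory.{w, t} D]
  {E : Type u₁} [Category.{v₁} E] [DoubleCategory.{w₁, t₁} E]

namespace OplaxMonadMor

variable [ConjointClosed E] {S : LaxMonad D} {T : LaxMonad E} (M : OplaxMonadMor S T)

/-- The opcartesian 2-cell `F a ⟶ F a · φ_x^*`. -/
def ext (A : HLaxAlgData S) : Cell (M.F.hor A.a) (hcomp (M.F.hor A.a) (M.conjφ A.x).hor) :=
  (M.conjφ A.x).extend (M.F.hor A.a)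

theorem isExtension_ext (A : HLaxAlgData S) : IsExtension (M.appφ A.x) (M.ext A) :=
  IsExtension.extend (M.appφ A.x) (M.F.hor A.a)

/-- As 2-cells into a conjoint, both sides are determined by their composites with the counit. There
the counits in the definition of `mC` cancel the units, and what remains is the object part of the
compatibility of `φ` with multiplications. -/
theorem unit_mC (x : D) : (M.conjφ (S.toFun.base.obj x)).unit ≫ᵥ
    (conj (T.toFun.base.map (M.φ.app x))).extend (M.conjφ (S.toFun.base.obj x)).hor ≫ᵥ M.mC x =
      honeMap (M.F.base.map (S.m.app x)) ≫ᵥ (M.conjφ x).unit := by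
  refine (M.conjφ x).hom_ext ?_ ?_
  · simp only [cod_vcomp, Conjoint.cod_unit, Conjoint.cod_extend, cod_mC, cod_honeMap]
    exact (Category.id_comp _).trans ((Category.id_comp _).trans (Category.comp_id _).symm)
  · have h := (conj (T.toFun.base.map (M.φ.app x))).extend_hc_counit
      ((M.conjφ (S.toFun.base.obj x)).counit ≫ᵥ honeMap (T.toFun.base.map (M.φ.app x)))
      (k := 𝟙 _) (by simp)
    simp only [honeMap_id, vcomp_cid] at h
    have h' := vcomp_congr h (honeMap (T.m.app (M.F.base.obj x)))
    have e := congrArg honeMap (M.mul x)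
    simp only [honeMap_comp, vcomp_assoc] at h' e
    simp only [vcomp_assoc, mC, Conjoint.lift_counit, Conjoint.unit_counit]
    rw [e]
    refine (congrArg (_ ≫ᵥ ·) h').trans ?_
    rw [vcomp_reassoc (M.conjφ (S.toFun.base.obj x)).unit_counit]

theorem unit_fC {x y : D} (f : x ⟶ y) : (M.conjφ x).unit ≫ᵥ M.fC f =
    honeMap (M.F.base.map (S.toFun.base.map f)) ≫ᵥ (M.conjφ y).unit := by
  refine (M.conjφ y).hom_ext ?_ ?_
  · simp only [cod_vcomp, Conjoint.cod_unit, cod_fC, cod_honeMap]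
    exact (Category.id_comp _).trans (Category.comp_id _).symm
  · have e := congrArg honeMap (M.φ.naturality f)
    simp only [vcomp_assoc, fC, Conjoint.lift_counit, Conjoint.unit_counit]
    rw [vcomp_reassoc (M.conjφ x).unit_counit]
    exact (honeMap_comp _ _).symm.trans (e.symm.trans (honeMap_comp _ _))

theorem ext_algMapCell {A B : HLaxAlgData S} (h : A.PreHom B) :
    M.ext A ≫ᵥ M.algMapCell h = M.F.cell h.ζ ≫ᵥ M.ext B :=
  (M.conjφ A.x).extend_hc (M.conjφ B.x) _ _ (by simp) (M.unit_fC h.f) _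

variable (hφ : M.φ.HasStrongConjoint)
  (hT : ∀ {a b c : E} (r : Hor a c) (f : a ⟶ b), IsInv (T.toFun.conjComp r f))

theorem algObj_υ (A : HLaxAlgData S) :
    (M.algObj hφ hT A).υ = M.F.unitC A.x ≫ᵥ M.F.cell A.υ ≫ᵥ M.ext A :=
  ((M.conjφ A.x).lamInv_hc_unit (M.F.unitC A.x ≫ᵥ M.F.cell A.υ) (by simp)).trans
    (vcomp_assoc _ _ _)

/-- The characterisation of `F_!μ` that replaces its formula. Restricting along the square cancels
the two chosen inverses in `shuffle` and leaves the units of `φ_{Sx}^*` and `(Tφ_x)^*`, which `mC`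
merges into the unit of `φ_x^*`. -/
theorem square_algObj_μ (A : HLaxAlgData S) :
    M.square (M.ext A) (M.isExtension_ext A).dom_eq (M.isExtension_ext A).cod_eq ≫ᵥ
      (M.algObj hφ hT A).μ =
    M.F.compC A.a (S.toFun.hor A.a) ≫ᵥ M.F.cell A.μ ≫ᵥ M.ext A := by
  have h := (M.conjφ A.x).extend_shuffle (M.conjφ (S.toFun.base.obj A.x))
    (conj (T.toFun.base.map (M.φ.app A.x))) (p := M.F.hor A.a) (φ := M.cellφ A.a)
    (τ := T.toFun.cell (M.ext A)) (θ := M.theta hT A) (n := M.nInv hφ A)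
    (M.cod_cellφ A.a) (by simp [(M.isExtension_ext A).cod_eq]) (M.cod_theta hT A)
    (M.dom_nInv hφ A) (M.cod_nInv hφ A)
    (by
      -- `theta` cancels the comparison that appears when `T` is applied to the opcartesian cell.
      rw [ext, LaxFunctor.map_extend, vcomp_assoc]
      exact (congrArg (_ ≫ᵥ ·) (hT _ _).vcomp_inv).trans (vcomp_cid _))
    (by
      -- `nInv` cancels `conjN`, after `φ_a` next to the unit has been recognised as a restriction
      -- of `conjN`.
      have e := vcomp_congr (M.φ.extend_conjN A.a).symm (M.nInv hφ A)
      simp only [vcomp_assoc] at e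
      exact e.trans ((congrArg (_ ≫ᵥ ·) (hφ A.a).vcomp_inv).trans (vcomp_cid _)))
  have e : M.square (M.ext A) (M.isExtension_ext A).dom_eq (M.isExtension_ext A).cod_eq ≫ᵥ
      (M.algObj hφ hT A).μ = rhoInv _ ≫ᵥ
        hc (cid _) ((M.conjφ (S.toFun.base.obj A.x)).unit ≫ᵥ
          (conj (T.toFun.base.map (M.φ.app A.x))).extend (M.conjφ (S.toFun.base.obj A.x)).hor)
          (by simp) ≫ᵥ
        hc (M.F.compC A.a (S.toFun.hor A.a) ≫ᵥ M.F.cell A.μ) (M.mC A.x) (by simp [cod_mC]) := by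
    have h' := vcomp_congr h (hc (M.F.compC A.a (S.toFun.hor A.a) ≫ᵥ M.F.cell A.μ) (M.mC A.x)
      (by simp [cod_mC]))
    simp only [vcomp_assoc] at h'
    exact h'
  rw [e]
  have e₂ : hc (cid (hcomp (M.F.hor A.a) (M.F.hor (S.toFun.hor A.a))))
      ((M.conjφ (S.toFun.base.obj A.x)).unit ≫ᵥ (conj (T.toFun.base.map (M.φ.app A.x))).extend
        (M.conjφ (S.toFun.base.obj A.x)).hor) (by simp) ≫ᵥ
      hc (M.F.compC A.a (S.toFun.hor A.a) ≫ᵥ M.F.cell A.μ) (M.mC A.x) (by simp [cod_mC]) =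
      hc (M.F.compC A.a (S.toFun.hor A.a) ≫ᵥ M.F.cell A.μ)
        (honeMap (M.F.base.map (S.m.app A.x)) ≫ᵥ (M.conjφ A.x).unit) (by simp) := by
    rw [hc_vcomp]
    exact hc_congr (by simp) ((vcomp_assoc _ _ _).trans (M.unit_mC A.x)) _ _
  rw [e₂]
  exact ((M.conjφ A.x).rhoInv_hc_unit _ (by simp)).trans (vcomp_assoc _ _ _)

theorem algObj_isAlg (hc' : ∀ {a b c : E} (s : Hor b c) (r : Hor a b), IsInv (T.toFun.compC s r))
    {A : HLaxAlgData S} (hA : A.IsAlg) : (M.algObj hφ hT A).IsAlg where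
  left_unit := M.extended_left_unit hA (M.isExtension_ext A) (M.algObj hφ hT A).dom_υ
    (M.algObj hφ hT A).dom_μ (M.algObj_υ hφ hT A) (M.square_algObj_μ hφ hT A)
  right_unit := M.extended_right_unit hA (M.isExtension_ext A) (M.algObj hφ hT A).dom_υ
    (M.algObj hφ hT A).cod_υ (M.algObj hφ hT A).dom_μ (M.algObj_υ hφ hT A)
    (M.square_algObj_μ hφ hT A)
  assoc := M.extended_assoc (fun r => hφ.isExact r) hT hc' hA (M.isExtension_ext A)
    (M.algObj hφ hT A).dom_μ (M.algObj hφ hT A).cod_μ (M.square_algObj_μ hφ hT A)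

/-- The two conditions on a morphism out of the extended algebra are equivalent to conditions on `ι
≫ ζ` alone, and here the useful direction is recorded: the unit condition by substituting `eυ`, the
multiplication condition by testing on the square. -/
theorem extended_isHom {A : HLaxAlgData S}
    {a' : Hor (T.toFun.base.obj (M.F.base.obj A.x)) (M.F.base.obj A.x)}
    {ι : Cell (M.F.hor A.a) a'} {υ' : Cell (hone (M.F.base.obj A.x)) a'}
    {μ' : Cell (hcomp a' (T.toFun.hor a')) a'}
    (hφ : ∀ {x y : D} (r : Hor x y), IsExact (M.appφ x) (M.appφ y) (M.cellφ r)
      (M.dom_cellφ r) (M.cod_cellφ r))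
    (hT : ∀ {a b c : E} (r : Hor a c) (f : a ⟶ b), IsInv (T.toFun.conjComp r f))
    (h : IsExtension (M.appφ A.x) ι)
    (dμ : dom μ' = T.m.app (M.F.base.obj A.x))
    (eυ : υ' = M.F.unitC A.x ≫ᵥ M.F.cell A.υ ≫ᵥ ι)
    (eμ : M.square ι h.dom_eq h.cod_eq ≫ᵥ μ' =
      M.F.compC A.a (S.toFun.hor A.a) ≫ᵥ M.F.cell A.μ ≫ᵥ ι)
    {B : HLaxAlgData T} (g : M.F.base.obj A.x ⟶ B.x) (ζ : Cell a' B.a)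
    (dζ : dom ζ = T.toFun.base.map g) (cζ : cod ζ = g)
    (h₁ : M.F.unitC A.x ≫ᵥ M.F.cell A.υ ≫ᵥ ι ≫ᵥ ζ = honeMap g ≫ᵥ B.υ)
    (h₂ : M.F.compC A.a (S.toFun.hor A.a) ≫ᵥ M.F.cell A.μ ≫ᵥ ι ≫ᵥ ζ =
      hc (ι ≫ᵥ ζ) (M.cellφ A.a ≫ᵥ T.toFun.cell (ι ≫ᵥ ζ)) (by simp [h.dom_eq, h.cod_eq, dζ, cζ]) ≫ᵥ
        B.μ) :
    υ' ≫ᵥ ζ = honeMap g ≫ᵥ B.υ ∧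
      μ' ≫ᵥ ζ = hc ζ (T.toFun.cell ζ) (by simp [dζ, cζ]) ≫ᵥ B.μ := by
  refine ⟨by rw [eυ, vcomp_assoc, vcomp_assoc, h₁], M.square_hom_ext hφ hT h ?_ ?_⟩
  · simp only [dom_vcomp, dom_hc, dμ, LaxFunctor.dom_cell, dζ, B.dom_μ]
    exact (T.m.naturality g).symm
  · have e : M.square ι h.dom_eq h.cod_eq ≫ᵥ hc ζ (T.toFun.cell ζ) (by simp [dζ, cζ]) =
        hc (ι ≫ᵥ ζ) (M.cellφ A.a ≫ᵥ T.toFun.cell (ι ≫ᵥ ζ))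
          (by simp [h.dom_eq, h.cod_eq, dζ, cζ]) := by
      rw [square, hc_vcomp]
      exact hc_congr rfl (by simp) _ _
    rw [vcomp_reassoc eμ, vcomp_reassoc e, ← h₂]
    simp only [vcomp_assoc]

/-- The restriction of `k.ζ` is allowed to be given in another form `ξ`. In the two applications, to
images of morphisms and to the counit, `ξ` is a composite of images under `F` with `ι` or `ε`. -/
theorem isHom_of_ext {A : HLaxAlgData S} {B : HLaxAlgData T} (k : (M.algObj hφ hT A).PreHom B)
    (ξ : Cell (M.F.hor A.a) B.a) (hξ : M.ext A ≫ᵥ k.ζ = ξ)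
    (dξ : dom ξ = M.appφ A.x ≫ T.toFun.base.map k.f)
    (cξ : cod ξ = k.f) (h₁ : M.F.unitC A.x ≫ᵥ M.F.cell A.υ ≫ᵥ ξ = honeMap k.f ≫ᵥ B.υ)
    (h₂ : M.F.compC A.a (S.toFun.hor A.a) ≫ᵥ M.F.cell A.μ ≫ᵥ ξ =
      hc ξ (M.cellφ A.a ≫ᵥ T.toFun.cell ξ) (by simp [dξ, cξ]) ≫ᵥ B.μ) : k.IsHom := by
  subst hξ
  have h := M.extended_isHom (fun r => hφ.isExact r) hT (M.isExtension_ext A)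
    (M.algObj hφ hT A).dom_μ (M.algObj_υ hφ hT A) (M.square_algObj_μ hφ hT A) k.f k.ζ
    k.dom_ζ k.cod_ζ h₁ h₂
  exact ⟨h.1, h.2⟩

/-- The restriction of `Fζ · φ_f^*` is `Fζ ≫ ι_B`, so the conditions reduce to the image under `F`
of those for `h`, once `F_!υ` and `F_!μ` of the target have been evaluated on `ι_B` and its square.
-/
theorem baseChange_isHom {A B : HLaxAlg S} (h : A ⟶ B) :
    ((M.baseChange hφ hT).map h).IsHom := by
  have e₁ : A.υ ≫ᵥ h.ζ = honeMap h.f ≫ᵥ B.υ := h.isHom.unit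
  have e₂ : A.μ ≫ᵥ h.ζ = hc h.ζ (S.toFun.cell h.ζ) (by simp) ≫ᵥ B.μ := h.isHom.mul
  have dB := (M.isExtension_ext B.toHLaxAlgData).dom_eq
  have cB := (M.isExtension_ext B.toHLaxAlgData).cod_eq
  have f₁ : dom (M.F.cell h.ζ ≫ᵥ M.ext B.toHLaxAlgData) =
      M.appφ A.x ≫ T.toFun.base.map (M.F.base.map h.f) := by
    simp only [dom_vcomp, dB, LaxFunctor.dom_cell, HLaxAlgData.PreHom.dom_ζ]
    exact M.appφ_nat h.f
  have f₂ : cod (M.F.cell h.ζ ≫ᵥ M.ext B.toHLaxAlgData) = M.F.base.map h.f := by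
    simp only [cod_vcomp, cB, LaxFunctor.cod_cell, HLaxAlgData.PreHom.cod_ζ, Category.comp_id]
  have f₃ : M.F.unitC A.x ≫ᵥ M.F.cell A.υ ≫ᵥ M.F.cell h.ζ ≫ᵥ M.ext B.toHLaxAlgData =
      honeMap (M.F.base.map h.f) ≫ᵥ M.F.unitC B.x ≫ᵥ M.F.cell B.υ ≫ᵥ M.ext B.toHLaxAlgData := by
    rw [M.F.cell_vcomp_assoc, e₁, M.F.cell_vcomp, vcomp_assoc, ← M.F.unitC_nat_assoc]
  have f₄ : M.F.compC A.a (S.toFun.hor A.a) ≫ᵥ M.F.cell A.μ ≫ᵥ M.F.cell h.ζ ≫ᵥ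
      M.ext B.toHLaxAlgData = hc (M.F.cell h.ζ) (M.F.cell (S.toFun.cell h.ζ)) (by simp) ≫ᵥ
        M.F.compC B.a (S.toFun.hor B.a) ≫ᵥ M.F.cell B.μ ≫ᵥ M.ext B.toHLaxAlgData := by
    have e₃ := M.F.compC_nat_assoc h.ζ (S.toFun.cell h.ζ) (by simp)
      (M.F.cell B.μ ≫ᵥ M.ext B.toHLaxAlgData)
    rw [M.F.cell_vcomp_assoc, e₂, M.F.cell_vcomp, vcomp_assoc, ← e₃]
  have f₅ : hc (M.F.cell h.ζ) (M.F.cell (S.toFun.cell h.ζ)) (by simp) ≫ᵥ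
      M.square (M.ext B.toHLaxAlgData) dB cB = hc (M.F.cell h.ζ ≫ᵥ M.ext B.toHLaxAlgData)
        (M.cellφ A.a ≫ᵥ T.toFun.cell (M.F.cell h.ζ ≫ᵥ M.ext B.toHLaxAlgData))
        (by rw [f₁, cod_vcomp, T.toFun.cod_cell, f₂, M.cod_cellφ]) := by
    rw [square, hc_vcomp]
    refine hc_congr rfl ?_ _ _
    rw [T.toFun.cell_vcomp, ← vcomp_assoc, ← vcomp_assoc, M.cellφ_nat]
  have f₆ := M.square_algObj_μ hφ hT B.toHLaxAlgData
  rw [← f₆] at f₄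
  exact M.isHom_of_ext hφ hT _ _ (M.ext_algMapCell h.toPreHom) f₁ f₂
    (f₃.trans (congrArg (_ ≫ᵥ ·) (M.algObj_υ hφ hT B.toHLaxAlgData).symm))
    (f₄.trans (vcomp_reassoc f₅ _))

/-- Preservation of identities and composites is tested on the opcartesian cell, where it becomes
functoriality of `F` on 2-cells. -/
theorem baseChange_isFunctorial
    (hc' : ∀ {a b c : E} (s : Hor b c) (r : Hor a b), IsInv (T.toFun.compC s r)) :
    (M.baseChange hφ hT).IsFunctorial where
  isAlg A := M.algObj_isAlg hφ hT hc' A.isAlg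
  isHom h := M.baseChange_isHom hφ hT h
  map_id A := HLaxAlgData.PreHom.ext (M.F.base.map_id _) <|
    (M.isExtension_ext A.toHLaxAlgData).hom_ext (by
      refine (M.dom_algMapCell _).trans (Eq.trans ?_ (dom_cid _).symm)
      exact (congrArg T.toFun.base.map (M.F.base.map_id _)).trans (T.toFun.base.map_id _))
      ((M.ext_algMapCell (HLaxAlgData.PreHom.id A.toHLaxAlgData)).trans
        ((congrArg (· ≫ᵥ _) (M.F.cell_cid _)).trans
          ((cid_vcomp _).trans (vcomp_cid _).symm)))
  map_comp {A B C} h k := HLaxAlgData.PreHom.ext (M.F.base.map_comp _ _) <|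
    (M.isExtension_ext A.toHLaxAlgData).hom_ext (by
      refine (M.dom_algMapCell _).trans (Eq.trans ?_ (dom_vcomp _ _).symm)
      refine Eq.trans ?_ (congrArg₂ (· ≫ ·) (M.dom_algMapCell h.toPreHom)
        (M.dom_algMapCell k.toPreHom)).symm
      exact (congrArg T.toFun.base.map (M.F.base.map_comp _ _)).trans (T.toFun.base.map_comp _ _))
      (by
        refine (M.ext_algMapCell (HLaxAlgData.PreHom.comp h.toPreHom k.toPreHom)).trans ?_
        refine Eq.trans ?_ (vcomp_reassoc (M.ext_algMapCell h.toPreHom) _).symm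
        refine Eq.trans ?_ (vcomp_assoc _ _ _).symm
        refine Eq.trans ?_ (congrArg (_ ≫ᵥ ·) (M.ext_algMapCell k.toPreHom)).symm
        exact (congrArg (· ≫ᵥ _) (M.F.cell_vcomp _ _)).trans (vcomp_assoc _ _ _))

end OplaxMonadMor

end ExtendedAlgebras

/-! ### Rearrangement of companions inside the multiplication of `G_!`. -/

section CompanionShuffle

variable {D : Type u} [Category.{v} D] [DoubleCategory.{w, t} D]

namespace Companion

theorem lamInv_hc_restrict {a b c d : D} {f : a ⟶ b} (C : Companion f) {r : Hor b c}
    (θ : Cell (hone d) r) {k : d ⟶ a} (h : dom θ = k ≫ f) :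
    lamInv (hone d) ≫ᵥ hc θ (honeMap k ≫ᵥ C.unit) (by simp [h]) ≫ᵥ C.restrict r = θ := by
  rw [lamInv_hone, C.rhoInv_hc_unit_restrict θ h]

/-- Dual to `extend_hc`: `hm` lets the counit of the second companion be replaced by that of the
first, and the loop left over is absorbed by the right unitor. -/
theorem hc_restrict {a b c a' b' c' : D} {f : a ⟶ b} (C : Companion f) {f' : a' ⟶ b'}
    (C' : Companion f') {r : Hor b c} {s : Hor b' c'} (β : Cell r s) (m : Cell C.hor C'.hor)
    {k : b ⟶ b'} (h : dom β = k) (hm : m ≫ᵥ C'.counit = C.counit ≫ᵥ honeMap k)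
    (h' : cod m = dom β) : hc β m h' ≫ᵥ C'.restrict s = C.restrict r ≫ᵥ β := by
  have e : hc β m h' ≫ᵥ hc (cid s) C'.counit (by simp) =
      hc (cid r) C.counit (by simp) ≫ᵥ hc β (honeMap k) (by simp [h]) := by
    rw [hc_vcomp, hc_vcomp]
    exact hc_congr (by simp) hm _ _
  rw [restrict, vcomp_reassoc e, vcomp_assoc, hc_honeMap_rho, restrict, vcomp_assoc]

/-- The interchange of the companions of `f`, `g` and `h` along `ψ : q ⟶ r` over `g` and `f`. -/
theorem shuffle_restrict {s₀ s₁ s₂ t₀ t₁ y : D} {f : s₀ ⟶ t₀} {g : s₁ ⟶ t₁} {h : s₂ ⟶ s₁}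
    (Cf : Companion f) (Cg : Companion g) (Ch : Companion h) {p : Hor t₀ y} {q : Hor s₁ s₀}
    {r : Hor t₁ t₀} {q' : Hor s₂ s₀} {ψ : Cell q r} {τ : Cell q' q}
    {θ : Cell q' (hcomp q Ch.hor)} {n : Cell (hcomp Cf.hor q) (hcomp r Cg.hor)}
    (cψ : cod ψ = f) (cτ : cod τ = 𝟙 _) (cθ : cod θ = 𝟙 _)
    (dn : dom n = 𝟙 _) (cn : cod n = 𝟙 _) (hθ : θ ≫ᵥ Ch.restrict q = τ)
    (hn : n ≫ᵥ Cg.restrict r = hc Cf.counit ψ (by simp [cψ]) ≫ᵥ lam r) :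
    assoc p Cf.hor q' ≫ᵥ
      hc (cid p) (hc (cid Cf.hor) θ (by simp [cθ]) ≫ᵥ assocInv Cf.hor q Ch.hor ≫ᵥ
        hc n (cid Ch.hor) (by simp [dn]) ≫ᵥ assoc r Cg.hor Ch.hor) (by simp [cn]) ≫ᵥ
          assocInv p r (hcomp Cg.hor Ch.hor) ≫ᵥ
      hc (cid (hcomp p r)) (hc Cg.counit (Ch.counit ≫ᵥ honeMap g) (by simp) ≫ᵥ lam _)
        (by simp) ≫ᵥ rho (hcomp p r) =
    hc (Cf.restrict p) (τ ≫ᵥ ψ) (by simp [cψ, cτ]) := by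
  -- Applying the two counits side by side amounts to restricting along `h` first and applying the
  -- counit for `g` afterwards.
  have i₁ : hc Cg.counit (Ch.counit ≫ᵥ honeMap g) (by simp) ≫ᵥ lam (hone t₁) =
      Ch.restrict Cg.hor ≫ᵥ Cg.counit := by
    have e : hc Cg.counit (Ch.counit ≫ᵥ honeMap g) (by simp) =
        hc (cid Cg.hor) Ch.counit (by simp) ≫ᵥ hc Cg.counit (honeMap g) (by simp) := by simp
    rw [e, lam_hone, vcomp_assoc, hc_honeMap_rho, restrict, vcomp_assoc]
  have i₂ : assoc r Cg.hor Ch.hor ≫ᵥ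
      hc (cid r) (hc Cg.counit (Ch.counit ≫ᵥ honeMap g) (by simp) ≫ᵥ lam _) (by simp) ≫ᵥ rho r =
      Ch.restrict (hcomp r Cg.hor) ≫ᵥ Cg.restrict r := by
    have e : hc (cid r) (hc Cg.counit (Ch.counit ≫ᵥ honeMap g) (by simp) ≫ᵥ lam _) (by simp) =
        hc (cid r) (Ch.restrict Cg.hor) (by simp) ≫ᵥ hc (cid r) Cg.counit (by simp) := by
      rw [hc_vcomp]
      exact hc_congr (by simp) i₁ _ _
    rw [e, ← Ch.assocInv_restrict, vcomp_assoc, vcomp_assoc, assoc_assocInv_assoc]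
    rfl
  have i₃ : hc (cid Cf.hor) θ (by simp [cθ]) ≫ᵥ hc (cid Cf.hor) (Ch.restrict q) (by simp) ≫ᵥ
      hc Cf.counit ψ (by simp [cψ]) = hc Cf.counit (τ ≫ᵥ ψ) (by simp [cψ, cτ]) := by
    rw [hc_vcomp, hc_vcomp]
    exact hc_congr (by simp) (by rw [← hθ, vcomp_assoc]) _ _
  -- The part under `p`: restriction along `h` slides back past `n`, so that `hn` applies to `n` and
  -- `hθ` to `θ`, leaving `ψ` next to the counit of `f_!`.
  have i₄ : (hc (cid Cf.hor) θ (by simp [cθ]) ≫ᵥ assocInv Cf.hor q Ch.hor ≫ᵥ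
        hc n (cid Ch.hor) (by simp [dn]) ≫ᵥ assoc r Cg.hor Ch.hor) ≫ᵥ
      hc (cid r) (hc Cg.counit (Ch.counit ≫ᵥ honeMap g) (by simp) ≫ᵥ lam _) (by simp) ≫ᵥ rho r =
      hc Cf.counit (τ ≫ᵥ ψ) (by simp [cψ, cτ]) ≫ᵥ lam r := by
    rw [← i₃]
    simp only [vcomp_assoc]
    rw [i₂, ← vcomp_assoc (hc n _ _), ← Ch.restrict_nat n dn, vcomp_assoc, hn,
      vcomp_reassoc (Ch.assocInv_restrict _ _)]
  have i₅ : assocInv p r (hcomp Cg.hor Ch.hor) ≫ᵥ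
      hc (cid (hcomp p r)) (hc Cg.counit (Ch.counit ≫ᵥ honeMap g) (by simp) ≫ᵥ lam _)
        (by simp) ≫ᵥ rho (hcomp p r) =
      hc (cid p) (hc (cid r) (hc Cg.counit (Ch.counit ≫ᵥ honeMap g) (by simp) ≫ᵥ lam _)
        (by simp) ≫ᵥ rho r) (by simp) := by
    have e := assocInv_nat (cid p) (cid r)
      (hc Cg.counit (Ch.counit ≫ᵥ honeMap g) (by simp) ≫ᵥ lam _) (by simp) (by simp)
    rw [hc_congr (hc_cid p r) rfl _ (by simp)] at e
    rw [vcomp_reassoc e, vcomp_assoc, assocInv_rho]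
    simp
  rw [i₅, hc_vcomp, hc_congr (vcomp_cid _) i₄ _ (by simp)]
  -- The remaining counit is carried across the associator to `p`; the triangle turns the left
  -- unitor of `r` into the right unitor that completes `restrict p`.
  have e₁ : hc (cid p) (hc Cf.counit (τ ≫ᵥ ψ) (by simp [cψ, cτ]) ≫ᵥ lam r) (by simp) =
      hc (cid p) (hc Cf.counit (τ ≫ᵥ ψ) (by simp [cψ, cτ])) (by simp) ≫ᵥ
        hc (cid p) (lam r) (by simp) := by simp
  rw [e₁, vcomp_reassoc (assoc_nat (cid p) Cf.counit (τ ≫ᵥ ψ) (by simp) (by simp [cψ, cτ])).symm,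
    vcomp_assoc, triangle]
  simp [restrict]

end Companion

end CompanionShuffle

/-! ### Algebra laws transferred along a restriction `b' ⟶ G b`. -/

section RestrictedAlgebraLaws

variable {D : Type u} [Category.{v} D] [DoubleCategory.{w, t} D]
  {E : Type u₁} [Category.{v₁} E] [DoubleCategory.{w₁, t₁} E]

/-- A 2-cell `π : q ⟶ r` over `f` and `𝟙` through which 2-cells into `r` factor at most once with
given vertical source. -/
structure IsRestriction {a b c : D} (f : a ⟶ b) {q : Hor a c} {r : Hor b c} (π : Cell q r) :
    Prop where
  dom_eq : dom π = f
  cod_eq : cod π = 𝟙 c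
  hom_ext : ∀ {d e : D} {p : Hor d e} {χ χ' : Cell p q}, dom χ = dom χ' →
    χ ≫ᵥ π = χ' ≫ᵥ π → χ = χ'

theorem Companion.isRestriction {a b c : D} {f : a ⟶ b} (C : Companion f) (r : Hor b c) :
    IsRestriction f (C.restrict r) where
  dom_eq := C.dom_restrict r
  cod_eq := C.cod_restrict r
  hom_ext := C.restrict_hom_ext

namespace LaxMonadMor

variable {S : LaxMonad D} {T : LaxMonad E} (M : LaxMonadMor T S)

/-- The 2-cell `b' · S b' ⟶ G b · G T b` induced by `π : b' ⟶ G b`. -/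
def square {y : E} {b : Hor (T.toFun.base.obj y) y}
    {b' : Hor (S.toFun.base.obj (M.G.base.obj y)) (M.G.base.obj y)} (π : Cell b' (M.G.hor b))
    (h₁ : dom π = M.appψ y) (h₂ : cod π = 𝟙 _) :
    Cell (hcomp b' (S.toFun.hor b')) (hcomp (M.G.hor b) (M.G.hor (T.toFun.hor b))) :=
  hc π (S.toFun.cell π ≫ᵥ M.cellψ b) (by simp [h₁, h₂])

variable {B : HLaxAlgData T}
  {b' : Hor (S.toFun.base.obj (M.G.base.obj B.x)) (M.G.base.obj B.x)}
  {π : Cell b' (M.G.hor B.a)} {υ' : Cell (hone (M.G.base.obj B.x)) b'}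
  {μ' : Cell (hcomp b' (S.toFun.hor b')) b'}

/-- Both sides end in `b'`, so it suffices to compose with `π`. The square built from `π` stands on
the source side and never has to be cancelled; this is why no analogue of exactness is needed for
`ψ`. -/
theorem restricted_left_unit (hB : B.IsAlg) (h : IsRestriction (M.appψ B.x) π)
    (dυ : dom υ' = S.e.app (M.G.base.obj B.x)) (dμ : dom μ' = S.m.app (M.G.base.obj B.x))
    (eυ : υ' ≫ᵥ π = M.G.unitC B.x ≫ᵥ M.G.cell B.υ)
    (eμ : μ' ≫ᵥ π =
      M.square π h.dom_eq h.cod_eq ≫ᵥ M.G.compC B.a (T.toFun.hor B.a) ≫ᵥ M.G.cell B.μ) :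
    hc υ' (S.unitCell b') (by simp [dυ]) ≫ᵥ μ' = lam b' := by
  refine h.hom_ext (by simpa [dμ] using S.left_unit _) ?_
  have h₁ : S.unitCell b' ≫ᵥ S.toFun.cell π ≫ᵥ M.cellψ B.a =
      π ≫ᵥ M.G.cell (T.unitCell B.a) := by
    rw [← M.unitCell_cellψ, ← vcomp_assoc, ← S.unitCell_nat, vcomp_assoc]
  have h₂ : hc υ' (S.unitCell b') (by simp [dυ]) ≫ᵥ M.square π h.dom_eq h.cod_eq =
      hc (cid _) π (by simp [h.cod_eq]) ≫ᵥ
        hc (M.G.unitC B.x) (cid (M.G.hor B.a)) (by simp) ≫ᵥ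
          hc (M.G.cell B.υ) (M.G.cell (T.unitCell B.a)) (by simp) := by
    simp only [square, hc_vcomp, cid_vcomp]
    exact hc_congr eυ h₁ _ _
  have h₃ := M.G.compC_nat_assoc B.υ (T.unitCell B.a) (by simp) (M.G.cell B.μ)
  have h₄ : hc B.υ (T.unitCell B.a) (by simp) ≫ᵥ B.μ = lam B.a := hB.left_unit
  rw [vcomp_assoc, eμ, vcomp_reassoc h₂, vcomp_assoc, vcomp_assoc, h₃, ← M.G.cell_vcomp, h₄,
    M.G.unitC_compC_lam, hc_cid_lam]

/-- After `π`, the compatibility of `ψ` with identity comparisons replaces `Sυ'` by the image of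
`Tυ`, and the right unit law of `B` applies under `G`. -/
theorem restricted_right_unit (hB : B.IsAlg) (h : IsRestriction (M.appψ B.x) π)
    (dυ : dom υ' = S.e.app (M.G.base.obj B.x)) (cυ : cod υ' = 𝟙 _)
    (dμ : dom μ' = S.m.app (M.G.base.obj B.x))
    (eυ : υ' ≫ᵥ π = M.G.unitC B.x ≫ᵥ M.G.cell B.υ)
    (eμ : μ' ≫ᵥ π =
      M.square π h.dom_eq h.cod_eq ≫ᵥ M.G.compC B.a (T.toFun.hor B.a) ≫ᵥ M.G.cell B.μ) :
    hc (cid b') (S.toFun.unitC (M.G.base.obj B.x) ≫ᵥ S.toFun.cell υ') (by simp [cυ]) ≫ᵥ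
      μ' = rho b' := by
  refine h.hom_ext (by simpa [dυ, dμ] using S.right_unit _) ?_
  have h₁ : (S.toFun.unitC (M.G.base.obj B.x) ≫ᵥ S.toFun.cell υ') ≫ᵥ
      S.toFun.cell π ≫ᵥ M.cellψ B.a = honeMap (M.appψ B.x) ≫ᵥ
        M.G.unitC (T.toFun.base.obj B.x) ≫ᵥ
          M.G.cell (T.toFun.unitC B.x ≫ᵥ T.toFun.cell B.υ) := by
    have e := vcomp_congr (M.cellψ_unit B.x) (M.G.cell (T.toFun.cell B.υ))
    simp only [vcomp_assoc] at e
    rw [vcomp_assoc, S.toFun.cell_vcomp_assoc, eυ, S.toFun.cell_vcomp, vcomp_assoc, M.cellψ_nat, e,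
      M.G.cell_vcomp]
  have h₂ : hc (cid b') (S.toFun.unitC (M.G.base.obj B.x) ≫ᵥ S.toFun.cell υ') (by simp [cυ]) ≫ᵥ
      M.square π h.dom_eq h.cod_eq = hc π (honeMap (M.appψ B.x)) (by simp [h.dom_eq]) ≫ᵥ
        hc (cid (M.G.hor B.a)) (M.G.unitC (T.toFun.base.obj B.x)) (by simp) ≫ᵥ
          hc (M.G.cell (cid B.a)) (M.G.cell (T.toFun.unitC B.x ≫ᵥ T.toFun.cell B.υ))
            (by simp) := by
    simp only [square, hc_vcomp]
    exact hc_congr (by simp) h₁ _ _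
  have h₃ := M.G.compC_nat_assoc (cid B.a) (T.toFun.unitC B.x ≫ᵥ T.toFun.cell B.υ) (by simp)
    (M.G.cell B.μ)
  rw [vcomp_assoc, eμ, vcomp_reassoc h₂, vcomp_assoc, vcomp_assoc, h₃, ← M.G.cell_vcomp,
    hB.right_unit, M.G.right_unit, hc_honeMap_rho]

/-- After `π`, both sides begin with the same threefold composite built from `π` and `ψ`, up to the
associator. Behind it stand the two sides of the associativity law of `B` under `G`, matched by the
coherence of the comparisons of `G`. -/
theorem restricted_assoc (hB : B.IsAlg) (h : IsRestriction (M.appψ B.x) π)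
    (dμ : dom μ' = S.m.app (M.G.base.obj B.x)) (cμ : cod μ' = 𝟙 _)
    (eμ : μ' ≫ᵥ π =
      M.square π h.dom_eq h.cod_eq ≫ᵥ M.G.compC B.a (T.toFun.hor B.a) ≫ᵥ M.G.cell B.μ) :
    hc (cid b') (S.toFun.compC b' (S.toFun.hor b') ≫ᵥ S.toFun.cell μ') (by simp [cμ]) ≫ᵥ
      μ' = assocInv _ _ _ ≫ᵥ hc μ' (S.mulCell b') (by simp [dμ]) ≫ᵥ μ' := by
  refine h.hom_ext (by simpa [dμ] using S.mul_assoc _) ?_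
  -- `eμ` under `S` evaluates `Sμ'`, and the compatibility of `ψ` with composition comparisons
  -- carries the result through `ψ`.
  have h₁ : (S.toFun.compC b' (S.toFun.hor b') ≫ᵥ S.toFun.cell μ') ≫ᵥ
      S.toFun.cell π ≫ᵥ M.cellψ B.a =
      hc (S.toFun.cell π ≫ᵥ M.cellψ B.a) (S.toFun.cell (S.toFun.cell π ≫ᵥ M.cellψ B.a) ≫ᵥ
        M.cellψ (T.toFun.hor B.a)) (by simp [h.dom_eq, h.cod_eq]) ≫ᵥ
          M.G.compC (T.toFun.hor B.a) (T.toFun.hor (T.toFun.hor B.a)) ≫ᵥ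
            M.G.cell (T.toFun.compC B.a (T.toFun.hor B.a) ≫ᵥ T.toFun.cell B.μ) := by
    have e₁ := S.toFun.compC_nat_assoc π (S.toFun.cell π ≫ᵥ M.cellψ B.a)
      (by simp [h.dom_eq, h.cod_eq]) (S.toFun.cell (M.G.compC B.a (T.toFun.hor B.a)) ≫ᵥ
        M.cellψ _ ≫ᵥ M.G.cell (T.toFun.cell B.μ))
    have e₃ := vcomp_congr (M.cellψ_comp B.a (T.toFun.hor B.a)) (M.G.cell (T.toFun.cell B.μ))
    have e₅ : hc (S.toFun.cell π ≫ᵥ M.cellψ B.a) (S.toFun.cell (S.toFun.cell π ≫ᵥ M.cellψ B.a) ≫ᵥ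
        M.cellψ (T.toFun.hor B.a)) (by simp [h.dom_eq, h.cod_eq]) =
        hc (S.toFun.cell π) (S.toFun.cell (S.toFun.cell π ≫ᵥ M.cellψ B.a)) (by simp [h.dom_eq, h.cod_eq]) ≫ᵥ
          hc (M.cellψ B.a) (M.cellψ (T.toFun.hor B.a)) (by simp) := by
      simp only [hc_vcomp]
    simp only [vcomp_assoc] at e₃
    rw [e₅, vcomp_assoc, M.G.cell_vcomp, vcomp_assoc, ← e₃, e₁, S.toFun.cell_vcomp_assoc, eμ,
      S.toFun.cell_vcomp, S.toFun.cell_vcomp, vcomp_assoc, vcomp_assoc, M.cellψ_nat]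
    rfl
  have h₂ : hc (cid b') (S.toFun.compC b' (S.toFun.hor b') ≫ᵥ S.toFun.cell μ') (by simp [cμ]) ≫ᵥ
      M.square π h.dom_eq h.cod_eq = hc π (hc (S.toFun.cell π ≫ᵥ M.cellψ B.a)
        (S.toFun.cell (S.toFun.cell π ≫ᵥ M.cellψ B.a) ≫ᵥ M.cellψ (T.toFun.hor B.a))
          (by simp [h.dom_eq, h.cod_eq])) (by simp [h.dom_eq, h.cod_eq]) ≫ᵥ
        hc (cid (M.G.hor B.a)) (M.G.compC (T.toFun.hor B.a) (T.toFun.hor (T.toFun.hor B.a)))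
          (by simp) ≫ᵥ hc (M.G.cell (cid B.a)) (M.G.cell (T.toFun.compC B.a (T.toFun.hor B.a) ≫ᵥ
            T.toFun.cell B.μ)) (by simp) := by
    simp only [square, hc_vcomp]
    exact hc_congr (by simp) h₁ _ _
  have h₃ : assocInv _ _ _ ≫ᵥ hc (M.square π h.dom_eq h.cod_eq)
        (S.toFun.cell (S.toFun.cell π ≫ᵥ M.cellψ B.a) ≫ᵥ M.cellψ (T.toFun.hor B.a))
          (by simp [square, h.dom_eq, h.cod_eq]) =
      hc π (hc (S.toFun.cell π ≫ᵥ M.cellψ B.a)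
        (S.toFun.cell (S.toFun.cell π ≫ᵥ M.cellψ B.a) ≫ᵥ M.cellψ (T.toFun.hor B.a))
          (by simp [h.dom_eq, h.cod_eq])) (by simp [h.dom_eq, h.cod_eq]) ≫ᵥ assocInv _ _ _ :=
    assocInv_nat _ _ _ _ _
  have h₄ : S.mulCell b' ≫ᵥ S.toFun.cell π ≫ᵥ M.cellψ B.a =
      (S.toFun.cell (S.toFun.cell π ≫ᵥ M.cellψ B.a) ≫ᵥ M.cellψ (T.toFun.hor B.a)) ≫ᵥ
        M.G.cell (T.mulCell B.a) := by
    rw [← vcomp_assoc, ← S.mulCell_nat, S.toFun.cell_vcomp, vcomp_assoc, vcomp_assoc, vcomp_assoc,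
      ← M.mulCell_cellψ]
  have h₅ : hc μ' (S.mulCell b') (by simp [dμ]) ≫ᵥ M.square π h.dom_eq h.cod_eq =
      hc (M.square π h.dom_eq h.cod_eq)
        (S.toFun.cell (S.toFun.cell π ≫ᵥ M.cellψ B.a) ≫ᵥ M.cellψ (T.toFun.hor B.a))
          (by simp [square, h.dom_eq, h.cod_eq]) ≫ᵥ
        hc (M.G.compC B.a (T.toFun.hor B.a)) (cid (M.G.hor (T.toFun.hor (T.toFun.hor B.a))))
          (by simp) ≫ᵥ hc (M.G.cell B.μ) (M.G.cell (T.mulCell B.a)) (by simp) := by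
    simp only [square, hc_vcomp, cid_vcomp]
    exact hc_congr eμ h₄ _ _
  have h₆ := M.G.compC_nat_assoc (cid B.a) (T.toFun.compC B.a (T.toFun.hor B.a) ≫ᵥ
    T.toFun.cell B.μ) (by simp) (M.G.cell B.μ)
  have h₇ := M.G.compC_nat_assoc B.μ (T.mulCell B.a) (by simp) (M.G.cell B.μ)
  have h₈ : hc (cid B.a) (T.toFun.compC B.a (T.toFun.hor B.a) ≫ᵥ T.toFun.cell B.μ)
      (by simp) ≫ᵥ B.μ = assocInv _ _ _ ≫ᵥ hc B.μ (T.mulCell B.a) (by simp) ≫ᵥ B.μ := hB.assoc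
  have h₉ := vcomp_congr (M.G.assocInv_comp B.a (T.toFun.hor B.a)
    (T.toFun.hor (T.toFun.hor B.a))) (M.G.cell (hc B.μ (T.mulCell B.a) (by simp) ≫ᵥ B.μ))
  simp only [vcomp_assoc]
  rw [eμ, vcomp_reassoc h₂]
  simp only [vcomp_assoc]
  rw [h₆, ← M.G.cell_vcomp, h₈, vcomp_reassoc h₅]
  simp only [vcomp_assoc]
  rw [vcomp_reassoc h₃]
  simp only [vcomp_assoc]
  rw [h₇]
  simp only [vcomp_assoc, M.G.cell_vcomp] at h₉ ⊢
  rw [h₉]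

/-- A 2-cell into the restricted algebra respects the structure as soon as its composite with `π`
satisfies the transposed equations, in which `S` is replaced by `T` through `ψ`. -/
theorem restricted_isHom {A : HLaxAlgData S} (h : IsRestriction (M.appψ B.x) π)
    (dυ : dom υ' = S.e.app (M.G.base.obj B.x)) (dμ : dom μ' = S.m.app (M.G.base.obj B.x))
    (eυ : υ' ≫ᵥ π = M.G.unitC B.x ≫ᵥ M.G.cell B.υ)
    (eμ : μ' ≫ᵥ π =
      M.square π h.dom_eq h.cod_eq ≫ᵥ M.G.compC B.a (T.toFun.hor B.a) ≫ᵥ M.G.cell B.μ)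
    (g : A.x ⟶ M.G.base.obj B.x) (ζ : Cell A.a b')
    (dζ : dom ζ = S.toFun.base.map g) (cζ : cod ζ = g)
    (h₁ : A.υ ≫ᵥ ζ ≫ᵥ π = honeMap g ≫ᵥ M.G.unitC B.x ≫ᵥ M.G.cell B.υ)
    (h₂ : A.μ ≫ᵥ ζ ≫ᵥ π =
      hc (ζ ≫ᵥ π) (S.toFun.cell (ζ ≫ᵥ π) ≫ᵥ M.cellψ B.a) (by simp [h.dom_eq, h.cod_eq, dζ, cζ]) ≫ᵥ
        M.G.compC B.a (T.toFun.hor B.a) ≫ᵥ M.G.cell B.μ) :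
    A.υ ≫ᵥ ζ = honeMap g ≫ᵥ υ' ∧
      A.μ ≫ᵥ ζ = hc ζ (S.toFun.cell ζ) (by simp [dζ, cζ]) ≫ᵥ μ' := by
  refine ⟨h.hom_ext (by simpa [dυ, dζ] using (S.e.naturality g).symm)
    (by rw [vcomp_assoc, vcomp_assoc, eυ, h₁]),
    h.hom_ext (by simpa [dμ, dζ] using (S.m.naturality g).symm) ?_⟩
  have e : hc ζ (S.toFun.cell ζ) (by simp [dζ, cζ]) ≫ᵥ M.square π h.dom_eq h.cod_eq =
      hc (ζ ≫ᵥ π) (S.toFun.cell (ζ ≫ᵥ π) ≫ᵥ M.cellψ B.a) (by simp [h.dom_eq, h.cod_eq, dζ, cζ]) := by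
    rw [square, hc_vcomp]
    exact hc_congr rfl (by simp) _ _
  rw [vcomp_assoc A.μ, h₂, ← e]
  simp only [vcomp_assoc]
  rw [eμ]

end LaxMonadMor

end RestrictedAlgebraLaws

/-! ### The functor `G_!`. -/

section RestrictedAlgebras

variable {D : Type u} [Category.{v} D] [DoubleCategory.{w, t} D]
  {E : Type u₁} [Category.{v₁} E] [DoubleCategory.{w₁, t₁} E]

namespace LaxMonadMor

variable [CompanionClosed D] {S : LaxMonad D} {T : LaxMonad E} (M : LaxMonadMor T S)

/-- The cartesian 2-cell `G b · ψ_{y!} ⟶ G b`. -/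
def res (B : HLaxAlgData T) : Cell (hcomp (M.G.hor B.a) (M.compψ B.x).hor) (M.G.hor B.a) :=
  (M.compψ B.x).restrict (M.G.hor B.a)

theorem dom_res (B : HLaxAlgData T) : dom (M.res B) = M.appψ B.x :=
  (M.compψ B.x).dom_restrict _

theorem cod_res (B : HLaxAlgData T) : cod (M.res B) = 𝟙 _ := (M.compψ B.x).cod_restrict _

theorem isRestriction_res (B : HLaxAlgData T) : IsRestriction (M.appψ B.x) (M.res B) :=
  (M.compψ B.x).isRestriction _

theorem mC_counit (y : E) : M.mC y ≫ᵥ (M.compψ y).counit =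
    (hc (M.compψ (T.toFun.base.obj y)).counit
        ((companion (S.toFun.base.map (M.ψ.app y))).counit ≫ᵥ
          honeMap (M.ψ.app (T.toFun.base.obj y))) (by simp) ≫ᵥ
      lam _) ≫ᵥ honeMap (M.G.base.map (T.m.app y)) :=
  ((M.compψ y).lift_counit _ _ _).trans (vcomp_assoc _ _ _).symm

theorem fC_counit {x y : E} (f : x ⟶ y) : M.fC f ≫ᵥ (M.compψ y).counit =
    (M.compψ x).counit ≫ᵥ honeMap (M.G.base.map (T.toFun.base.map f)) :=
  (M.compψ y).lift_counit _ _ _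

theorem algMapCell_res {A B : HLaxAlgData T} (h : A.PreHom B) :
    M.algMapCell h ≫ᵥ M.res B = M.res A ≫ᵥ M.G.cell h.ζ :=
  (M.compψ A.x).hc_restrict (M.compψ B.x) _ _ (by simp) (M.fC_counit h.f) _

theorem algObj_υ_res (B : HLaxAlgData T) :
    (M.algObj B).υ ≫ᵥ M.res B = M.G.unitC B.x ≫ᵥ M.G.cell B.υ :=
  (vcomp_assoc _ _ _).trans
    ((M.compψ B.x).lamInv_hc_restrict (M.G.unitC B.x ≫ᵥ M.G.cell B.υ)
      (by simpa using (M.unit B.x).symm))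

/-- The characterisation of `G_!μ` that replaces its formula: composing with the cartesian cell
turns `mC` into the counits of its two companions, and `shuffle_restrict` collapses these with the
rearranging cells into the square. -/
theorem algObj_μ_res (B : HLaxAlgData T) :
    (M.algObj B).μ ≫ᵥ M.res B = M.square (M.res B) (M.dom_res B) (M.cod_res B) ≫ᵥ
      M.G.compC B.a (T.toFun.hor B.a) ≫ᵥ M.G.cell B.μ := by
  have h := Companion.shuffle_restrict (M.compψ B.x) (M.compψ (T.toFun.base.obj B.x))
    (companion (S.toFun.base.map (M.ψ.app B.x))) (p := M.G.hor B.a) (ψ := M.cellψ B.a)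
    (τ := S.toFun.cell (M.res B)) (θ := S.toFun.compComp (M.G.hor B.a) (M.ψ.app B.x))
    (n := M.ψ.compN B.a) (M.cod_cellψ B.a) (by simp [M.cod_res B])
    (by simp [LaxFunctor.cod_compComp]) (by simp [VertTrans.dom_compN])
    (by simp [VertTrans.cod_compN]) (S.toFun.compComp_restrict _ _) (M.ψ.compN_restrict B.a)
  have e₁ := vcomp_congr h (M.G.compC B.a (T.toFun.hor B.a) ≫ᵥ M.G.cell B.μ)
  have e₂ : hc (M.G.compC B.a (T.toFun.hor B.a) ≫ᵥ M.G.cell B.μ) (M.mC B.x)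
        (by simp [cod_mC]) ≫ᵥ M.res B =
      hc (cid _) (hc (M.compψ (T.toFun.base.obj B.x)).counit
        ((companion (S.toFun.base.map (M.ψ.app B.x))).counit ≫ᵥ
          honeMap (M.ψ.app (T.toFun.base.obj B.x))) (by simp) ≫ᵥ lam _) (by simp) ≫ᵥ
        rho _ ≫ᵥ M.G.compC B.a (T.toFun.hor B.a) ≫ᵥ M.G.cell B.μ := by
    have f₁ : hc (M.G.compC B.a (T.toFun.hor B.a) ≫ᵥ M.G.cell B.μ) (M.mC B.x)
          (by simp [cod_mC]) ≫ᵥ hc (cid _) (M.compψ B.x).counit (by simp) =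
        hc (cid _) (hc (M.compψ (T.toFun.base.obj B.x)).counit
          ((companion (S.toFun.base.map (M.ψ.app B.x))).counit ≫ᵥ
            honeMap (M.ψ.app (T.toFun.base.obj B.x))) (by simp) ≫ᵥ lam _) (by simp) ≫ᵥ
          hc (M.G.compC B.a (T.toFun.hor B.a) ≫ᵥ M.G.cell B.μ)
            (honeMap (M.G.base.map (T.m.app B.x))) (by simp) := by
      rw [hc_vcomp, hc_vcomp]
      exact hc_congr (by simp) (M.mC_counit B.x) _ _
    rw [res, Companion.restrict, vcomp_reassoc f₁, vcomp_assoc, hc_honeMap_rho]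
  refine Eq.trans ?_ e₁
  simp only [algObj, shuffle, vcomp_assoc]
  rw [e₂]

theorem algObj_isAlg {B : HLaxAlgData T} (hB : B.IsAlg) : (M.algObj B).IsAlg where
  left_unit := M.restricted_left_unit hB (M.isRestriction_res B) (M.algObj B).dom_υ
    (M.algObj B).dom_μ (M.algObj_υ_res B) (M.algObj_μ_res B)
  right_unit := M.restricted_right_unit hB (M.isRestriction_res B) (M.algObj B).dom_υ
    (M.algObj B).cod_υ (M.algObj B).dom_μ (M.algObj_υ_res B) (M.algObj_μ_res B)
  assoc := M.restricted_assoc hB (M.isRestriction_res B) (M.algObj B).dom_μ (M.algObj B).cod_μ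
    (M.algObj_μ_res B)

theorem isHom_of_res {A : HLaxAlgData S} {B : HLaxAlgData T} (k : A.PreHom (M.algObj B))
    (ξ : Cell A.a (M.G.hor B.a)) (hξ : k.ζ ≫ᵥ M.res B = ξ)
    (dξ : dom ξ = S.toFun.base.map k.f ≫ M.appψ B.x) (cξ : cod ξ = k.f)
    (h₁ : A.υ ≫ᵥ ξ = honeMap k.f ≫ᵥ M.G.unitC B.x ≫ᵥ M.G.cell B.υ)
    (h₂ : A.μ ≫ᵥ ξ = hc ξ (S.toFun.cell ξ ≫ᵥ M.cellψ B.a)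
        (by rw [dξ, cod_vcomp, S.toFun.cod_cell, cξ, M.cod_cellψ]; rfl) ≫ᵥ
      M.G.compC B.a (T.toFun.hor B.a) ≫ᵥ M.G.cell B.μ) : k.IsHom := by
  subst hξ
  have h := M.restricted_isHom (M.isRestriction_res B) (M.algObj B).dom_υ (M.algObj B).dom_μ
    (M.algObj_υ_res B) (M.algObj_μ_res B) k.f k.ζ k.dom_ζ k.cod_ζ h₁ h₂
  exact ⟨h.1, h.2⟩

/-- Composed with the cartesian cell, `Gζ · ψ_{f!}` becomes `π_A ≫ Gζ`; the conditions are then the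
image under `G` of those for `h`, preceded by the equations for `G_!υ` and `G_!μ` of the source. -/
theorem baseChange_isHom {A B : HLaxAlg T} (h : A ⟶ B) : (M.baseChange.map h).IsHom := by
  have e₁ : A.υ ≫ᵥ h.ζ = honeMap h.f ≫ᵥ B.υ := h.isHom.unit
  have e₂ : A.μ ≫ᵥ h.ζ = hc h.ζ (T.toFun.cell h.ζ) (by simp) ≫ᵥ B.μ := h.isHom.mul
  have dA := M.dom_res A.toHLaxAlgData
  have cA := M.cod_res A.toHLaxAlgData
  have f₁ : dom (M.res A.toHLaxAlgData ≫ᵥ M.G.cell h.ζ) =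
      S.toFun.base.map (M.G.base.map h.f) ≫ M.appψ B.x := by
    simp only [dom_vcomp, dA, LaxFunctor.dom_cell, HLaxAlgData.PreHom.dom_ζ]
    exact (M.appψ_nat h.f).symm
  have f₂ : cod (M.res A.toHLaxAlgData ≫ᵥ M.G.cell h.ζ) = M.G.base.map h.f := by
    simp only [cod_vcomp, cA, LaxFunctor.cod_cell, HLaxAlgData.PreHom.cod_ζ]
    exact Category.id_comp _
  have f₃ : (M.algObj A.toHLaxAlgData).υ ≫ᵥ M.res A.toHLaxAlgData ≫ᵥ M.G.cell h.ζ =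
      honeMap (M.G.base.map h.f) ≫ᵥ M.G.unitC B.x ≫ᵥ M.G.cell B.υ := by
    refine (vcomp_reassoc (M.algObj_υ_res A.toHLaxAlgData) _).trans ?_
    exact (vcomp_assoc _ _ _).trans ((congrArg (_ ≫ᵥ ·) ((M.G.cell_vcomp _ _).symm.trans
      ((congrArg M.G.cell e₁).trans (M.G.cell_vcomp _ _)))).trans (M.G.unitC_nat_assoc _ _).symm)
  have f₅ : hc (M.res A.toHLaxAlgData ≫ᵥ M.G.cell h.ζ)
      (S.toFun.cell (M.res A.toHLaxAlgData ≫ᵥ M.G.cell h.ζ) ≫ᵥ M.cellψ B.a)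
        (by rw [f₁, cod_vcomp, S.toFun.cod_cell, f₂, M.cod_cellψ]) =
      M.square (M.res A.toHLaxAlgData) dA cA ≫ᵥ
        hc (M.G.cell h.ζ) (M.G.cell (T.toFun.cell h.ζ)) (by simp) := by
    rw [square, hc_vcomp]
    refine hc_congr rfl ?_ _ _
    rw [S.toFun.cell_vcomp, vcomp_assoc, vcomp_assoc, M.cellψ_nat]
  have f₄ : (M.algObj A.toHLaxAlgData).μ ≫ᵥ M.res A.toHLaxAlgData ≫ᵥ M.G.cell h.ζ =
      hc (M.res A.toHLaxAlgData ≫ᵥ M.G.cell h.ζ)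
        (S.toFun.cell (M.res A.toHLaxAlgData ≫ᵥ M.G.cell h.ζ) ≫ᵥ M.cellψ B.a)
        (by rw [f₁, cod_vcomp, S.toFun.cod_cell, f₂, M.cod_cellψ]) ≫ᵥ
        M.G.compC B.a (T.toFun.hor B.a) ≫ᵥ M.G.cell B.μ := by
    have e₃ := M.G.compC_nat_assoc h.ζ (T.toFun.cell h.ζ) (by simp) (M.G.cell B.μ)
    rw [f₅, vcomp_assoc (M.square _ _ _), e₃, ← M.G.cell_vcomp, ← e₂, M.G.cell_vcomp]
    refine (vcomp_reassoc (M.algObj_μ_res A.toHLaxAlgData) _).trans ?_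
    exact (vcomp_assoc _ _ _).trans (congrArg (_ ≫ᵥ ·) (vcomp_assoc _ _ _))
  exact M.isHom_of_res _ _ (M.algMapCell_res h.toPreHom) f₁ f₂ f₃ f₄

theorem baseChange_isFunctorial : M.baseChange.IsFunctorial where
  isAlg A := M.algObj_isAlg A.isAlg
  isHom h := M.baseChange_isHom h
  map_id A := HLaxAlgData.PreHom.ext (M.G.base.map_id _) <|
    (M.compψ A.x).restrict_hom_ext (by
      refine (M.dom_algMapCell _).trans (Eq.trans ?_ (dom_cid _).symm)
      exact (congrArg S.toFun.base.map (M.G.base.map_id _)).trans (S.toFun.base.map_id _))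
      ((M.algMapCell_res (HLaxAlgData.PreHom.id A.toHLaxAlgData)).trans
        ((congrArg (_ ≫ᵥ ·) (M.G.cell_cid _)).trans
          ((vcomp_cid _).trans (cid_vcomp _).symm)))
  map_comp {A B C} h k := HLaxAlgData.PreHom.ext (M.G.base.map_comp _ _) <|
    (M.compψ C.x).restrict_hom_ext (by
      refine (M.dom_algMapCell _).trans (Eq.trans ?_ (dom_vcomp _ _).symm)
      refine Eq.trans ?_ (congrArg₂ (· ≫ ·) (M.dom_algMapCell h.toPreHom)
        (M.dom_algMapCell k.toPreHom)).symm
      exact (congrArg S.toFun.base.map (M.G.base.map_comp _ _)).trans (S.toFun.base.map_comp _ _))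
      (by
        refine (M.algMapCell_res (HLaxAlgData.PreHom.comp h.toPreHom k.toPreHom)).trans ?_
        refine Eq.trans ?_ (vcomp_assoc _ _ _).symm
        refine Eq.trans ?_ (congrArg (_ ≫ᵥ ·) (M.algMapCell_res k.toPreHom)).symm
        refine Eq.trans ?_ (vcomp_reassoc (M.algMapCell_res h.toPreHom) _).symm
        refine Eq.trans ?_ (vcomp_assoc _ _ _).symm
        exact congrArg (_ ≫ᵥ ·) (M.G.cell_vcomp _ _))

end LaxMonadMor

end RestrictedAlgebras

/-! ### Unit, counit and mates, and transposes of algebra structure. -/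

section AdjunctionCells

variable {D : Type u} [Category.{v} D] [DoubleCategory.{w, t} D]
  {E : Type u₁} [Category.{v₁} E] [DoubleCategory.{w₁, t₁} E]

namespace LaxAdjunction

variable {F : LaxFunctor D E} {G : LaxFunctor E D} (A : LaxAdjunction F G)

/-- The component `η_x : x ⟶ G F x`. -/
def appη (x : D) : x ⟶ G.base.obj (F.base.obj x) := A.η.app x

/-- The component `η_r : r ⟶ G F r`. -/
def cellη {x y : D} (r : Hor x y) : Cell r (G.hor (F.hor r)) := A.η.cell r

/-- The component `ε_y : F G y ⟶ y`. -/
def appε (y : E) : F.base.obj (G.base.obj y) ⟶ y := A.ε.app y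

/-- The component `ε_r : F G r ⟶ r`. -/
def cellε {x y : E} (r : Hor x y) : Cell (F.hor (G.hor r)) r := A.ε.cell r

@[simp]
theorem dom_cellη {x y : D} (r : Hor x y) : dom (A.cellη r) = A.appη x := A.η.dom_cell r

@[simp]
theorem cod_cellη {x y : D} (r : Hor x y) : cod (A.cellη r) = A.appη y := A.η.cod_cell r

@[simp]
theorem dom_cellε {x y : E} (r : Hor x y) : dom (A.cellε r) = A.appε x := A.ε.dom_cell r

@[simp]
theorem cod_cellε {x y : E} (r : Hor x y) : cod (A.cellε r) = A.appε y := A.ε.cod_cell r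

theorem cellη_nat {a b c d : D} {r : Hor a b} {s : Hor c d} (θ : Cell r s) :
    θ ≫ᵥ A.cellη s = A.cellη r ≫ᵥ G.cell (F.cell θ) := A.η.cell_naturality θ

theorem cellε_nat {a b c d : E} {r : Hor a b} {s : Hor c d} (θ : Cell r s) :
    F.cell (G.cell θ) ≫ᵥ A.cellε s = A.cellε r ≫ᵥ θ := A.ε.cell_naturality θ

theorem cellη_unit (x : D) : A.cellη (hone x) =
    honeMap (A.appη x) ≫ᵥ G.unitC (F.base.obj x) ≫ᵥ G.cell (F.unitC x) :=
  (cid_vcomp _).symm.trans (A.η.unit x)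

theorem cellη_comp {x y z : D} (s : Hor y z) (r : Hor x y) : A.cellη (hcomp s r) =
    hc (A.cellη s) (A.cellη r) (by simp) ≫ᵥ G.compC (F.hor s) (F.hor r) ≫ᵥ
      G.cell (F.compC s r) :=
  (cid_vcomp _).symm.trans (A.η.comp s r)

theorem cellε_unit (y : E) : F.unitC (G.base.obj y) ≫ᵥ F.cell (G.unitC y) ≫ᵥ A.cellε (hone y) =
    honeMap (A.appε y) :=
  (vcomp_assoc _ _ _).symm.trans ((A.ε.unit y).trans (vcomp_cid _))

theorem cellε_comp {x y z : E} (s : Hor y z) (r : Hor x y) :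
    F.compC (G.hor s) (G.hor r) ≫ᵥ F.cell (G.compC s r) ≫ᵥ A.cellε (hcomp s r) =
      hc (A.cellε s) (A.cellε r) (by simp) :=
  (vcomp_assoc _ _ _).symm.trans ((A.ε.comp s r).trans (vcomp_cid _))

theorem cell_cellη_cellε {x y : D} (r : Hor x y) :
    F.cell (A.cellη r) ≫ᵥ A.cellε (F.hor r) = cid (F.hor r) := A.left_triangle_cell r

theorem cellη_cell_cellε {x y : E} (r : Hor x y) :
    A.cellη (G.hor r) ≫ᵥ G.cell (A.cellε r) = cid (G.hor r) := A.right_triangle_cell r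

end LaxAdjunction

namespace MonadConjunction

variable {S : LaxMonad D} {T : LaxMonad E} (C : MonadConjunction S T)

theorem appη_compat (x : D) : C.adj.appη (S.toFun.base.obj x) ≫
    C.right.G.base.map (C.left.appφ x) =
      S.toFun.base.map (C.adj.appη x) ≫ C.right.appψ (C.left.F.base.obj x) := C.unit_compat x

theorem cellη_compat {x y : D} (r : Hor x y) : C.adj.cellη (S.toFun.hor r) ≫ᵥ
    C.right.G.cell (C.left.cellφ r) =
      S.toFun.cell (C.adj.cellη r) ≫ᵥ C.right.cellψ (C.left.F.hor r) := C.unit_compat_cell r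

theorem appε_compat (y : E) : C.left.F.base.map (C.right.appψ y) ≫
    C.adj.appε (T.toFun.base.obj y) =
      C.left.appφ (C.right.G.base.obj y) ≫ T.toFun.base.map (C.adj.appε y) := C.counit_compat y

theorem cellε_compat {x y : E} (r : Hor x y) : C.left.F.cell (C.right.cellψ r) ≫ᵥ
    C.adj.cellε (T.toFun.hor r) =
      C.left.cellφ (C.right.G.hor r) ≫ᵥ T.toFun.cell (C.adj.cellε r) := C.counit_compat_cell r

/-- The transpose of `ι : F a ⟶ a'` is compatible with the units and multiplications. -/
theorem transpose_isHom {A : HLaxAlgData S}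
    {a' : Hor (T.toFun.base.obj (C.left.F.base.obj A.x)) (C.left.F.base.obj A.x)}
    {ι : Cell (C.left.F.hor A.a) a'} {υ' : Cell (hone (C.left.F.base.obj A.x)) a'}
    {μ' : Cell (hcomp a' (T.toFun.hor a')) a'} (dι : dom ι = C.left.appφ A.x)
    (cι : cod ι = 𝟙 _)
    (eυ : υ' = C.left.F.unitC A.x ≫ᵥ C.left.F.cell A.υ ≫ᵥ ι)
    (eμ : C.left.square ι dι cι ≫ᵥ μ' =
      C.left.F.compC A.a (S.toFun.hor A.a) ≫ᵥ C.left.F.cell A.μ ≫ᵥ ι)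
    (h : cod (S.toFun.cell (C.adj.cellη A.a ≫ᵥ C.right.G.cell ι) ≫ᵥ C.right.cellψ a') =
      dom (C.adj.cellη A.a ≫ᵥ C.right.G.cell ι)) :
    A.υ ≫ᵥ C.adj.cellη A.a ≫ᵥ C.right.G.cell ι =
        honeMap (C.adj.appη A.x) ≫ᵥ C.right.G.unitC _ ≫ᵥ C.right.G.cell υ' ∧
      A.μ ≫ᵥ C.adj.cellη A.a ≫ᵥ C.right.G.cell ι =
        hc (C.adj.cellη A.a ≫ᵥ C.right.G.cell ι)
          (S.toFun.cell (C.adj.cellη A.a ≫ᵥ C.right.G.cell ι) ≫ᵥ C.right.cellψ a') h ≫ᵥ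
            C.right.G.compC a' (T.toFun.hor a') ≫ᵥ C.right.G.cell μ' := by
  constructor
  · rw [vcomp_reassoc (C.adj.cellη_nat A.υ), C.adj.cellη_unit, eυ]
    simp only [vcomp_assoc, LaxFunctor.cell_vcomp]
  · have e₁ : hc (C.adj.cellη A.a ≫ᵥ C.right.G.cell ι)
        (S.toFun.cell (C.adj.cellη A.a ≫ᵥ C.right.G.cell ι) ≫ᵥ C.right.cellψ a') h =
        hc (C.adj.cellη A.a) (C.adj.cellη (S.toFun.hor A.a)) (by simp) ≫ᵥ
          hc (C.right.G.cell ι) (C.right.G.cell (C.left.cellφ A.a ≫ᵥ T.toFun.cell ι))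
            (by simp [dι, cι]) := by
      rw [hc_vcomp]
      refine hc_congr rfl ?_ _ _
      rw [S.toFun.cell_vcomp, vcomp_assoc, C.right.cellψ_nat, C.right.G.cell_vcomp,
        vcomp_reassoc (C.cellη_compat A.a), vcomp_assoc]
    have e₂ := C.right.G.compC_nat_assoc ι (C.left.cellφ A.a ≫ᵥ T.toFun.cell ι)
      (by simp [dι, cι]) (C.right.G.cell μ')
    have e₃ := congrArg C.right.G.cell eμ
    rw [OplaxMonadMor.square, C.right.G.cell_vcomp] at e₃
    rw [vcomp_reassoc (C.adj.cellη_nat A.μ), C.adj.cellη_comp, e₁]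
    simp only [vcomp_assoc]
    rw [e₂, e₃]
    simp only [LaxFunctor.cell_vcomp]

/-- The transpose of `π : b' ⟶ G b` is compatible with the units and multiplications. -/
theorem cotranspose_isHom {B : HLaxAlgData T}
    {b' : Hor (S.toFun.base.obj (C.right.G.base.obj B.x)) (C.right.G.base.obj B.x)}
    {π : Cell b' (C.right.G.hor B.a)} {υ' : Cell (hone (C.right.G.base.obj B.x)) b'}
    {μ' : Cell (hcomp b' (S.toFun.hor b')) b'} (dπ : dom π = C.right.appψ B.x)
    (cπ : cod π = 𝟙 _)
    (eυ : υ' ≫ᵥ π = C.right.G.unitC B.x ≫ᵥ C.right.G.cell B.υ)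
    (eμ : μ' ≫ᵥ π = C.right.square π dπ cπ ≫ᵥ C.right.G.compC B.a (T.toFun.hor B.a) ≫ᵥ
      C.right.G.cell B.μ)
    (h : cod (C.left.cellφ b' ≫ᵥ T.toFun.cell (C.left.F.cell π ≫ᵥ C.adj.cellε B.a)) =
      dom (C.left.F.cell π ≫ᵥ C.adj.cellε B.a)) :
    C.left.F.unitC _ ≫ᵥ C.left.F.cell υ' ≫ᵥ C.left.F.cell π ≫ᵥ C.adj.cellε B.a =
        honeMap (C.adj.appε B.x) ≫ᵥ B.υ ∧
      C.left.F.compC b' (S.toFun.hor b') ≫ᵥ C.left.F.cell μ' ≫ᵥ C.left.F.cell π ≫ᵥ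
          C.adj.cellε B.a =
        hc (C.left.F.cell π ≫ᵥ C.adj.cellε B.a)
          (C.left.cellφ b' ≫ᵥ T.toFun.cell (C.left.F.cell π ≫ᵥ C.adj.cellε B.a)) h ≫ᵥ B.μ := by
  constructor
  · rw [C.left.F.cell_vcomp_assoc, eυ, C.left.F.cell_vcomp, vcomp_assoc, C.adj.cellε_nat,
      ← C.adj.cellε_unit]
    simp only [vcomp_assoc]
  · have e₁ : hc (C.left.F.cell π ≫ᵥ C.adj.cellε B.a)
          (C.left.cellφ b' ≫ᵥ T.toFun.cell (C.left.F.cell π ≫ᵥ C.adj.cellε B.a)) h =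
        hc (C.left.F.cell π) (C.left.F.cell (S.toFun.cell π ≫ᵥ C.right.cellψ B.a))
            (by simp [dπ, cπ]) ≫ᵥ
          hc (C.adj.cellε B.a) (C.adj.cellε (T.toFun.hor B.a)) (by simp) := by
      rw [hc_vcomp]
      refine hc_congr rfl ?_ _ _
      rw [T.toFun.cell_vcomp, ← vcomp_assoc, ← C.left.cellφ_nat, vcomp_assoc, ← C.cellε_compat,
        C.left.F.cell_vcomp, vcomp_assoc]
    have e₂ := C.left.F.compC_nat_assoc π (S.toFun.cell π ≫ᵥ C.right.cellψ B.a)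
      (by simp [dπ, cπ]) (C.left.F.cell (C.right.G.compC B.a (T.toFun.hor B.a)) ≫ᵥ
        C.adj.cellε _ ≫ᵥ B.μ)
    rw [C.left.F.cell_vcomp_assoc, eμ, e₁, ← C.adj.cellε_comp, LaxMonadMor.square]
    simp only [vcomp_assoc, LaxFunctor.cell_vcomp] at e₂ ⊢
    rw [C.adj.cellε_nat, e₂]

end MonadConjunction

end AdjunctionCells

/-! ### The adjunction `F_! ⊣ G_!`. -/

section BaseChangeAdjunction

variable {D : Type u} [Category.{v} D] [DoubleCategory.{w, t} D]
  {E : Type u₁} [Category.{v₁} E] [DoubleCategory.{w₁, t₁} E]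

namespace MonadConjunction

variable [CompanionClosed D] [ConjointClosed E] {S : LaxMonad D} {T : LaxMonad E}
  (C : MonadConjunction S T) (hφ : C.left.φ.HasStrongConjoint)
  (hT : ∀ {a b c : E} (r : Hor a c) (f : a ⟶ b), IsInv (T.toFun.conjComp r f))

/-- `unitCell` is by construction the factorisation of `η_a ≫ Gι` through the cartesian cell. The
mate equation on objects ensures that the vertical source factors through `ψ`. -/
theorem unitCell_res (A : HLaxAlgData S) :
    C.unitCell A ≫ᵥ C.right.res (C.left.algObj hφ hT A) =
      C.adj.cellη A.a ≫ᵥ C.right.G.cell (C.left.ext A) :=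
  (vcomp_assoc _ _ _).trans
    ((C.right.compψ (C.left.F.base.obj A.x)).rhoInv_hc_unit_restrict
      (C.adj.cellη A.a ≫ᵥ C.right.G.cell (C.left.ext A))
      (k := S.toFun.base.map (C.adj.η.app A.x)) (by
        have e := C.appη_compat A.x
        simp only [dom_vcomp, LaxAdjunction.dom_cellη, LaxFunctor.dom_cell,
          (C.left.isExtension_ext A).dom_eq]
        exact e))

/-- `counitCell` is by construction the extension of `Fπ ≫ ε_b` along the opcartesian cell. The mate
equation on objects ensures that the vertical source factors through `φ`. -/
theorem ext_counitCell (B : HLaxAlgData T) :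
    C.left.ext (C.right.algObj B) ≫ᵥ C.counitCell B =
      C.left.F.cell (C.right.res B) ≫ᵥ C.adj.cellε B.a :=
  (C.left.conjφ (C.right.G.base.obj B.x)).extend_hc_counit
    (C.left.F.cell (C.right.res B) ≫ᵥ C.adj.cellε B.a)
    (k := T.toFun.base.map (C.adj.ε.app B.x)) (by
      have e := C.appε_compat B.x
      simp only [dom_vcomp, LaxAdjunction.dom_cellε, LaxFunctor.dom_cell, C.right.dom_res B]
      exact e)

/-- The target is a restricted algebra, so only `η_a ≫ Gι` has to be examined, and `transpose_isHom`
supplies its two equations from those defining `F_!υ` and `F_!μ`. -/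
theorem unitHom_isHom (A : HLaxAlgData S) : (C.unitHom hφ hT A).IsHom := by
  have d : dom (C.adj.cellη A.a ≫ᵥ C.right.G.cell (C.left.ext A)) =
      S.toFun.base.map (C.adj.appη A.x) ≫ C.right.appψ (C.left.F.base.obj A.x) := by
    rw [← C.appη_compat, dom_vcomp, C.adj.dom_cellη, LaxFunctor.dom_cell,
      (C.left.isExtension_ext A).dom_eq]
  have c : cod (C.adj.cellη A.a ≫ᵥ C.right.G.cell (C.left.ext A)) = C.adj.appη A.x := by
    rw [cod_vcomp, C.adj.cod_cellη, LaxFunctor.cod_cell, (C.left.isExtension_ext A).cod_eq]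
    exact (congrArg (_ ≫ ·) (C.right.G.base.map_id _)).trans (Category.comp_id _)
  have h := C.transpose_isHom (C.left.isExtension_ext A).dom_eq (C.left.isExtension_ext A).cod_eq
    (C.left.algObj_υ hφ hT A) (C.left.square_algObj_μ hφ hT A)
    (by rw [cod_vcomp, S.toFun.cod_cell, c, C.right.cod_cellψ, d])
  exact C.right.isHom_of_res _ _ (C.unitCell_res hφ hT A) d c h.1 h.2

theorem counitHom_isHom (B : HLaxAlgData T) : (C.counitHom hφ hT B).IsHom := by
  have d : dom (C.left.F.cell (C.right.res B) ≫ᵥ C.adj.cellε B.a) =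
      C.left.appφ (C.right.G.base.obj B.x) ≫ T.toFun.base.map (C.adj.appε B.x) := by
    rw [← C.appε_compat, dom_vcomp, C.adj.dom_cellε, LaxFunctor.dom_cell, C.right.dom_res]
  have c : cod (C.left.F.cell (C.right.res B) ≫ᵥ C.adj.cellε B.a) = C.adj.appε B.x := by
    rw [cod_vcomp, C.adj.cod_cellε, LaxFunctor.cod_cell, C.right.cod_res]
    exact (congrArg (· ≫ _) (C.left.F.base.map_id _)).trans (Category.id_comp _)
  have h := C.cotranspose_isHom (C.right.dom_res B) (C.right.cod_res B)
    (C.right.algObj_υ_res B) (C.right.algObj_μ_res B)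
    (by rw [cod_vcomp, T.toFun.cod_cell, c, C.left.cod_cellφ, d])
  exact C.left.isHom_of_ext hφ hT _ _ (C.ext_counitCell B) d c h.1 h.2

variable {hφ hT}

/-- Tested on the cartesian cell, this is naturality of `η` at `h.ζ` together with the image under
`G` of `ext_algMapCell`. The image of `h` enters as a variable `k` pinned down by its components; in
the application both equations are `rfl`. -/
theorem unitCell_naturality {A B : HLaxAlgData S} (h : A.PreHom B)
    (k : (C.left.algObj hφ hT A).PreHom (C.left.algObj hφ hT B))
    (hf : k.f = C.left.F.base.map h.f) (hζ : k.ζ = C.left.algMapCell h) :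
    h.ζ ≫ᵥ C.unitCell B = C.unitCell A ≫ᵥ C.right.algMapCell k := by
  refine (C.right.isRestriction_res (C.left.algObj hφ hT B)).hom_ext ?_ ?_
  · refine (dom_vcomp _ _).trans (Eq.trans ?_ (dom_vcomp _ _).symm)
    refine (congrArg₂ (· ≫ ·) h.dom_ζ (C.dom_unitCell B)).trans (Eq.trans ?_
      (congrArg₂ (· ≫ ·) (C.dom_unitCell A) (C.right.dom_algMapCell k)).symm)
    refine (S.toFun.base.map_comp _ _).symm.trans (Eq.trans ?_ (S.toFun.base.map_comp _ _))
    rw [hf]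
    exact congrArg S.toFun.base.map (C.adj.η.naturality h.f)
  · have e₁ := vcomp_congr (C.adj.cellη_nat h.ζ) (C.right.G.cell (C.left.ext B))
    have e₂ := congrArg C.right.G.cell (C.left.ext_algMapCell h)
    have e₃ := congrArg (C.right.res _ ≫ᵥ ·) (congrArg C.right.G.cell hζ)
    refine (vcomp_assoc _ _ _).trans ((congrArg (_ ≫ᵥ ·) (C.unitCell_res hφ hT B)).trans ?_)
    refine Eq.trans ?_ (vcomp_assoc _ _ _).symm
    refine Eq.trans ?_ (congrArg (_ ≫ᵥ ·) ((C.right.algMapCell_res k).trans e₃)).symm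
    refine Eq.trans ?_ (vcomp_reassoc (C.unitCell_res hφ hT A) _).symm
    refine (vcomp_assoc _ _ _).symm.trans (e₁.trans ((vcomp_assoc _ _ _).trans ?_))
    refine Eq.trans ?_ (vcomp_assoc _ _ _).symm
    refine congrArg (_ ≫ᵥ ·) ?_
    exact (C.right.G.cell_vcomp _ _).symm.trans (e₂.symm.trans (C.right.G.cell_vcomp _ _))

/-- Tested on the opcartesian cell, this is naturality of `ε` at `h.ζ` together with the image under
`F` of `algMapCell_res`. -/
theorem counitCell_naturality {A B : HLaxAlgData T} (h : A.PreHom B)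
    (k : (C.right.algObj A).PreHom (C.right.algObj B))
    (hf : k.f = C.right.G.base.map h.f) (hζ : k.ζ = C.right.algMapCell h) :
    C.left.algMapCell k ≫ᵥ C.counitCell B = C.counitCell A ≫ᵥ h.ζ := by
  refine (C.left.isExtension_ext (C.right.algObj A)).hom_ext ?_ ?_
  · refine (dom_vcomp _ _).trans (Eq.trans ?_ (dom_vcomp _ _).symm)
    refine (congrArg₂ (· ≫ ·) (C.left.dom_algMapCell k) (C.dom_counitCell B)).trans (Eq.trans ?_
      (congrArg₂ (· ≫ ·) (C.dom_counitCell A) h.dom_ζ).symm)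
    refine (T.toFun.base.map_comp _ _).symm.trans (Eq.trans ?_ (T.toFun.base.map_comp _ _))
    rw [hf]
    exact congrArg T.toFun.base.map (C.adj.ε.naturality h.f)
  · have e₁ := congrArg C.left.F.cell ((vcomp_congr hζ _).trans (C.right.algMapCell_res h))
    have e₂ := congrArg (C.left.F.cell (C.right.res A) ≫ᵥ ·) (C.adj.cellε_nat h.ζ)
    refine (vcomp_reassoc (C.left.ext_algMapCell k) _).trans ((vcomp_assoc _ _ _).trans ?_)
    refine (congrArg (_ ≫ᵥ ·) (C.ext_counitCell B)).trans ?_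
    refine Eq.trans ?_ (vcomp_reassoc (C.ext_counitCell A) _).symm
    refine Eq.trans ?_ (vcomp_assoc _ _ _).symm
    refine Eq.trans ?_ e₂
    refine (vcomp_assoc _ _ _).symm.trans (Eq.trans ?_ (vcomp_assoc _ _ _))
    exact congrArg (· ≫ᵥ _) ((C.left.F.cell_vcomp _ _).symm.trans
      (e₁.trans (C.left.F.cell_vcomp _ _)))

/-- Tested on `ι`, the composite becomes `F(η_a ≫ Gι) ≫ ε`. Naturality of `ε` moves `ι` to the end,
and the triangle identity of `F ⊣ G` at `a` leaves `ι`. -/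
theorem algMapCell_unitHom_counitCell (A : HLaxAlgData S) :
    C.left.algMapCell (C.unitHom hφ hT A) ≫ᵥ C.counitCell (C.left.algObj hφ hT A) = cid _ := by
  refine (C.left.isExtension_ext A).hom_ext ?_ ?_
  · refine (dom_vcomp _ _).trans (Eq.trans ?_ (dom_cid _).symm)
    refine (congrArg₂ (· ≫ ·) (C.left.dom_algMapCell (C.unitHom hφ hT A))
      (C.dom_counitCell (C.left.algObj hφ hT A))).trans ?_
    refine (T.toFun.base.map_comp _ _).symm.trans ?_
    exact (congrArg T.toFun.base.map (C.adj.left_triangle A.x)).trans (T.toFun.base.map_id _)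
  · have e₁ := congrArg C.left.F.cell (C.unitCell_res hφ hT A)
    have e₂ := congrArg (C.left.F.cell (C.adj.cellη A.a) ≫ᵥ ·) (C.adj.cellε_nat (C.left.ext A))
    have e₃ := vcomp_congr (C.adj.cell_cellη_cellε A.a) (C.left.ext A)
    refine (vcomp_reassoc (C.left.ext_algMapCell (C.unitHom hφ hT A)) _).trans
      ((vcomp_assoc _ _ _).trans ?_)
    refine (congrArg (_ ≫ᵥ ·) (C.ext_counitCell (C.left.algObj hφ hT A))).trans ?_
    refine (vcomp_assoc _ _ _).symm.trans ?_
    refine (congrArg (· ≫ᵥ _) ((C.left.F.cell_vcomp _ _).symm.trans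
      (e₁.trans (C.left.F.cell_vcomp _ _)))).trans ?_
    refine (vcomp_assoc _ _ _).trans (e₂.trans ((vcomp_assoc _ _ _).symm.trans ?_))
    exact e₃.trans ((cid_vcomp _).trans (vcomp_cid _).symm)

/-- Tested on `π`, the composite becomes `η ≫ G(Fπ ≫ ε_b)`. Naturality of `η` moves `π` to the
front, and the triangle identity of `F ⊣ G` at `b` leaves `π`. -/
theorem unitCell_algMapCell_counitHom (B : HLaxAlgData T) :
    C.unitCell (C.right.algObj B) ≫ᵥ C.right.algMapCell (C.counitHom hφ hT B) = cid _ := by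
  refine (C.right.isRestriction_res B).hom_ext ?_ ?_
  · refine (dom_vcomp _ _).trans (Eq.trans ?_ (dom_cid _).symm)
    refine (congrArg₂ (· ≫ ·) (C.dom_unitCell (C.right.algObj B))
      (C.right.dom_algMapCell (C.counitHom hφ hT B))).trans ?_
    refine (S.toFun.base.map_comp _ _).symm.trans ?_
    exact (congrArg S.toFun.base.map (C.adj.right_triangle B.x)).trans (S.toFun.base.map_id _)
  · have e₁ := congrArg C.right.G.cell (C.ext_counitCell B)
    have e₂ := vcomp_congr (C.adj.cellη_nat (C.right.res B)) (C.right.G.cell (C.adj.cellε B.a))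
    have e₃ := congrArg (C.right.res B ≫ᵥ ·) (C.adj.cellη_cell_cellε B.a)
    refine (vcomp_assoc _ _ _).trans ?_
    refine (congrArg (_ ≫ᵥ ·) (C.right.algMapCell_res (C.counitHom hφ hT B))).trans ?_
    refine (vcomp_reassoc (C.unitCell_res hφ hT (C.right.algObj B)) _).trans ?_
    refine (vcomp_assoc _ _ _).trans ?_
    refine (congrArg (_ ≫ᵥ ·) ((C.right.G.cell_vcomp _ _).symm.trans
      (e₁.trans (C.right.G.cell_vcomp _ _)))).trans ?_
    refine (vcomp_assoc _ _ _).symm.trans (e₂.symm.trans ((vcomp_assoc _ _ _).trans ?_))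
    exact e₃.trans ((vcomp_cid _).trans (cid_vcomp _).symm)

/-- The unit of `F_! ⊣ G_!`. -/
noncomputable def baseChangeUnit (hF : (C.left.baseChange hφ hT).IsFunctorial)
    (hG : C.right.baseChange.IsFunctorial) : 𝟭 (HLaxAlg S) ⟶ hF.functor ⋙ hG.functor where
  app A := ⟨C.unitHom hφ hT A.toHLaxAlgData, C.unitHom_isHom hφ hT A.toHLaxAlgData⟩
  naturality A B h := by
    have e := C.unitCell_naturality (hφ := hφ) (hT := hT) h.toPreHom ((C.left.baseChange hφ hT).map h) rfl rfl
    exact HLaxAlg.Hom.ext (C.adj.η.naturality h.f) e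

/-- The counit of `F_! ⊣ G_!`. -/
noncomputable def baseChangeCounit (hF : (C.left.baseChange hφ hT).IsFunctorial)
    (hG : C.right.baseChange.IsFunctorial) : hG.functor ⋙ hF.functor ⟶ 𝟭 (HLaxAlg T) where
  app B := ⟨C.counitHom hφ hT B.toHLaxAlgData, C.counitHom_isHom hφ hT B.toHLaxAlgData⟩
  naturality A B h := by
    have e := C.counitCell_naturality h.toPreHom (C.right.baseChange.map h) rfl rfl
    exact HLaxAlg.Hom.ext (C.adj.ε.naturality h.f) e

/-- The adjunction `F_! ⊣ G_!` between categories of horizontal lax algebras. -/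
noncomputable def baseChangeAdjunction (hF : (C.left.baseChange hφ hT).IsFunctorial)
    (hG : C.right.baseChange.IsFunctorial) : hF.functor ⊣ hG.functor where
  unit := C.baseChangeUnit hF hG
  counit := C.baseChangeCounit hF hG
  left_triangle_components A := by
    have e := C.algMapCell_unitHom_counitCell (hφ := hφ) (hT := hT) A.toHLaxAlgData
    refine HLaxAlg.Hom.ext ?_ ?_
    · exact C.adj.left_triangle A.x
    · exact e
  right_triangle_components B := by
    have e := C.unitCell_algMapCell_counitHom (hφ := hφ) (hT := hT) B.toHLaxAlgData
    refine HLaxAlg.Hom.ext ?_ ?_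
    · exact C.adj.right_triangle B.x
    · exact e

end MonadConjunction

end BaseChangeAdjunction

/-- The middle component of the comparison is the inverse of the pullback comparison of `T`, hence
an isomorphism because `T` preserves pullbacks. -/
theorem spanMonad_compC {V : Type u} [Category.{v} V] [HasFiniteLimits V] (T : Monad V)
    [CartesianMonad T] {a b c : V} (s : Hor b c) (r : Hor a b) :
    IsInv ((spanMonad T).toFun.compC s r) :=
  Span.isInv _ rfl rfl (by change IsIso (pbInv _ _ _); infer_instance)

end TCat

theorem mainTheorem2 {V : Type u} [Category.{v} V] [HasFiniteLimits V] [HasCoproducts.{v} V]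
    [TCat.Extensive V] (T : Monad V) [TCat.CartesianMonad T]
    (hε : (TCat.matConjunction T).left.φ.HasStrongConjoint) :
    ∃ (hF : ((TCat.matConjunction T).left.baseChange hε (TCat.spanMonad_conjComp T)).IsFunctorial)
      (hG : (TCat.matConjunction T).right.baseChange.IsFunctorial)
      (adj : hF.functor ⊣ hG.functor),
      (∀ A : TCat.HLaxAlg (TCat.matMonad T), (adj.unit.app A).toPreHom =
        (TCat.matConjunction T).unitHom hε (TCat.spanMonad_conjComp T) A.toHLaxAlgData) ∧
      ∀ B : TCat.HLaxAlg (TCat.spanMonad T), (adj.counit.app B).toPreHom =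
        (TCat.matConjunction T).counitHom hε (TCat.spanMonad_conjComp T) B.toHLaxAlgData :=
  have hF := (TCat.matConjunction T).left.baseChange_isFunctorial hε (TCat.spanMonad_conjComp T)
    (TCat.spanMonad_compC T)
  have hG := (TCat.matConjunction T).right.baseChange_isFunctorial
  -- The adjunction was built with `unitHom` and `counitHom` as its components, so the two
  -- descriptions hold by definition.
  ⟨hF, hG, (TCat.matConjunction T).baseChangeAdjunction hF hG, fun _ => rfl, fun _ => rfl⟩
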